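/- **Theorem.** Let $U$ be a real-valued $C^\infty$ function on an open set containing $y_0\in\mathbb R$, let $c_0\in\mathbb C$ and $n\ge 1$, and let $(y_0,c_0)$ be a critical point of order $n$ of $U$: $U(y_0)=c_0$, $U^{(k)}(y_0)=0$ for $1\le k<n$, and $U^{(n)}(y_0)\neq 0$. Fix a real $\alpha\neq 0$. There are $r,\varepsilon>0$ such that, with $I=(y_0-r,y_0+r)$ and $D=\{c\in\mathbb C: |c-c_0|<\varepsilon\}$ if $n=1$, $D=\{c\in\mathbb C: 0<|c-c_0|<\varepsilon\}$ if $n\ge 2$, the Rayleigh equation $$(U(y)-c)(\partial_y^2-\alpha^2)\psi-U''(y)\,\psi=0$$ has two solutions $\psi_1(y,c),\psi_2(y,c)$, $(y,c)\in I\times D$, with the following properties. (When $c$ belongs to $U(I)$, hence is real, $\psi_j(\cdot,c)$ stands for two functions $\psi_j(\cdot,c\pm i0)$, the boundary values from $\pm\operatorname{Im}c>0$, which may differ, and every statement below holds for both.) 1. *Regularity.* $\psi_1,\psi_2$ are $C^\infty$ in $(y,c)\in I\times\mathbb C$ (as functions of three real variables) wherever $c\in D\setminus U(I)$, in particular wherever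 $c\in D$ is not real. On each of $\{c\in D:\operatorname{Im}c\ge0\}$ and $\{c\in D:\operatorname{Im}c\le0\}$ (with the boundary values $c\pm i0$ on the real axis) they are $C^\infty$ up to the real axis at all points with $U(y)\neq c$, satisfy the equation there, and are continuous also at the points with $U(y)=c$. 2. *Independence.* The Wronskian $W=\psi_1\partial_y\psi_2-\psi_2\,\partial_y\psi_1$ does not vanish at any $(y,c)\in I\times D$ with $U(y)\ne c$. 3. *Bounds.* $|\psi_j(y,c)|\lesssim 1$, and $|\partial_y^2\psi_j(y,c)|\lesssim |U(y)-c|^{-1}$ where $U(y)\ne c$, for $j=1,2$. 4. If $n=1$, then $\psi_1$ is $C^\infty$ in $(y,c)$ on all of $I\times D$, including $(y_0,c_0)$ and the points with $U(y)=c$ (its two boundary values agree), and $|\partial_y\psi_2(y,c)|\lesssim|\log(U(y)-c)|$ where $U(y)\neq c$. 5. If $n\ge2$, then $$|\psi_1(y,c)|\lesssim|c-c_0|\,\zeta\Bigl(\frac{y-y_0}{|c-c_0|^{1/n}}\Bigr),\qquad |\psi_2(y,c)|\lesssim|c-c_0|\,\zeta\Bigl(-\frac{y-y_0}{|c-c_0|^{1/n}}\Bigr),$$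 where $\zeta(z)=(1+|z|)^n$ for $z\ge0$ and $\zeta(z)=(1+|z|)^{1-n}$ for $z\le0$. The solutions are normalized so that $|W|\gtrsim|c-c_0|^{2-1/n}$ where $U(y)\ne c$. The implied constants depend only on $U,y_0,n,\alpha,r,\varepsilon$, not on $(y,c)$. -/

import Mathlib

open scoped ContDiff

/-- `(y₀, c₀)` is a critical point of order `n` of the profile `U`: `U y₀ = c₀`, the derivatives of
orders `1, …, n - 1` of `U` vanish at `y₀`, and the derivative of order `n` does not. -/
def IsCriticalPointOfOrder (U : ℝ → ℝ) (n : ℕ) (y₀ : ℝ) (c₀ : ℂ) : Prop :=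
  (U y₀ : ℂ) = c₀ ∧ (∀ k : ℕ, 1 ≤ k → k < n → iteratedDeriv k U y₀ = 0) ∧
    iteratedDeriv n U y₀ ≠ 0

/-- The Rayleigh operator `(U - c) (∂_y² - α²) φ - U'' φ`, evaluated at `y`. -/
noncomputable def rayleighOp (U : ℝ → ℝ) (α : ℝ) (c : ℂ) (φ : ℝ → ℂ) (y : ℝ) : ℂ :=
  ((U y : ℂ) - c) * (iteratedDeriv 2 φ y - (α : ℂ) ^ 2 * φ y) - ((iteratedDeriv 2 U y : ℝ) : ℂ) * φ y

/-- The Wronskian of `φ₁` and `φ₂` at `y`. -/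
noncomputable def wronskianAt (φ₁ φ₂ : ℝ → ℂ) (y : ℝ) : ℂ :=
  φ₁ y * deriv φ₂ y - deriv φ₁ y * φ₂ y

/-- The weight `ζ`: equal to `(1 + |z|) ^ n` for `z ≥ 0` and to `(1 + |z|) ^ (1 - n)` for
`z ≤ 0`. -/
noncomputable def zetaWeight (n : ℕ) (z : ℝ) : ℝ :=
  if 0 ≤ z then (1 + |z|) ^ n else (1 + |z|) ^ (1 - (n : ℤ))

/-- The closed half-plane `Im c ≥ 0` (for `s = 1`) or `Im c ≤ 0` (for `s = -1`). -/
def closedHalfPlane (s : ℤˣ) : Set ℂ := {c | 0 ≤ (((s : ℤ) : ℝ)) * c.im}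

/-- The parameters `c` at distance less than `ε` from `c₀`; the value `c = c₀` itself is left out
when `n ≠ 1`. -/
def paramSet (n : ℕ) (c₀ : ℂ) (ε : ℝ) : Set ℂ := {c | c ∈ Metric.ball c₀ ε ∧ (n = 1 ∨ c ≠ c₀)}

/-- The pairs `(y, c)` near `(y₀, c₀)`, with `c` in the closed half-plane of sign `s`, which do not
lie on the critical layer `U y = c`. -/
def offCritical (U : ℝ → ℝ) (n : ℕ) (y₀ : ℝ) (c₀ : ℂ) (r ε : ℝ) (s : ℤˣ) : Set (ℝ × ℂ) :=
  {p | p.1 ∈ Set.Ioo (y₀ - r) (y₀ + r) ∧ p.2 ∈ paramSet n c₀ ε ∩ closedHalfPlane s ∧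
    (U p.1 : ℂ) ≠ p.2}

/-- The parameters `c` near `c₀` which are not a value of `U` on the interval, so that the Rayleigh
equation is not singular there. -/
def noncriticalParams (U : ℝ → ℝ) (n : ℕ) (y₀ : ℝ) (c₀ : ℂ) (r ε : ℝ) : Set ℂ :=
  {c | c ∈ paramSet n c₀ ε ∧ ∀ z ∈ Set.Ioo (y₀ - r) (y₀ + r), (U z : ℂ) ≠ c}

/-- `ψ` is a family of solutions of the Rayleigh equation for `(y, c)` near `(y₀, c₀)`, regular off
the critical layer, bounded, with second derivative `O(1 / |U - c|)`.

When `c` is a value of `U` (hence real), a solution may have different limits as `c` is approached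
from the upper and from the lower half-plane (they come from the two determinations of
`log (U - c)`): `ψ 1` and `ψ (-1)` carry these two boundary values. For all other `c`, in
particular for all nonreal `c`, the two coincide. -/
structure IsLocalRayleighFamily (U : ℝ → ℝ) (α : ℝ) (n : ℕ) (y₀ : ℝ) (c₀ : ℂ) (r ε C : ℝ)
    (ψ : ℤˣ → ℝ → ℂ → ℂ) : Prop where
  /-- one single function away from the values of `U` -/
  agree : ∀ y ∈ Set.Ioo (y₀ - r) (y₀ + r), ∀ c ∈ noncriticalParams U n y₀ c₀ r ε,
    ψ 1 y c = ψ (-1) y c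
  /-- smoothness in `(y, c)` where `c` is not a value of `U` -/
  smooth : ∀ s : ℤˣ, ContDiffOn ℝ ∞ (fun p : ℝ × ℂ => ψ s p.1 p.2)
    (Set.Ioo (y₀ - r) (y₀ + r) ×ˢ noncriticalParams U n y₀ c₀ r ε)
  /-- smoothness in `(y, c)`, up to the real axis, off the critical layer -/
  smooth_side : ∀ s : ℤˣ, ContDiffOn ℝ ∞ (fun p : ℝ × ℂ => ψ s p.1 p.2)
    (offCritical U n y₀ c₀ r ε s)
  /-- continuity across the critical layer -/
  continuous_side : ∀ s : ℤˣ, ContinuousOn (fun p : ℝ × ℂ => ψ s p.1 p.2)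
    (Set.Ioo (y₀ - r) (y₀ + r) ×ˢ (paramSet n c₀ ε ∩ closedHalfPlane s))
  /-- the Rayleigh equation -/
  solves : ∀ s : ℤˣ, ∀ y c, (y, c) ∈ offCritical U n y₀ c₀ r ε s →
    rayleighOp U α c (fun x => ψ s x c) y = 0
  /-- boundedness -/
  bounded : ∀ s : ℤˣ, ∀ y ∈ Set.Ioo (y₀ - r) (y₀ + r), ∀ c ∈ paramSet n c₀ ε ∩ closedHalfPlane s,
    ‖ψ s y c‖ ≤ C
  /-- bound on the second derivative -/
  second_deriv : ∀ s : ℤˣ, ∀ y c, (y, c) ∈ offCritical U n y₀ c₀ r ε s →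
    ‖iteratedDeriv 2 (fun x => ψ s x c) y‖ ≤ C * ‖(U y : ℂ) - c‖⁻¹

set_option linter.unusedSectionVars false
set_option linter.style.longLine false

/-! Write β = α² and Q = U - c. Off the critical layer Q = 0 the equation is φ'' = (β + U''/Q) φ,
equivalently (Q² (φ/Q)')' = β Q φ. It is invariant under complex conjugation, so all the work is
done for Im c ≥ 0 and then reflected (`twoSided`).

Case n = 1. One solution has the form Qχ with χ smooth and nonvanishing, the other is Qχ ∫ (Qχ)⁻².
As U is merely smooth, no analytic continuation in the parameter is available, and the difficulty is
the smoothness of χ in (y, c) across the layer. For real c = a, a Volterra system of Frobenius type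
in the variable t = U - a yields χ (`exists_regular_solution`). It is carried to c = a + ib by an
almost analytic extension, the average ∫ k(s) f(y, a + bs) ds, where the moments of k are the powers
of i (`exists_moment_kernel`): formally this is the Taylor series of f(y, a + ib). Multiplication by
U - a becomes multiplication by U - c up to an error smaller than every power of b, because all
moments of (s - i) k vanish. This gives an approximate solution whose defect is flat at the real
axis (`exists_approximate_solution`). The defect is removed by a solution with zero data on one side
of the layer. That correction is as small as its source, since Q ∫ Q⁻² stays bounded across the
layer uniformly in Im c (`exists_norm_mul_integral_inv_sq_le`); each derivative costs only powers of
1/|Im c|, which a flat function absorbs (`flatOn_of_zero_data`). Three integrations by parts in ∫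
(Qχ)⁻² then express the second solution by log Q and smooth functions, so that only its y-derivative
is logarithmic (`exists_basis_of_deriv_pos`).

Case n ≥ 2. Rescale by δ = |c - c₀|^(1/n): in z = (y - y₀)/δ the profile becomes V, comparable to zⁿ
on [-ρ, ρ] with ρ = r/δ, and the parameter becomes a unit complex number. The solution vanishing at
-ρ is, up to the small term β, a multiple of Q I with I(z) = ∫ Q⁻² from -ρ to z. Splitting the
interval into far, monotone and central parts gives |Q I| ≲ ζ(z)
(`exists_norm_mul_integral_le_zetaWeight`), and reflection controls Q (J - I), where J = I(ρ). The
decisive fact is a lower bound for |J| (`exists_le_norm_integral`): an integration by parts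
expresses J through ∫ f/Q with f ≥ 1/2, and a suitable real linear functional of 1/Q is nonnegative
on the whole interval and has mass bounded below. The lower bound allows the β term to be absorbed
(`exists_scaled_solution_bound`) and keeps the solution away from zero at the right end. The second
solution is the mirror image, vanishing at y₀ + r; there the Wronskian reduces to one product, which
gives its lower bound.

For n ≥ 2 a punctured neighbourhood of c₀ meets only simple layers. Boundary values therefore come
from the case n = 1: near each layer the solution is a combination of the local basis with
coefficients given by Wronskians, and smoothness propagates along the interval by connectedness
(`exists_upper_extension`). -/

namespace Rayleigh

open Set Filter Topology MeasureTheory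

/-! ### Integrals over compact sets depending smoothly on a parameter. -/

section ParametricIntegral

variable {W G : Type} [NormedAddCommGroup W] [NormedSpace ℝ W] [MeasurableSpace W] [BorelSpace W]
  [SecondCountableTopology W] [NormedAddCommGroup G] [NormedSpace ℝ G] [FiniteDimensional ℝ G]

/-- Differentiation under the integral sign over a compact set. -/
theorem hasFDerivAt_setIntegral {E : Type} [NormedAddCommGroup E] [NormedSpace ℝ E]
    (μ : Measure W) [IsLocallyFiniteMeasure μ] {s : Set W} (hs : IsCompact s) {f : W × G → E}
    (hf : ContDiff ℝ 1 f) (q : G) :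
    HasFDerivAt (fun q => ∫ w in s, f (w, q) ∂μ)
      (∫ w in s, (fderiv ℝ f (w, q)).comp (ContinuousLinearMap.inr ℝ W G) ∂μ) q := by
  have : ProperSpace G := FiniteDimensional.proper ℝ G
  have hcont : Continuous f := hf.continuous
  have hd : Continuous (fun p : W × G => (fderiv ℝ f p).comp (ContinuousLinearMap.inr ℝ W G)) :=
    (hf.continuous_fderiv (by norm_num)).clm_comp continuous_const
  obtain ⟨C, hC⟩ := (hs.prod (isCompact_closedBall q 1)).exists_bound_of_continuousOn
    hd.continuousOn
  have hmeas : ∀ q : G, AEStronglyMeasurable (fun w => f (w, q)) (μ.restrict s) := fun q =>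
    ((hcont.comp (by fun_prop : Continuous fun w : W => (w, q))).continuousOn).aestronglyMeasurable
      hs.measurableSet
  refine hasFDerivAt_integral_of_dominated_of_fderiv_le (bound := fun _ => C)
    (s := Metric.closedBall q 1)
    (F' := fun q w => (fderiv ℝ f (w, q)).comp (ContinuousLinearMap.inr ℝ W G))
    (Metric.closedBall_mem_nhds q one_pos) (Eventually.of_forall hmeas) ?_ ?_ ?_ ?_ ?_
  · exact (hcont.comp (by fun_prop : Continuous fun w : W => (w, q))).continuousOn.integrableOn_compact
      hs
  · exact ((hd.comp (by fun_prop : Continuous fun w : W => (w, q))).continuousOn).aestronglyMeasurable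
      hs.measurableSet
  · filter_upwards [ae_restrict_mem hs.measurableSet] with w hw x hx
    exact hC (w, x) ⟨hw, hx⟩
  · exact (continuousOn_const (c := C)).integrableOn_compact hs
  · refine Eventually.of_forall fun w x _ => ?_
    have h1 : HasFDerivAt f (fderiv ℝ f (w, x)) (w, x) :=
      (hf.differentiable (by norm_num)).differentiableAt.hasFDerivAt
    have h2 : HasFDerivAt (fun x : G => ((w, x) : W × G)) (ContinuousLinearMap.inr ℝ W G) x :=
      hasFDerivAt_prodMk_right w x
    exact h1.comp x h2

/-- The integral of a jointly smooth function over a compact set is smooth in the parameter. -/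
theorem contDiff_setIntegral (μ : Measure W) [IsLocallyFiniteMeasure μ] {s : Set W}
    (hs : IsCompact s) (n : ℕ) : ∀ {E : Type} [NormedAddCommGroup E] [NormedSpace ℝ E]
    {f : W × G → E}, ContDiff ℝ n f → ContDiff ℝ n (fun q => ∫ w in s, f (w, q) ∂μ) := by
  have : ProperSpace G := FiniteDimensional.proper ℝ G
  -- The codomain stays general in the induction, because the derivative is an integral of the same
  -- kind with values in a space of linear maps.
  induction n with
  | zero =>
    intro E _ _ f hf
    have : Continuous f := hf.continuous
    refine contDiff_zero.2 (continuous_parametric_integral_of_continuous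
      (f := fun q w => f (w, q)) ?_ hs)
    exact this.comp (by fun_prop : Continuous fun p : G × W => (p.2, p.1))
  | succ n ih =>
    intro E _ _ f hf
    have h1 : ContDiff ℝ 1 f := hf.of_le (by exact_mod_cast Nat.le_add_left 1 n)
    refine contDiff_succ_iff_hasFDerivAt.2 ⟨_, ?_, fun q => hasFDerivAt_setIntegral μ hs h1 q⟩
    apply ih (f := fun p => (fderiv ℝ f p).comp (ContinuousLinearMap.inr ℝ W G))
    exact (hf.fderiv_right (m := n) (by norm_cast)).clm_comp contDiff_const

end ParametricIntegral

/-! ### Smoothness up to the boundary of a half-plane. -/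

section Boundary

/-- The partial derivative data of a function on a relatively open part of the closed half-plane
`0 ≤ Im c`: if the derivative in the open half-plane extends smoothly up to the boundary, so does
the function. -/
theorem contDiffOn_succ_closedHalf {E : Type} [NormedAddCommGroup E] [NormedSpace ℝ E]
    {O : Set (ℝ × ℂ)} (hO : IsOpen O) {f : ℝ × ℂ → E} {g : ℝ × ℂ → (ℝ × ℂ →L[ℝ] E)} {n : ℕ}
    (hf : ContinuousOn f (O ∩ {p | 0 ≤ p.2.im}))
    (hfd : ∀ p ∈ O, 0 < p.2.im → HasFDerivAt f (g p) p)
    (hg : ContDiffOn ℝ n g (O ∩ {p | 0 ≤ p.2.im})) :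
    ContDiffOn ℝ (n + 1 : ℕ) f (O ∩ {p | 0 ≤ p.2.im}) := by
  have key : ∀ x ∈ O ∩ {p : ℝ × ℂ | 0 ≤ p.2.im},
      HasFDerivWithinAt f (g x) (O ∩ {p | 0 ≤ p.2.im}) x := by
    rintro x ⟨hxO, hx⟩
    obtain ⟨ρ, hρ, hball⟩ := Metric.isOpen_iff.1 hO x hxO
    -- Half the radius, so that the closure of the ball still lies in `O`.
    set B := Metric.ball x (ρ / 2) with hB
    set H : Set (ℝ × ℂ) := {p | 0 < p.2.im} with hH
    have hHo : IsOpen H := isOpen_lt continuous_const (Complex.continuous_im.comp continuous_snd)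
    have hHc : Convex ℝ H := by
      have : IsLinearMap ℝ (fun p : ℝ × ℂ => p.2.im) := ⟨fun _ _ => by simp, fun _ _ => by simp⟩
      exact convex_halfSpace_gt this 0
    have hclH : closure H ⊆ {p : ℝ × ℂ | 0 ≤ p.2.im} :=
      closure_minimal (fun p (hp : 0 < p.2.im) => hp.le)
        (isClosed_le continuous_const (Complex.continuous_im.comp continuous_snd))
    have hBO : closure (B ∩ H) ⊆ O ∩ {p | 0 ≤ p.2.im} := by
      intro p hp
      refine ⟨hball ?_, hclH (closure_mono inter_subset_right hp)⟩
      have := Metric.closure_ball_subset_closedBall (closure_mono inter_subset_left hp)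
      exact lt_of_le_of_lt (Metric.mem_closedBall.1 this) (by linarith)
    -- By the mean value inequality on the convex open set `B ∩ H`, a derivative that has a limit at
    -- a boundary point is the derivative there.
    have h1 : HasFDerivWithinAt f (g x) (closure (B ∩ H)) x := by
      refine hasFDerivWithinAt_closure_of_tendsto_fderiv ?_ ((convex_ball _ _).inter hHc)
        (Metric.isOpen_ball.inter hHo) ?_ ?_
      · intro p hp
        exact (hfd p (hBO (subset_closure hp)).1 hp.2).differentiableAt.differentiableWithinAt
      · intro y hy
        exact (hf y (hBO hy)).mono (subset_closure.trans hBO)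
      · have h2 : Tendsto g (𝓝[B ∩ H] x) (𝓝 (g x)) :=
          ((hg.continuousOn x ⟨hxO, hx⟩).mono (subset_closure.trans hBO))
        refine h2.congr' ?_
        filter_upwards [self_mem_nhdsWithin] with p hp
        exact (hfd p (hBO (subset_closure hp)).1 hp.2).fderiv.symm
    refine h1.mono_of_mem_nhdsWithin ?_
    have hH' : {p : ℝ × ℂ | 0 ≤ p.2.im} ⊆ closure H := by
      have : H = univ ×ˢ {c : ℂ | 0 < c.im} := by ext; simp [hH]
      rw [this, closure_prod_eq, closure_univ, Complex.closure_setOfPred_lt_im]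
      exact fun p hp => ⟨mem_univ _, hp⟩
    have : B ∩ {p : ℝ × ℂ | 0 ≤ p.2.im} ⊆ closure (B ∩ H) :=
      fun p hp => Metric.isOpen_ball.inter_closure ⟨hp.1, hH' hp.2⟩
    refine mem_of_superset (inter_mem_nhdsWithin _ (Metric.ball_mem_nhds x (half_pos hρ))) ?_
    rintro p ⟨⟨_, hp⟩, hpB⟩
    exact this ⟨hpB, hp⟩
  rw [show ((n + 1 : ℕ) : WithTop ℕ∞) = n + 1 by norm_cast,
    contDiffOn_succ_iff_hasFDerivWithinAt (by exact_mod_cast ENat.natCast_ne_top n)]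
  intro x hx
  refine ⟨O ∩ {p | 0 ≤ p.2.im}, ?_, by norm_num, g, fun y hy => key y hy, hg⟩
  rw [insert_eq_of_mem hx]
  exact self_mem_nhdsWithin

end Boundary

/-! ### Functions flat at the real axis, and functions of moderate growth there. -/

section Flat

variable {E F G : Type} [NormedAddCommGroup E] [NormedSpace ℝ E] [NormedAddCommGroup F]
  [NormedSpace ℝ F] [NormedAddCommGroup G] [NormedSpace ℝ G]

/-- `f` is smooth on `S`, and its derivatives of order at most `k` are `O(|Im c| ^ N)` for all `N`. -/
structure FlatOn (S : Set (ℝ × ℂ)) (k : ℕ) (f : ℝ × ℂ → E) : Prop where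
  contDiffOn : ContDiffOn ℝ ∞ f S
  bound : ∀ j ≤ k, ∀ N : ℕ, ∃ C, ∀ p ∈ S, ‖iteratedFDeriv ℝ j f p‖ ≤ C * |p.2.im| ^ N

/-- `f` is smooth on `S`, and its derivatives of order at most `k` grow at most like a power of
`1 / |Im c|`. -/
structure ModerateOn (S : Set (ℝ × ℂ)) (k : ℕ) (f : ℝ × ℂ → E) : Prop where
  contDiffOn : ContDiffOn ℝ ∞ f S
  bound : ∀ j ≤ k, ∃ N : ℕ, ∃ C, ∀ p ∈ S, ‖iteratedFDeriv ℝ j f p‖ * |p.2.im| ^ N ≤ C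

variable {S : Set (ℝ × ℂ)} {k : ℕ} {f g : ℝ × ℂ → E}

theorem FlatOn.mono (h : FlatOn S k f) {l : ℕ} (hl : l ≤ k) : FlatOn S l f :=
  ⟨h.contDiffOn, fun j hj => h.bound j (hj.trans hl)⟩

theorem ModerateOn.mono (h : ModerateOn S k f) {l : ℕ} (hl : l ≤ k) : ModerateOn S l f :=
  ⟨h.contDiffOn, fun j hj => h.bound j (hj.trans hl)⟩

theorem FlatOn.mono_set (h : FlatOn S k f) {T : Set (ℝ × ℂ)} (hT : T ⊆ S) : FlatOn T k f :=
  ⟨h.contDiffOn.mono hT, fun j hj N => (h.bound j hj N).imp fun _ hC p hp => hC p (hT hp)⟩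

theorem contDiffOn_iteratedFDeriv_congr (hS : IsOpen S) (hfg : ∀ p ∈ S, f p = g p) {p : ℝ × ℂ}
    (hp : p ∈ S) (j : ℕ) : iteratedFDeriv ℝ j f p = iteratedFDeriv ℝ j g p :=
  (Filter.EventuallyEq.iteratedFDeriv ℝ
    (Filter.eventually_of_mem (hS.mem_nhds hp) hfg : f =ᶠ[𝓝 p] g) j).self_of_nhds

theorem FlatOn.congr (hS : IsOpen S) (h : FlatOn S k f) (hfg : ∀ p ∈ S, g p = f p) :
    FlatOn S k g :=
  ⟨h.contDiffOn.congr hfg, fun j hj N => (h.bound j hj N).imp fun _ hC p hp => by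
    rw [contDiffOn_iteratedFDeriv_congr hS hfg hp]; exact hC p hp⟩

theorem ModerateOn.congr (hS : IsOpen S) (h : ModerateOn S k f) (hfg : ∀ p ∈ S, g p = f p) :
    ModerateOn S k g :=
  ⟨h.contDiffOn.congr hfg, fun j hj => (h.bound j hj).imp fun _ => Exists.imp fun _ hC p hp => by
    rw [contDiffOn_iteratedFDeriv_congr hS hfg hp]; exact hC p hp⟩

/-- The device for all inductions on the order: estimates of order `k + 1` are estimates of order
`k` for the Fréchet derivative, at the price of a larger codomain. -/
theorem flatOn_succ_iff (hS : IsOpen S) :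
    FlatOn S (k + 1) f ↔ FlatOn S 0 f ∧ FlatOn S k (fderiv ℝ f) := by
  constructor
  · intro h
    refine ⟨h.mono (Nat.zero_le _), (contDiffOn_infty_iff_fderiv_of_isOpen hS |>.1 h.contDiffOn).2,
      fun j hj N => ?_⟩
    obtain ⟨C, hC⟩ := h.bound (j + 1) (by omega) N
    exact ⟨C, fun p hp => by rw [norm_iteratedFDeriv_fderiv]; exact hC p hp⟩
  · rintro ⟨h0, h1⟩
    refine ⟨h0.contDiffOn, fun j hj N => ?_⟩
    rcases j with _ | j
    · exact h0.bound 0 le_rfl N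
    · obtain ⟨C, hC⟩ := h1.bound j (by omega) N
      exact ⟨C, fun p hp => by rw [← norm_iteratedFDeriv_fderiv]; exact hC p hp⟩

theorem moderateOn_succ_iff (hS : IsOpen S) :
    ModerateOn S (k + 1) f ↔ ModerateOn S 0 f ∧ ModerateOn S k (fderiv ℝ f) := by
  constructor
  · intro h
    refine ⟨h.mono (Nat.zero_le _), (contDiffOn_infty_iff_fderiv_of_isOpen hS |>.1 h.contDiffOn).2,
      fun j hj => ?_⟩
    obtain ⟨N, C, hC⟩ := h.bound (j + 1) (by omega)
    exact ⟨N, C, fun p hp => by rw [norm_iteratedFDeriv_fderiv]; exact hC p hp⟩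
  · rintro ⟨h0, h1⟩
    refine ⟨h0.contDiffOn, fun j hj => ?_⟩
    rcases j with _ | j
    · exact h0.bound 0 le_rfl
    · obtain ⟨N, C, hC⟩ := h1.bound j (by omega)
      exact ⟨N, C, fun p hp => by rw [← norm_iteratedFDeriv_fderiv]; exact hC p hp⟩

theorem flatOn_zero_iff : FlatOn S 0 f ↔
    ContDiffOn ℝ ∞ f S ∧ ∀ N : ℕ, ∃ C, ∀ p ∈ S, ‖f p‖ ≤ C * |p.2.im| ^ N := by
  constructor
  · intro h
    exact ⟨h.contDiffOn, fun N => (h.bound 0 le_rfl N).imp fun C hC p hp => by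
      simpa using hC p hp⟩
  · rintro ⟨h0, h1⟩
    refine ⟨h0, fun j hj N => (h1 N).imp fun C hC p hp => ?_⟩
    obtain rfl : j = 0 := by omega
    simpa using hC p hp

theorem moderateOn_zero_iff : ModerateOn S 0 f ↔
    ContDiffOn ℝ ∞ f S ∧ ∃ N : ℕ, ∃ C, ∀ p ∈ S, ‖f p‖ * |p.2.im| ^ N ≤ C := by
  constructor
  · intro h
    exact ⟨h.contDiffOn, (h.bound 0 le_rfl).imp fun N => Exists.imp fun C hC p hp => by
      simpa using hC p hp⟩
  · rintro ⟨h0, h1⟩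
    refine ⟨h0, fun j hj => h1.imp fun N => Exists.imp fun C hC p hp => ?_⟩
    obtain rfl : j = 0 := by omega
    simpa using hC p hp

theorem FlatOn.add (hS : IsOpen S) (hf : FlatOn S k f) (hg : FlatOn S k g) :
    FlatOn S k (fun p => f p + g p) := by
  refine ⟨hf.contDiffOn.add hg.contDiffOn, fun j hj N => ?_⟩
  obtain ⟨C, hC⟩ := hf.bound j hj N
  obtain ⟨D, hD⟩ := hg.bound j hj N
  refine ⟨C + D, fun p hp => ?_⟩
  have h1 : iteratedFDeriv ℝ j (fun p => f p + g p) p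
      = iteratedFDeriv ℝ j f p + iteratedFDeriv ℝ j g p :=
    iteratedFDeriv_add_apply ((hf.contDiffOn.contDiffAt (hS.mem_nhds hp)).of_le (by exact_mod_cast le_top))
      ((hg.contDiffOn.contDiffAt (hS.mem_nhds hp)).of_le (by exact_mod_cast le_top))
  rw [h1, add_mul]
  exact (norm_add_le _ _).trans (add_le_add (hC p hp) (hD p hp))

theorem FlatOn.clm_comp (hS : IsOpen S) (hf : FlatOn S k f) (A : E →L[ℝ] F) :
    FlatOn S k (fun p => A (f p)) := by
  refine ⟨A.contDiff.comp_contDiffOn hf.contDiffOn, fun j hj N => ?_⟩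
  obtain ⟨C, hC⟩ := hf.bound j hj N
  refine ⟨‖A‖ * C, fun p hp => ?_⟩
  have h1 : ‖iteratedFDeriv ℝ j (A ∘ f) p‖ ≤ ‖A‖ * ‖iteratedFDeriv ℝ j f p‖ :=
    A.norm_iteratedFDeriv_comp_left (N := ∞) (hf.contDiffOn.contDiffAt (hS.mem_nhds hp))
      (by exact_mod_cast le_top)
  refine h1.trans ?_
  rw [mul_assoc]
  exact mul_le_mul_of_nonneg_left (hC p hp) (norm_nonneg _)

theorem ModerateOn.clm_comp (hS : IsOpen S) (hf : ModerateOn S k f) (A : E →L[ℝ] F) :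
    ModerateOn S k (fun p => A (f p)) := by
  refine ⟨A.contDiff.comp_contDiffOn hf.contDiffOn, fun j hj => ?_⟩
  obtain ⟨N, C, hC⟩ := hf.bound j hj
  refine ⟨N, ‖A‖ * C, fun p hp => ?_⟩
  have h1 : ‖iteratedFDeriv ℝ j (A ∘ f) p‖ ≤ ‖A‖ * ‖iteratedFDeriv ℝ j f p‖ :=
    A.norm_iteratedFDeriv_comp_left (N := ∞) (hf.contDiffOn.contDiffAt (hS.mem_nhds hp))
      (by exact_mod_cast le_top)
  calc _ ≤ ‖A‖ * ‖iteratedFDeriv ℝ j f p‖ * |p.2.im| ^ N := by gcongr; exact h1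
    _ = ‖A‖ * (‖iteratedFDeriv ℝ j f p‖ * |p.2.im| ^ N) := by ring
    _ ≤ _ := mul_le_mul_of_nonneg_left (hC p hp) (norm_nonneg _)

theorem norm_iteratedFDeriv_bilin_le (hS : IsOpen S) (B : E →L[ℝ] F →L[ℝ] G) {g : ℝ × ℂ → F}
    (hf : ContDiffOn ℝ ∞ f S) (hg : ContDiffOn ℝ ∞ g S) {p : ℝ × ℂ} (hp : p ∈ S) (j : ℕ) :
    ‖iteratedFDeriv ℝ j (fun p => B (f p) (g p)) p‖ ≤ ‖B‖ * ∑ i ∈ Finset.range (j + 1),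
      (j.choose i : ℝ) * ‖iteratedFDeriv ℝ i f p‖ * ‖iteratedFDeriv ℝ (j - i) g p‖ := by
  have := B.norm_iteratedFDerivWithin_le_of_bilinear hf hg hS.uniqueDiffOn hp (n := j)
    (by exact_mod_cast le_top)
  simpa only [iteratedFDerivWithin_of_isOpen _ hS hp] using this

/-- By the Leibniz rule: the moderate factor consumes finitely many powers of |Im c|, and the flat
factor supplies as many as needed. -/
theorem FlatOn.bilin (hS : IsOpen S) (hS0 : ∀ p ∈ S, p.2.im ≠ 0) (B : E →L[ℝ] F →L[ℝ] G)
    {g : ℝ × ℂ → F} (hf : ModerateOn S k f) (hg : FlatOn S k g) :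
    FlatOn S k (fun p => B (f p) (g p)) := by
  refine ⟨B.isBoundedBilinearMap.contDiff.comp_contDiffOn (hf.contDiffOn.prodMk hg.contDiffOn),
    fun j hj N => ?_⟩
  have h1 : ∀ i ∈ Finset.range (j + 1), ∃ C, ∀ p ∈ S,
      (j.choose i : ℝ) * ‖iteratedFDeriv ℝ i f p‖ * ‖iteratedFDeriv ℝ (j - i) g p‖
        ≤ C * |p.2.im| ^ N := by
    intro i hi
    have hi' : i ≤ j := by simpa [Nat.lt_succ_iff] using hi
    obtain ⟨M, C, hC⟩ := hf.bound i (hi'.trans hj)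
    -- The `M` additional powers pay for the growth of the derivative of `f`.
    obtain ⟨D, hD⟩ := hg.bound (j - i) (by omega) (N + M)
    refine ⟨j.choose i * (C * D), fun p hp => ?_⟩
    have hb : 0 < |p.2.im| ^ (N + M) := pow_pos (abs_pos.2 (hS0 p hp)) _
    have hD0 : 0 ≤ D := by
      have := (norm_nonneg _).trans (hD p hp)
      exact le_of_mul_le_mul_right (by simpa using this) hb
    calc _ = j.choose i * (‖iteratedFDeriv ℝ i f p‖ * ‖iteratedFDeriv ℝ (j - i) g p‖) := by ring
      _ ≤ j.choose i * (‖iteratedFDeriv ℝ i f p‖ * (D * |p.2.im| ^ (N + M))) := by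
          gcongr; exact hD p hp
      _ = j.choose i * ((‖iteratedFDeriv ℝ i f p‖ * |p.2.im| ^ M) * D * |p.2.im| ^ N) := by
          rw [pow_add]; ring
      _ ≤ j.choose i * (C * D * |p.2.im| ^ N) := by gcongr; exact hC p hp
      _ = _ := by ring
  choose! C hC using h1
  refine ⟨‖B‖ * ∑ i ∈ Finset.range (j + 1), C i, fun p hp => ?_⟩
  refine (norm_iteratedFDeriv_bilin_le hS B hf.contDiffOn hg.contDiffOn hp j).trans ?_
  rw [mul_assoc, Finset.sum_mul]
  exact mul_le_mul_of_nonneg_left (Finset.sum_le_sum fun i hi => hC i hi p hp) (norm_nonneg B)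

theorem ModerateOn.bilin (hS : IsOpen S) (hS1 : ∀ p ∈ S, |p.2.im| ≤ 1) (B : E →L[ℝ] F →L[ℝ] G)
    {g : ℝ × ℂ → F} (hf : ModerateOn S k f) (hg : ModerateOn S k g) :
    ModerateOn S k (fun p => B (f p) (g p)) := by
  refine ⟨B.isBoundedBilinearMap.contDiff.comp_contDiffOn (hf.contDiffOn.prodMk hg.contDiffOn),
    fun j hj => ?_⟩
  have h1 : ∀ i ∈ Finset.range (j + 1), ∃ N : ℕ, ∃ C, ∀ p ∈ S,
      (j.choose i : ℝ) * ‖iteratedFDeriv ℝ i f p‖ * ‖iteratedFDeriv ℝ (j - i) g p‖ * |p.2.im| ^ N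
        ≤ C := by
    intro i hi
    have hi' : i ≤ j := by simpa [Nat.lt_succ_iff] using hi
    obtain ⟨M, C, hC⟩ := hf.bound i (hi'.trans hj)
    obtain ⟨M', D, hD⟩ := hg.bound (j - i) (by omega)
    refine ⟨M + M', j.choose i * (C * D), fun p hp => ?_⟩
    have hC0 : 0 ≤ C := (mul_nonneg (norm_nonneg _) (by positivity)).trans (hC p hp)
    calc _ = j.choose i * ((‖iteratedFDeriv ℝ i f p‖ * |p.2.im| ^ M) *
          (‖iteratedFDeriv ℝ (j - i) g p‖ * |p.2.im| ^ M')) := by rw [pow_add]; ring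
      _ ≤ _ := by
        gcongr
        · exact hC p hp
        · exact hD p hp
  choose! N C hC using h1
  -- The sum serves as a common exponent for all Leibniz terms; raising an exponent is harmless
  -- because |Im c| ≤ 1.
  refine ⟨∑ i ∈ Finset.range (j + 1), N i, ‖B‖ * ∑ i ∈ Finset.range (j + 1), C i, fun p hp => ?_⟩
  refine (mul_le_mul_of_nonneg_right
    (norm_iteratedFDeriv_bilin_le hS B hf.contDiffOn hg.contDiffOn hp j) (by positivity)).trans ?_
  rw [mul_assoc, Finset.sum_mul]
  gcongr with i hi
  refine le_trans ?_ (hC i hi p hp)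
  refine mul_le_mul_of_nonneg_left ?_ (by positivity)
  exact pow_le_pow_of_le_one (abs_nonneg _) (hS1 p hp)
    (Finset.single_le_sum (f := N) (fun _ _ => Nat.zero_le _) hi)

/-- A function with bounded derivatives is moderate. -/
theorem moderateOn_of_bounded (hf : ContDiffOn ℝ ∞ f S)
    (h : ∀ j : ℕ, ∃ C, ∀ p ∈ S, ‖iteratedFDeriv ℝ j f p‖ ≤ C) : ModerateOn S k f :=
  ⟨hf, fun j _ => ⟨0, (h j).imp fun C hC p hp => by simpa using hC p hp⟩⟩

/-- The reciprocal of a bounded smooth function of size at least `|Im c|` is moderate. -/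
theorem moderateOn_inv (hS : IsOpen S) (hS0 : ∀ p ∈ S, p.2.im ≠ 0) (hS1 : ∀ p ∈ S, |p.2.im| ≤ 1)
    {q : ℝ × ℂ → ℂ} (hq : ContDiffOn ℝ ∞ q S)
    (hb : ∀ j : ℕ, ∃ C, ∀ p ∈ S, ‖iteratedFDeriv ℝ j q p‖ ≤ C)
    (hlow : ∀ p ∈ S, |p.2.im| ≤ ‖q p‖) : ∀ k, ModerateOn S k (fun p => (q p)⁻¹) := by
  have hne : ∀ p ∈ S, q p ≠ 0 := fun p hp =>
    norm_pos_iff.1 ((abs_pos.2 (hS0 p hp)).trans_le (hlow p hp))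
  have hsm : ContDiffOn ℝ ∞ (fun p => (q p)⁻¹) S := hq.inv hne
  intro k
  induction k with
  | zero =>
    refine moderateOn_zero_iff.2 ⟨hsm, 1, 1, fun p hp => ?_⟩
    rw [norm_inv, pow_one, inv_mul_le_iff₀ (norm_pos_iff.2 (hne p hp)), mul_one]
    exact hlow p hp
  | succ k ih =>
    refine (moderateOn_succ_iff hS).2 ⟨ih.mono (Nat.zero_le _), ?_⟩
    have hDq : ModerateOn S k (fderiv ℝ q) := by
      refine moderateOn_of_bounded ((contDiffOn_infty_iff_fderiv_of_isOpen hS).1 hq).2 fun j => ?_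
      obtain ⟨C, hC⟩ := hb (j + 1)
      exact ⟨C, fun p hp => by rw [norm_iteratedFDeriv_fderiv]; exact hC p hp⟩
    -- Since D(1/q) = -q⁻² Dq, order `k + 1` for 1/q follows from order `k` for the product of 1/q,
    -- 1/q and Dq.
    have h2 : ModerateOn S k (fun p => (q p)⁻¹ * (q p)⁻¹) :=
      ModerateOn.bilin hS hS1 (ContinuousLinearMap.mul ℝ ℂ) ih ih
    have h3 := ModerateOn.bilin hS hS1
      (ContinuousLinearMap.lsmul ℝ ℂ : ℂ →L[ℝ] (ℝ × ℂ →L[ℝ] ℂ) →L[ℝ] (ℝ × ℂ →L[ℝ] ℂ)) h2 hDq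
    have h4 := h3.clm_comp hS (-ContinuousLinearMap.id ℝ _)
    refine h4.congr hS fun p hp => ?_
    have hd : HasFDerivAt q (fderiv ℝ q p) p :=
      ((hq.contDiffAt (hS.mem_nhds hp)).differentiableAt (by norm_num)).hasFDerivAt
    have h5 := (hasDerivAt_inv (hne p hp)).comp_hasFDerivAt (𝕜 := ℝ) p hd
    rw [show (fun p => (q p)⁻¹) = Inv.inv ∘ q from rfl, h5.fderiv]
    ext v <;> simp [sq]

/-- A flat function extends smoothly by zero to the real axis. -/
theorem contDiffOn_of_flat {O : Set (ℝ × ℂ)} (hO : IsOpen O) (n : ℕ) :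
    ∀ {E : Type} [NormedAddCommGroup E] [NormedSpace ℝ E] {f : ℝ × ℂ → E},
      (∀ k, FlatOn (O ∩ {p | p.2.im ≠ 0}) k f) → (∀ p, p.2.im = 0 → f p = 0) →
      ContDiffOn ℝ n f O := by
  have him : Continuous fun p : ℝ × ℂ => p.2.im := Complex.continuous_im.comp continuous_snd
  have hS : IsOpen (O ∩ {p : ℝ × ℂ | p.2.im ≠ 0}) :=
    hO.inter (isOpen_ne_fun him continuous_const)
  have key : ∀ {E : Type} [NormedAddCommGroup E] [NormedSpace ℝ E] {f : ℝ × ℂ → E},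
      (∀ k, FlatOn (O ∩ {p | p.2.im ≠ 0}) k f) → (∀ p, p.2.im = 0 → f p = 0) →
      (∀ p ∈ O, DifferentiableAt ℝ f p) ∧ ∀ p ∈ O, p.2.im = 0 → fderiv ℝ f p = 0 := by
    intro E _ _ f hf h0
    have hz : ∀ p ∈ O, p.2.im = 0 → HasFDerivAt f (0 : ℝ × ℂ →L[ℝ] E) p := by
      intro p hp hp0
      -- Near a real point |Im| is at most the norm of the increment, so the exponent 2 makes `f`
      -- quadratically small and its derivative zero there.
      obtain ⟨C, hC⟩ := (flatOn_zero_iff.1 (hf 0)).2 2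
      rw [hasFDerivAt_iff_isLittleO_nhds_zero]
      have hbig : (fun h : ℝ × ℂ => f (p + h) - f p - (0 : ℝ × ℂ →L[ℝ] E) h)
          =O[𝓝 0] fun h => ‖h‖ ^ 2 := by
        refine Asymptotics.IsBigO.of_bound |C| ?_
        have : ∀ᶠ h : ℝ × ℂ in 𝓝 0, p + h ∈ O := by
          have : Tendsto (fun h : ℝ × ℂ => p + h) (𝓝 0) (𝓝 p) := by
            have h1 : Continuous fun h : ℝ × ℂ => p + h := by fun_prop
            simpa using h1.tendsto 0
          exact this.eventually (hO.mem_nhds hp)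
        filter_upwards [this] with h hh
        have him_le : |(p + h).2.im| ≤ ‖h‖ := by
          simp only [Prod.snd_add, Complex.add_im, hp0, zero_add]
          exact (Complex.abs_im_le_norm _).trans (norm_snd_le h)
        rw [h0 p hp0]
        by_cases hq : (p + h).2.im = 0
        · simp only [h0 _ hq]; simp; positivity
        · simp only [sub_zero, zero_apply, norm_pow, norm_norm]
          refine (hC _ ⟨hh, hq⟩).trans ?_
          gcongr
          exact le_abs_self C
      exact hbig.trans_isLittleO (Asymptotics.isLittleO_norm_pow_id one_lt_two)
    refine ⟨fun p hp => ?_, fun p hp hp0 => (hz p hp hp0).fderiv⟩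
    by_cases hp0 : p.2.im = 0
    · exact (hz p hp hp0).differentiableAt
    · exact ((hf 0).contDiffOn.contDiffAt (hS.mem_nhds ⟨hp, hp0⟩)).differentiableAt (by norm_num)
  induction n with
  | zero =>
    intro E _ _ f hf h0
    exact contDiffOn_zero.2 fun p hp => ((key hf h0).1 p hp).continuousAt.continuousWithinAt
  | succ n ih =>
    intro E _ _ f hf h0
    obtain ⟨hd, hz⟩ := key hf h0
    rw [show ((n + 1 : ℕ) : WithTop ℕ∞) = n + 1 by norm_cast,
      contDiffOn_succ_iff_fderiv_of_isOpen hO]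
    refine ⟨fun p hp => (hd p hp).differentiableWithinAt, by norm_num, ?_⟩
    classical
    -- The induction hypothesis asks for vanishing at every real point, also outside `O`, where
    -- nothing is known about the derivative. Hence the derivative is replaced by zero on the real
    -- axis, which changes nothing on `O`.
    have h1 : ContDiffOn ℝ n (fun p : ℝ × ℂ => if p.2.im = 0 then 0 else fderiv ℝ f p) O := by
      refine ih (fun k => ?_) fun p hp => if_pos hp
      exact ((flatOn_succ_iff hS).1 (hf (k + 1))).2.congr hS fun p hp => if_neg hp.2
    refine h1.congr fun p hp => ?_
    by_cases hp0 : p.2.im = 0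
    · simp [hp0, hz p hp hp0]
    · simp [hp0]

end Flat

/-! ### Linear Volterra equations with parameters, on a fixed domain of integration. -/

section Volterra

variable {W P : Type} [NormedAddCommGroup W] [NormedSpace ℝ W] [MeasurableSpace W] [BorelSpace W]
  [SecondCountableTopology W] [NormedAddCommGroup P] [NormedSpace ℝ P] [FiniteDimensional ℝ P]

/-- Contraction of the first variable by the factor `m`. -/
noncomputable def contractFst (P : Type) [NormedAddCommGroup P] [NormedSpace ℝ P] (m : ℝ) :
    (ℝ × P) →L[ℝ] (ℝ × P) :=
  (m • ContinuousLinearMap.fst ℝ ℝ P).prod (ContinuousLinearMap.snd ℝ ℝ P)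

@[simp] theorem contractFst_apply (m : ℝ) (q : ℝ × P) : contractFst P m q = (m * q.1, q.2) := by
  simp [contractFst]

theorem contDiff_contractFst : ContDiff ℝ ∞ (fun m : ℝ => contractFst P m) := by
  have h1 : ∀ m : ℝ, contractFst P m = m • ((ContinuousLinearMap.fst ℝ ℝ P).prod 0)
      + (0 : (ℝ × P) →L[ℝ] ℝ).prod (ContinuousLinearMap.snd ℝ ℝ P) := by
    intro m; ext q <;> simp
  simp_rw [h1]
  exact (contDiff_id.smul contDiff_const).add contDiff_const

theorem norm_contractFst_apply_le {m : ℝ} (h0 : 0 ≤ m) (h1 : m ≤ 1) (q : ℝ × P) :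
    ‖contractFst P m q‖ ≤ ‖q‖ := by
  rw [contractFst_apply, Prod.norm_def, Prod.norm_def]
  refine max_le_max ?_ le_rfl
  rw [norm_mul, Real.norm_of_nonneg h0]
  exact mul_le_of_le_one_left (norm_nonneg _) h1

theorem norm_contractFst_le {m : ℝ} (h0 : 0 ≤ m) (h1 : m ≤ 1) : ‖contractFst P m‖ ≤ 1 :=
  ContinuousLinearMap.opNorm_le_bound _ zero_le_one fun q => by
    rw [one_mul]; exact norm_contractFst_apply_le h0 h1 q

/-- Geometric decay, uniformly on balls. -/
def GeoDecay {E : Type} [NormedAddCommGroup E] (h : ℕ → ℝ × P → E) : Prop :=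
  ∀ R : ℝ, ∃ B : ℝ, ∀ n q, ‖q‖ ≤ R → ‖h n q‖ ≤ B * (1 / 2) ^ n

/-- Geometric decay of the derivatives of order at most `j`. -/
def GeoDecayUpTo : ℕ → ∀ {E : Type} [NormedAddCommGroup E] [NormedSpace ℝ E],
    (ℕ → ℝ × P → E) → Prop
  | 0, _, _, _, h => GeoDecay h
  | j + 1, _, _, _, h => GeoDecay h ∧ GeoDecayUpTo j fun n => fderiv ℝ (h n)

theorem GeoDecayUpTo.zero {j : ℕ} {E : Type} [NormedAddCommGroup E] [NormedSpace ℝ E]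
    {h : ℕ → ℝ × P → E} (hh : GeoDecayUpTo j h) : GeoDecay h := by
  cases j with
  | zero => exact hh
  | succ j => exact hh.1

theorem GeoDecay.add {E : Type} [NormedAddCommGroup E] {h g : ℕ → ℝ × P → E} (hh : GeoDecay h)
    (hg : GeoDecay g) : GeoDecay fun n q => h n q + g n q := by
  intro R
  obtain ⟨B, hB⟩ := hh R
  obtain ⟨C, hC⟩ := hg R
  refine ⟨B + C, fun n q hq => ?_⟩
  rw [add_mul]
  exact (norm_add_le _ _).trans (add_le_add (hB n q hq) (hC n q hq))

theorem GeoDecayUpTo.add {j : ℕ} : ∀ {E : Type} [NormedAddCommGroup E] [NormedSpace ℝ E]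
    {h g : ℕ → ℝ × P → E}, (∀ n, ContDiff ℝ ∞ (h n)) → (∀ n, ContDiff ℝ ∞ (g n)) →
    GeoDecayUpTo j h → GeoDecayUpTo j g → GeoDecayUpTo j fun n q => h n q + g n q := by
  induction j with
  | zero => exact fun _ _ hh hg => GeoDecay.add hh hg
  | succ j ih =>
    intro E _ _ h g hhs hgs hh hg
    refine ⟨hh.1.add hg.1, ?_⟩
    have : (fun n => fderiv ℝ (fun q => h n q + g n q))
        = fun n q => fderiv ℝ (h n) q + fderiv ℝ (g n) q := by
      funext n q
      exact fderiv_fun_add ((hhs n).differentiable (by norm_num)).differentiableAt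
        ((hgs n).differentiable (by norm_num)).differentiableAt
    rw [this]
    exact ih (fun n => (hhs n).fderiv_right (by norm_cast)) (fun n => (hgs n).fderiv_right (by norm_cast))
      hh.2 hg.2

theorem GeoDecayUpTo.mono {j : ℕ} : ∀ {E : Type} [NormedAddCommGroup E] [NormedSpace ℝ E]
    {h : ℕ → ℝ × P → E}, GeoDecayUpTo (j + 1) h → GeoDecayUpTo j h := by
  induction j with
  | zero => exact fun hh => hh.1
  | succ j ih => exact fun hh => ⟨hh.1, ih hh.2⟩

variable (μ : Measure W) [IsLocallyFiniteMeasure μ] {s : Set W} {m : W → ℝ}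

/-- The integral operator with kernel `K`, which contracts the first variable. -/
noncomputable def volterraOp {E F : Type} [NormedAddCommGroup E] [NormedSpace ℝ E]
    [NormedAddCommGroup F] [NormedSpace ℝ F] (s : Set W) (m : W → ℝ)
    (K : W × (ℝ × P) → (E →L[ℝ] F)) (f : ℝ × P → E) (q : ℝ × P) : F :=
  ∫ w in s, K (w, q) (f (contractFst P (m w) q)) ∂μ

section Derivative

variable {E F : Type} [NormedAddCommGroup E] [NormedSpace ℝ E] [NormedAddCommGroup F]
  [NormedSpace ℝ F]

/-- The part of the derivative of `volterraOp` in which the kernel is differentiated. -/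
noncomputable def kernelDeriv (K : W × (ℝ × P) → (E →L[ℝ] F)) (p : W × (ℝ × P)) :
    E →L[ℝ] (ℝ × P) →L[ℝ] F :=
  ((fderiv ℝ K p).comp (ContinuousLinearMap.inr ℝ W (ℝ × P))).flip

/-- The part of the derivative of `volterraOp` in which the argument is differentiated. -/
noncomputable def kernelLift (m : W → ℝ) (K : W × (ℝ × P) → (E →L[ℝ] F)) (p : W × (ℝ × P)) :
    ((ℝ × P) →L[ℝ] E) →L[ℝ] (ℝ × P) →L[ℝ] F :=
  (ContinuousLinearMap.compL ℝ (ℝ × P) E F (K p)).comp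
    ((ContinuousLinearMap.compL ℝ (ℝ × P) (ℝ × P) E).flip (contractFst P (m p.1)))

theorem contDiff_kernelDeriv {K : W × (ℝ × P) → (E →L[ℝ] F)} (hK : ContDiff ℝ ∞ K) :
    ContDiff ℝ ∞ (kernelDeriv K) := by
  have h1 : ContDiff ℝ ∞ fun p => (fderiv ℝ K p).comp (ContinuousLinearMap.inr ℝ W (ℝ × P)) :=
    (hK.fderiv_right (m := ∞) (by norm_cast)).clm_comp contDiff_const
  have h2 : ContDiff ℝ ∞ fun A : (ℝ × P) →L[ℝ] E →L[ℝ] F =>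
      (ContinuousLinearMap.flipₗᵢ ℝ (ℝ × P) E F) A := LinearIsometryEquiv.contDiff _
  exact h2.comp h1

theorem contDiff_kernelLift (hm : ContDiff ℝ ∞ m) {K : W × (ℝ × P) → (E →L[ℝ] F)}
    (hK : ContDiff ℝ ∞ K) : ContDiff ℝ ∞ (kernelLift m K) := by
  refine ContDiff.clm_comp ?_ ?_
  · have h2 : ContDiff ℝ ∞ fun A : E →L[ℝ] F => ContinuousLinearMap.compL ℝ (ℝ × P) E F A :=
      ContinuousLinearMap.contDiff _
    exact h2.comp hK
  · have h2 : ContDiff ℝ ∞ fun A : (ℝ × P) →L[ℝ] (ℝ × P) =>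
        (ContinuousLinearMap.compL ℝ (ℝ × P) (ℝ × P) E).flip A := ContinuousLinearMap.contDiff _
    exact h2.comp ((contDiff_contractFst (P := P)).comp (hm.comp contDiff_fst))

theorem contDiff_volterra_integrand (hm : ContDiff ℝ ∞ m) {K : W × (ℝ × P) → (E →L[ℝ] F)}
    (hK : ContDiff ℝ ∞ K) {f : ℝ × P → E} (hf : ContDiff ℝ ∞ f) :
    ContDiff ℝ ∞ fun p : W × (ℝ × P) => K p (f (contractFst P (m p.1) p.2)) :=
  hK.clm_apply (hf.comp (((contDiff_contractFst (P := P)).comp (hm.comp contDiff_fst)).clm_apply contDiff_snd))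

theorem contDiff_volterraOp (hs : IsCompact s) (hm : ContDiff ℝ ∞ m)
    {K : W × (ℝ × P) → (E →L[ℝ] F)} (hK : ContDiff ℝ ∞ K) {f : ℝ × P → E}
    (hf : ContDiff ℝ ∞ f) : ContDiff ℝ ∞ (volterraOp μ s m K f) :=
  contDiff_infty.2 fun n => contDiff_setIntegral μ hs n
    ((contDiff_volterra_integrand hm hK hf).of_le (by exact_mod_cast le_top))

/-- The product rule under the integral. Both terms are again operators of this type, so the class
is closed under differentiation and estimates can be iterated. -/
theorem fderiv_volterraOp (hs : IsCompact s) (hm : ContDiff ℝ ∞ m)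
    {K : W × (ℝ × P) → (E →L[ℝ] F)} (hK : ContDiff ℝ ∞ K) {f : ℝ × P → E}
    (hf : ContDiff ℝ ∞ f) (q : ℝ × P) :
    fderiv ℝ (volterraOp μ s m K f) q = volterraOp μ s m (kernelDeriv K) f q
      + volterraOp μ s m (kernelLift m K) (fderiv ℝ f) q := by
  have hI := contDiff_volterra_integrand hm hK hf
  have h1 := hasFDerivAt_setIntegral μ hs (hI.of_le (by norm_num)) q
  rw [show volterraOp μ s m K f = fun q => ∫ w in s, K (w, q) (f (contractFst P (m w) q)) ∂μ from rfl,
    h1.fderiv, volterraOp, volterraOp, ← integral_add]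
  · refine integral_congr_ae (Eventually.of_forall fun w => ?_)
    have hKd : HasFDerivAt (fun q => K (w, q))
        ((fderiv ℝ K (w, q)).comp (ContinuousLinearMap.inr ℝ W (ℝ × P))) q :=
      ((hK.differentiable (by norm_num)).differentiableAt.hasFDerivAt).comp q
        (hasFDerivAt_prodMk_right w q)
    have hfd : HasFDerivAt (fun q => f (contractFst P (m w) q))
        ((fderiv ℝ f (contractFst P (m w) q)).comp (contractFst P (m w))) q :=
      ((hf.differentiable (by norm_num)).differentiableAt.hasFDerivAt).comp q
        (contractFst P (m w)).hasFDerivAt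
    have h2 := hKd.clm_apply hfd
    have h3 : HasFDerivAt (fun q => K (w, q) (f (contractFst P (m w) q)))
        ((fderiv ℝ (fun p : W × (ℝ × P) => K p (f (contractFst P (m p.1) p.2))) (w, q)).comp
          (ContinuousLinearMap.inr ℝ W (ℝ × P))) q :=
      ((hI.differentiable (by norm_num)).differentiableAt.hasFDerivAt).comp q
        (hasFDerivAt_prodMk_right w q)
    simp only
    rw [h3.unique h2]
    ext v <;> simp [kernelDeriv, kernelLift, add_comm]
  · have := (contDiff_volterra_integrand hm (contDiff_kernelDeriv hK) hf).continuous
    exact (this.comp (by fun_prop : Continuous fun w : W => (w, q))).continuousOn.integrableOn_compact hs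
  · have := (contDiff_volterra_integrand hm (contDiff_kernelLift hm hK)
      (hf.fderiv_right (m := ∞) (by norm_cast))).continuous
    exact (this.comp (by fun_prop : Continuous fun w : W => (w, q))).continuousOn.integrableOn_compact hs

theorem GeoDecay.volterraOp (hs : IsCompact s) (hm01 : ∀ w ∈ s, m w ∈ Icc (0 : ℝ) 1)
    {K : W × (ℝ × P) → (E →L[ℝ] F)} (hK : Continuous K) {f : ℕ → ℝ × P → E} (hf : GeoDecay f) :
    GeoDecay fun n => volterraOp μ s m K (f n) := by
  have : ProperSpace P := FiniteDimensional.proper ℝ P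
  intro R
  obtain ⟨B, hB⟩ := hf R
  obtain ⟨C, hC⟩ := (hs.prod (isCompact_closedBall (0 : ℝ × P) R)).exists_bound_of_continuousOn
    hK.continuousOn
  refine ⟨C * B * μ.real s, fun n q hq => ?_⟩
  have h1 : ∀ w ∈ s, ‖K (w, q) (f n (contractFst P (m w) q))‖ ≤ C * (B * (1 / 2) ^ n) := by
    intro w hw
    have hKb := hC (w, q) ⟨hw, by simpa using hq⟩
    refine ((K (w, q)).le_opNorm _).trans (mul_le_mul hKb ?_ (norm_nonneg _) ((norm_nonneg _).trans hKb))
    exact hB n _ ((norm_contractFst_apply_le (hm01 w hw).1 (hm01 w hw).2 q).trans hq)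
  have h2 := norm_setIntegral_le_of_norm_le_const (μ := μ) hs.measure_lt_top h1
  calc _ ≤ C * (B * (1 / 2) ^ n) * μ.real s := h2
    _ = _ := by ring

end Derivative

theorem GeoDecayUpTo.volterraOp (hs : IsCompact s) (hm : ContDiff ℝ ∞ m)
    (hm01 : ∀ w ∈ s, m w ∈ Icc (0 : ℝ) 1) {j : ℕ} :
    ∀ {E F : Type} [NormedAddCommGroup E] [NormedSpace ℝ E] [NormedAddCommGroup F]
      [NormedSpace ℝ F] {K : W × (ℝ × P) → (E →L[ℝ] F)} {f : ℕ → ℝ × P → E}, ContDiff ℝ ∞ K →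
      (∀ n, ContDiff ℝ ∞ (f n)) → GeoDecayUpTo j f →
      GeoDecayUpTo j fun n => volterraOp μ s m K (f n) := by
  induction j with
  | zero => exact fun hK hfs hf => GeoDecay.volterraOp μ hs hm01 hK.continuous hf
  | succ j ih =>
    intro E F _ _ _ _ K f hK hfs hf
    refine ⟨GeoDecay.volterraOp μ hs hm01 hK.continuous hf.1, ?_⟩
    have : (fun n => fderiv ℝ (Rayleigh.volterraOp μ s m K (f n)))
        = fun n q => Rayleigh.volterraOp μ s m (kernelDeriv K) (f n) q
          + Rayleigh.volterraOp μ s m (kernelLift m K) (fderiv ℝ (f n)) q := by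
      funext n q
      exact fderiv_volterraOp μ hs hm hK (hfs n) q
    rw [this]
    have hfs' : ∀ n, ContDiff ℝ ∞ (fderiv ℝ (f n)) := fun n => (hfs n).fderiv_right (by norm_cast)
    exact GeoDecayUpTo.add
      (fun n => contDiff_volterraOp μ hs hm (contDiff_kernelDeriv hK) (hfs n))
      (fun n => contDiff_volterraOp μ hs hm (contDiff_kernelLift hm hK) (hfs' n))
      (ih (contDiff_kernelDeriv hK) hfs hf.mono) (ih (contDiff_kernelLift hm hK) hfs' hf.2)

/-- On each ball, the kernel is small when measured with a suitable exponential weight. -/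
def SmallKernel {E : Type} [NormedAddCommGroup E] [NormedSpace ℝ E] (s : Set W) (m : W → ℝ)
    (K : W × (ℝ × P) → (E →L[ℝ] E)) : Prop :=
  ∀ R : ℝ, ∃ l : ℝ, ∀ q : ℝ × P, ‖q‖ ≤ R →
    ∫ w in s, ‖K (w, q)‖ * Real.exp (l * (m w * |q.1| - |q.1|)) ∂μ ≤ 1 / 4

/-- Composition with a contraction does not increase norms, so the kernel that acts on the
derivative is small with the same weight exponent. -/
theorem SmallKernel.kernelLift (hs : IsCompact s) (hm : ContDiff ℝ ∞ m)
    (hm01 : ∀ w ∈ s, m w ∈ Icc (0 : ℝ) 1) {E : Type}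
    [NormedAddCommGroup E] [NormedSpace ℝ E] {K : W × (ℝ × P) → (E →L[ℝ] E)}
    (hK : ContDiff ℝ ∞ K) (h : SmallKernel μ s m K) : SmallKernel μ s m (kernelLift m K) := by
  intro R
  obtain ⟨l, hl⟩ := h R
  refine ⟨l, fun q hq => le_trans ?_ (hl q hq)⟩
  have hc : Continuous fun w : W => Real.exp (l * (m w * |q.1| - |q.1|)) := by
    have := hm.continuous
    fun_prop
  have hpair : Continuous fun w : W => (w, q) := by fun_prop
  refine setIntegral_mono_on ?_ ?_ hs.measurableSet fun w hw => ?_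
  · exact ((((contDiff_kernelLift hm hK).continuous.comp hpair).norm.mul
      hc).continuousOn).integrableOn_compact hs
  · exact (((hK.continuous.comp hpair).norm.mul hc).continuousOn).integrableOn_compact hs
  · refine mul_le_mul_of_nonneg_right ?_ (Real.exp_pos _).le
    refine ContinuousLinearMap.opNorm_le_bound _ (norm_nonneg _) fun v => ?_
    simp only [Rayleigh.kernelLift, ContinuousLinearMap.comp_apply, ContinuousLinearMap.compL_apply,
      ContinuousLinearMap.flip_apply]
    refine (ContinuousLinearMap.opNorm_comp_le _ _).trans ?_
    refine mul_le_mul_of_nonneg_left ?_ (norm_nonneg _)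
    refine (ContinuousLinearMap.opNorm_comp_le _ _).trans ?_
    exact mul_le_of_le_one_right (norm_nonneg _) (norm_contractFst_le (hm01 w hw).1 (hm01 w hw).2)

/-- In the norm weighted by exp(-l |q.1|) on a ball, which contractions of the first variable
preserve, the operator has norm at most 1/4. A source of size 2⁻ⁿ adds another quarter, and 1/4 +
1/4 = 1/2 is the rate of decay. -/
theorem GeoDecay.of_recursion (hs : IsCompact s) (hm : Continuous m)
    (hm01 : ∀ w ∈ s, m w ∈ Icc (0 : ℝ) 1) {E : Type}
    [NormedAddCommGroup E] [NormedSpace ℝ E] {K : W × (ℝ × P) → (E →L[ℝ] E)} (hK : Continuous K)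
    (h : SmallKernel μ s m K) {f g : ℕ → ℝ × P → E} (hf0 : Continuous (f 0)) (hg : GeoDecay g)
    (hrec : ∀ n q, f (n + 1) q = g n q + Rayleigh.volterraOp μ s m K (f n) q) : GeoDecay f := by
  have : ProperSpace P := FiniteDimensional.proper ℝ P
  intro R
  obtain ⟨l, hl⟩ := h R
  obtain ⟨B, hB⟩ := hg R
  obtain ⟨A, hA⟩ := (isCompact_closedBall (0 : ℝ × P) R).exists_bound_of_continuousOn
    hf0.continuousOn
  -- The first entry covers `n = 0`; the second makes the source at most a quarter of the claimed
  -- bound. The factor exp(|l| R) compares the weighted norm with the plain one.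
  set D := max (A * Real.exp (|l| * R)) (4 * B * Real.exp (|l| * R)) with hD
  have hexp : ∀ q : ℝ × P, ‖q‖ ≤ R → 1 ≤ Real.exp (|l| * R) * Real.exp (l * |q.1|) ∧
      Real.exp (l * |q.1|) ≤ Real.exp (|l| * R) := by
    intro q hq
    have h1 : |q.1| ≤ R := (norm_fst_le q).trans hq
    have h2 : abs (l * |q.1|) ≤ |l| * R := by
      rw [abs_mul, abs_abs]; gcongr
    rw [← Real.exp_add]
    constructor
    · rw [Real.one_le_exp_iff]; linarith [neg_abs_le (l * |q.1|)]
    · exact Real.exp_le_exp.2 ((le_abs_self _).trans h2)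
  have key : ∀ n q, ‖q‖ ≤ R → ‖f n q‖ ≤ D * (1 / 2) ^ n * Real.exp (l * |q.1|) := by
    intro n
    induction n with
    | zero =>
      intro q hq
      have h1 := hA q (by simpa using hq)
      have hA0 : 0 ≤ A := (norm_nonneg _).trans h1
      calc ‖f 0 q‖ ≤ A * 1 := by simpa using h1
        _ ≤ A * (Real.exp (|l| * R) * Real.exp (l * |q.1|)) := by gcongr; exact (hexp q hq).1
        _ = (A * Real.exp (|l| * R)) * (1 / 2) ^ 0 * Real.exp (l * |q.1|) := by ring
        _ ≤ _ := by gcongr; exact le_max_left _ _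
    | succ n ih =>
      intro q hq
      have hD0 : 0 ≤ D * (1 / 2) ^ n := by
        have := (norm_nonneg _).trans (ih q hq)
        exact le_of_mul_le_mul_right (by simpa using this) (Real.exp_pos (l * |q.1|))
      have h1 : ‖Rayleigh.volterraOp μ s m K (f n) q‖
          ≤ 1 / 4 * (D * (1 / 2) ^ n * Real.exp (l * |q.1|)) := by
        calc _ ≤ ∫ w in s, (‖K (w, q)‖ * Real.exp (l * (m w * |q.1| - |q.1|)))
              * (D * (1 / 2) ^ n * Real.exp (l * |q.1|)) ∂μ := by
              refine norm_integral_le_of_norm_le ?_ ?_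
              · have hc : Continuous fun w : W => Real.exp (l * (m w * |q.1| - |q.1|)) := by fun_prop
                have hpair : Continuous fun w : W => (w, q) := by fun_prop
                exact ((((hK.comp hpair).norm.mul hc).mul
                  continuous_const).continuousOn).integrableOn_compact hs
              · filter_upwards [ae_restrict_mem hs.measurableSet] with w hw
                refine ((K (w, q)).le_opNorm _).trans ?_
                rw [mul_assoc]
                refine mul_le_mul_of_nonneg_left ?_ (norm_nonneg _)
                refine (ih _ ((norm_contractFst_apply_le (hm01 w hw).1 (hm01 w hw).2 q).trans hq)).trans
                  (le_of_eq ?_)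
                rw [contractFst_apply, abs_mul, abs_of_nonneg (hm01 w hw).1, mul_left_comm,
                  mul_left_comm (Real.exp (l * (m w * |q.1| - |q.1|))), ← Real.exp_add]
                ring_nf
          _ = (∫ w in s, ‖K (w, q)‖ * Real.exp (l * (m w * |q.1| - |q.1|)) ∂μ)
              * (D * (1 / 2) ^ n * Real.exp (l * |q.1|)) := integral_mul_const _ _
          _ ≤ _ := by gcongr; exact hl q hq
      have h2 : ‖g n q‖ ≤ 1 / 4 * (D * (1 / 2) ^ n * Real.exp (l * |q.1|)) := by
        have hB0 : 0 ≤ B := by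
          have := (norm_nonneg _).trans (hB n q hq)
          exact le_of_mul_le_mul_right (by simpa using this) (by positivity : (0 : ℝ) < (1 / 2) ^ n)
        calc ‖g n q‖ ≤ B * (1 / 2) ^ n * 1 := by simpa using hB n q hq
          _ ≤ B * (1 / 2) ^ n * (Real.exp (|l| * R) * Real.exp (l * |q.1|)) := by
              gcongr; exact (hexp q hq).1
          _ = 1 / 4 * ((4 * B * Real.exp (|l| * R)) * (1 / 2) ^ n * Real.exp (l * |q.1|)) := by ring
          _ ≤ _ := by gcongr; exact le_max_right _ _
      rw [hrec]
      refine (norm_add_le _ _).trans ((add_le_add h2 h1).trans (le_of_eq ?_))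
      ring
  refine ⟨D * Real.exp (|l| * R), fun n q hq => (key n q hq).trans ?_⟩
  have hD0 : 0 ≤ D * (1 / 2) ^ n := by
    have := (norm_nonneg _).trans (key n q hq)
    exact le_of_mul_le_mul_right (by simpa using this) (Real.exp_pos (l * |q.1|))
  calc _ ≤ D * (1 / 2) ^ n * Real.exp (|l| * R) := mul_le_mul_of_nonneg_left (hexp q hq).2 hD0
    _ = _ := by ring

/-- Differentiating the recursion gives a recursion of the same form for the derivatives. Its source
contains the undifferentiated sequence through `kernelDeriv`, and that part decays by the induction
hypothesis. -/
theorem GeoDecayUpTo.of_recursion (hs : IsCompact s) (hm : ContDiff ℝ ∞ m)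
    (hm01 : ∀ w ∈ s, m w ∈ Icc (0 : ℝ) 1) {j : ℕ} :
    ∀ {E : Type} [NormedAddCommGroup E] [NormedSpace ℝ E] {K : W × (ℝ × P) → (E →L[ℝ] E)}
      {f g : ℕ → ℝ × P → E}, ContDiff ℝ ∞ K → SmallKernel μ s m K → (∀ n, ContDiff ℝ ∞ (f n)) →
      (∀ n, ContDiff ℝ ∞ (g n)) → GeoDecayUpTo j g →
      (∀ n q, f (n + 1) q = g n q + Rayleigh.volterraOp μ s m K (f n) q) → GeoDecayUpTo j f := by
  induction j with
  | zero =>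
    intro E _ _ K f g hK hsm hf _ hg hrec
    exact GeoDecay.of_recursion μ hs hm.continuous hm01 hK.continuous hsm (hf 0).continuous hg hrec
  | succ j ih =>
    intro E _ _ K f g hK hsm hf hgs hg hrec
    have hf' : GeoDecayUpTo j f := ih hK hsm hf hgs hg.mono hrec
    refine ⟨hf'.zero, ?_⟩
    have hfs' : ∀ n, ContDiff ℝ ∞ (fderiv ℝ (f n)) := fun n => (hf n).fderiv_right (by norm_cast)
    have hgs' : ∀ n, ContDiff ℝ ∞ (fderiv ℝ (g n)) := fun n => (hgs n).fderiv_right (by norm_cast)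
    have hks : ∀ n, ContDiff ℝ ∞ (Rayleigh.volterraOp μ s m (kernelDeriv K) (f n)) := fun n =>
      contDiff_volterraOp μ hs hm (contDiff_kernelDeriv hK) (hf n)
    refine ih (g := fun n q => fderiv ℝ (g n) q
      + Rayleigh.volterraOp μ s m (kernelDeriv K) (f n) q)
      (contDiff_kernelLift hm hK) (hsm.kernelLift μ hs hm hm01 hK) hfs'
      (fun n => (hgs' n).add (hks n)) (GeoDecayUpTo.add hgs' hks hg.2
        (GeoDecayUpTo.volterraOp μ hs hm hm01 (contDiff_kernelDeriv hK) hf hf')) fun n q => ?_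
    have h1 : f (n + 1) = fun q => g n q + Rayleigh.volterraOp μ s m K (f n) q := funext (hrec n)
    rw [h1, fderiv_fun_add ((hgs n).differentiable (by norm_num)).differentiableAt
      ((contDiff_volterraOp μ hs hm hK (hf n)).differentiable (by norm_num)).differentiableAt,
      fderiv_volterraOp μ hs hm hK (hf n) q, add_assoc]

omit [FiniteDimensional ℝ P] in
theorem GeoDecay.summable {E : Type} [NormedAddCommGroup E] [NormedSpace ℝ E] [CompleteSpace E]
    {f : ℕ → ℝ × P → E} (hf : GeoDecay f) (q : ℝ × P) : Summable fun n => f n q := by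
  obtain ⟨B, hB⟩ := hf ‖q‖
  exact Summable.of_norm_bounded ((summable_geometric_of_lt_one (by norm_num)
    (by norm_num : (1 / 2 : ℝ) < 1)).mul_left B) fun n => hB n q le_rfl

theorem GeoDecayUpTo.contDiff_tsum {j : ℕ} : ∀ {E : Type} [NormedAddCommGroup E] [NormedSpace ℝ E]
    [CompleteSpace E] {f : ℕ → ℝ × P → E}, (∀ n, ContDiff ℝ ∞ (f n)) →
    (∀ i, GeoDecayUpTo i f) → ContDiff ℝ j fun q => ∑' n, f n q := by
  have key : ∀ {E : Type} [NormedAddCommGroup E] [NormedSpace ℝ E]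
      [CompleteSpace E] {f : ℕ → ℝ × P → E}, (∀ n, ContDiff ℝ ∞ (f n)) →
      (∀ i, GeoDecayUpTo i f) → ∀ q, HasFDerivAt (fun q => ∑' n, f n q) (∑' n, fderiv ℝ (f n) q) q := by
    intro E _ _ _ f hf hg q
    obtain ⟨B, hB⟩ := (hg 1).2 (‖q‖ + 1)
    refine hasFDerivAt_tsum_of_isPreconnected (u := fun n => B * (1 / 2) ^ n)
      (s := Metric.ball (0 : ℝ × P) (‖q‖ + 1))
      ((summable_geometric_of_lt_one (by norm_num) (by norm_num)).mul_left B) Metric.isOpen_ball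
      (convex_ball _ _).isPreconnected
      (fun n x _ => ((hf n).differentiable (by norm_num)).differentiableAt.hasFDerivAt)
      (fun n x hx => hB n x ?_) (x₀ := q) ?_ ((hg 0).zero.summable q) ?_
    · simpa using (Metric.mem_ball.1 hx).le
    · simp
    · simp
  induction j with
  | zero =>
    intro E _ _ _ f hf hg
    exact contDiff_zero.2 (continuous_iff_continuousAt.2 fun q => (key hf hg q).continuousAt)
  | succ j ih =>
    intro E _ _ _ f hf hg
    refine contDiff_succ_iff_hasFDerivAt.2 ⟨_, ?_, key hf hg⟩
    exact ih (fun n => (hf n).fderiv_right (by norm_cast)) fun i => (hg (i + 1)).2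

/-- Smooth solvability of a linear Volterra type integral equation with parameters. -/
theorem exists_contDiff_volterra (hs : IsCompact s) (hm : ContDiff ℝ ∞ m)
    (hm01 : ∀ w ∈ s, m w ∈ Icc (0 : ℝ) 1) {E : Type} [NormedAddCommGroup E] [NormedSpace ℝ E]
    [CompleteSpace E] {K : W × (ℝ × P) → (E →L[ℝ] E)} (hK : ContDiff ℝ ∞ K)
    (hsm : SmallKernel μ s m K) {h : ℝ × P → E} (hh : ContDiff ℝ ∞ h) :
    ∃ u : ℝ × P → E, ContDiff ℝ ∞ u ∧
      ∀ q, u q = h q + ∫ w in s, K (w, q) (u (contractFst P (m w) q)) ∂μ := by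
  -- The terms of the Neumann series. Together with all their derivatives they decay geometrically
  -- on balls, so the sum is smooth.
  set f : ℕ → ℝ × P → E := fun n => (volterraOp μ s m K)^[n] h with hf
  have hf0 : f 0 = h := rfl
  have hfs : ∀ n, f (n + 1) = volterraOp μ s m K (f n) := fun n =>
    Function.iterate_succ_apply' _ _ _
  have hsmooth : ∀ n, ContDiff ℝ ∞ (f n) := by
    intro n
    induction n with
    | zero => exact hh
    | succ n ih => rw [hfs]; exact contDiff_volterraOp μ hs hm hK ih
  have hz : ∀ i, GeoDecayUpTo i fun (_ : ℕ) (_ : ℝ × P) => (0 : E) := by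
    intro i
    have : ∀ i, ∀ {E : Type} [NormedAddCommGroup E] [NormedSpace ℝ E],
        GeoDecayUpTo i fun (_ : ℕ) (_ : ℝ × P) => (0 : E) := by
      intro i
      induction i with
      | zero => intro E _ _ R; exact ⟨0, fun n q _ => by simp⟩
      | succ i ih =>
        intro E _ _
        refine ⟨fun R => ⟨0, fun n q _ => by simp⟩, ?_⟩
        have h0 : (fun (_ : ℕ) => fderiv ℝ fun _ : ℝ × P => (0 : E)) = fun _ _ => 0 := by
          funext n q; simp
        rw [h0]
        exact ih
    exact this i
  have hgeo : ∀ i, GeoDecayUpTo i f := fun i =>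
    GeoDecayUpTo.of_recursion μ hs hm hm01 hK hsm hsmooth (fun _ => contDiff_const) (hz i)
      fun n q => by rw [hfs, zero_add]
  refine ⟨fun q => ∑' n, f n q, contDiff_infty.2 fun j => GeoDecayUpTo.contDiff_tsum hsmooth hgeo,
    fun q => ?_⟩
  have h1 : (∑' n, f n q) = h q + ∑' n, f (n + 1) q := by
    rw [((hgeo 0).zero.summable q).tsum_eq_zero_add, hf0]
  refine h1.trans ?_
  congr 1
  obtain ⟨B, hB⟩ := (hgeo 0).zero ‖q‖
  have hpair : Continuous fun w : W => (w, q) := by fun_prop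
  obtain ⟨C, hC⟩ := hs.exists_bound_of_continuousOn (hK.continuous.comp hpair).continuousOn
  have hbd : ∀ n, ∀ w ∈ s, ‖K (w, q) (f n (contractFst P (m w) q))‖ ≤ C * (B * (1 / 2) ^ n) := by
    intro n w hw
    have hKb := hC w hw
    refine ((K (w, q)).le_opNorm _).trans (mul_le_mul hKb ?_ (norm_nonneg _) ((norm_nonneg _).trans hKb))
    exact hB n _ (norm_contractFst_apply_le (hm01 w hw).1 (hm01 w hw).2 q)
  have hgsum : Summable fun n : ℕ => C * (B * (1 / 2 : ℝ) ^ n) :=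
    ((summable_geometric_of_lt_one (by norm_num) (by norm_num)).mul_left B).mul_left C
  have hsum : HasSum (fun n => ∫ w in s, K (w, q) (f n (contractFst P (m w) q)) ∂μ)
      (∫ w in s, K (w, q) (∑' n, f n (contractFst P (m w) q)) ∂μ) := by
    refine hasSum_integral_of_dominated_convergence (fun n _ => C * (B * (1 / 2) ^ n)) ?_ ?_ ?_ ?_ ?_
    · intro n
      exact (((contDiff_volterra_integrand hm hK (hsmooth n)).continuous.comp
        hpair).continuousOn).aestronglyMeasurable hs.measurableSet
    · intro n
      filter_upwards [ae_restrict_mem hs.measurableSet] with w hw using hbd n w hw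
    · exact Eventually.of_forall fun w => hgsum
    · exact (continuousOn_const (c := ∑' n : ℕ, C * (B * (1 / 2 : ℝ) ^ n))).integrableOn_compact hs
    · refine Eventually.of_forall fun w => ?_
      exact ((hgeo 0).zero.summable _).hasSum.mapL (K (w, q))
  simp_rw [hfs]
  exact hsum.tsum_eq

end Volterra

/-! ### Second order linear equations with smooth dependence on a complex parameter. -/

section LinearODE

/-- The matrix of the first order system of `φ'' = z φ`. -/
noncomputable def companion (z : ℂ) : (ℂ × ℂ) →L[ℝ] (ℂ × ℂ) :=
  (ContinuousLinearMap.inl ℝ ℂ ℂ).comp (ContinuousLinearMap.snd ℝ ℂ ℂ) +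
    (ContinuousLinearMap.inr ℝ ℂ ℂ).comp
      ((ContinuousLinearMap.mul ℝ ℂ z).comp (ContinuousLinearMap.fst ℝ ℂ ℂ))

@[simp] theorem companion_apply (z : ℂ) (e : ℂ × ℂ) : companion z e = (e.2, z * e.1) := by
  simp [companion]

theorem contDiff_companion : ContDiff ℝ ∞ companion := by
  refine contDiff_const.add (contDiff_const.clm_comp (ContDiff.clm_comp ?_ contDiff_const))
  exact (ContinuousLinearMap.mul ℝ ℂ).contDiff

/-- The integral is (1 - exp(-l |t|))/l. A large exponent thus makes any locally bounded kernel with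
a factor `q.1` a `SmallKernel`, whatever its size. -/
theorem integral_exp_weight_le {l : ℝ} (hl : 0 < l) (t : ℝ) :
    ∫ w in Icc (0 : ℝ) 1, |t| * Real.exp (l * (w * |t| - |t|)) ≤ 1 / l := by
  rw [integral_Icc_eq_integral_Ioc, ← intervalIntegral.integral_of_le zero_le_one]
  have h : ∀ w ∈ uIcc (0 : ℝ) 1, HasDerivAt (fun w => Real.exp (l * (w * |t| - |t|)) / l)
      (|t| * Real.exp (l * (w * |t| - |t|))) w := by
    intro w _
    have h1 : HasDerivAt (fun w : ℝ => l * (w * |t| - |t|)) (l * |t|) w := by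
      simpa using (((hasDerivAt_id w).mul_const |t|).sub_const |t|).const_mul l
    have h2 := h1.exp.div_const l
    refine h2.congr_deriv ?_
    rw [div_eq_iff hl.ne']
    ring
  rw [intervalIntegral.integral_eq_sub_of_hasDerivAt h
    (Continuous.intervalIntegrable (by fun_prop) _ _), ← sub_div]
  gcongr
  have : Real.exp (l * (1 * |t| - |t|)) = 1 := by simp
  rw [this]
  linarith [Real.exp_pos (l * (0 * |t| - |t|))]

/-- The substitution τ = w t, with t = y - y₁, turns the integral equation of the first order system
into one over the fixed interval [0, 1], to which the Volterra theorem applies. Joint smoothness in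
`y` and `c` comes with it. -/
theorem exists_global_solution {q S : ℝ × ℂ → ℂ} (hq : ContDiff ℝ ∞ q) (hS : ContDiff ℝ ∞ S)
    {d₀ d₁ : ℂ → ℂ} (h₀ : ContDiff ℝ ∞ d₀) (h₁ : ContDiff ℝ ∞ d₁) (y₁ : ℝ) :
    ∃ φ φ' : ℝ × ℂ → ℂ, ContDiff ℝ ∞ φ ∧ ContDiff ℝ ∞ φ' ∧ ∀ c,
      φ (y₁, c) = d₀ c ∧ φ' (y₁, c) = d₁ c ∧ ∀ y,
        HasDerivAt (fun y => φ (y, c)) (φ' (y, c)) y ∧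
        HasDerivAt (fun y => φ' (y, c)) (q (y, c) * φ (y, c) + S (y, c)) y := by
  have hpt : ContDiff ℝ ∞ fun p : ℝ × (ℝ × ℂ) => (y₁ + p.1 * p.2.1, p.2.2) := by fun_prop
  set K : ℝ × (ℝ × ℂ) → ((ℂ × ℂ) →L[ℝ] (ℂ × ℂ)) := fun p =>
    p.2.1 • companion (q (y₁ + p.1 * p.2.1, p.2.2)) with hKdef
  have hA : ContDiff ℝ ∞ fun p : ℝ × (ℝ × ℂ) => companion (q (y₁ + p.1 * p.2.1, p.2.2)) :=
    contDiff_companion.comp (hq.comp hpt)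
  have hK : ContDiff ℝ ∞ K := (contDiff_fst.comp contDiff_snd).smul hA
  set g : ℝ × (ℝ × ℂ) → ℂ × ℂ := fun p => p.2.1 • ((0 : ℂ), S (y₁ + p.1 * p.2.1, p.2.2)) with hg
  have hgs : ContDiff ℝ ∞ g :=
    (contDiff_fst.comp contDiff_snd).smul (contDiff_const.prodMk (hS.comp hpt))
  have hI : IsCompact (Icc (0 : ℝ) 1) := isCompact_Icc
  set h : ℝ × ℂ → ℂ × ℂ := fun q => (d₀ q.2, d₁ q.2) + ∫ w in Icc (0 : ℝ) 1, g (w, q) with hh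
  have hhs : ContDiff ℝ ∞ h := by
    refine ContDiff.add ((h₀.comp contDiff_snd).prodMk (h₁.comp contDiff_snd)) ?_
    exact contDiff_infty.2 fun n => contDiff_setIntegral volume hI n
      (hgs.of_le (by exact_mod_cast le_top))
  have hsmall : SmallKernel volume (Icc (0 : ℝ) 1) id K := by
    intro R
    obtain ⟨C, hC⟩ := (hI.prod (isCompact_closedBall (0 : ℝ × ℂ) R)).exists_bound_of_continuousOn
      hA.continuous.continuousOn
    -- This exponent makes the weighted mass at most |C| / (4 (|C| + 1)).
    refine ⟨4 * (|C| + 1), fun q hq => ?_⟩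
    have hl : 0 < 4 * (|C| + 1) := by positivity
    calc _ ≤ ∫ w in Icc (0 : ℝ) 1, |C| * (|q.1| * Real.exp (4 * (|C| + 1) * (w * |q.1| - |q.1|))) := by
          refine setIntegral_mono_on ?_ ?_ measurableSet_Icc fun w hw => ?_
          · refine Continuous.integrableOn_Icc (Continuous.mul ?_ ?_)
            · exact (hK.continuous.comp (by fun_prop : Continuous fun w : ℝ => (w, q))).norm
            · simp only [id]; fun_prop
          · exact Continuous.integrableOn_Icc (by fun_prop)
          · rw [← mul_assoc]
            refine mul_le_mul_of_nonneg_right ?_ (Real.exp_pos _).le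
            simp only [hKdef, norm_smul, Real.norm_eq_abs]
            rw [mul_comm]
            exact mul_le_mul_of_nonneg_right
              ((hC (w, q) ⟨hw, by simpa using hq⟩).trans (le_abs_self C)) (abs_nonneg _)
      _ = |C| * ∫ w in Icc (0 : ℝ) 1, |q.1| * Real.exp (4 * (|C| + 1) * (w * |q.1| - |q.1|)) :=
          integral_const_mul _ _
      _ ≤ |C| * (1 / (4 * (|C| + 1))) := by gcongr; exact integral_exp_weight_le hl q.1
      _ ≤ 1 / 4 := by
          rw [mul_one_div, div_le_div_iff₀ hl (by norm_num)]; linarith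
  obtain ⟨u, hu, hueq⟩ := exists_contDiff_volterra volume hI contDiff_id (fun w hw => hw) hK hsmall hhs
  have hint : ∀ t c, u (t, c) = (d₀ c, d₁ c) + ∫ τ in (0 : ℝ)..t,
      (companion (q (y₁ + τ, c)) (u (τ, c)) + (0, S (y₁ + τ, c))) := by
    intro t c
    have h1 : ∫ τ in (0 : ℝ)..t, (companion (q (y₁ + τ, c)) (u (τ, c)) + (0, S (y₁ + τ, c)))
        = ∫ w in (0 : ℝ)..1, t • (companion (q (y₁ + w * t, c)) (u (w * t, c))
          + (0, S (y₁ + w * t, c))) := by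
      rw [intervalIntegral.integral_smul, intervalIntegral.smul_integral_comp_mul_right
        (fun τ => companion (q (y₁ + τ, c)) (u (τ, c)) + ((0 : ℂ), S (y₁ + τ, c)))]
      simp
    rw [h1, hueq (t, c), hh, add_assoc]
    congr 1
    rw [intervalIntegral.integral_of_le zero_le_one, ← integral_Icc_eq_integral_Ioc,
      ← integral_add]
    · refine integral_congr_ae (Eventually.of_forall fun w => ?_)
      simp only [hg, hKdef, contractFst_apply, id, smul_add, FunLike.coe_smul, Pi.smul_apply]
      rw [add_comm]
    · exact (hgs.continuous.comp (by fun_prop : Continuous fun w : ℝ => (w, (t, c)))).integrableOn_Icc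
    · exact ((contDiff_volterra_integrand contDiff_id hK hu).continuous.comp
        (by fun_prop : Continuous fun w : ℝ => (w, (t, c)))).integrableOn_Icc
  have hder : ∀ t c, HasDerivAt (fun t => u (t, c))
      (companion (q (y₁ + t, c)) (u (t, c)) + (0, S (y₁ + t, c))) t := by
    intro t c
    have hcont : Continuous fun τ : ℝ => companion (q (y₁ + τ, c)) (u (τ, c)) + ((0 : ℂ), S (y₁ + τ, c)) := by
      have e1 : Continuous fun τ : ℝ => companion (q (y₁ + τ, c)) :=
        contDiff_companion.continuous.comp (hq.continuous.comp (by fun_prop))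
      have e2 : Continuous fun τ : ℝ => u (τ, c) := hu.continuous.comp (by fun_prop)
      have e3 : Continuous fun τ : ℝ => S (y₁ + τ, c) := hS.continuous.comp (by fun_prop)
      exact (e1.clm_apply e2).add (continuous_const.prodMk e3)
    have h1 := (intervalIntegral.integral_hasDerivAt_right (hcont.intervalIntegrable 0 t)
      (hcont.stronglyMeasurableAtFilter _ _) hcont.continuousAt).const_add (d₀ c, d₁ c)
    refine h1.congr_of_eventuallyEq (Eventually.of_forall fun t => hint t c)
  have hsub : ContDiff ℝ ∞ fun p : ℝ × ℂ => (p.1 - y₁, p.2) := by fun_prop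
  refine ⟨fun p => (u (p.1 - y₁, p.2)).1, fun p => (u (p.1 - y₁, p.2)).2,
    contDiff_fst.comp (hu.comp hsub), contDiff_snd.comp (hu.comp hsub), fun c => ⟨?_, ?_, fun y => ?_⟩⟩
  · simp [hint 0 c]
  · simp [hint 0 c]
  · have h1 : HasDerivAt (fun y => u (y - y₁, c)) _ y :=
      (hder (y - y₁) c).comp_sub_const y y₁
    rw [add_sub_cancel] at h1
    have h2 := h1.hasFDerivAt
    constructor
    · have := (hasFDerivAt_fst.comp y h2).hasDerivAt
      simpa [Function.comp_def] using this
    · have := (hasFDerivAt_snd.comp y h2).hasDerivAt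
      simpa [Function.comp_def] using this

/-- Uniqueness for `φ'' = q φ + S` with given initial data. -/
theorem solution_unique {a b y₁ : ℝ} (hy₁ : y₁ ∈ Ioo a b) {q S φ φ' ψ ψ' : ℝ → ℂ}
    (hq : ContinuousOn q (Ioo a b))
    (hφ : ∀ y ∈ Ioo a b, HasDerivAt φ (φ' y) y ∧ HasDerivAt φ' (q y * φ y + S y) y)
    (hψ : ∀ y ∈ Ioo a b, HasDerivAt ψ (ψ' y) y ∧ HasDerivAt ψ' (q y * ψ y + S y) y)
    (h0 : φ y₁ = ψ y₁) (h1 : φ' y₁ = ψ' y₁) :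
    ∀ y ∈ Ioo a b, φ y = ψ y ∧ φ' y = ψ' y := by
  intro y hy
  obtain ⟨a', ha', ha''⟩ := exists_between (lt_min hy.1 hy₁.1)
  obtain ⟨b', hb', hb''⟩ := exists_between (max_lt hy.2 hy₁.2)
  have hsub : Icc a' b' ⊆ Ioo a b := fun x hx => ⟨ha'.trans_le hx.1, hx.2.trans_lt hb''⟩
  obtain ⟨C, hC⟩ := isCompact_Icc.exists_bound_of_continuousOn (hq.mono hsub)
  have key := ODE_solution_unique_of_mem_Ioo (K := (|C| + 1).toNNReal)
    (v := fun t (e : ℂ × ℂ) => (e.2, q t * e.1 + S t)) (s := fun _ => univ) (a := a') (b := b')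
    (f := fun t => (φ t, φ' t)) (g := fun t => (ψ t, ψ' t)) (t₀ := y₁) ?_
    ⟨(lt_min_iff.1 ha'').2, (max_lt_iff.1 hb').2⟩ ?_ ?_ (by simp [h0, h1])
  · have := key (⟨(lt_min_iff.1 ha'').1, (max_lt_iff.1 hb').1⟩ : y ∈ Ioo a' b')
    simpa using this
  · intro t ht
    refine (LipschitzWith.of_dist_le_mul fun e f => ?_).lipschitzOnWith
    have hCt := hC t (Ioo_subset_Icc_self ht)
    rw [Real.coe_toNNReal _ (by positivity), Prod.dist_eq, Prod.dist_eq]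
    refine max_le ?_ ?_
    · calc dist e.2 f.2 ≤ max (dist e.1 f.1) (dist e.2 f.2) := le_max_right _ _
        _ ≤ (|C| + 1) * max (dist e.1 f.1) (dist e.2 f.2) :=
          le_mul_of_one_le_left (le_max_of_le_left dist_nonneg) (by linarith [abs_nonneg C])
    · rw [dist_add_right, dist_eq_norm, ← mul_sub, norm_mul, ← dist_eq_norm]
      gcongr
      · linarith [le_abs_self C]
      · exact le_max_left _ _
  · intro t ht
    have := hφ t (hsub (Ioo_subset_Icc_self ht))
    exact ⟨this.1.prodMk this.2, mem_univ _⟩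
  · intro t ht
    have := hψ t (hsub (Ioo_subset_Icc_self ht))
    exact ⟨this.1.prodMk this.2, mem_univ _⟩

/-- Coefficients and data are cut off to globally smooth functions. The cut-off is one on an
interval containing both `y` and `y₁` and on a disc about `c`, so the equation is unchanged there.
-/
theorem exists_local_solution {a b : ℝ} {D : Set ℂ} (hD : IsOpen D) {q S : ℝ × ℂ → ℂ}
    (hq : ContDiffOn ℝ ∞ q (Ioo a b ×ˢ D)) (hS : ContDiffOn ℝ ∞ S (Ioo a b ×ˢ D))
    {d₀ d₁ : ℂ → ℂ} (h₀ : ContDiffOn ℝ ∞ d₀ D) (h₁ : ContDiffOn ℝ ∞ d₁ D) {y₁ : ℝ}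
    (hy₁ : y₁ ∈ Ioo a b) {y : ℝ} (hy : y ∈ Ioo a b) {c : ℂ} (hc : c ∈ D) :
    ∃ a' b' : ℝ, a < a' ∧ b' < b ∧ y ∈ Ioo a' b' ∧ y₁ ∈ Ioo a' b' ∧ ∃ ρ > (0 : ℝ),
      Metric.ball c ρ ⊆ D ∧ ∃ φ φ' : ℝ × ℂ → ℂ, ContDiff ℝ ∞ φ ∧ ContDiff ℝ ∞ φ' ∧
      ∀ c' ∈ Metric.ball c ρ, φ (y₁, c') = d₀ c' ∧ φ' (y₁, c') = d₁ c' ∧ ∀ y ∈ Ioo a' b',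
        HasDerivAt (fun y => φ (y, c')) (φ' (y, c')) y ∧
        HasDerivAt (fun y => φ' (y, c')) (q (y, c') * φ (y, c') + S (y, c')) y := by
  obtain ⟨a₂, ha₂, ha₂'⟩ := exists_between (lt_min hy.1 hy₁.1)
  obtain ⟨a₁, ha₁, ha₁'⟩ := exists_between ha₂
  obtain ⟨b₂, hb₂', hb₂⟩ := exists_between (max_lt hy.2 hy₁.2)
  obtain ⟨b₁, hb₁', hb₁⟩ := exists_between hb₂
  have hab : a₂ < b₂ := ((lt_min_iff.1 ha₂').1).trans ((max_lt_iff.1 hb₂').1)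
  obtain ⟨ρ, hρ, hball⟩ := Metric.isOpen_iff.1 hD c hc
  have : ∃ η > 0, η ≤ a₂ - a₁ ∧ η ≤ b₁ - b₂ :=
    ⟨min (a₂ - a₁) (b₁ - b₂), lt_min (by linarith) (by linarith), min_le_left _ _, min_le_right _ _⟩
  obtain ⟨η, hη, hη1, hη2⟩ := this
  let χ₁ : ContDiffBump ((a₂ + b₂) / 2) := ⟨(b₂ - a₂) / 2, (b₂ - a₂) / 2 + η, by linarith, by linarith⟩
  let χ₂ : ContDiffBump c := ⟨ρ / 3, ρ / 2, by linarith, by linarith⟩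
  have hχ₁1 : ∀ y ∈ Ioo a₂ b₂, χ₁ y = 1 := fun y hy => χ₁.one_of_mem_closedBall (by
    rw [Metric.mem_closedBall, Real.dist_eq, abs_le]
    change -((b₂ - a₂) / 2) ≤ _ ∧ _ ≤ (b₂ - a₂) / 2
    constructor <;> linarith [hy.1, hy.2])
  have hχ₁0 : tsupport χ₁ ⊆ Ioo a b := by
    rw [χ₁.tsupport_eq]
    intro y hy
    rw [Metric.mem_closedBall, Real.dist_eq, abs_le] at hy
    change -((b₂ - a₂) / 2 + η) ≤ _ ∧ _ ≤ (b₂ - a₂) / 2 + η at hy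
    constructor <;> linarith [hy.1, hy.2]
  have hχ₂1 : ∀ c' ∈ Metric.ball c (ρ / 3), χ₂ c' = 1 := fun c' hc' =>
    χ₂.one_of_mem_closedBall (Metric.ball_subset_closedBall hc')
  have hχ₂0 : tsupport χ₂ ⊆ D := by
    rw [χ₂.tsupport_eq]
    exact (Metric.closedBall_subset_ball (by change ρ / 2 < ρ; linarith)).trans hball
  have hχs : ContDiff ℝ ∞ fun p : ℝ × ℂ => ((χ₁ p.1 * χ₂ p.2 : ℝ) : ℂ) :=
    Complex.ofRealCLM.contDiff.comp ((χ₁.contDiff.comp contDiff_fst).mul (χ₂.contDiff.comp contDiff_snd))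
  have hglob : ∀ f : ℝ × ℂ → ℂ, ContDiffOn ℝ ∞ f (Ioo a b ×ˢ D) →
      ContDiff ℝ ∞ fun p : ℝ × ℂ => ((χ₁ p.1 * χ₂ p.2 : ℝ) : ℂ) * f p := by
    intro f hf
    rw [contDiff_iff_contDiffAt]
    intro p
    by_cases hp : p.1 ∈ tsupport χ₁ ∧ p.2 ∈ tsupport χ₂
    · exact hχs.contDiffAt.mul (hf.contDiffAt ((isOpen_Ioo.prod hD).mem_nhds
        ⟨hχ₁0 hp.1, hχ₂0 hp.2⟩))
    · have : (fun p : ℝ × ℂ => ((χ₁ p.1 * χ₂ p.2 : ℝ) : ℂ) * f p) =ᶠ[𝓝 p] fun _ => 0 := by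
        rw [not_and_or] at hp
        rcases hp with hp | hp
        · filter_upwards [(isClosed_tsupport χ₁).isOpen_compl.preimage continuous_fst |>.mem_nhds hp]
            with z hz
          simp [image_eq_zero_of_notMem_tsupport (f := χ₁) hz]
        · filter_upwards [(isClosed_tsupport χ₂).isOpen_compl.preimage continuous_snd |>.mem_nhds hp]
            with z hz
          simp [image_eq_zero_of_notMem_tsupport (f := χ₂) hz]
      exact contDiffAt_const.congr_of_eventuallyEq this
  have hglob₂ : ∀ f : ℂ → ℂ, ContDiffOn ℝ ∞ f D → ContDiff ℝ ∞ fun z : ℂ => ((χ₂ z : ℝ) : ℂ) * f z := by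
    intro f hf
    rw [contDiff_iff_contDiffAt]
    intro p
    by_cases hp : p ∈ tsupport χ₂
    · exact (Complex.ofRealCLM.contDiff.comp χ₂.contDiff).contDiffAt.mul
        (hf.contDiffAt (hD.mem_nhds (hχ₂0 hp)))
    · have : (fun z : ℂ => ((χ₂ z : ℝ) : ℂ) * f z) =ᶠ[𝓝 p] fun _ => 0 := by
        filter_upwards [(isClosed_tsupport χ₂).isOpen_compl.mem_nhds hp] with z hz
        simp [image_eq_zero_of_notMem_tsupport (f := χ₂) hz]
      exact contDiffAt_const.congr_of_eventuallyEq this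
  obtain ⟨φ, φ', hφ, hφ', hsol⟩ := exists_global_solution (hglob q hq) (hglob S hS)
    (hglob₂ d₀ h₀) (hglob₂ d₁ h₁) y₁
  refine ⟨a₂, b₂, ha₂, hb₂, ⟨(lt_min_iff.1 ha₂').1, (max_lt_iff.1 hb₂').1⟩,
    ⟨(lt_min_iff.1 ha₂').2, (max_lt_iff.1 hb₂').2⟩, ρ / 3, by positivity,
    (Metric.ball_subset_ball (by linarith)).trans hball, φ, φ', hφ, hφ', fun c' hc' => ?_⟩
  obtain ⟨e0, e1, e2⟩ := hsol c'
  refine ⟨by simpa [hχ₂1 c' hc'] using e0, by simpa [hχ₂1 c' hc'] using e1, fun y hy => ?_⟩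
  simpa [hχ₂1 c' hc', hχ₁1 y hy] using e2 y

/-- Linear second order equations with smooth coefficients depending smoothly on a complex
parameter have solutions depending smoothly on the parameter. -/
theorem exists_solution_family {a b : ℝ} {D : Set ℂ} (hD : IsOpen D) {q S : ℝ × ℂ → ℂ}
    (hq : ContDiffOn ℝ ∞ q (Ioo a b ×ˢ D)) (hS : ContDiffOn ℝ ∞ S (Ioo a b ×ˢ D))
    {d₀ d₁ : ℂ → ℂ} (h₀ : ContDiffOn ℝ ∞ d₀ D) (h₁ : ContDiffOn ℝ ∞ d₁ D) {y₁ : ℝ}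
    (hy₁ : y₁ ∈ Ioo a b) :
    ∃ φ φ' : ℝ × ℂ → ℂ, ContDiffOn ℝ ∞ φ (Ioo a b ×ˢ D) ∧ ContDiffOn ℝ ∞ φ' (Ioo a b ×ˢ D) ∧
      ∀ c ∈ D, φ (y₁, c) = d₀ c ∧ φ' (y₁, c) = d₁ c ∧ ∀ y ∈ Ioo a b,
        HasDerivAt (fun y => φ (y, c)) (φ' (y, c)) y ∧
        HasDerivAt (fun y => φ' (y, c)) (q (y, c) * φ (y, c) + S (y, c)) y := by
  classical
  have hloc := fun (p : ℝ × ℂ) (hp : p ∈ Ioo a b ×ˢ D) =>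
    exists_local_solution hD hq hS h₀ h₁ hy₁ hp.1 hp.2
  choose! A B hA hB hyAB hy₁AB R hR hRD Φ Φ' hΦ hΦ' hsol using hloc
  have hqc : ∀ c ∈ D, ContinuousOn (fun y => q (y, c)) (Ioo a b) := fun c hc =>
    hq.continuousOn.comp (by fun_prop) fun y hy => ⟨hy, hc⟩
  -- All local solutions have the same data at `y₁`, hence coincide where they overlap. The diagonal
  -- `Φ p p` therefore agrees near each point with one smooth function.
  have heq : ∀ p ∈ Ioo a b ×ˢ D, ∀ y ∈ Ioo (A p) (B p), ∀ c ∈ Metric.ball p.2 (R p),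
      Φ p (y, c) = Φ (y, c) (y, c) ∧ Φ' p (y, c) = Φ' (y, c) (y, c) := by
    intro p hp y hy c hc
    have hyab : y ∈ Ioo a b := ⟨(hA p hp).trans hy.1, hy.2.trans (hB p hp)⟩
    have hcD : c ∈ D := hRD p hp hc
    have hp' : (y, c) ∈ Ioo a b ×ˢ D := ⟨hyab, hcD⟩
    obtain ⟨e0, e1, e2⟩ := hsol p hp c hc
    obtain ⟨f0, f1, f2⟩ := hsol (y, c) hp' c (Metric.mem_ball_self (hR _ hp'))
    have hsubset : Ioo (max (A p) (A (y, c))) (min (B p) (B (y, c))) ⊆ Ioo a b := fun z hz =>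
      ⟨(hA p hp).trans ((le_max_left _ _).trans_lt hz.1), (hz.2.trans_le (min_le_left _ _)).trans (hB p hp)⟩
    refine solution_unique (a := max (A p) (A (y, c))) (b := min (B p) (B (y, c))) (y₁ := y₁)
      (φ := fun y => Φ p (y, c)) (φ' := fun y => Φ' p (y, c)) (ψ := fun z => Φ (y, c) (z, c))
      (ψ' := fun z => Φ' (y, c) (z, c)) (q := fun y => q (y, c)) (S := fun y => S (y, c))
      ⟨max_lt (hy₁AB p hp).1 (hy₁AB _ hp').1, lt_min (hy₁AB p hp).2 (hy₁AB _ hp').2⟩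
      ((hqc c hcD).mono hsubset) (fun z hz => e2 z ?_) (fun z hz => f2 z ?_)
      (e0.trans f0.symm) (e1.trans f1.symm) y
      ⟨max_lt hy.1 (hyAB _ hp').1, lt_min hy.2 (hyAB _ hp').2⟩
    · exact ⟨(le_max_left _ _).trans_lt hz.1, hz.2.trans_le (min_le_left _ _)⟩
    · exact ⟨(le_max_right _ _).trans_lt hz.1, hz.2.trans_le (min_le_right _ _)⟩
  have hnhds : ∀ p ∈ Ioo a b ×ˢ D, Ioo (A p) (B p) ×ˢ Metric.ball p.2 (R p) ∈ 𝓝 p := fun p hp =>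
    (isOpen_Ioo.prod Metric.isOpen_ball).mem_nhds ⟨hyAB p hp, Metric.mem_ball_self (hR p hp)⟩
  refine ⟨fun p => Φ p p, fun p => Φ' p p, fun p hp => ?_, fun p hp => ?_, fun c hc => ?_⟩
  · refine ((hΦ p hp).contDiffAt.congr_of_eventuallyEq ?_).contDiffWithinAt
    filter_upwards [hnhds p hp] with z hz using (heq p hp z.1 hz.1 z.2 hz.2).1.symm
  · refine ((hΦ' p hp).contDiffAt.congr_of_eventuallyEq ?_).contDiffWithinAt
    filter_upwards [hnhds p hp] with z hz using (heq p hp z.1 hz.1 z.2 hz.2).2.symm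
  · have hp₁ : (y₁, c) ∈ Ioo a b ×ˢ D := ⟨hy₁, hc⟩
    obtain ⟨e0, e1, -⟩ := hsol (y₁, c) hp₁ c (Metric.mem_ball_self (hR _ hp₁))
    refine ⟨e0, e1, fun y hy => ?_⟩
    have hp : (y, c) ∈ Ioo a b ×ˢ D := ⟨hy, hc⟩
    have hcR : c ∈ Metric.ball c (R (y, c)) := Metric.mem_ball_self (hR _ hp)
    have hd := (hsol (y, c) hp c hcR).2.2 y (hyAB _ hp)
    have hev : ∀ᶠ z in 𝓝 y, z ∈ Ioo (A (y, c)) (B (y, c)) :=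
      isOpen_Ioo.mem_nhds (hyAB _ hp)
    constructor
    · refine hd.1.congr_of_eventuallyEq ?_
      filter_upwards [hev] with z hz using (heq (y, c) hp z hz c hcR).1.symm
    · refine hd.2.congr_of_eventuallyEq ?_
      filter_upwards [hev] with z hz using (heq (y, c) hp z hz c hcR).2.symm

end LinearODE

/-! ### Integral bounds across a simple critical layer, uniform in Im c. -/

section SimpleLayer

theorem abs_mul_log_le {K x : ℝ} (hx : 0 < x) (hK : x ≤ K) : |x * Real.log x| ≤ 1 + K ^ 2 := by
  rcases le_total x 1 with h | h
  · have := Real.abs_log_mul_self_lt x hx h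
    rw [mul_comm]; nlinarith [sq_nonneg K]
  · rw [abs_of_nonneg (mul_nonneg hx.le (Real.log_nonneg h))]
    have := Real.log_le_sub_one_of_pos hx
    nlinarith [Real.log_nonneg h]

theorem norm_log_le (z : ℂ) : ‖Complex.log z‖ ≤ |Real.log ‖z‖| + Real.pi := by
  refine (Complex.norm_le_abs_re_add_abs_im _).trans ?_
  rw [Complex.log_re, Complex.log_im]
  gcongr
  exact Complex.abs_arg_le_pi z

theorem norm_mul_log_le {K : ℝ} {z : ℂ} (hz : z ≠ 0) (hK : ‖z‖ ≤ K) :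
    ‖z * Complex.log z‖ ≤ 1 + K ^ 2 + K * Real.pi := by
  have h0 : 0 < ‖z‖ := norm_pos_iff.2 hz
  have h1 := abs_mul_log_le h0 hK
  rw [abs_mul, abs_of_pos h0] at h1
  rw [norm_mul]
  calc ‖z‖ * ‖Complex.log z‖ ≤ ‖z‖ * (|Real.log ‖z‖| + Real.pi) := by
        gcongr; exact norm_log_le z
    _ = ‖z‖ * |Real.log ‖z‖| + ‖z‖ * Real.pi := by ring
    _ ≤ _ := by gcongr

variable {V V₁ V₂ V₃ : ℝ → ℝ} {p q : ℝ} {c : ℂ}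

theorem sub_mem_slitPlane (hc : c.im ≠ 0) (x : ℝ) : (x : ℂ) - c ∈ Complex.slitPlane :=
  Or.inr (by simpa using hc)

theorem sub_ne_zero_of_im (hc : c.im ≠ 0) (x : ℝ) : (x : ℂ) - c ≠ 0 :=
  Complex.slitPlane_ne_zero (sub_mem_slitPlane hc x)

theorem hasDerivAt_ofReal_sub {V : ℝ → ℝ} {v t : ℝ} (h : HasDerivAt V v t) (c : ℂ) :
    HasDerivAt (fun t => (V t : ℂ) - c) (v : ℂ) t :=
  h.ofReal_comp.sub_const c

theorem integral_norm_log_le (hpq : p ≤ q) (hV : ∀ t ∈ Icc p q, HasDerivAt V (V₁ t) t)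
    (hV₁ : ContinuousOn V₁ (Icc p q)) {m K : ℝ} (hm : 0 < m) (hmV : ∀ t ∈ Icc p q, m ≤ V₁ t)
    (hK1 : 1 ≤ K) (hc : c.im ≠ 0) (hQ : ∀ t ∈ Icc p q, ‖(V t : ℂ) - c‖ ≤ K) :
    ∫ t in p..q, ‖Complex.log ((V t : ℂ) - c)‖ ≤
      (Real.log K + Real.pi) * (q - p) +
        (Real.log K * (2 * K) + 2 * (1 + K ^ 2 + K * Real.pi + K)) / m := by
  have hVc : ContinuousOn V (Icc p q) := fun t ht => (hV t ht).continuousAt.continuousWithinAt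
  have hQc : ContinuousOn (fun t => (V t : ℂ) - c) (Icc p q) :=
    (Complex.continuous_ofReal.comp_continuousOn hVc).sub continuousOn_const
  have hLc : ContinuousOn (fun t => Complex.log ((V t : ℂ) - c)) (Icc p q) :=
    hQc.clog fun t _ => sub_mem_slitPlane hc _
  have hpos : ∀ t, 0 < ‖(V t : ℂ) - c‖ := fun t => norm_pos_iff.2 (sub_ne_zero_of_im hc _)
  have hlogK : 0 ≤ Real.log K := Real.log_nonneg hK1
  have hpt : ∀ t ∈ Icc p q, ‖Complex.log ((V t : ℂ) - c)‖ ≤ (Real.log K + Real.pi) +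
      (V₁ t * (Real.log K - (Complex.log ((V t : ℂ) - c)).re)) / m := by
    intro t ht
    refine (norm_log_le _).trans ?_
    rw [Complex.log_re]
    have h1 : Real.log ‖(V t : ℂ) - c‖ ≤ Real.log K := Real.log_le_log (hpos t) (hQ t ht)
    have h2 : |Real.log ‖(V t : ℂ) - c‖| ≤ Real.log K + (Real.log K - Real.log ‖(V t : ℂ) - c‖) := by
      rw [abs_le]; constructor <;> linarith
    have h3 : Real.log K - Real.log ‖(V t : ℂ) - c‖
        ≤ (V₁ t * (Real.log K - Real.log ‖(V t : ℂ) - c‖)) / m := by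
      rw [le_div_iff₀ hm, mul_comm]
      exact mul_le_mul_of_nonneg_right (hmV t ht) (by linarith)
    linarith
  have hprim : ∀ t ∈ uIcc p q, HasDerivAt (fun t => Real.log K * V t
      - (((V t : ℂ) - c) * Complex.log ((V t : ℂ) - c) - ((V t : ℂ) - c)).re)
      (V₁ t * (Real.log K - (Complex.log ((V t : ℂ) - c)).re)) t := by
    intro t ht
    rw [uIcc_of_le hpq] at ht
    have hQ' := hasDerivAt_ofReal_sub (hV t ht) c
    have hL := hQ'.clog_real (sub_mem_slitPlane hc _)
    have h1 := ((hQ'.mul hL).sub hQ')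
    have h2 : HasDerivAt (fun t => (((V t : ℂ) - c) * Complex.log ((V t : ℂ) - c) - ((V t : ℂ) - c)).re)
        (((V₁ t : ℂ) * Complex.log ((V t : ℂ) - c)).re) t := by
      have h3 := (Complex.reCLM.hasFDerivAt.comp t h1.hasFDerivAt).hasDerivAt
      refine h3.congr_deriv ?_
      have := sub_ne_zero_of_im hc (V t)
      simp only [ContinuousLinearMap.comp_apply, ContinuousLinearMap.toSpanSingleton_apply, one_smul,
        Complex.reCLM_apply]
      congr 1
      field_simp
      ring
    refine (((hV t ht).const_mul (Real.log K)).sub h2).congr_deriv ?_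
    rw [Complex.re_ofReal_mul]
    ring
  have hint : IntervalIntegrable (fun t => V₁ t * (Real.log K - (Complex.log ((V t : ℂ) - c)).re))
      volume p q := by
    refine ContinuousOn.intervalIntegrable ?_
    rw [uIcc_of_le hpq]
    exact hV₁.mul (continuousOn_const.sub (Complex.continuous_re.comp_continuousOn hLc))
  have hFTC := intervalIntegral.integral_eq_sub_of_hasDerivAt hprim hint
  have hE : ∀ t ∈ Icc p q, |(((V t : ℂ) - c) * Complex.log ((V t : ℂ) - c) - ((V t : ℂ) - c)).re|
      ≤ 1 + K ^ 2 + K * Real.pi + K := fun t ht => by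
    refine (Complex.abs_re_le_norm _).trans ((norm_sub_le _ _).trans ?_)
    exact add_le_add (norm_mul_log_le (sub_ne_zero_of_im hc _) (hQ t ht)) (hQ t ht)
  have hVd : V q - V p ≤ 2 * K := by
    have h1 : ‖((V q : ℂ) - c) - ((V p : ℂ) - c)‖ ≤ K + K :=
      (norm_sub_le _ _).trans (add_le_add (hQ q ⟨hpq, le_rfl⟩) (hQ p ⟨le_rfl, hpq⟩))
    rw [sub_sub_sub_cancel_right, ← Complex.ofReal_sub, Complex.norm_real] at h1
    linarith [le_abs_self (V q - V p), Real.norm_eq_abs (V q - V p)]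
  calc ∫ t in p..q, ‖Complex.log ((V t : ℂ) - c)‖
      ≤ ∫ t in p..q, ((Real.log K + Real.pi) +
        (V₁ t * (Real.log K - (Complex.log ((V t : ℂ) - c)).re)) / m) := by
        refine intervalIntegral.integral_mono_on hpq ?_ ?_ hpt
        · refine ContinuousOn.intervalIntegrable ?_
          rw [uIcc_of_le hpq]; exact hLc.norm
        · exact intervalIntegrable_const.add (hint.div_const m)
    _ = (Real.log K + Real.pi) * (q - p) +
        (∫ t in p..q, V₁ t * (Real.log K - (Complex.log ((V t : ℂ) - c)).re)) / m := by
        rw [intervalIntegral.integral_add intervalIntegrable_const (hint.div_const m),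
          intervalIntegral.integral_const, intervalIntegral.integral_div, smul_eq_mul, mul_comm]
    _ ≤ _ := by
        gcongr
        rw [hFTC]
        have h1 := abs_le.1 (hE p ⟨le_rfl, hpq⟩)
        have h2 := abs_le.1 (hE q ⟨hpq, le_rfl⟩)
        nlinarith [mul_le_mul_of_nonneg_left hVd hlogK]

/-- The function `Q ∫ Q⁻²` is bounded across a simple critical layer, with explicit dependence on
the profile. -/
theorem exists_norm_mul_integral_inv_sq_le {m K κ l : ℝ} (hm : 0 < m) (hK1 : 1 ≤ K) (hκ : 0 < κ) :
    ∃ C, ∀ (V V₁ V₂ V₃ : ℝ → ℝ) (p q : ℝ) (c : ℂ), p ≤ q → q - p ≤ l →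
      (∀ t ∈ Icc p q, HasDerivAt V (V₁ t) t) → (∀ t ∈ Icc p q, HasDerivAt V₁ (V₂ t) t) →
      (∀ t ∈ Icc p q, HasDerivAt V₂ (V₃ t) t) → ContinuousOn V₃ (Icc p q) →
      (∀ t ∈ Icc p q, m ≤ V₁ t) → (∀ t ∈ Icc p q, |V₂ t| ≤ K) → (∀ t ∈ Icc p q, |V₃ t| ≤ K) →
      c.im ≠ 0 → (∀ t ∈ Icc p q, ‖(V t : ℂ) - c‖ ≤ K) → κ ≤ ‖(V p : ℂ) - c‖ →
      ∀ y ∈ Icc p q, ‖((V y : ℂ) - c) * ∫ t in p..y, (((V t : ℂ) - c) ^ 2)⁻¹‖ ≤ C := by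
  set H₀ : ℝ := K / m ^ 3 with hH₀
  set H₁ : ℝ := K / m ^ 3 + 3 * K ^ 2 / m ^ 4 with hH₁
  set I₀ : ℝ := (Real.log K + Real.pi) * l +
        (Real.log K * (2 * K) + 2 * (1 + K ^ 2 + K * Real.pi + K)) / m with hI₀
  refine ⟨(1 / m + H₀ * (1 + K ^ 2 + K * Real.pi)) +
    K * (1 / (m * κ) + H₀ * (|Real.log κ| + |Real.log K| + Real.pi)) + K * (H₁ * I₀), ?_⟩
  intro V V₁ V₂ V₃ p q c hpq hl hV hV₁ hV₂ hV₃ hmV hKV₂ hKV₃ hc hQ hκQ y hy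
  have hK0 : 0 < K := by linarith
  have hH₀0 : 0 ≤ H₀ := by positivity
  have hH₁0 : 0 ≤ H₁ := by positivity
  have hsub : Icc p y ⊆ Icc p q := Icc_subset_Icc_right hy.2
  have hV₁0 : ∀ t ∈ Icc p q, V₁ t ≠ 0 := fun t ht => (hm.trans_le (hmV t ht)).ne'
  have hVc : ContinuousOn V (Icc p q) := fun t ht => (hV t ht).continuousAt.continuousWithinAt
  have hV₁c : ContinuousOn V₁ (Icc p q) := fun t ht => (hV₁ t ht).continuousAt.continuousWithinAt
  have hV₂c : ContinuousOn V₂ (Icc p q) := fun t ht => (hV₂ t ht).continuousAt.continuousWithinAt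
  have hQc : ContinuousOn (fun t => (V t : ℂ) - c) (Icc p q) :=
    (Complex.continuous_ofReal.comp_continuousOn hVc).sub continuousOn_const
  have hLc : ContinuousOn (fun t => Complex.log ((V t : ℂ) - c)) (Icc p q) :=
    hQc.clog fun t _ => sub_mem_slitPlane hc _
  -- Differentiating -1/(V₁ Q) gives Q⁻² and a remainder V₂/(V₁² Q); this `h` makes the derivative
  -- of log Q cancel the remainder. So `Θ` is a primitive of Q⁻² up to the integrable error h' log
  -- Q, and Q Θ is bounded because Q log Q is.
  set h : ℝ → ℝ := fun t => -(V₂ t / V₁ t ^ 3) with hh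
  set h' : ℝ → ℝ := fun t => -(V₃ t / V₁ t ^ 3) + 3 * V₂ t ^ 2 / V₁ t ^ 4 with hh'
  have hhd : ∀ t ∈ Icc p q, HasDerivAt h (h' t) t := by
    intro t ht
    have := ((hV₂ t ht).div ((hV₁ t ht).pow 3) (pow_ne_zero 3 (hV₁0 t ht))).neg
    refine this.congr_deriv ?_
    have := hV₁0 t ht
    simp only [hh', Pi.pow_apply]
    field_simp
    ring
  have hhb : ∀ t ∈ Icc p q, |h t| ≤ H₀ := by
    intro t ht
    rw [hh, abs_neg, abs_div, abs_of_pos (pow_pos (hm.trans_le (hmV t ht)) 3)]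
    exact div_le_div₀ hK0.le (hKV₂ t ht) (by positivity) (pow_le_pow_left₀ hm.le (hmV t ht) 3)
  have hhb' : ∀ t ∈ Icc p q, |h' t| ≤ H₁ := by
    intro t ht
    have h1 := hmV t ht
    have h2 := hKV₂ t ht
    have h3 := hKV₃ t ht
    have h4 : 0 < V₁ t := hm.trans_le h1
    refine (abs_add_le _ _).trans (add_le_add ?_ ?_)
    · rw [abs_neg, abs_div, abs_of_pos (pow_pos h4 3)]
      gcongr
    · rw [abs_div, abs_of_pos (pow_pos h4 4), abs_mul, abs_pow, abs_of_pos (by norm_num : (0 : ℝ) < 3)]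
      gcongr
  have hh'c : ContinuousOn h' (Icc p q) := by
    refine (hV₃.div (hV₁c.pow 3) fun t ht => pow_ne_zero 3 (hV₁0 t ht)).neg.add
      ((continuousOn_const.mul (hV₂c.pow 2)).div (hV₁c.pow 4) fun t ht => pow_ne_zero 4 (hV₁0 t ht))
  set Θ : ℝ → ℂ := fun t => -(((V₁ t : ℂ))⁻¹ / ((V t : ℂ) - c)) + (h t : ℂ) * Complex.log ((V t : ℂ) - c)
    with hΘ
  have hΘd : ∀ t ∈ uIcc p y, HasDerivAt Θ ((((V t : ℂ) - c) ^ 2)⁻¹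
      + (h' t : ℂ) * Complex.log ((V t : ℂ) - c)) t := by
    intro t ht
    rw [uIcc_of_le hy.1] at ht
    have ht' := hsub ht
    have hQ' := hasDerivAt_ofReal_sub (hV t ht') c
    have hne : (V t : ℂ) - c ≠ 0 := sub_ne_zero_of_im hc _
    have hne₁ : (V₁ t : ℂ) ≠ 0 := by exact_mod_cast hV₁0 t ht'
    have hL := hQ'.clog_real (sub_mem_slitPlane hc _)
    have h1 := (((hV₁ t ht').ofReal_comp.inv hne₁).div hQ' hne).neg
    have h2 := (hhd t ht').ofReal_comp.mul hL
    refine (h1.add h2).congr_deriv ?_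
    simp only [hh, Pi.inv_apply, Complex.ofReal_neg, Complex.ofReal_div, Complex.ofReal_pow]
    field_simp
    ring
  have hint1 : IntervalIntegrable (fun t => (((V t : ℂ) - c) ^ 2)⁻¹) volume p y := by
    refine ContinuousOn.intervalIntegrable ?_
    rw [uIcc_of_le hy.1]
    exact ((hQc.mono hsub).pow 2).inv₀ fun t _ => pow_ne_zero 2 (sub_ne_zero_of_im hc _)
  have hint2 : IntervalIntegrable (fun t => (h' t : ℂ) * Complex.log ((V t : ℂ) - c)) volume p y := by
    refine ContinuousOn.intervalIntegrable ?_
    rw [uIcc_of_le hy.1]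
    exact (Complex.continuous_ofReal.comp_continuousOn (hh'c.mono hsub)).mul (hLc.mono hsub)
  have hFTC := intervalIntegral.integral_eq_sub_of_hasDerivAt hΘd (hint1.add hint2)
  rw [intervalIntegral.integral_add hint1 hint2] at hFTC
  have hIlog : ‖∫ t in p..y, (h' t : ℂ) * Complex.log ((V t : ℂ) - c)‖ ≤ H₁ * I₀ := by
    calc _ ≤ ∫ t in p..y, H₁ * ‖Complex.log ((V t : ℂ) - c)‖ := by
          refine intervalIntegral.norm_integral_le_of_norm_le hy.1 ?_ ?_
          · refine (ae_of_all _ fun t ht => ?_)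
            rw [norm_mul, Complex.norm_real]
            gcongr
            exact hhb' t (hsub ⟨ht.1.le, ht.2⟩)
          · refine ContinuousOn.intervalIntegrable ?_
            rw [uIcc_of_le hy.1]
            exact continuousOn_const.mul (hLc.mono hsub).norm
      _ = H₁ * ∫ t in p..y, ‖Complex.log ((V t : ℂ) - c)‖ := by
          rw [intervalIntegral.integral_const_mul]
      _ ≤ _ := by
          gcongr
          refine (integral_norm_log_le hy.1 (fun t ht => hV t (hsub ht)) (hV₁c.mono hsub) hm
            (fun t ht => hmV t (hsub ht)) hK1 hc fun t ht => hQ t (hsub ht)).trans ?_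
          rw [hI₀]
          have : 0 ≤ Real.log K := Real.log_nonneg hK1
          have := Real.pi_pos
          gcongr
          linarith [hy.2]
  have hQy := hQ y hy
  have hpmem : p ∈ Icc p q := ⟨le_rfl, hpq⟩
  have hΘy : ‖((V y : ℂ) - c) * Θ y‖ ≤ 1 / m + H₀ * (1 + K ^ 2 + K * Real.pi) := by
    have hne : (V y : ℂ) - c ≠ 0 := sub_ne_zero_of_im hc _
    have : ((V y : ℂ) - c) * Θ y = -((V₁ y : ℂ))⁻¹
        + (h y : ℂ) * (((V y : ℂ) - c) * Complex.log ((V y : ℂ) - c)) := by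
      simp only [hΘ]; field_simp
    rw [this]
    refine (norm_add_le _ _).trans (add_le_add ?_ ?_)
    · rw [norm_neg, norm_inv, Complex.norm_real, one_div]
      refine inv_anti₀ hm ((hmV y hy).trans (le_abs_self _))
    · rw [norm_mul, Complex.norm_real]
      gcongr
      · exact hhb y hy
      · exact norm_mul_log_le hne hQy
  have hΘp : ‖Θ p‖ ≤ 1 / (m * κ) + H₀ * (|Real.log κ| + |Real.log K| + Real.pi) := by
    refine (norm_add_le _ _).trans (add_le_add ?_ ?_)
    · rw [norm_neg, norm_div, norm_inv, Complex.norm_real, one_div, mul_inv, div_eq_mul_inv]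
      gcongr
      exact (hmV p hpmem).trans (le_abs_self _)
    · rw [norm_mul, Complex.norm_real]
      gcongr
      · exact hhb p hpmem
      · refine (norm_log_le _).trans ?_
        gcongr
        have h1 : Real.log κ ≤ Real.log ‖(V p : ℂ) - c‖ := Real.log_le_log hκ hκQ
        have h2 : Real.log ‖(V p : ℂ) - c‖ ≤ Real.log K :=
          Real.log_le_log (hκ.trans_le hκQ) (hQ p hpmem)
        rw [abs_le]
        constructor
        · linarith [neg_abs_le (Real.log κ), abs_nonneg (Real.log K)]
        · linarith [le_abs_self (Real.log K), abs_nonneg (Real.log κ)]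
  have heq : ((V y : ℂ) - c) * ∫ t in p..y, (((V t : ℂ) - c) ^ 2)⁻¹ = ((V y : ℂ) - c) * Θ y
      - ((V y : ℂ) - c) * Θ p
      - ((V y : ℂ) - c) * ∫ t in p..y, (h' t : ℂ) * Complex.log ((V t : ℂ) - c) := by
    rw [eq_sub_of_add_eq hFTC]; ring
  rw [heq]
  refine (norm_sub_le _ _).trans (add_le_add ((norm_sub_le _ _).trans (add_le_add hΘy ?_)) ?_)
  · rw [norm_mul]; gcongr
  · rw [norm_mul]; gcongr

end SimpleLayer

/-! ### The regular solution for real parameters. -/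

section Frobenius

/-- The kernel of the system of integral equations for the regular solution at a critical layer. -/
noncomputable def layerKernel (k₁ k₂ : ℝ) : (ℝ × ℝ) →L[ℝ] (ℝ × ℝ) :=
  (k₁ • ContinuousLinearMap.snd ℝ ℝ ℝ).prod (k₂ • ContinuousLinearMap.fst ℝ ℝ ℝ)

@[simp] theorem layerKernel_apply (k₁ k₂ : ℝ) (e : ℝ × ℝ) :
    layerKernel k₁ k₂ e = (k₁ * e.2, k₂ * e.1) := by
  simp [layerKernel]

theorem layerKernel_eq (k₁ k₂ : ℝ) : layerKernel k₁ k₂ = k₁ • layerKernel 1 0 + k₂ • layerKernel 0 1 := by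
  refine ContinuousLinearMap.ext fun e => ?_
  simp

theorem norm_layerKernel_le (k₁ k₂ : ℝ) : ‖layerKernel k₁ k₂‖ ≤ |k₁| + |k₂| := by
  refine ContinuousLinearMap.opNorm_le_bound _ (by positivity) fun e => ?_
  rw [layerKernel_apply, Prod.norm_mk, norm_mul, norm_mul]
  have h1 := norm_fst_le e
  have h2 := norm_snd_le e
  simp only [Real.norm_eq_abs] at *
  refine max_le ?_ ?_
  · calc |k₁| * |e.2| ≤ |k₁| * ‖e‖ := by gcongr
      _ ≤ _ := by have := abs_nonneg k₂; have := norm_nonneg e; nlinarith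
  · calc |k₂| * |e.1| ≤ |k₂| * ‖e‖ := by gcongr
      _ ≤ _ := by have := abs_nonneg k₁; have := norm_nonneg e; nlinarith

/-- The regular solution of the Rayleigh equation at a noncritical point of the profile, in the
variable `t = U - a`, where `g` is the derivative of the inverse function of the profile `U`. -/
theorem exists_regular_solution {g : ℝ → ℝ} (hg : ContDiff ℝ ∞ g) {M : ℝ} (hM : ∀ x, |g x| ≤ M)
    (β : ℝ) :
    ∃ X G : ℝ × ℝ → ℝ, ContDiff ℝ ∞ X ∧ ContDiff ℝ ∞ G ∧ ∀ a, X (0, a) = 1 ∧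
      ∀ t, HasDerivAt (fun t => X (t, a)) (β * g (a + t) * (t * G (t, a))) t ∧
        HasDerivAt (fun t => t ^ 3 * G (t, a)) (t ^ 2 * g (a + t) * X (t, a)) t := by
  have hM0 : 0 ≤ M := (abs_nonneg _).trans (hM 0)
  -- With g = 1/U' as a function of U, the system encodes (Q² χ')' = β Q² χ for χ = X(U - a, a),
  -- with Q² χ' = β Q³ G. Dividing t³ G by t³ leaves an average of X over [0, 1] without a small
  -- factor, so the second unknown is taken to be `η * G`, which brings that kernel below 1/8. The
  -- factor 1/η in the other kernel is harmless: that kernel carries t² and is beaten by the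
  -- exponential weight.
  set η : ℝ := 1 / (8 * (M + 1)) with hη
  have hη0 : 0 < η := by positivity
  have hgp : ContDiff ℝ ∞ fun p : ℝ × (ℝ × ℝ) => g (p.2.2 + p.1 * p.2.1) := hg.comp (by fun_prop)
  set k₁ : ℝ × (ℝ × ℝ) → ℝ := fun p => β * p.2.1 ^ 2 * p.1 * g (p.2.2 + p.1 * p.2.1) / η with hk₁
  set k₂ : ℝ × (ℝ × ℝ) → ℝ := fun p => η * p.1 ^ 2 * g (p.2.2 + p.1 * p.2.1) with hk₂
  set K : ℝ × (ℝ × ℝ) → ((ℝ × ℝ) →L[ℝ] (ℝ × ℝ)) := fun p => layerKernel (k₁ p) (k₂ p) with hK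
  have hk₁s : ContDiff ℝ ∞ k₁ := by
    rw [hk₁]; exact (ContDiff.mul (by fun_prop) hgp).div_const _
  have hk₂s : ContDiff ℝ ∞ k₂ := ContDiff.mul (by fun_prop) hgp
  have hKs : ContDiff ℝ ∞ K := by
    have : K = fun p => k₁ p • layerKernel 1 0 + k₂ p • layerKernel 0 1 :=
      funext fun p => layerKernel_eq _ _
    rw [this]
    exact (hk₁s.smul contDiff_const).add (hk₂s.smul contDiff_const)
  have hsmall : SmallKernel volume (Icc (0 : ℝ) 1) id K := by
    intro R
    set A : ℝ := |β| * |R| * M / η with hA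
    have hA0 : 0 ≤ A := by positivity
    refine ⟨8 * (A + 1), fun q hq => ?_⟩
    have hl : 0 < 8 * (A + 1) := by positivity
    have hq1 : |q.1| ≤ |R| := ((norm_fst_le q).trans hq).trans (le_abs_self R)
    calc _ ≤ ∫ w in Icc (0 : ℝ) 1, (A * (|q.1| * Real.exp (8 * (A + 1) * (w * |q.1| - |q.1|))) + 1 / 8) := by
          refine setIntegral_mono_on ?_ ?_ measurableSet_Icc fun w hw => ?_
          · refine Continuous.integrableOn_Icc (Continuous.mul ?_ ?_)
            · exact (hKs.continuous.comp (by fun_prop : Continuous fun w : ℝ => (w, q))).norm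
            · simp only [id]; fun_prop
          · exact Continuous.integrableOn_Icc (by fun_prop)
          · have hexp : Real.exp (8 * (A + 1) * (id w * |q.1| - |q.1|)) ≤ 1 := by
              rw [Real.exp_le_one_iff]
              refine mul_nonpos_of_nonneg_of_nonpos hl.le ?_
              simp only [id]
              nlinarith [abs_nonneg q.1, hw.2]
            have hg1 := hM (q.2 + w * q.1)
            have h1 : |k₁ (w, q)| ≤ A * |q.1| := by
              have e : A * |q.1| = |β| * (|R| * |q.1|) * 1 * M / η := by rw [hA]; ring
              rw [e]
              simp only [hk₁, abs_div, abs_mul, abs_of_pos hη0, abs_pow]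
              have h2 : |w| ≤ 1 := by rw [abs_of_nonneg hw.1]; exact hw.2
              have h3 : |q.1| ^ 2 ≤ |R| * |q.1| := by rw [sq]; gcongr
              gcongr
            have h2 : |k₂ (w, q)| ≤ 1 / 8 := by
              have e : η * 1 * M ≤ 1 / 8 := by
                rw [hη, mul_one, one_div_mul_eq_div, div_le_div_iff₀ (by positivity) (by norm_num)]
                linarith
              refine le_trans ?_ e
              simp only [hk₂, abs_mul, abs_of_pos hη0, abs_pow]
              have h2 : |w| ^ 2 ≤ 1 := by
                rw [abs_of_nonneg hw.1]; exact pow_le_one₀ hw.1 hw.2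
              exact mul_le_mul (mul_le_mul_of_nonneg_left h2 hη0.le) hg1 (abs_nonneg _) (by positivity)
            calc _ ≤ (|k₁ (w, q)| + |k₂ (w, q)|) * Real.exp (8 * (A + 1) * (id w * |q.1| - |q.1|)) :=
                  mul_le_mul_of_nonneg_right (norm_layerKernel_le _ _) (Real.exp_pos _).le
              _ ≤ A * |q.1| * Real.exp (8 * (A + 1) * (id w * |q.1| - |q.1|)) + 1 / 8 * 1 := by
                  rw [add_mul]
                  exact add_le_add (mul_le_mul_of_nonneg_right h1 (Real.exp_pos _).le)
                    (mul_le_mul h2 hexp (Real.exp_pos _).le (by norm_num))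
              _ = _ := by simp only [id]; ring
      _ = A * (∫ w in Icc (0 : ℝ) 1, |q.1| * Real.exp (8 * (A + 1) * (w * |q.1| - |q.1|))) + 1 / 8 := by
          rw [integral_add (Continuous.integrableOn_Icc (by fun_prop))
            (Continuous.integrableOn_Icc (by fun_prop)), integral_const_mul]
          simp
      _ ≤ A * (1 / (8 * (A + 1))) + 1 / 8 := by gcongr; exact integral_exp_weight_le hl q.1
      _ ≤ 1 / 4 := by
          have : A * (1 / (8 * (A + 1))) ≤ 1 / 8 := by
            rw [mul_one_div, div_le_div_iff₀ hl (by norm_num)]; linarith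
          linarith
  obtain ⟨u, hu, hueq⟩ := exists_contDiff_volterra volume isCompact_Icc contDiff_id (fun w hw => hw)
    hKs hsmall (contDiff_const (c := ((1 : ℝ), (0 : ℝ))))
  have hcont : ∀ q : ℝ × ℝ, Continuous fun w : ℝ => K (w, q) (u (contractFst ℝ (id w) q)) := fun q =>
    (contDiff_volterra_integrand contDiff_id hKs hu).continuous.comp
        (by fun_prop : Continuous fun w : ℝ => (w, q))
  have hI : ∀ q : ℝ × ℝ, u q = (1, 0) + ∫ w in (0 : ℝ)..1, (k₁ (w, q) * (u (w * q.1, q.2)).2,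
      k₂ (w, q) * (u (w * q.1, q.2)).1) := by
    intro q
    rw [hueq q, intervalIntegral.integral_of_le zero_le_one, ← integral_Icc_eq_integral_Ioc]
    simp [hK]
  have hint : ∀ q : ℝ × ℝ, IntervalIntegrable (fun w => (k₁ (w, q) * (u (w * q.1, q.2)).2,
      k₂ (w, q) * (u (w * q.1, q.2)).1)) volume 0 1 := by
    intro q
    refine ((hcont q).congr fun w => ?_).intervalIntegrable _ _
    simp [hK]
  have hI1 : ∀ q : ℝ × ℝ, (u q).1 = 1 + ∫ w in (0 : ℝ)..1, k₁ (w, q) * (u (w * q.1, q.2)).2 := by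
    intro q
    have := congrArg (ContinuousLinearMap.fst ℝ ℝ ℝ) (hI q)
    rw [map_add, ← ContinuousLinearMap.intervalIntegral_comp_comm _ (hint q)] at this
    simpa using this
  have hI2 : ∀ q : ℝ × ℝ, (u q).2 = ∫ w in (0 : ℝ)..1, k₂ (w, q) * (u (w * q.1, q.2)).1 := by
    intro q
    have := congrArg (ContinuousLinearMap.snd ℝ ℝ ℝ) (hI q)
    rw [map_add, ← ContinuousLinearMap.intervalIntegral_comp_comm _ (hint q)] at this
    simpa using this
  have hX : ∀ t a, (u (t, a)).1 = 1 + ∫ s in (0 : ℝ)..t, β * g (a + s) * (s * ((u (s, a)).2 / η)) := by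
    intro t a
    rw [hI1]
    have := intervalIntegral.smul_integral_comp_mul_right (a := (0 : ℝ)) (b := 1)
      (fun s => β * g (a + s) * (s * ((u (s, a)).2 / η))) t
    rw [zero_mul, one_mul] at this
    rw [← this, smul_eq_mul, ← intervalIntegral.integral_const_mul]
    congr 1
    refine intervalIntegral.integral_congr fun w _ => ?_
    simp only [hk₁]
    ring
  have hG : ∀ t a, t ^ 3 * ((u (t, a)).2 / η) = ∫ s in (0 : ℝ)..t, s ^ 2 * g (a + s) * (u (s, a)).1 := by
    intro t a
    rw [hI2]
    have := intervalIntegral.smul_integral_comp_mul_right (a := (0 : ℝ)) (b := 1)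
      (fun s => s ^ 2 * g (a + s) * (u (s, a)).1) t
    rw [zero_mul, one_mul] at this
    rw [← this, smul_eq_mul, ← intervalIntegral.integral_div, ← intervalIntegral.integral_const_mul,
      ← intervalIntegral.integral_const_mul]
    refine intervalIntegral.integral_congr fun w _ => ?_
    simp only [hk₂]
    field_simp
  refine ⟨fun q => (u q).1, fun q => (u q).2 / η, contDiff_fst.comp hu,
    (contDiff_snd.comp hu).div_const _, fun a => ⟨by simp [hX], fun t => ⟨?_, ?_⟩⟩⟩
  · have hc : Continuous fun s => β * g (a + s) * (s * ((u (s, a)).2 / η)) := by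
      have := hu.continuous; have := hg.continuous; fun_prop
    have h1 := (intervalIntegral.integral_hasDerivAt_right (hc.intervalIntegrable 0 t)
      (hc.stronglyMeasurableAtFilter _ _) hc.continuousAt).const_add 1
    exact h1.congr_of_eventuallyEq (Eventually.of_forall fun t => hX t a)
  · have hc : Continuous fun s => s ^ 2 * g (a + s) * (u (s, a)).1 := by
      have := hu.continuous; have := hg.continuous; fun_prop
    have h1 := intervalIntegral.integral_hasDerivAt_right (hc.intervalIntegrable 0 t)
      (hc.stronglyMeasurableAtFilter _ _) hc.continuousAt
    exact h1.congr_of_eventuallyEq (Eventually.of_forall fun t => hG t a)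

end Frobenius

/-! ### A kernel that evaluates polynomials at i. -/

section MomentKernel

open FourierTransform in
/-- There is a rapidly decreasing kernel which integrates polynomials to their value at `i`. -/
theorem exists_moment_kernel : ∃ k : ℝ → ℂ, Continuous k ∧
    (∀ j : ℕ, Integrable fun s : ℝ => |s| ^ j * ‖k s‖) ∧
    ∀ j : ℕ, ∫ s : ℝ, (s : ℂ) ^ j * k s = Complex.I ^ j := by
  let b : ContDiffBump (0 : ℝ) := ⟨1, 2, one_pos, by norm_num⟩
  -- The moments of a function are the derivatives of its Fourier transform at 0 divided by (-2πi)ʲ.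
  -- A transform equal to exp(2πξ) near 0 has derivatives (2π)ʲ, and the quotient is iʲ. The cut-off
  -- makes it a Schwartz function.
  set φ : ℝ → ℂ := fun ξ => (b ξ : ℂ) * Complex.exp (2 * Real.pi * ξ) with hφ
  have hφs : ContDiff ℝ ∞ φ := by
    refine ContDiff.mul (Complex.ofRealCLM.contDiff.comp b.contDiff) (ContDiff.cexp ?_)
    exact contDiff_const.mul Complex.ofRealCLM.contDiff
  have hφc : HasCompactSupport φ := by
    refine HasCompactSupport.mul_right ?_
    exact b.hasCompactSupport.comp_left (g := ((↑) : ℝ → ℂ)) Complex.ofReal_zero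
  set f := 𝓕⁻ (hφc.toSchwartzMap hφs) with hf
  have hFf : 𝓕 (f : ℝ → ℂ) = φ := by
    rw [← SchwartzMap.fourier_coe, hf, FourierTransform.fourier_fourierInv_eq]
    rfl
  have hint : ∀ j : ℕ, Integrable fun s : ℝ => |s| ^ j * ‖f s‖ := fun j =>
    f.integrable_pow_mul volume j
  refine ⟨f, f.continuous, hint, fun j => ?_⟩
  have h1 := Real.iteratedDeriv_fourier (f := (f : ℝ → ℂ)) (N := ⊤) (n := j) (fun n _ => by
    refine (hint n).mono' ?_ (Eventually.of_forall fun s => ?_)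
    · exact ((continuous_id.pow n).smul f.continuous).aestronglyMeasurable
    · simp) le_top
  rw [hFf] at h1
  have h2 : ∀ n : ℕ, iteratedDeriv n (fun ξ : ℝ => Complex.exp (2 * Real.pi * ξ)) =
      fun ξ : ℝ => (2 * Real.pi : ℂ) ^ n * Complex.exp (2 * Real.pi * ξ) := by
    intro n
    induction n with
    | zero => simp
    | succ n ih =>
      rw [iteratedDeriv_succ, ih]
      funext ξ
      have h3 : HasDerivAt (fun ξ : ℝ => (2 * Real.pi : ℂ) * ξ) (2 * Real.pi * 1) ξ :=
        (Complex.ofRealCLM.hasDerivAt).const_mul _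
      rw [(h3.cexp.const_mul _).deriv]
      ring
  have h3 : iteratedDeriv j φ 0 = (2 * Real.pi : ℂ) ^ j := by
    have h4 : φ =ᶠ[𝓝 0] fun ξ : ℝ => Complex.exp (2 * Real.pi * ξ) := by
      filter_upwards [b.eventuallyEq_one] with ξ hξ
      simp only [hφ, hξ]
      simp
    rw [h4.iteratedDeriv_eq, h2]
    simp
  have h4 := congrFun h1 0
  rw [h3, Real.fourier_real_eq] at h4
  simp only [mul_zero, neg_zero, AddChar.map_zero_eq_one, one_smul, smul_eq_mul, mul_pow] at h4
  have h5 : (fun s : ℝ => (-2 : ℂ) ^ j * (Real.pi : ℂ) ^ j * Complex.I ^ j * (s : ℂ) ^ j * f s) =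
      fun s : ℝ => ((-2 : ℂ) ^ j * (Real.pi : ℂ) ^ j * Complex.I ^ j) * ((s : ℂ) ^ j * f s) := by
    funext s; ring
  rw [h5, integral_const_mul] at h4
  have hpi : (Real.pi : ℂ) ≠ 0 := by exact_mod_cast Real.pi_ne_zero
  have h6 : ((-2 : ℂ) ^ j * (Real.pi : ℂ) ^ j * Complex.I ^ j) * Complex.I ^ j = 2 ^ j * (Real.pi : ℂ) ^ j := by
    rw [← mul_pow, ← mul_pow, ← mul_pow, ← mul_pow]
    congr 1
    linear_combination (-2 * (Real.pi : ℂ)) * Complex.I_mul_I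
  have h7 : ((-2 : ℂ) ^ j * (Real.pi : ℂ) ^ j * Complex.I ^ j) ≠ 0 := by
    exact mul_ne_zero (mul_ne_zero (pow_ne_zero _ (by norm_num)) (pow_ne_zero _ hpi))
      (pow_ne_zero _ Complex.I_ne_zero)
  exact mul_left_cancel₀ h7 (h4.symm.trans h6.symm)

end MomentKernel

/-! ### Almost analytic extension by averaging in the real parameter. -/

section Smear

/-- Continuous functions all of whose moments exist. -/
structure RapidDecay (κ : ℝ → ℝ) : Prop where
  continuous : Continuous κ
  integrable : ∀ j : ℕ, Integrable fun s : ℝ => |s| ^ j * |κ s|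

theorem RapidDecay.mul_id {κ : ℝ → ℝ} (h : RapidDecay κ) : RapidDecay fun s => s * κ s :=
  ⟨continuous_id.mul h.continuous, fun j => (h.integrable (j + 1)).congr
    (Eventually.of_forall fun s => by simp only [abs_mul]; ring)⟩

theorem RapidDecay.add {κ κ' : ℝ → ℝ} (h : RapidDecay κ) (h' : RapidDecay κ') :
    RapidDecay fun s => κ s + κ' s := by
  refine ⟨h.continuous.add h'.continuous, fun j => ((h.integrable j).add (h'.integrable j)).mono' ?_
    (Eventually.of_forall fun s => ?_)⟩
  · exact ((continuous_abs.pow j).mul (h.continuous.add h'.continuous).abs).aestronglyMeasurable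
  · rw [Real.norm_eq_abs, abs_mul, abs_pow, abs_abs, abs_abs]
    simp only [Pi.add_apply]
    rw [← mul_add]
    gcongr
    exact abs_add_le _ _

theorem RapidDecay.const_mul {κ : ℝ → ℝ} (h : RapidDecay κ) (a : ℝ) : RapidDecay fun s => a * κ s :=
  ⟨continuous_const.mul h.continuous, fun j => ((h.integrable j).const_mul |a|).congr
    (Eventually.of_forall fun s => by simp only [abs_mul]; ring)⟩

theorem RapidDecay.integrable_moment {κ : ℝ → ℝ} (h : RapidDecay κ) (j : ℕ) :
    Integrable fun s : ℝ => s ^ j * κ s :=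
  (h.integrable j).mono' ((continuous_id.pow j).mul h.continuous).aestronglyMeasurable
    (Eventually.of_forall fun s => by simp)

/-- The point `(y, a + b s)` for `c = a + i b`, as a linear function of `(y, c)`. -/
noncomputable def shear (s : ℝ) : (ℝ × ℂ) →L[ℝ] (ℝ × ℝ) :=
  (ContinuousLinearMap.fst ℝ ℝ ℂ).prod
    ((Complex.reCLM + s • Complex.imCLM).comp (ContinuousLinearMap.snd ℝ ℝ ℂ))

@[simp] theorem shear_apply (s : ℝ) (q : ℝ × ℂ) : shear s q = (q.1, q.2.re + s * q.2.im) := by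
  simp [shear]

/-- The derivative of `shear` with respect to its parameter. -/
noncomputable def shearDir : (ℝ × ℂ) →L[ℝ] (ℝ × ℝ) :=
  (ContinuousLinearMap.inr ℝ ℝ ℝ).comp (Complex.imCLM.comp (ContinuousLinearMap.snd ℝ ℝ ℂ))

theorem shear_eq (s : ℝ) : shear s = shear 0 + s • shearDir := by
  refine ContinuousLinearMap.ext fun q => ?_
  simp [shearDir]

variable {E : Type} [NormedAddCommGroup E] [NormedSpace ℝ E] [CompleteSpace E]

/-- The integral `∫ κ(s) N(y, a + b s) ds` as a function of `y` and `c = a + i b`. -/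
noncomputable def smear (κ : ℝ → ℝ) (N : ℝ × ℝ → E) (q : ℝ × ℂ) : E := ∫ s, κ s • N (shear s q)

theorem continuous_shear : Continuous shear := by
  have : shear = fun s => shear 0 + s • shearDir := funext shear_eq
  rw [this]
  fun_prop

theorem RapidDecay.integrable_smear {κ : ℝ → ℝ} (hκ : RapidDecay κ) {N : ℝ × ℝ → E}
    (hN : Continuous N) (hNc : HasCompactSupport N) (q : ℝ × ℂ) :
    Integrable fun s => κ s • N (shear s q) := by
  obtain ⟨C, hC⟩ := hN.bounded_above_of_compact_support hNc
  refine ((hκ.integrable 0).mul_const C).mono' ?_ (Eventually.of_forall fun s => ?_)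
  · refine (hκ.continuous.smul (hN.comp ?_)).aestronglyMeasurable
    exact continuous_shear.clm_apply continuous_const
  · rw [norm_smul, pow_zero, one_mul]
    exact mul_le_mul_of_nonneg_left (hC _) (abs_nonneg _)

/-- The averaging point depends affinely on `s`, so differentiation only replaces κ(s) by κ(s) and s
κ(s). Rapidly decaying kernels are stable under this. -/
theorem hasFDerivAt_smear {κ : ℝ → ℝ} (hκ : RapidDecay κ) {N : ℝ × ℝ → E}
    (hN : ContDiff ℝ 1 N) (hNc : HasCompactSupport N) (q : ℝ × ℂ) :
    HasFDerivAt (smear κ N) ((smear κ (fderiv ℝ N) q).comp (shear 0) +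
      (smear (fun s => s * κ s) (fderiv ℝ N) q).comp shearDir) q := by
  have hd : Continuous (fderiv ℝ N) := hN.continuous_fderiv (by norm_num)
  have hdc : HasCompactSupport (fderiv ℝ N) := hNc.fderiv ℝ
  obtain ⟨C, hC⟩ := hd.bounded_above_of_compact_support hdc
  have key := hasFDerivAt_integral_of_dominated_of_fderiv_le (𝕜 := ℝ) (μ := volume)
    (F := fun q s => κ s • N (shear s q)) (F' := fun q s => κ s • (fderiv ℝ N (shear s q)).comp (shear s))
    (bound := fun s => |κ s| * (C * (‖shear 0‖ + |s| * ‖shearDir‖))) (x₀ := q) (s := univ) univ_mem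
    (Eventually.of_forall fun q => (hκ.integrable_smear hN.continuous hNc q).aestronglyMeasurable)
    (hκ.integrable_smear hN.continuous hNc q) ?_ ?_ ?_ ?_
  · convert! key using 1
    have h1 : ∀ s, κ s • (fderiv ℝ N (shear s q)).comp (shear s) =
        (ContinuousLinearMap.compL ℝ (ℝ × ℂ) (ℝ × ℝ) E).flip (shear 0) (κ s • fderiv ℝ N (shear s q)) +
        (ContinuousLinearMap.compL ℝ (ℝ × ℂ) (ℝ × ℝ) E).flip shearDir ((s * κ s) • fderiv ℝ N (shear s q)) := by
      intro s
      refine ContinuousLinearMap.ext fun p => ?_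
      rw [shear_eq s]
      simp only [ContinuousLinearMap.flip_apply, ContinuousLinearMap.compL_apply, _root_.add_apply,
        FunLike.coe_smul, Pi.smul_apply, ContinuousLinearMap.comp_apply, map_add, map_smul, smul_add,
        smul_smul, mul_comm s]
    have i1 := hκ.integrable_smear hd hdc q
    have i2 := hκ.mul_id.integrable_smear hd hdc q
    simp only [h1]
    rw [integral_add (ContinuousLinearMap.integrable_comp _ i1) (ContinuousLinearMap.integrable_comp _ i2),
      ContinuousLinearMap.integral_comp_comm _ i1, ContinuousLinearMap.integral_comp_comm _ i2]
    rfl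
  · refine (hκ.continuous.smul ((hd.comp ?_).clm_comp continuous_shear)).aestronglyMeasurable
    exact continuous_shear.clm_apply continuous_const
  · refine Eventually.of_forall fun s x _ => ?_
    rw [norm_smul, Real.norm_eq_abs]
    refine mul_le_mul_of_nonneg_left ((ContinuousLinearMap.opNorm_comp_le _ _).trans ?_) (abs_nonneg _)
    refine mul_le_mul (hC _) ?_ (norm_nonneg _) ((norm_nonneg _).trans (hC 0))
    rw [shear_eq s]
    refine (norm_add_le _ _).trans ?_
    rw [norm_smul, Real.norm_eq_abs]
  · have : (fun s => |κ s| * (C * (‖shear 0‖ + |s| * ‖shearDir‖))) =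
        fun s => (C * ‖shear 0‖) * (|s| ^ 0 * |κ s|) + (C * ‖shearDir‖) * (|s| ^ 1 * |κ s|) := by
      funext s; ring
    rw [this]
    exact ((hκ.integrable 0).const_mul _).add ((hκ.integrable 1).const_mul _)
  · refine Eventually.of_forall fun s x _ => ?_
    exact (((hN.differentiable (by norm_num)).differentiableAt.hasFDerivAt).comp x
      (shear s).hasFDerivAt).const_smul (κ s)

theorem contDiff_smear (n : ℕ) : ∀ {E : Type} [NormedAddCommGroup E] [NormedSpace ℝ E] [CompleteSpace E]
    {κ : ℝ → ℝ} (_ : RapidDecay κ) {N : ℝ × ℝ → E} (_ : ContDiff ℝ ∞ N) (_ : HasCompactSupport N),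
    ContDiff ℝ n (smear κ N) := by
  induction n with
  | zero =>
    intro E _ _ _ κ hκ N hN hNc
    refine contDiff_zero.2 (continuous_iff_continuousAt.2 fun q =>
      (hasFDerivAt_smear hκ (hN.of_le (by norm_cast)) hNc q).continuousAt)
  | succ n ih =>
    intro E _ _ _ κ hκ N hN hNc
    have h1 : ∀ q, HasFDerivAt (smear κ N) _ q := hasFDerivAt_smear hκ (hN.of_le (by norm_cast)) hNc
    have hd : ContDiff ℝ ∞ (fderiv ℝ N) := hN.fderiv_right (m := ∞) (by norm_cast)
    have hdc : HasCompactSupport (fderiv ℝ N) := hNc.fderiv ℝ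
    push_cast
    refine contDiff_succ_iff_hasFDerivAt.2 ⟨_, ?_, h1⟩
    exact ((ih hκ hd hdc).clm_comp contDiff_const).add ((ih hκ.mul_id hd hdc).clm_comp contDiff_const)

/-- Kernels all of whose moments vanish. -/
structure NullKernel (κ : ℝ → ℝ) : Prop extends RapidDecay κ where
  moment : ∀ j : ℕ, ∫ s : ℝ, s ^ j * κ s = 0

theorem NullKernel.mul_id {κ : ℝ → ℝ} (h : NullKernel κ) : NullKernel fun s => s * κ s :=
  ⟨h.toRapidDecay.mul_id, fun j => by rw [← h.moment (j + 1)]; congr 1; funext s; ring⟩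

/-- At Im c = 0 the average is a multiple of the zeroth moment and vanishes. Its derivative in Im c
is an average with the kernel s κ(s), again null, so integrating from the real axis gains one power
of |Im c| at each step. -/
theorem norm_smear_le_of_nullKernel (J : ℕ) : ∀ {E : Type} [NormedAddCommGroup E] [NormedSpace ℝ E] [CompleteSpace E]
    {κ : ℝ → ℝ} (_ : NullKernel κ) {N : ℝ × ℝ → E} (_ : ContDiff ℝ ∞ N) (_ : HasCompactSupport N),
    ∃ C, ∀ q : ℝ × ℂ, ‖smear κ N q‖ ≤ C * |q.2.im| ^ J := by
  induction J with
  | zero =>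
    intro E _ _ _ κ hκ N hN hNc
    obtain ⟨C, hC⟩ := hN.continuous.bounded_above_of_compact_support hNc
    refine ⟨∫ s, |κ s| * C, fun q => ?_⟩
    rw [pow_zero, mul_one]
    refine norm_integral_le_of_norm_le (by simpa using (hκ.integrable 0).mul_const C)
      (Eventually.of_forall fun s => ?_)
    rw [norm_smul, Real.norm_eq_abs]
    exact mul_le_mul_of_nonneg_left (hC _) (abs_nonneg _)
  | succ J ih =>
    intro E _ _ _ κ hκ N hN hNc
    have hd : ContDiff ℝ ∞ (fderiv ℝ N) := hN.fderiv_right (m := ∞) (by norm_cast)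
    have hdc : HasCompactSupport (fderiv ℝ N) := hNc.fderiv ℝ
    obtain ⟨C, hC⟩ := ih hκ.mul_id hd hdc
    refine ⟨C * ‖shearDir‖, fun q => ?_⟩
    have hpath : ∀ t : ℝ, HasFDerivAt (fun t : ℝ => ((q.1, (q.2.re : ℂ) + t * Complex.I) : ℝ × ℂ)) _ t :=
      fun t => ((hasDerivAt_const t q.1).prodMk
        (((Complex.ofRealCLM.hasDerivAt (x := t)).mul_const Complex.I).const_add (q.2.re : ℂ))).hasFDerivAt
    have hder : ∀ t : ℝ, HasDerivAt (fun t : ℝ => smear κ N (q.1, (q.2.re : ℂ) + t * Complex.I))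
        (smear (fun s => s * κ s) (fderiv ℝ N) (q.1, (q.2.re : ℂ) + t * Complex.I)
          (shearDir (0, Complex.I))) t := by
      intro t
      have h1 := ((hasFDerivAt_smear hκ.toRapidDecay (hN.of_le (by norm_cast)) hNc
        (q.1, (q.2.re : ℂ) + t * Complex.I)).comp t (hpath t)).hasDerivAt
      convert! h1 using 1
      simp [shearDir, Prod.mk_zero_zero]
    have h0 : smear κ N (q.1, (q.2.re : ℂ) + (0 : ℝ) * Complex.I) = 0 := by
      have : ∀ s, κ s • N (shear s (q.1, (q.2.re : ℂ) + (0 : ℝ) * Complex.I)) = κ s • N (q.1, q.2.re) := by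
        intro s; simp
      simp only [smear, this]
      rw [integral_smul_const]
      have := hκ.moment 0
      simp only [pow_zero, one_mul] at this
      rw [this, zero_smul]
    have h1 := Convex.norm_image_sub_le_of_norm_hasDerivWithin_le (s := uIcc 0 q.2.im)
      (C := C * |q.2.im| ^ J * ‖shearDir‖)
      (fun t _ => (hder t).hasDerivWithinAt) (fun t ht => ?_) (convex_uIcc _ _) left_mem_uIcc right_mem_uIcc
    · rw [h0, sub_zero, Complex.re_add_im, sub_zero] at h1
      refine h1.trans (le_of_eq ?_)
      rw [Real.norm_eq_abs]; ring
    · refine (ContinuousLinearMap.le_opNorm _ _).trans (mul_le_mul ?_ ?_ (norm_nonneg _) ?_)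
      · refine (hC _).trans ?_
        have hC0 : 0 ≤ C := by simpa using (norm_nonneg _).trans (hC (0, Complex.I))
        have : |((q.2.re : ℂ) + t * Complex.I).im| ≤ |q.2.im| := by
          simp only [Complex.add_im, Complex.ofReal_im, Complex.mul_im, Complex.ofReal_re, Complex.I_im,
            Complex.I_re, mul_one, mul_zero, add_zero, zero_add]
          have := abs_sub_left_of_mem_uIcc ht
          simpa using this
        dsimp only
        gcongr
      · refine (ContinuousLinearMap.le_opNorm _ _).trans (le_of_eq ?_)
        simp
      · have hC0 : 0 ≤ C := by simpa using (norm_nonneg _).trans (hC (0, Complex.I))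
        positivity

theorem flatOn_smear {S : Set (ℝ × ℂ)} (hS : IsOpen S) (k : ℕ) : ∀ {E : Type} [NormedAddCommGroup E]
    [NormedSpace ℝ E] [CompleteSpace E] {κ : ℝ → ℝ} (_ : NullKernel κ) {N : ℝ × ℝ → E} (_ : ContDiff ℝ ∞ N)
    (_ : HasCompactSupport N), FlatOn S k (smear κ N) := by
  have h0 : ∀ {E : Type} [NormedAddCommGroup E]
    [NormedSpace ℝ E] [CompleteSpace E] {κ : ℝ → ℝ} (_ : NullKernel κ) {N : ℝ × ℝ → E} (_ : ContDiff ℝ ∞ N)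
    (_ : HasCompactSupport N), FlatOn S 0 (smear κ N) := by
    intro E _ _ _ κ hκ N hN hNc
    refine flatOn_zero_iff.2 ⟨(contDiff_infty.2 fun n =>
      contDiff_smear n hκ.toRapidDecay hN hNc).contDiffOn, fun J => ?_⟩
    exact (norm_smear_le_of_nullKernel J hκ hN hNc).imp fun C hC p _ => hC p
  induction k with
  | zero => exact h0
  | succ k ih =>
    intro E _ _ _ κ hκ N hN hNc
    have hd : ContDiff ℝ ∞ (fderiv ℝ N) := hN.fderiv_right (m := ∞) (by norm_cast)
    have hdc : HasCompactSupport (fderiv ℝ N) := hNc.fderiv ℝ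
    refine (flatOn_succ_iff hS).2 ⟨h0 hκ hN hNc, ?_⟩
    refine FlatOn.congr hS (((ih hκ hd hdc).clm_comp hS
      ((ContinuousLinearMap.compL ℝ (ℝ × ℂ) (ℝ × ℝ) E).flip (shear 0))).add hS
      ((ih hκ.mul_id hd hdc).clm_comp hS
      ((ContinuousLinearMap.compL ℝ (ℝ × ℂ) (ℝ × ℝ) E).flip shearDir))) fun p _ => ?_
    rw [(hasFDerivAt_smear hκ.toRapidDecay (hN.of_le (by norm_cast)) hNc p).fderiv]
    rfl

/-- Differentiation in `y`. -/
theorem hasDerivAt_smear {κ : ℝ → ℝ} (hκ : RapidDecay κ) {N N' : ℝ × ℝ → E}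
    (hN : ContDiff ℝ 1 N) (hNc : HasCompactSupport N)
    (hN' : ∀ p : ℝ × ℝ, HasDerivAt (fun y => N (y, p.2)) (N' p) p.1) (q : ℝ × ℂ) :
    HasDerivAt (fun y => smear κ N (y, q.2)) (smear κ N' q) q.1 := by
  have hd : Continuous (fderiv ℝ N) := hN.continuous_fderiv (by norm_num)
  have hdc : HasCompactSupport (fderiv ℝ N) := hNc.fderiv ℝ
  have h1 := ((hasFDerivAt_smear hκ hN hNc (q.1, q.2)).comp q.1
    (((hasDerivAt_id q.1).prodMk (hasDerivAt_const q.1 q.2)).hasFDerivAt)).hasDerivAt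
  convert! h1 using 1
  have h2 : ∀ p, N' p = fderiv ℝ N p (1, 0) := by
    intro p
    have h3 := (((hN.differentiable (by norm_num)).differentiableAt (x := (p.1, p.2))).hasFDerivAt.comp p.1
      (((hasDerivAt_id p.1).prodMk (hasDerivAt_const p.1 p.2)).hasFDerivAt)).hasDerivAt
    have h4 := (hN' p).unique h3
    simpa using h4
  have h5 := ContinuousLinearMap.integral_comp_comm
    ((ContinuousLinearMap.apply ℝ E) ((1 : ℝ), (0 : ℝ))) (hκ.integrable_smear hd hdc q)
  simp only [smear, h2]
  simpa [shearDir, smear, Prod.mk_zero_zero] using h5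

end Smear

/-! ### Approximate regular solutions for complex parameters. -/

section ApproximateSolution

/-- The derivative of a local inverse, extended to a bounded smooth function. -/
theorem exists_inverse_deriv {U : ℝ → ℝ} (hU : ContDiff ℝ ∞ U) {y₀ : ℝ} (hd : deriv U y₀ ≠ 0) :
    ∃ g : ℝ → ℝ, ContDiff ℝ ∞ g ∧ (∃ M, ∀ x, |g x| ≤ M) ∧
      ∃ r > 0, ∀ y ∈ Ioo (y₀ - r) (y₀ + r), g (U y) * deriv U y = 1 := by
  have hU' : ContDiff ℝ ∞ (deriv U) := (contDiff_infty_iff_deriv.1 hU).2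
  have hder : ∀ y, HasDerivAt U (deriv U y) y := fun y =>
    ((hU.differentiable (by norm_num)).differentiableAt).hasDerivAt
  have hs : HasStrictDerivAt U (deriv U y₀) y₀ :=
    hU.contDiffAt.hasStrictDerivAt' (hder y₀) (by norm_num)
  have hs' := hs.hasStrictFDerivAt_equiv hd
  set e := hs'.toOpenPartialHomeomorph U with he
  have hey : ∀ y, e y = U y := fun y => rfl
  have hsrc : y₀ ∈ e.source := hs'.mem_toOpenPartialHomeomorph_source
  have hopen : IsOpen {y | deriv U y ≠ 0} := isOpen_ne_fun hU'.continuous continuous_const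
  have hT := e.isOpen_inter_preimage_symm hopen
  have hmem : U y₀ ∈ e.target ∩ e.symm ⁻¹' {y | deriv U y ≠ 0} := by
    refine ⟨e.map_source hsrc, ?_⟩
    change deriv U (e.symm (e y₀)) ≠ 0
    rw [e.left_inv hsrc]
    exact hd
  obtain ⟨ρ, hρ, hball⟩ := Metric.isOpen_iff.1 hT _ hmem
  let b : ContDiffBump (U y₀) := ⟨ρ / 3, ρ / 2, by linarith, by linarith⟩
  set g : ℝ → ℝ := fun x => b x * (deriv U (e.symm x))⁻¹ with hg
  have hb : tsupport b ⊆ e.target ∩ e.symm ⁻¹' {y | deriv U y ≠ 0} := by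
    rw [b.tsupport_eq]
    exact (Metric.closedBall_subset_ball (by change ρ / 2 < ρ; linarith)).trans hball
  have hgs : ContDiff ℝ ∞ g := by
    rw [contDiff_iff_contDiffAt]
    intro x
    by_cases hx : x ∈ tsupport b
    · obtain ⟨h1, h2⟩ := hb hx
      have h3 : ContDiffAt ℝ ∞ e.symm x :=
        e.contDiffAt_symm_deriv h2 h1 (hder _) hU.contDiffAt
      exact b.contDiff.contDiffAt.mul ((hU'.contDiffAt.comp x h3).inv h2)
    · have : g =ᶠ[𝓝 x] fun _ => 0 := by
        filter_upwards [(isClosed_tsupport b).isOpen_compl.mem_nhds hx] with z hz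
        simp [hg, image_eq_zero_of_notMem_tsupport (f := b) hz]
      exact contDiffAt_const.congr_of_eventuallyEq this
  have hgc : HasCompactSupport g := b.hasCompactSupport.mul_right
  obtain ⟨M, hM⟩ := hgs.continuous.bounded_above_of_compact_support hgc
  refine ⟨g, hgs, ⟨M, hM⟩, ?_⟩
  have h1 : ∀ᶠ y in 𝓝 y₀, y ∈ e.source ∧ U y ∈ Metric.ball (U y₀) (ρ / 3) ∧ deriv U y ≠ 0 :=
    inter_mem (e.open_source.mem_nhds hsrc) (inter_mem (hU.continuous.continuousAt.preimage_mem_nhds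
      (Metric.ball_mem_nhds _ (by positivity))) (hopen.mem_nhds hd))
  obtain ⟨r, hr, hrb⟩ := Metric.eventually_nhds_iff_ball.1 h1
  refine ⟨r, hr, fun y hy => ?_⟩
  rw [← Real.ball_eq_Ioo] at hy
  obtain ⟨h2, h3, h4⟩ := hrb y hy
  have h5 : b (U y) = 1 := b.one_of_mem_closedBall (Metric.ball_subset_closedBall h3)
  have h6 : e.symm (U y) = y := e.left_inv h2
  simp only [hg, h5, h6, one_mul]
  exact inv_mul_cancel₀ h4

theorem exists_bound_iteratedFDeriv {E : Type} [NormedAddCommGroup E] [NormedSpace ℝ E]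
    {f : ℝ × ℂ → E} (hf : ContDiff ℝ ∞ f) {S : Set (ℝ × ℂ)} (hS : Bornology.IsBounded S) (j : ℕ) :
    ∃ C, ∀ p ∈ S, ‖iteratedFDeriv ℝ j f p‖ ≤ C := by
  obtain ⟨C, hC⟩ := hS.isCompact_closure.exists_bound_of_continuousOn
    (hf.continuous_iteratedFDeriv (m := j) (by exact_mod_cast le_top)).continuousOn
  exact ⟨C, fun p hp => hC p (subset_closure hp)⟩

theorem moderateOn_of_contDiff {E : Type} [NormedAddCommGroup E] [NormedSpace ℝ E]
    {f : ℝ × ℂ → E} (hf : ContDiff ℝ ∞ f) {S : Set (ℝ × ℂ)} (hS : Bornology.IsBounded S) (k : ℕ) :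
    ModerateOn S k f :=
  moderateOn_of_bounded hf.contDiffOn (exists_bound_iteratedFDeriv hf hS)

/-- Here κ₁ + iκ₂ = k is the moment kernel. The two null kernels are the real and imaginary parts of
(s - i) k, whose j-th moment is iʲ⁺¹ - i · iʲ = 0. -/
theorem exists_real_moment_kernels : ∃ κ₁ κ₂ : ℝ → ℝ, RapidDecay κ₁ ∧ RapidDecay κ₂ ∧
    ∫ s, κ₁ s = 1 ∧ ∫ s, κ₂ s = 0 ∧ NullKernel (fun s => s * κ₁ s + κ₂ s) ∧
    NullKernel (fun s => s * κ₂ s + (-1) * κ₁ s) := by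
  obtain ⟨k, hk, hint, hmom⟩ := exists_moment_kernel
  have h1 : RapidDecay fun s => (k s).re := by
    refine ⟨Complex.continuous_re.comp hk, fun j => (hint j).mono' ?_ (Eventually.of_forall fun s => ?_)⟩
    · exact ((continuous_abs.pow j).mul (Complex.continuous_re.comp hk).abs).aestronglyMeasurable
    · rw [Real.norm_eq_abs, abs_mul, abs_pow, abs_abs, abs_abs]
      exact mul_le_mul_of_nonneg_left (Complex.abs_re_le_norm _) (by positivity)
  have h2 : RapidDecay fun s => (k s).im := by
    refine ⟨Complex.continuous_im.comp hk, fun j => (hint j).mono' ?_ (Eventually.of_forall fun s => ?_)⟩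
    · exact ((continuous_abs.pow j).mul (Complex.continuous_im.comp hk).abs).aestronglyMeasurable
    · rw [Real.norm_eq_abs, abs_mul, abs_pow, abs_abs, abs_abs]
      exact mul_le_mul_of_nonneg_left (Complex.abs_im_le_norm _) (by positivity)
  have hi : ∀ j : ℕ, Integrable fun s : ℝ => (s : ℂ) ^ j * k s := fun j =>
    (hint j).mono' (((Complex.continuous_ofReal.pow j).mul hk).aestronglyMeasurable)
      (Eventually.of_forall fun s => by simp)
  have m1 : ∀ j : ℕ, ∫ s : ℝ, s ^ j * (k s).re = (Complex.I ^ j).re := by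
    intro j
    rw [← hmom j]
    have := integral_re (hi j)
    simp only [RCLike.re_to_complex] at this
    rw [← this]
    congr 1; funext s
    rw [← Complex.ofReal_pow, Complex.re_ofReal_mul]
  have m2 : ∀ j : ℕ, ∫ s : ℝ, s ^ j * (k s).im = (Complex.I ^ j).im := by
    intro j
    rw [← hmom j]
    have := integral_im (hi j)
    simp only [RCLike.im_to_complex] at this
    rw [← this]
    congr 1; funext s
    rw [← Complex.ofReal_pow, Complex.im_ofReal_mul]
  refine ⟨_, _, h1, h2, by simpa using m1 0, by simpa using m2 0,
    ⟨h1.mul_id.add h2, fun j => ?_⟩, ⟨h2.mul_id.add (h1.const_mul (-1)), fun j => ?_⟩⟩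
  · have e : ∀ s : ℝ, s ^ j * (s * (k s).re + (k s).im) = s ^ (j + 1) * (k s).re + s ^ j * (k s).im :=
      fun s => by ring
    simp only [e]
    rw [integral_add (h1.integrable_moment _) (h2.integrable_moment _), m1, m2, pow_succ]
    simp
  · have e : ∀ s : ℝ, s ^ j * (s * (k s).im + (-1) * (k s).re) = s ^ (j + 1) * (k s).im - s ^ j * (k s).re :=
      fun s => by ring
    simp only [e]
    rw [integral_sub (h2.integrable_moment _) (h1.integrable_moment _), m1, m2, pow_succ]
    simp

theorem smear_mul {κ : ℝ → ℝ} (hκ : RapidDecay κ) {N : ℝ × ℝ → ℝ} (hN : Continuous N)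
    (hNc : HasCompactSupport N) {f : ℝ × ℝ → ℝ} {u : ℝ} {p : ℝ × ℂ}
    (hf : ∀ a, f (p.1, a) = (u - a) * N (p.1, a)) :
    smear κ f p = (u - p.2.re) * smear κ N p - p.2.im * smear (fun s => s * κ s) N p := by
  have i1 := hκ.integrable_smear hN hNc p
  have i2 := hκ.mul_id.integrable_smear hN hNc p
  simp only [smear]
  rw [← integral_const_mul, ← integral_const_mul, ← integral_sub (i1.const_mul _) (i2.const_mul _)]
  congr 1; funext s
  simp only [shear_apply, hf, smul_eq_mul]
  ring

/-- An approximate solution of the Rayleigh equation near a noncritical point of the profile. -/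
theorem exists_approximate_solution {U : ℝ → ℝ} (hU : ContDiff ℝ ∞ U) {y₀ : ℝ}
    (hd : deriv U y₀ ≠ 0) (β : ℝ) :
    ∃ r > 0, ∃ X F F₁ σ : ℝ × ℂ → ℂ, ContDiff ℝ ∞ X ∧ X (y₀, U y₀) = 1 ∧ ContDiff ℝ ∞ F ∧
      ContDiff ℝ ∞ F₁ ∧ ∀ S : Set (ℝ × ℂ), IsOpen S →
      S ⊆ Ioo (y₀ - r) (y₀ + r) ×ˢ Metric.ball (U y₀ : ℂ) 1 → (∀ p ∈ S, p.2.im ≠ 0) →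
      (∀ k, FlatOn S k fun p => F p - ((U p.1 : ℂ) - p.2) * X p) ∧ (∀ k, FlatOn S k σ) ∧
      ∀ p ∈ S, HasDerivAt (fun y => F (y, p.2)) (F₁ p) p.1 ∧
        HasDerivAt (fun y => F₁ (y, p.2))
          ((β + ((deriv (deriv U) p.1 : ℝ) : ℂ) / ((U p.1 : ℂ) - p.2)) * F p + σ p) p.1 := by
  obtain ⟨g, hg, ⟨M, hM⟩, r, hr, hgU⟩ := exists_inverse_deriv hU hd
  obtain ⟨X, G, hX, hG, hXG⟩ := exists_regular_solution hg hM β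
  obtain ⟨κ₁, κ₂, hκ₁, hκ₂, hi₁, hi₂, hn₁, hn₂⟩ := exists_real_moment_kernels
  have hU' : ContDiff ℝ ∞ (deriv U) := (contDiff_infty_iff_deriv.1 hU).2
  have hU'' : ContDiff ℝ ∞ (deriv (deriv U)) := (contDiff_infty_iff_deriv.1 hU').2
  have hdU : ∀ y, HasDerivAt U (deriv U y) y := fun y =>
    ((hU.differentiable (by norm_num)).differentiableAt).hasDerivAt
  have hdU' : ∀ y, HasDerivAt (deriv U) (deriv (deriv U) y) y := fun y =>
    ((hU'.differentiable (by norm_num)).differentiableAt).hasDerivAt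
  let b₁ : ContDiffBump y₀ := ⟨r, 2 * r, hr, by linarith⟩
  let b₂ : ContDiffBump (U y₀) := ⟨1, 2, one_pos, by norm_num⟩
  have hcut : HasCompactSupport fun p : ℝ × ℝ => b₁ p.1 * b₂ p.2 := by
    refine HasCompactSupport.intro ((isCompact_closedBall y₀ b₁.rOut).prod
      (isCompact_closedBall (U y₀) b₂.rOut)) fun p hp => ?_
    rw [mem_prod, not_and_or] at hp
    rcases hp with hp | hp
    · rw [b₁.zero_of_le_dist (by simpa using (not_le.1 hp).le), zero_mul]
    · rw [b₂.zero_of_le_dist (by simpa using (not_le.1 hp).le), mul_zero]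
  have hcuts : ContDiff ℝ ∞ fun p : ℝ × ℝ => b₁ p.1 * b₂ p.2 :=
    (b₁.contDiff.comp contDiff_fst).mul (b₂.contDiff.comp contDiff_snd)
  -- The regular factor χ for real parameters, cut off to compact support so that it can be
  -- averaged; `Ψ` is the corresponding solution (U - a) χ.
  set Ξ : ℝ × ℝ → ℝ := fun p => (b₁ p.1 * b₂ p.2) * X (U p.1 - p.2, p.2) with hΞ
  have hUf : ContDiff ℝ ∞ fun p : ℝ × ℝ => U p.1 := hU.comp contDiff_fst
  have hQs : ContDiff ℝ ∞ fun p : ℝ × ℝ => U p.1 - p.2 := hUf.sub contDiff_snd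
  have hΞs : ContDiff ℝ ∞ Ξ := hcuts.mul (hX.comp (hQs.prodMk contDiff_snd))
  have hΞc : HasCompactSupport Ξ := hcut.mul_right
  set Ψ : ℝ × ℝ → ℝ := fun p => Ξ p * (U p.1 - p.2) with hΨ
  have hΨs : ContDiff ℝ ∞ Ψ := hΞs.mul hQs
  have hΨc : HasCompactSupport Ψ := hΞc.mul_right
  have hdy : ∀ f : ℝ × ℝ → ℝ, ContDiff ℝ ∞ f → HasCompactSupport f → ∃ f' : ℝ × ℝ → ℝ,
      ContDiff ℝ ∞ f' ∧ HasCompactSupport f' ∧ ∀ p : ℝ × ℝ, HasDerivAt (fun y => f (y, p.2)) (f' p) p.1 := by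
    intro f hf hfc
    refine ⟨fun p => fderiv ℝ f p (1, 0), (hf.fderiv_right (m := ∞) (by norm_cast)).clm_apply contDiff_const,
      (hfc.fderiv ℝ).comp_left (g := fun A : ℝ × ℝ →L[ℝ] ℝ => A (1, 0)) rfl, fun p => ?_⟩
    have := (((hf.differentiable (by norm_num)).differentiableAt (x := (p.1, p.2))).hasFDerivAt.comp p.1
      (((hasDerivAt_id p.1).prodMk (hasDerivAt_const p.1 p.2)).hasFDerivAt)).hasDerivAt
    simpa [Function.comp_def] using this
  obtain ⟨Ψ₁, hΨ₁s, hΨ₁c, hΨ₁⟩ := hdy Ψ hΨs hΨc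
  obtain ⟨Ψ₂, hΨ₂s, hΨ₂c, hΨ₂⟩ := hdy Ψ₁ hΨ₁s hΨ₁c
  set N : ℝ × ℝ → ℝ := fun p => Ψ₂ p + (-β) * Ψ p with hN
  have hNs : ContDiff ℝ ∞ N := hΨ₂s.add (contDiff_const.mul hΨs)
  have hNc : HasCompactSupport N := hΨ₂c.add hΨc.mul_left
  -- The Rayleigh equation for real `a` in the division-free form U'' Ψ = (U - a) N with N = Ψ_yy -
  -- β Ψ. Both sides are smooth across the layer, so both can be averaged.
  have hRay : ∀ y ∈ Ioo (y₀ - r) (y₀ + r), ∀ a, deriv (deriv U) y * Ψ (y, a) = (U y - a) * N (y, a) := by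
    intro y hy a
    set G₁ : ℝ → ℝ := fun y => deriv (fun t => G (t, a)) (U y - a) * deriv U y with hG₁
    have hQ : ∀ y, HasDerivAt (fun y => U y - a) (deriv U y) y := fun y => (hdU y).sub_const a
    have hGa : ContDiff ℝ ∞ fun t => G (t, a) := hG.comp (contDiff_id.prodMk contDiff_const)
    have hGd : ∀ y, HasDerivAt (fun y => G (U y - a, a)) (G₁ y) y := fun y =>
      HasDerivAt.comp (h₂ := fun t => G (t, a)) y
        (((hGa.differentiable (by norm_num)).differentiableAt (x := U y - a)).hasDerivAt) (hQ y)
    have hXd : ∀ y ∈ Ioo (y₀ - r) (y₀ + r), HasDerivAt (fun y => X (U y - a, a))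
        (β * ((U y - a) * G (U y - a, a))) y := by
      intro y hy
      refine ((((hXG a).2 (U y - a)).1).comp y (hQ y)).congr_deriv ?_
      rw [add_sub_cancel]
      linear_combination (β * ((U y - a) * G (U y - a, a))) * hgU y hy
    have hQG : ∀ y ∈ Ioo (y₀ - r) (y₀ + r), 3 * (U y - a) ^ 2 * deriv U y * G (U y - a, a)
        + (U y - a) ^ 3 * G₁ y = (U y - a) ^ 2 * X (U y - a, a) := by
      intro y hy
      have h1 := (((hXG a).2 (U y - a)).2).comp y (hQ y)
      have h2 := ((hQ y).pow 3).mul (hGd y)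
      have h3 := h2.unique h1
      rw [add_sub_cancel] at h3
      simp only [Nat.cast_ofNat, Nat.add_one_sub_one, Pi.pow_apply] at h3
      linear_combination h3 + ((U y - a) ^ 2 * X (U y - a, a)) * hgU y hy
    have hb : ∀ y ∈ Ioo (y₀ - r) (y₀ + r), b₁ y = 1 := fun y hy => b₁.one_of_mem_closedBall (by
      rw [← Real.ball_eq_Ioo] at hy
      exact Metric.ball_subset_closedBall hy)
    have hev : ∀ y ∈ Ioo (y₀ - r) (y₀ + r), ∀ᶠ z in 𝓝 y, z ∈ Ioo (y₀ - r) (y₀ + r) := fun y hy =>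
      isOpen_Ioo.mem_nhds hy
    have e1 : ∀ y ∈ Ioo (y₀ - r) (y₀ + r), Ψ₁ (y, a) = b₂ a * (deriv U y * X (U y - a, a)
        + β * ((U y - a) ^ 2 * G (U y - a, a))) := by
      intro y hy
      have h1 : HasDerivAt (fun y => Ψ (y, a)) _ y :=
        (((hXd y hy).mul (hQ y)).const_mul (b₂ a)).congr_of_eventuallyEq (by
          filter_upwards [hev y hy] with z hz
          simp only [hΨ, hΞ, hb z hz, Pi.mul_apply]
          ring)
      rw [(hΨ₁ (y, a)).unique h1]
      ring
    have e2 : Ψ₂ (y, a) = b₂ a * (deriv (deriv U) y * X (U y - a, a) + deriv U y * (β * ((U y - a) * G (U y - a, a)))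
        + β * (2 * (U y - a) * deriv U y * G (U y - a, a) + (U y - a) ^ 2 * G₁ y)) := by
      have h1 : HasDerivAt (fun y => Ψ₁ (y, a)) _ y :=
        ((((hdU' y).mul (hXd y hy)).add ((((hQ y).pow 2).mul (hGd y)).const_mul β)).const_mul (b₂ a)).congr_of_eventuallyEq (by
          filter_upwards [hev y hy] with z hz
          simp only [e1 z hz, Pi.mul_apply, Pi.add_apply, Pi.pow_apply])
      rw [(hΨ₂ (y, a)).unique h1]
      simp only [Nat.cast_ofNat, Nat.add_one_sub_one, Pi.pow_apply, pow_one]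
    simp only [hN, e2]
    simp only [hΨ, hΞ, hb y hy]
    linear_combination (-b₂ a * β) * hQG y hy
  have smooth : ∀ {κ : ℝ → ℝ} (_ : RapidDecay κ) {f : ℝ × ℝ → ℝ} (_ : ContDiff ℝ ∞ f) (_ : HasCompactSupport f),
      ContDiff ℝ ∞ fun p => ((smear κ f p : ℝ) : ℂ) := fun hκ f hf hfc =>
    Complex.ofRealCLM.contDiff.comp (contDiff_infty.2 fun n => contDiff_smear n hκ hf hfc)
  set P : (ℝ × ℝ → ℝ) → ℝ × ℂ → ℂ := fun f p => ((smear κ₁ f p : ℝ) : ℂ) + Complex.I * ((smear κ₂ f p : ℝ) : ℂ) with hP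
  set Z : (ℝ × ℝ → ℝ) → ℝ × ℂ → ℂ := fun f p => (p.2.im : ℂ) *
    (((smear (fun s => s * κ₁ s + κ₂ s) f p : ℝ) : ℂ)
      + Complex.I * ((smear (fun s => s * κ₂ s + (-1) * κ₁ s) f p : ℝ) : ℂ)) with hZ
  have hPs : ∀ {f : ℝ × ℝ → ℝ} (_ : ContDiff ℝ ∞ f) (_ : HasCompactSupport f), ContDiff ℝ ∞ (P f) :=
    fun hf hfc => (smooth hκ₁ hf hfc).add (contDiff_const.mul (smooth hκ₂ hf hfc))
  have hPd : ∀ {f f' : ℝ × ℝ → ℝ} (_ : ContDiff ℝ ∞ f) (_ : HasCompactSupport f)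
      (_ : ∀ p : ℝ × ℝ, HasDerivAt (fun y => f (y, p.2)) (f' p) p.1) (p : ℝ × ℂ),
      HasDerivAt (fun y => P f (y, p.2)) (P f' p) p.1 := by
    intro f f' hf hfc hff' p
    exact ((hasDerivAt_smear hκ₁ (hf.of_le (by norm_cast)) hfc hff' p).ofReal_comp).add
      (((hasDerivAt_smear hκ₂ (hf.of_le (by norm_cast)) hfc hff' p).ofReal_comp).const_mul Complex.I)
  have hadd : ∀ {κ : ℝ → ℝ} (_ : RapidDecay κ) {κ' : ℝ → ℝ} (_ : RapidDecay κ') {f : ℝ × ℝ → ℝ}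
      (_ : Continuous f) (_ : HasCompactSupport f) (a : ℝ) (p : ℝ × ℂ),
      smear (fun s => κ s + a * κ' s) f p = smear κ f p + a * smear κ' f p := by
    intro κ hκ κ' hκ' f hf hfc a p
    simp only [smear]
    rw [← integral_const_mul, ← integral_add (hκ.integrable_smear hf hfc p)
      ((hκ'.integrable_smear hf hfc p).const_mul a)]
    congr 1; funext s
    simp only [smul_eq_mul]; ring
  -- On the averaging line the factor is U - Re c - s Im c = (U - c) - (s - i) Im c. Hence
  -- multiplication by U - a commutes with averaging up to Im c times an average with the kernel (s
  -- - i) k, which is flat.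
  have hPmul : ∀ {f h : ℝ × ℝ → ℝ} (_ : Continuous f) (_ : HasCompactSupport f) (p : ℝ × ℂ)
      (_ : ∀ a, h (p.1, a) = (U p.1 - a) * f (p.1, a)),
      P h p - ((U p.1 : ℂ) - p.2) * P f p = - Z f p := by
    intro f h hf hfc p hh
    have h1 := hadd hκ₁.mul_id hκ₂ hf hfc 1 p
    have h2 := hadd hκ₂.mul_id hκ₁ hf hfc (-1) p
    simp only [one_mul] at h1
    simp only [hP, hZ, h1, h2]
    rw [smear_mul hκ₁ hf hfc hh, smear_mul hκ₂ hf hfc hh]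
    have h3 : p.2 = (p.2.re : ℂ) + p.2.im * Complex.I := (Complex.re_add_im _).symm
    push_cast
    linear_combination (((smear κ₁ f p : ℝ) : ℂ) + Complex.I * ((smear κ₂ f p : ℝ) : ℂ)) * h3 + ((p.2.im : ℂ) * ((smear κ₂ f p : ℝ) : ℂ)) * Complex.I_mul_I
  have hPlin : ∀ p, P N p = P Ψ₂ p - β * P Ψ p := by
    intro p
    have : ∀ {κ : ℝ → ℝ} (_ : RapidDecay κ), smear κ N p = smear κ Ψ₂ p - β * smear κ Ψ p := by
      intro κ hκ
      simp only [smear]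
      rw [← integral_const_mul, ← integral_sub (hκ.integrable_smear hΨ₂s.continuous hΨ₂c p)
        ((hκ.integrable_smear hΨs.continuous hΨc p).const_mul _)]
      congr 1; funext s
      simp only [hN, smul_eq_mul]; ring
    simp only [hP, this hκ₁, this hκ₂]
    push_cast; ring
  -- The defect of the averaged equation is the flat term `Z N` divided by U - c. It stays flat
  -- because 1/(U - c) is moderate.
  refine ⟨r, hr, P Ξ, P Ψ, P Ψ₁, fun p => Z N p * ((U p.1 : ℂ) - p.2)⁻¹, hPs hΞs hΞc, ?_, hPs hΨs hΨc,
    hPs hΨ₁s hΨ₁c, ?_⟩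
  · have h1 : Ξ (y₀, U y₀) = 1 := by
      simp only [hΞ, sub_self, (hXG _).1, mul_one]
      rw [b₁.one_of_mem_closedBall (Metric.mem_closedBall_self hr.le),
        b₂.one_of_mem_closedBall (Metric.mem_closedBall_self zero_le_one), one_mul]
    have h2 : ∀ κ : ℝ → ℝ, smear κ Ξ (y₀, U y₀) = ∫ s, κ s := by
      intro κ
      simp [smear, h1]
    simp only [hP, h2, hi₁, hi₂]
    simp
  intro S hS hSsub hS0
  have hSb : Bornology.IsBounded S := ((Metric.isBounded_Ioo _ _).prod Metric.isBounded_ball).subset hSsub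
  have hZflat : ∀ {f : ℝ × ℝ → ℝ} (_ : ContDiff ℝ ∞ f) (_ : HasCompactSupport f) (k : ℕ), FlatOn S k (Z f) := by
    intro f hf hfc k
    refine FlatOn.bilin hS hS0 (ContinuousLinearMap.mul ℝ ℂ) (moderateOn_of_contDiff ?_ hSb k) ?_
    · exact Complex.ofRealCLM.contDiff.comp (Complex.imCLM.contDiff.comp contDiff_snd)
    · refine FlatOn.add hS ((flatOn_smear hS k hn₁ hf hfc).clm_comp hS Complex.ofRealCLM) ?_
      exact (flatOn_smear hS k hn₂ hf hfc).clm_comp hS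
        ((ContinuousLinearMap.mul ℝ ℂ Complex.I).comp Complex.ofRealCLM)
  have hQ0 : ∀ p ∈ S, (U p.1 : ℂ) - p.2 ≠ 0 := fun p hp => sub_ne_zero_of_im (hS0 p hp) _
  refine ⟨fun k => ?_, fun k => ?_, fun p hp => ⟨hPd hΨs hΨc hΨ₁ p, (hPd hΨ₁s hΨ₁c hΨ₂ p).congr_deriv ?_⟩⟩
  · refine FlatOn.congr hS ((hZflat hΞs hΞc k).clm_comp hS (-ContinuousLinearMap.id ℝ ℂ)) fun p _ => ?_
    rw [hPmul hΞs.continuous hΞc p fun a => by simp only [hΨ]; ring]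
    simp
  · have hQs : ContDiff ℝ ∞ fun p : ℝ × ℂ => (U p.1 : ℂ) - p.2 :=
      (Complex.ofRealCLM.contDiff.comp (hU.comp contDiff_fst)).sub contDiff_snd
    have hinv := moderateOn_inv hS hS0 (fun p hp => ?_) hQs.contDiffOn (exists_bound_iteratedFDeriv hQs hSb)
      (fun p hp => ?_) k
    · exact FlatOn.congr hS (FlatOn.bilin hS hS0 (ContinuousLinearMap.mul ℝ ℂ) hinv (hZflat hNs hNc k))
        fun p _ => by simp [mul_comm]
    · have h1 := (hSsub hp).2
      rw [Metric.mem_ball, dist_eq_norm] at h1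
      have h2 := (Complex.abs_im_le_norm (p.2 - U y₀)).trans h1.le
      simpa using h2
    · have h2 := Complex.abs_im_le_norm ((U p.1 : ℂ) - p.2)
      simpa using h2
  · have h1 := hPmul hNs.continuous hNc p (h := fun q => deriv (deriv U) p.1 * Ψ q)
      (fun a => hRay p.1 (hSsub hp).1 a)
    have h2 : P (fun q => deriv (deriv U) p.1 * Ψ q) p = ((deriv (deriv U) p.1 : ℝ) : ℂ) * P Ψ p := by
      have : ∀ κ : ℝ → ℝ, smear κ (fun q => deriv (deriv U) p.1 * Ψ q) p = deriv (deriv U) p.1 * smear κ Ψ p := by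
        intro κ
        simp only [smear]
        rw [← integral_const_mul]
        congr 1; funext s
        simp only [smul_eq_mul]; ring
      simp only [hP, this]
      push_cast; ring
    rw [h2, hPlin] at h1
    have := hQ0 p hp
    field_simp
    linear_combination -h1

end ApproximateSolution

/-! ### Variation of constants and bounds for solutions with zero data. -/

section Variation

/-- Variation of constants for the Rayleigh equation, relative to its leading part
`(Q² (f / Q)')' = 0`. -/
theorem variation_formula {a b p y : ℝ} (hp : p ∈ Ioo a b) (hy : y ∈ Ioo a b) {V V₁ V₂ : ℝ → ℝ}
    (hV : ∀ t ∈ Ioo a b, HasDerivAt V (V₁ t) t) (hV₁ : ∀ t ∈ Ioo a b, HasDerivAt V₁ (V₂ t) t)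
    {c : ℂ} (hc : c.im ≠ 0) {β : ℝ} {f f' s : ℝ → ℂ} (hs : ContinuousOn s (Ioo a b))
    (hf : ∀ t ∈ Ioo a b, HasDerivAt f (f' t) t)
    (hf' : ∀ t ∈ Ioo a b, HasDerivAt f' ((β + (V₂ t : ℂ) / ((V t : ℂ) - c)) * f t + s t) t) :
    f y / ((V y : ℂ) - c) = f p / ((V p : ℂ) - c)
      + (((V p : ℂ) - c) * f' p - V₁ p * f p) * (∫ t in p..y, (((V t : ℂ) - c) ^ 2)⁻¹)
      + ∫ t in p..y, ((V t : ℂ) - c) * (β * f t + s t) *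
        ((∫ x in p..y, (((V x : ℂ) - c) ^ 2)⁻¹) - ∫ x in p..t, (((V x : ℂ) - c) ^ 2)⁻¹) := by
  have hsub : ∀ t ∈ Ioo a b, uIcc p t ⊆ Ioo a b := fun t ht => ordConnected_Ioo.uIcc_subset hp ht
  have hQd : ∀ t ∈ Ioo a b, HasDerivAt (fun t => (V t : ℂ) - c) (V₁ t : ℂ) t := fun t ht =>
    hasDerivAt_ofReal_sub (hV t ht) c
  have hQ0 : ∀ t, (V t : ℂ) - c ≠ 0 := fun t => sub_ne_zero_of_im hc _
  have hQc : ContinuousOn (fun t => (V t : ℂ) - c) (Ioo a b) := fun t ht =>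
    (hQd t ht).continuousAt.continuousWithinAt
  have hfc : ContinuousOn f (Ioo a b) := fun t ht => (hf t ht).continuousAt.continuousWithinAt
  have hic : ContinuousOn (fun t => (((V t : ℂ) - c) ^ 2)⁻¹) (Ioo a b) :=
    (hQc.pow 2).inv₀ fun t _ => pow_ne_zero 2 (hQ0 t)
  have hgc : ContinuousOn (fun t => ((V t : ℂ) - c) * (β * f t + s t)) (Ioo a b) :=
    hQc.mul ((continuousOn_const.mul hfc).add hs)
  have hJd : ∀ {g : ℝ → ℂ}, ContinuousOn g (Ioo a b) → ∀ t ∈ Ioo a b,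
      HasDerivAt (fun t => ∫ x in p..t, g x) (g t) t := fun hg t ht =>
    intervalIntegral.integral_hasDerivAt_right ((hg.mono (hsub t ht)).intervalIntegrable)
      (hg.stronglyMeasurableAtFilter isOpen_Ioo _ ht) (hg.continuousAt (isOpen_Ioo.mem_nhds ht))
  set J : ℝ → ℂ := fun t => ∫ x in p..t, (((V x : ℂ) - c) ^ 2)⁻¹ with hJ
  have hJc : ContinuousOn J (Ioo a b) := fun t ht => (hJd hic t ht).continuousAt.continuousWithinAt
  -- This is Q² (f/Q)'; the singular term V₂/Q of the equation drops out of its derivative. One more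
  -- integration, by parts against the primitive of Q⁻², gives the formula.
  set w : ℝ → ℂ := fun t => ((V t : ℂ) - c) * f' t - V₁ t * f t with hw
  have hwd : ∀ t ∈ Ioo a b, HasDerivAt w (((V t : ℂ) - c) * (β * f t + s t)) t := by
    intro t ht
    refine (((hQd t ht).mul (hf' t ht)).sub (((hV₁ t ht).ofReal_comp).mul (hf t ht))).congr_deriv ?_
    have := hQ0 t
    field_simp
    ring
  have hgi : ∀ {g : ℝ → ℂ}, ContinuousOn g (Ioo a b) → IntervalIntegrable g volume p y := fun hg =>
    (hg.mono (hsub y hy)).intervalIntegrable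
  have h1 : ∫ t in p..y, ((V t : ℂ) - c) * (β * f t + s t) = w y - w p :=
    intervalIntegral.integral_eq_sub_of_hasDerivAt (fun t ht => hwd t (hsub y hy ht)) (hgi hgc)
  have h2 : ∫ t in p..y, (w t * (((V t : ℂ) - c) ^ 2)⁻¹) = f y / ((V y : ℂ) - c) - f p / ((V p : ℂ) - c) := by
    refine intervalIntegral.integral_eq_sub_of_hasDerivAt (f := fun t => f t / ((V t : ℂ) - c))
      (fun t ht => ?_) (hgi ?_)
    · have ht' := hsub y hy ht
      refine ((hf t ht').div (hQd t ht') (hQ0 t)).congr_deriv ?_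
      have := hQ0 t
      simp only [hw]
      field_simp
    · exact ContinuousOn.mul (fun t ht => (hwd t ht).continuousAt.continuousWithinAt) hic
  have h3 := intervalIntegral.integral_mul_deriv_eq_deriv_mul (fun t ht => hwd t (hsub y hy ht))
    (fun t ht => hJd hic t (hsub y hy ht)) (hgi hgc) (hgi hic)
  have h4 : J p = 0 := intervalIntegral.integral_same
  have h5 : ∫ t in p..y, ((V t : ℂ) - c) * (β * f t + s t) * (J y - J t) =
      (w y - w p) * J y - ∫ t in p..y, ((V t : ℂ) - c) * (β * f t + s t) * J t := by
    rw [← h1, ← intervalIntegral.integral_mul_const, ← intervalIntegral.integral_sub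
      ((hgi hgc).mul_const _) (hgi (show ContinuousOn (fun t => ((V t : ℂ) - c) * (β * f t + s t) * J t) _ from hgc.mul hJc))]
    congr 1; funext t; ring
  rw [h2] at h3
  change f y / ((V y : ℂ) - c) = f p / ((V p : ℂ) - c) + w p * J y + ∫ t in p..y, ((V t : ℂ) - c) * (β * f t + s t) * (J y - J t)
  rw [h5]
  change _ = w y * J y - w p * J p - _ at h3
  rw [h4] at h3
  linear_combination h3

/-- A linear integral inequality. -/
theorem bound_of_integral_inequality {p q A B : ℝ} (hpq : p ≤ q) (hA : 0 ≤ A) (hB : 0 ≤ B) {f : ℝ → ℂ}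
    (hf : ContinuousOn f (Icc p q)) (h : ∀ y ∈ Icc p q, ‖f y‖ ≤ A * (∫ t in p..y, ‖f t‖) + B) :
    ∀ y ∈ Icc p q, ‖f y‖ ≤ B * (1 + Real.exp ((A + 1) * (q - p))) := by
  intro y hy
  -- Extended by constants beyond the interval, so that the primitive is differentiable everywhere.
  set F : ℝ → ℝ := fun t => ‖f (max p (min q t))‖ with hF
  have hFc : Continuous F := by
    refine (hf.comp_continuous (by fun_prop) fun t => ⟨le_max_left _ _, max_le hpq (min_le_left _ _)⟩).norm
  have hFf : ∀ t ∈ Icc p q, F t = ‖f t‖ := fun t ht => by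
    simp only [hF, min_eq_right ht.2, max_eq_right ht.1]
  set g : ℝ → ℝ := fun t => ∫ x in p..t, F x with hg
  have hgd : ∀ t, HasDerivAt g (F t) t := fun t => intervalIntegral.integral_hasDerivAt_right
    (hFc.intervalIntegrable _ _) (hFc.stronglyMeasurableAtFilter _ _) hFc.continuousAt
  have hgf : ∀ t ∈ Icc p q, g t = ∫ x in p..t, ‖f x‖ := fun t ht => by
    refine intervalIntegral.integral_congr fun x hx => ?_
    rw [uIcc_of_le ht.1] at hx
    exact hFf x ⟨hx.1, hx.2.trans ht.2⟩
  have hg0 : ∀ t ∈ Icc p q, 0 ≤ g t := fun t ht =>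
    intervalIntegral.integral_nonneg ht.1 fun x _ => norm_nonneg _
  -- The rate is `A + 1` instead of `A` so that it is nonzero, as the closed form of the Gronwall
  -- bound requires.
  have h1 := norm_le_gronwallBound_of_norm_deriv_right_le (f := g) (f' := F) (δ := 0) (K := A + 1) (ε := B)
    (a := p) (b := q) (fun t _ => (hgd t).continuousAt.continuousWithinAt)
    (fun t _ => (hgd t).hasDerivWithinAt) (by simp [hg]) (fun t ht => by
      have ht' := Ico_subset_Icc_self ht
      have h2 := h t ht'
      rw [← hgf t ht'] at h2
      rw [Real.norm_of_nonneg (norm_nonneg _), Real.norm_of_nonneg (hg0 t ht')]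
      change F t ≤ _
      rw [hFf t ht']
      nlinarith [hg0 t ht']) y hy
  rw [gronwallBound_of_K_ne_0 (by positivity), Real.norm_of_nonneg (hg0 y hy)] at h1
  simp only [zero_mul, zero_add] at h1
  have h2 := h y hy
  rw [← hgf y hy] at h2
  have h3 : Real.exp ((A + 1) * (y - p)) ≤ Real.exp ((A + 1) * (q - p)) := by
    gcongr; exact hy.2
  have h4 : (A + 1) * g y ≤ B * (Real.exp ((A + 1) * (y - p)) - 1) := by
    calc (A + 1) * g y ≤ (A + 1) * (B / (A + 1) * (Real.exp ((A + 1) * (y - p)) - 1)) := by gcongr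
      _ = _ := by field_simp
  nlinarith [hg0 y hy, mul_le_mul_of_nonneg_left h3 hB]

theorem exists_norm_mul_integral_le {U : ℝ → ℝ} (hU : ContDiff ℝ ∞ U) {p q m κ : ℝ} (hpq : p ≤ q)
    (hm : 0 < m) (hmU : ∀ t ∈ Icc p q, m ≤ deriv U t) {D : Set ℂ} (hD : Bornology.IsBounded D)
    (hκ : 0 < κ) (hκD : ∀ c ∈ D, κ ≤ ‖(U p : ℂ) - c‖) :
    ∃ C, 0 ≤ C ∧ ∀ c ∈ D, c.im ≠ 0 → ∀ y ∈ Icc p q,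
      ‖((U y : ℂ) - c) * ∫ t in p..y, (((U t : ℂ) - c) ^ 2)⁻¹‖ ≤ C ∧ ‖(U y : ℂ) - c‖ ≤ C := by
  have hU1 : ContDiff ℝ ∞ (deriv U) := (contDiff_infty_iff_deriv.1 hU).2
  have hU2 : ContDiff ℝ ∞ (deriv (deriv U)) := (contDiff_infty_iff_deriv.1 hU1).2
  have hU3 : ContDiff ℝ ∞ (deriv (deriv (deriv U))) := (contDiff_infty_iff_deriv.1 hU2).2
  have hd : ∀ {f : ℝ → ℝ}, ContDiff ℝ ∞ f → ∀ t, HasDerivAt f (deriv f t) t := fun hf t =>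
    ((hf.differentiable (by norm_num)).differentiableAt).hasDerivAt
  obtain ⟨K₀, hK₀⟩ := (isCompact_Icc (a := p) (b := q)).exists_bound_of_continuousOn hU.continuous.continuousOn
  obtain ⟨K₂, hK₂⟩ := (isCompact_Icc (a := p) (b := q)).exists_bound_of_continuousOn hU2.continuous.continuousOn
  obtain ⟨K₃, hK₃⟩ := (isCompact_Icc (a := p) (b := q)).exists_bound_of_continuousOn hU3.continuous.continuousOn
  obtain ⟨Kd, hKd⟩ := hD.exists_norm_le
  set K : ℝ := 1 + |K₀| + |K₂| + |K₃| + |Kd| with hK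
  have e0 := le_abs_self K₀
  have e2 := le_abs_self K₂
  have e3 := le_abs_self K₃
  have ed := le_abs_self Kd
  have f0 := abs_nonneg K₀
  have f2 := abs_nonneg K₂
  have f3 := abs_nonneg K₃
  have fd := abs_nonneg Kd
  have hQK : ∀ c ∈ D, ∀ y ∈ Icc p q, ‖(U y : ℂ) - c‖ ≤ K := fun c hc y hy => by
    refine (norm_sub_le _ _).trans ?_
    have h1 := hK₀ y hy
    have h2 := hKd c hc
    rw [Complex.norm_real]
    linarith
  obtain ⟨C, hC⟩ := exists_norm_mul_integral_inv_sq_le (K := K) (l := q - p) hm (by linarith) hκ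
  refine ⟨max C K, le_max_of_le_right (by linarith), fun c hc hci y hy => ⟨le_max_of_le_left ?_, le_max_of_le_right (hQK c hc y hy)⟩⟩
  refine hC U (deriv U) (deriv (deriv U)) (deriv (deriv (deriv U))) p q c hpq le_rfl (fun t _ => hd hU t)
    (fun t _ => hd hU1 t) (fun t _ => hd hU2 t) hU3.continuous.continuousOn hmU (fun t ht => ?_)
    (fun t ht => ?_) hci (fun t ht => hQK c hc t ht) (hκD c hc) y hy
  · have := hK₂ t ht; rw [Real.norm_eq_abs] at this; linarith
  · have := hK₃ t ht; rw [Real.norm_eq_abs] at this; linarith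

/-- Solutions with zero data on one side of a simple critical layer are bounded by the source. -/
theorem exists_zero_data_bound {U : ℝ → ℝ} (hU : ContDiff ℝ ∞ U) {a b p q m κ : ℝ} (hp : a < p) (hpq : p ≤ q)
    (hq : q < b) (hm : 0 < m) (hmU : ∀ t ∈ Icc p q, m ≤ deriv U t) {D : Set ℂ} (hD : Bornology.IsBounded D)
    (hκ : 0 < κ) (hκD : ∀ c ∈ D, κ ≤ ‖(U p : ℂ) - c‖) (β : ℝ) :
    ∃ C, 0 ≤ C ∧ ∀ c ∈ D, c.im ≠ 0 → ∀ (f f' s : ℝ → ℂ) (σ : ℝ), ContinuousOn s (Ioo a b) →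
      (∀ t ∈ Ioo a b, HasDerivAt f (f' t) t) →
      (∀ t ∈ Ioo a b, HasDerivAt f' ((β + ((deriv (deriv U) t : ℝ) : ℂ) / ((U t : ℂ) - c)) * f t + s t) t) →
      f p = 0 → f' p = 0 → (∀ t ∈ Ioo p q, ‖s t‖ ≤ σ) → 0 ≤ σ → ∀ y ∈ Icc p q, ‖f y‖ ≤ C * σ := by
  obtain ⟨C, hC0, hC⟩ := exists_norm_mul_integral_le hU hpq hm hmU hD hκ hκD
  have hU1 : ContDiff ℝ ∞ (deriv U) := (contDiff_infty_iff_deriv.1 hU).2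
  have hd : ∀ {f : ℝ → ℝ}, ContDiff ℝ ∞ f → ∀ t, HasDerivAt f (deriv f t) t := fun hf t =>
    ((hf.differentiable (by norm_num)).differentiableAt).hasDerivAt
  set A : ℝ := 2 * C ^ 2 with hA
  refine ⟨A * (q - p) * (1 + Real.exp ((A * |β| + 1) * (q - p))), ?_, ?_⟩
  · have : 0 ≤ q - p := by linarith
    positivity
  intro c hc hci f f' s σ hs hf hf' h0 h1 hsσ hσ
  have hpab : p ∈ Ioo a b := ⟨hp, by linarith⟩
  have hsub : ∀ y ∈ Icc p q, y ∈ Ioo a b := fun y hy => ⟨by linarith [hy.1], by linarith [hy.2]⟩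
  have hfc : ContinuousOn f (Ioo a b) := fun t ht => (hf t ht).continuousAt.continuousWithinAt
  have key : ∀ y ∈ Icc p q, ‖f y‖ ≤ A * |β| * (∫ t in p..y, ‖f t‖) + A * (q - p) * σ := by
    intro y hy
    have hv := variation_formula hpab (hsub y hy) (fun t _ => hd hU t) (fun t _ => hd hU1 t) hci hs hf hf'
    rw [h0, h1] at hv
    simp only [zero_div, mul_zero, sub_zero, zero_mul, zero_add] at hv
    rw [div_eq_iff (sub_ne_zero_of_im hci _)] at hv
    rw [hv, ← intervalIntegral.integral_mul_const]
    have hle : ∀ t ∈ Ioo p y, ‖((U t : ℂ) - c) * (β * f t + s t) *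
        ((∫ x in p..y, (((U x : ℂ) - c) ^ 2)⁻¹) - ∫ x in p..t, (((U x : ℂ) - c) ^ 2)⁻¹) * ((U y : ℂ) - c)‖ ≤
        A * |β| * ‖f t‖ + A * σ := by
      intro t ht
      have ht' : t ∈ Icc p q := ⟨ht.1.le, ht.2.le.trans hy.2⟩
      -- The two integrals of Q⁻² may be large near the layer. After regrouping, each is multiplied
      -- by Q at its own end point and is then bounded.
      have e : ((U t : ℂ) - c) * (β * f t + s t) *
        ((∫ x in p..y, (((U x : ℂ) - c) ^ 2)⁻¹) - ∫ x in p..t, (((U x : ℂ) - c) ^ 2)⁻¹) * ((U y : ℂ) - c) =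
        (β * f t + s t) * (((U t : ℂ) - c) * (((U y : ℂ) - c) * (∫ x in p..y, (((U x : ℂ) - c) ^ 2)⁻¹)) -
          ((U y : ℂ) - c) * (((U t : ℂ) - c) * (∫ x in p..t, (((U x : ℂ) - c) ^ 2)⁻¹))) := by ring
      rw [e, norm_mul]
      have h2 : ‖(β * f t + s t : ℂ)‖ ≤ |β| * ‖f t‖ + σ := by
        refine (norm_add_le _ _).trans (add_le_add ?_ (hsσ t ⟨ht.1, ht.2.trans_le hy.2⟩))
        rw [norm_mul, Complex.norm_real, Real.norm_eq_abs]
      have h3 : ‖((U t : ℂ) - c) * (((U y : ℂ) - c) * (∫ x in p..y, (((U x : ℂ) - c) ^ 2)⁻¹)) -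
          ((U y : ℂ) - c) * (((U t : ℂ) - c) * (∫ x in p..t, (((U x : ℂ) - c) ^ 2)⁻¹))‖ ≤ C * C + C * C := by
        refine (norm_sub_le _ _).trans (add_le_add ?_ ?_)
        · rw [norm_mul]
          exact mul_le_mul (hC c hc hci t ht').2 (hC c hc hci y hy).1 (norm_nonneg _) hC0
        · rw [norm_mul]
          exact mul_le_mul (hC c hc hci y hy).2 (hC c hc hci t ht').1 (norm_nonneg _) hC0
      calc _ ≤ (|β| * ‖f t‖ + σ) * (C * C + C * C) := mul_le_mul h2 h3 (norm_nonneg _) (by positivity)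
        _ = _ := by rw [hA]; ring
    have hfi : IntervalIntegrable (fun t => ‖f t‖) volume p y := by
      refine ContinuousOn.intervalIntegrable (hfc.norm.mono ?_)
      rw [uIcc_of_le hy.1]
      exact fun t ht => hsub t ⟨ht.1, ht.2.trans hy.2⟩
    calc _ ≤ ∫ t in p..y, (A * |β| * ‖f t‖ + A * σ) := by
          refine intervalIntegral.norm_integral_le_of_norm_le hy.1 ?_ ((hfi.const_mul _).add intervalIntegrable_const)
          filter_upwards [compl_mem_ae_iff.2 (measure_singleton y)] with t hty ht
          exact hle t ⟨ht.1, lt_of_le_of_ne ht.2 hty⟩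
      _ = A * |β| * (∫ t in p..y, ‖f t‖) + A * σ * (y - p) := by
          rw [intervalIntegral.integral_add (hfi.const_mul _) intervalIntegrable_const,
            intervalIntegral.integral_const_mul, intervalIntegral.integral_const, smul_eq_mul]
          ring
      _ ≤ _ := by
          have : A * σ * (y - p) ≤ A * σ * (q - p) := by
            have := hy.2
            gcongr
          linarith
  intro y hy
  have h2 : 0 ≤ q - p := by linarith
  have := bound_of_integral_inequality hpq (by positivity) (by positivity)
    (hfc.mono fun y hy => hsub y hy) key y hy
  linarith

end Variation

/-! ### Flatness of solutions with flat source and zero data. -/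

section RegularFamily

theorem fderiv_apply_one_zero {φ : ℝ × ℂ → ℂ} {g : ℂ} {P : ℝ × ℂ} (hφ : DifferentiableAt ℝ φ P)
    (hd : HasDerivAt (fun y => φ (y, P.2)) g P.1) : fderiv ℝ φ P (1, 0) = g := by
  have h1 := ((hφ.hasFDerivAt (x := (P.1, P.2))).comp P.1
    (((hasDerivAt_id P.1).prodMk (hasDerivAt_const P.1 P.2)).hasFDerivAt)).hasDerivAt
  have h2 := hd.unique h1
  simpa using h2.symm

theorem hasDerivAt_slice {E : Type} [NormedAddCommGroup E] [NormedSpace ℝ E] {φ : ℝ × ℂ → E}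
    {P : ℝ × ℂ} (hφ : DifferentiableAt ℝ φ P) :
    HasDerivAt (fun y => φ (y, P.2)) (fderiv ℝ φ P (1, 0)) P.1 := by
  have h1 := ((hφ.hasFDerivAt (x := (P.1, P.2))).comp P.1
    (((hasDerivAt_id P.1).prodMk (hasDerivAt_const P.1 P.2)).hasFDerivAt)).hasDerivAt
  simpa [Function.comp_def] using h1

/-- Differentiation in `y` commutes with differentiation in the parameters. -/
theorem hasDerivAt_fderiv_apply {B : Set (ℝ × ℂ)} (hB : IsOpen B) {φ g : ℝ × ℂ → ℂ}
    (hφ : ContDiffOn ℝ ∞ φ B) (hd : ∀ P ∈ B, HasDerivAt (fun y => φ (y, P.2)) (g P) P.1)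
    (v : ℝ × ℂ) : ∀ P ∈ B, HasDerivAt (fun y => fderiv ℝ φ (y, P.2) v) (fderiv ℝ g P v) P.1 := by
  intro P hP
  have hφP := hφ.contDiffAt (hB.mem_nhds hP)
  have h1 : DifferentiableAt ℝ (fderiv ℝ φ) P :=
    (hφP.fderiv_right (m := 1) (by norm_cast)).differentiableAt (by norm_num)
  have h2 : g =ᶠ[𝓝 P] fun P => fderiv ℝ φ P (1, 0) := by
    filter_upwards [hB.mem_nhds hP] with R hR
    exact (fderiv_apply_one_zero ((hφ.contDiffAt (hB.mem_nhds hR)).differentiableAt (by norm_num))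
      (hd R hR)).symm
  have h3 : fderiv ℝ g P v = fderiv ℝ (fderiv ℝ φ) P v (1, 0) := by
    rw [h2.fderiv_eq]
    have := (h1.hasFDerivAt.clm_apply (hasFDerivAt_const ((1 : ℝ), (0 : ℂ)) P)).fderiv
    rw [this]
    simp
  have h4 : IsSymmSndFDerivAt ℝ φ P := hφP.isSymmSndFDerivAt (by
    simp only [minSmoothness_of_isRCLikeNormedField]; exact WithTop.coe_le_coe.2 (le_top : (2 : ℕ∞) ≤ ⊤))
  have h5 := hasDerivAt_slice (h1.clm_apply (differentiableAt_const v))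
  rw [h3, h4.eq]
  refine h5.congr_deriv ?_
  have := (h1.hasFDerivAt.clm_apply (hasFDerivAt_const v P)).fderiv
  rw [this]
  simp

/-- Separates the `y` derivative, which the equation controls, from the two parameter derivatives,
which are controlled by differentiating the equation. -/
theorem fderiv_eq_sum (φ : ℝ × ℂ → ℂ) (P : ℝ × ℂ) : fderiv ℝ φ P =
    ContinuousLinearMap.smulRightL ℝ (ℝ × ℂ) ℂ (ContinuousLinearMap.fst ℝ ℝ ℂ) (fderiv ℝ φ P (1, 0)) +
    (ContinuousLinearMap.smulRightL ℝ (ℝ × ℂ) ℂ (Complex.reCLM.comp (ContinuousLinearMap.snd ℝ ℝ ℂ))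
      (fderiv ℝ φ P (0, 1)) +
    ContinuousLinearMap.smulRightL ℝ (ℝ × ℂ) ℂ (Complex.imCLM.comp (ContinuousLinearMap.snd ℝ ℝ ℂ))
      (fderiv ℝ φ P (0, Complex.I))) := by
  refine ContinuousLinearMap.ext fun v => ?_
  have h1 : v = v.1 • ((1 : ℝ), (0 : ℂ)) + (v.2.re • ((0 : ℝ), (1 : ℂ)) + v.2.im • ((0 : ℝ), Complex.I)) := by
    refine Prod.ext (by simp) ?_
    simp
  conv_lhs => rw [h1]
  simp only [map_add, map_smul]
  rfl

/-- The coefficient `β + U'' / (U - c)` of the Rayleigh equation. -/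
noncomputable def coeff (U : ℝ → ℝ) (β : ℝ) (P : ℝ × ℂ) : ℂ :=
  β + ((deriv (deriv U) P.1 : ℝ) : ℂ) / ((U P.1 : ℂ) - P.2)

theorem contDiff_deriv {U : ℝ → ℝ} (hU : ContDiff ℝ ∞ U) : ContDiff ℝ ∞ (deriv U) :=
  (contDiff_infty_iff_deriv.1 hU).2

theorem hasDerivAt_of_contDiff {U : ℝ → ℝ} (hU : ContDiff ℝ ∞ U) (t : ℝ) : HasDerivAt U (deriv U t) t :=
  ((hU.differentiable (by norm_num)).differentiableAt).hasDerivAt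

theorem contDiff_profile_sub {U : ℝ → ℝ} (hU : ContDiff ℝ ∞ U) :
    ContDiff ℝ ∞ fun P : ℝ × ℂ => (U P.1 : ℂ) - P.2 :=
  (Complex.ofRealCLM.contDiff.comp (hU.comp contDiff_fst)).sub contDiff_snd

theorem contDiffOn_coeff {U : ℝ → ℝ} (hU : ContDiff ℝ ∞ U) (β : ℝ) {B : Set (ℝ × ℂ)}
    (hB : ∀ P ∈ B, (U P.1 : ℂ) ≠ P.2) : ContDiffOn ℝ ∞ (coeff U β) B := by
  have : coeff U β = fun P => (β : ℂ) + ((deriv (deriv U) P.1 : ℝ) : ℂ) * ((U P.1 : ℂ) - P.2)⁻¹ := by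
    funext P; simp only [coeff, div_eq_mul_inv]
  rw [this]
  refine contDiffOn_const.add (ContDiffOn.mul ?_ ((contDiff_profile_sub hU).contDiffOn.inv
    fun P hP => sub_ne_zero.2 (hB P hP)))
  exact (Complex.ofRealCLM.contDiff.comp ((contDiff_deriv (contDiff_deriv hU)).comp contDiff_fst)).contDiffOn

theorem moderateOn_profile_inv {U : ℝ → ℝ} (hU : ContDiff ℝ ∞ U) {S : Set (ℝ × ℂ)} (hS : IsOpen S)
    (hSb : Bornology.IsBounded S) (hS0 : ∀ P ∈ S, P.2.im ≠ 0) (hS1 : ∀ P ∈ S, |P.2.im| ≤ 1) (k : ℕ) :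
    ModerateOn S k fun P => ((U P.1 : ℂ) - P.2)⁻¹ :=
  moderateOn_inv hS hS0 hS1 (contDiff_profile_sub hU).contDiffOn
    (exists_bound_iteratedFDeriv (contDiff_profile_sub hU) hSb)
    (fun p _ => by simpa using Complex.abs_im_le_norm ((U p.1 : ℂ) - p.2)) k

/-- Solutions of the Rayleigh equation with flat source and zero data are flat. -/
theorem flatOn_of_zero_data {U : ℝ → ℝ} (hU : ContDiff ℝ ∞ U) {a b p q m κ : ℝ} (hp : a < p) (hpq : p ≤ q)
    (hq : q < b) (hm : 0 < m) (hmU : ∀ t ∈ Icc p q, m ≤ deriv U t) {D : Set ℂ} (hD : Bornology.IsBounded D)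
    (hDo : IsOpen D) (hκ : 0 < κ) (hκD : ∀ c ∈ D, κ ≤ ‖(U p : ℂ) - c‖) (hD0 : ∀ c ∈ D, c.im ≠ 0)
    (hD1 : ∀ c ∈ D, |c.im| ≤ 1) (β : ℝ) (k : ℕ) : ∀ φ φ' s : ℝ × ℂ → ℂ,
    ContDiffOn ℝ ∞ φ (Ioo a b ×ˢ D) → ContDiffOn ℝ ∞ φ' (Ioo a b ×ˢ D) →
    ContDiffOn ℝ ∞ s (Ioo a b ×ˢ D) → (∀ c ∈ D, φ (p, c) = 0 ∧ φ' (p, c) = 0) →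
    (∀ P ∈ Ioo a b ×ˢ D, HasDerivAt (fun y => φ (y, P.2)) (φ' P) P.1) →
    (∀ P ∈ Ioo a b ×ˢ D, HasDerivAt (fun y => φ' (y, P.2)) (coeff U β P * φ P + s P) P.1) →
    FlatOn (Ioo p q ×ˢ D) k s → FlatOn (Ioo p q ×ˢ D) k φ ∧ FlatOn (Ioo p q ×ˢ D) k φ' := by
  have hsub : Ioo p q ×ˢ D ⊆ Ioo a b ×ˢ D := prod_mono (Ioo_subset_Ioo hp.le hq.le) subset_rfl
  have hB : IsOpen (Ioo a b ×ˢ D) := isOpen_Ioo.prod hDo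
  have hS : IsOpen (Ioo p q ×ˢ D) := isOpen_Ioo.prod hDo
  have hS0 : ∀ P ∈ Ioo p q ×ˢ D, P.2.im ≠ 0 := fun P hP => hD0 _ hP.2
  have hS1 : ∀ P ∈ Ioo p q ×ˢ D, |P.2.im| ≤ 1 := fun P hP => hD1 _ hP.2
  have hSb : Bornology.IsBounded (Ioo p q ×ˢ D) := (Metric.isBounded_Ioo _ _).prod hD
  have hne : ∀ P ∈ Ioo a b ×ˢ D, (U P.1 : ℂ) ≠ P.2 := fun P hP =>
    sub_ne_zero.1 (sub_ne_zero_of_im (hD0 _ hP.2) _)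
  have hcoeff : ContDiffOn ℝ ∞ (coeff U β) (Ioo a b ×ˢ D) := contDiffOn_coeff hU β hne
  have hpab : p ∈ Ioo a b := ⟨hp, by linarith⟩
  obtain ⟨C₀, hC₀, hzero⟩ := exists_zero_data_bound hU hp hpq hq hm hmU hD hκ hκD β
  obtain ⟨K₂, hK₂⟩ := (isCompact_Icc (a := p) (b := q)).exists_bound_of_continuousOn
    (contDiff_deriv (contDiff_deriv hU)).continuous.continuousOn
  induction k with
  | zero =>
    intro φ φ' s hφ hφ' hs h0 hd hd' hsF
    obtain ⟨-, hsF⟩ := flatOn_zero_iff.1 hsF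
    -- The zero data bound is uniform in `c`, so smallness of the source passes to the solution for
    -- each exponent separately.
    have hφb : ∀ N : ℕ, ∃ C, 0 ≤ C ∧ ∀ P ∈ Ioo p q ×ˢ D, ‖φ P‖ ≤ C * |P.2.im| ^ N := by
      intro N
      obtain ⟨C, hC⟩ := hsF N
      refine ⟨C₀ * |C|, by positivity, fun P hP => ?_⟩
      have := hzero P.2 hP.2 (hD0 _ hP.2) (fun y => φ (y, P.2)) (fun y => φ' (y, P.2)) (fun y => s (y, P.2))
        (|C| * |P.2.im| ^ N)
        (hs.continuousOn.comp (by fun_prop : ContinuousOn (fun y : ℝ => (y, P.2)) _) fun y hy => ⟨hy, hP.2⟩)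
        (fun t ht => hd (t, P.2) ⟨ht, hP.2⟩) (fun t ht => hd' (t, P.2) ⟨ht, hP.2⟩) (h0 _ hP.2).1 (h0 _ hP.2).2
        (fun t ht => (hC (t, P.2) ⟨ht, hP.2⟩).trans (by gcongr; exact le_abs_self C)) (by positivity)
        P.1 (Ioo_subset_Icc_self hP.1)
      linarith
    refine ⟨flatOn_zero_iff.2 ⟨hφ.mono hsub, fun N => ?_⟩, flatOn_zero_iff.2 ⟨hφ'.mono hsub, fun N => ?_⟩⟩
    · obtain ⟨C, -, hC⟩ := hφb N
      exact ⟨C, hC⟩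
    · obtain ⟨C, hC⟩ := hsF N
      -- One power more than needed: it pays for the coefficient U''/(U - c), which is O(1/|Im c|).
      obtain ⟨C₁, hC₁0, hC₁⟩ := hφb (N + 1)
      refine ⟨((|β| + |K₂|) * C₁ + |C|) * (q - p), fun P hP => ?_⟩
      have hpy : ∀ t ∈ uIcc p P.1, t ∈ Ioo a b := fun t ht =>
        ordConnected_Ioo.uIcc_subset hpab (hsub hP).1 ht
      have hcont : ContinuousOn (fun t => coeff U β (t, P.2) * φ (t, P.2) + s (t, P.2)) (Ioo a b) :=
        ((hcoeff.mul hφ).add hs).continuousOn.comp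
          (by fun_prop : ContinuousOn (fun y : ℝ => (y, P.2)) _) fun y hy => ⟨hy, hP.2⟩
      have hI := intervalIntegral.integral_eq_sub_of_hasDerivAt (a := p) (b := P.1)
        (f := fun y => φ' (y, P.2)) (fun t ht => hd' (t, P.2) ⟨hpy t ht, hP.2⟩)
        ((hcont.mono hpy).intervalIntegrable)
      have h2 : φ' (p, P.2) = 0 := (h0 _ hP.2).2
      simp only [h2, sub_zero] at hI
      change _ = φ' P at hI
      rw [← hI]
      have hb : 0 < |P.2.im| := abs_pos.2 (hS0 P hP)
      have hle : ∀ t ∈ uIoc p P.1, ‖coeff U β (t, P.2) * φ (t, P.2) + s (t, P.2)‖ ≤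
          ((|β| + |K₂|) * C₁ + |C|) * |P.2.im| ^ N := by
        intro t ht
        rw [uIoc_of_le hP.1.1.le] at ht
        have ht' : t ∈ Ioo p q := ⟨ht.1, ht.2.trans_lt hP.1.2⟩
        have h3 : ‖coeff U β (t, P.2)‖ * |P.2.im| ≤ |β| + |K₂| := by
          have h4 : |P.2.im| ≤ ‖(U t : ℂ) - P.2‖ := by
            simpa using Complex.abs_im_le_norm ((U t : ℂ) - P.2)
          have h5 : ‖coeff U β (t, P.2)‖ ≤ |β| + |K₂| / |P.2.im| := by
            refine (norm_add_le _ _).trans ?_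
            rw [norm_div, Complex.norm_real, Complex.norm_real]
            have h6 := (hK₂ t (Ioo_subset_Icc_self ht')).trans (le_abs_self K₂)
            rw [Real.norm_eq_abs]
            gcongr
          calc _ ≤ (|β| + |K₂| / |P.2.im|) * |P.2.im| := by gcongr
            _ = |β| * |P.2.im| + |K₂| := by field_simp
            _ ≤ |β| * 1 + |K₂| := by gcongr; exact hS1 P hP
            _ = _ := by ring
        have h4 := hC₁ (t, P.2) ⟨ht', hP.2⟩
        have h5 := hC (t, P.2) ⟨ht', hP.2⟩
        refine (norm_add_le _ _).trans ?_
        rw [norm_mul, add_mul]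
        refine add_le_add ?_ (h5.trans (by gcongr; exact le_abs_self C))
        calc _ ≤ ‖coeff U β (t, P.2)‖ * (C₁ * |P.2.im| ^ (N + 1)) := by gcongr
          _ = (‖coeff U β (t, P.2)‖ * |P.2.im|) * (C₁ * |P.2.im| ^ N) := by ring
          _ ≤ (|β| + |K₂|) * (C₁ * |P.2.im| ^ N) := by gcongr
          _ = _ := by ring
      refine (intervalIntegral.norm_integral_le_of_norm_le_const hle).trans ?_
      rw [abs_of_nonneg (by linarith [hP.1.1] : 0 ≤ P.1 - p)]
      calc _ ≤ ((|β| + |K₂|) * C₁ + |C|) * |P.2.im| ^ N * (q - p) := by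
            gcongr
            exact hP.1.2.le
        _ = _ := by ring
  | succ k ih =>
    intro φ φ' s hφ hφ' hs h0 hd hd' hsF
    obtain ⟨hs0, hsk⟩ := (flatOn_succ_iff hS).1 hsF
    obtain ⟨hφk, hφ'k⟩ := ih φ φ' s hφ hφ' hs h0 hd hd' (hsF.mono (Nat.le_succ k))
    have hrhs : ContDiffOn ℝ ∞ (fun P => coeff U β P * φ P + s P) (Ioo a b ×ˢ D) := (hcoeff.mul hφ).add hs
    have hfd : ∀ {f : ℝ × ℂ → ℂ}, ContDiffOn ℝ ∞ f (Ioo a b ×ˢ D) → ∀ v,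
        ContDiffOn ℝ ∞ (fun P => fderiv ℝ f P v) (Ioo a b ×ˢ D) := fun hf v =>
      (hf.fderiv_of_isOpen hB (m := ∞) (by norm_cast)).clm_apply contDiffOn_const
    have hdiff : ∀ {f : ℝ × ℂ → ℂ}, ContDiffOn ℝ ∞ f (Ioo a b ×ˢ D) → ∀ P ∈ Ioo a b ×ˢ D,
        DifferentiableAt ℝ f P := fun hf P hP => (hf.contDiffAt (hB.mem_nhds hP)).differentiableAt (by norm_num)
    have hmod : ModerateOn (Ioo p q ×ˢ D) k (fderiv ℝ (coeff U β)) := by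
      have h1 : ModerateOn (Ioo p q ×ˢ D) (k + 1)
          (fun P => ((deriv (deriv U) P.1 : ℝ) : ℂ) * ((U P.1 : ℂ) - P.2)⁻¹) :=
        ModerateOn.bilin hS hS1 (ContinuousLinearMap.mul ℝ ℂ) (moderateOn_of_contDiff
          (Complex.ofRealCLM.contDiff.comp ((contDiff_deriv (contDiff_deriv hU)).comp contDiff_fst)) hSb _)
          (moderateOn_profile_inv hU hS hSb hS0 hS1 _)
      have h2 := ((moderateOn_succ_iff hS).1 h1).2
      refine h2.congr hS fun P _ => ?_
      have : coeff U β = fun P => (β : ℂ) + ((deriv (deriv U) P.1 : ℝ) : ℂ) * ((U P.1 : ℂ) - P.2)⁻¹ := by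
        funext P; simp only [coeff, div_eq_mul_inv]
      rw [this, fderiv_const_add]
    -- A parameter derivative solves the same equation with zero data; the source is the derivative
    -- of `s` plus that of the coefficient times φ. The latter is moderate times flat, so the
    -- induction hypothesis applies.
    have hpar : ∀ v : ℂ, FlatOn (Ioo p q ×ˢ D) k (fun P => fderiv ℝ φ P (0, v)) ∧
        FlatOn (Ioo p q ×ˢ D) k (fun P => fderiv ℝ φ' P (0, v)) := by
      intro v
      refine ih _ _ (fun P => fderiv ℝ s P (0, v) + fderiv ℝ (coeff U β) P (0, v) * φ P)
        (hfd hφ _) (hfd hφ' _) ((hfd hs _).add ((hfd hcoeff _).mul hφ)) ?_ ?_ ?_ ?_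
      · intro c hc
        have hz : ∀ {f : ℝ × ℂ → ℂ}, ContDiffOn ℝ ∞ f (Ioo a b ×ˢ D) → (∀ c ∈ D, f (p, c) = 0) →
            fderiv ℝ f (p, c) (0, v) = 0 := by
          intro f hf hf0
          have h1 := (hdiff hf (p, c) ⟨hpab, hc⟩).hasFDerivAt.comp c (hasFDerivAt_prodMk_right p c)
          have h2 : HasFDerivAt (f ∘ fun c => (p, c)) (0 : ℂ →L[ℝ] ℂ) c := by
            refine (hasFDerivAt_const (0 : ℂ) c).congr_of_eventuallyEq ?_
            filter_upwards [hDo.mem_nhds hc] with z hz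
            exact hf0 z hz
          have h3 := congrArg (fun A : ℂ →L[ℝ] ℂ => A v) (h1.unique h2)
          simpa using h3
        exact ⟨hz hφ fun c hc => (h0 c hc).1, hz hφ' fun c hc => (h0 c hc).2⟩
      · exact hasDerivAt_fderiv_apply hB hφ hd (0, v)
      · intro P hP
        refine (hasDerivAt_fderiv_apply hB hφ' hd' (0, v) P hP).congr_deriv ?_
        have h1 := (((hdiff hcoeff P hP).hasFDerivAt.mul (hdiff hφ P hP).hasFDerivAt).add
          (hdiff hs P hP).hasFDerivAt).fderiv
        change fderiv ℝ (fun P => coeff U β P * φ P + s P) P = _ at h1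
        rw [h1]
        simp only [_root_.add_apply, FunLike.coe_smul, Pi.smul_apply, smul_eq_mul]
        ring
      · refine FlatOn.add hS (hsk.clm_comp hS (ContinuousLinearMap.apply ℝ ℂ ((0 : ℝ), v))) ?_
        exact FlatOn.bilin hS hS0 (ContinuousLinearMap.mul ℝ ℂ)
          (hmod.clm_comp hS (ContinuousLinearMap.apply ℝ ℂ ((0 : ℝ), v))) hφk
    have hsum : ∀ {f : ℝ × ℂ → ℂ}, ContDiffOn ℝ ∞ f (Ioo a b ×ˢ D) → ∀ {g : ℝ × ℂ → ℂ},
        (∀ P ∈ Ioo a b ×ˢ D, HasDerivAt (fun y => f (y, P.2)) (g P) P.1) → FlatOn (Ioo p q ×ˢ D) k g →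
        (∀ v : ℂ, FlatOn (Ioo p q ×ˢ D) k (fun P => fderiv ℝ f P (0, v))) →
        FlatOn (Ioo p q ×ˢ D) k (fderiv ℝ f) := by
      intro f hf g hg hgF hv
      refine FlatOn.congr hS (FlatOn.add hS (hgF.clm_comp hS (ContinuousLinearMap.smulRightL ℝ (ℝ × ℂ) ℂ
          (ContinuousLinearMap.fst ℝ ℝ ℂ)))
        (FlatOn.add hS ((hv 1).clm_comp hS (ContinuousLinearMap.smulRightL ℝ (ℝ × ℂ) ℂ
          (Complex.reCLM.comp (ContinuousLinearMap.snd ℝ ℝ ℂ))))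
        ((hv Complex.I).clm_comp hS (ContinuousLinearMap.smulRightL ℝ (ℝ × ℂ) ℂ
          (Complex.imCLM.comp (ContinuousLinearMap.snd ℝ ℝ ℂ)))))) fun P hP => ?_
      refine (fderiv_eq_sum f P).trans ?_
      rw [fderiv_apply_one_zero (hdiff hf P (hsub hP)) (hg P (hsub hP))]
    have hrhsF : FlatOn (Ioo p q ×ˢ D) k (fun P => coeff U β P * φ P + s P) := by
      refine FlatOn.add hS ?_ (hsF.mono (Nat.le_succ k))
      have h1 : FlatOn (Ioo p q ×ˢ D) k
          (fun P => ((deriv (deriv U) P.1 : ℝ) : ℂ) * (((U P.1 : ℂ) - P.2)⁻¹ * φ P)) :=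
        FlatOn.bilin hS hS0 (ContinuousLinearMap.mul ℝ ℂ) (moderateOn_of_contDiff
          (Complex.ofRealCLM.contDiff.comp ((contDiff_deriv (contDiff_deriv hU)).comp contDiff_fst)) hSb _)
          (FlatOn.bilin hS hS0 (ContinuousLinearMap.mul ℝ ℂ) (moderateOn_profile_inv hU hS hSb hS0 hS1 _) hφk)
      refine FlatOn.congr hS (FlatOn.add hS (hφk.clm_comp hS (ContinuousLinearMap.mul ℝ ℂ (β : ℂ))) h1) fun P _ => ?_
      simp only [coeff, ContinuousLinearMap.mul_apply']
      ring
    have hφ0 := (ih φ φ' s hφ hφ' hs h0 hd hd' (hsF.mono (Nat.le_succ k)))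
    exact ⟨(flatOn_succ_iff hS).2 ⟨hφk.mono (Nat.zero_le _), hsum hφ hd hφ'k fun v => (hpar v).1⟩,
      (flatOn_succ_iff hS).2 ⟨hφ'k.mono (Nat.zero_le _), hsum hφ' hd' hrhsF fun v => (hpar v).2⟩⟩

end RegularFamily

/-! ### The regular solution at a simple critical layer. -/

section RegularFamily

theorem hasDerivAt_conj {f : ℝ → ℂ} {f' : ℂ} {t : ℝ} (h : HasDerivAt f f' t) :
    HasDerivAt (fun t => (starRingEnd ℂ) (f t)) ((starRingEnd ℂ) f') t :=
  ((Complex.conjCLE : ℂ →L[ℝ] ℂ).hasFDerivAt.comp_hasDerivAt t h)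

theorem coeff_conj (U : ℝ → ℝ) (β : ℝ) (y : ℝ) (c : ℂ) :
    coeff U β (y, (starRingEnd ℂ) c) = (starRingEnd ℂ) (coeff U β (y, c)) := by
  simp [coeff]

/-- Near a noncritical point of the profile the Rayleigh equation has a solution `(U - c) χ` with
`χ` smooth and nonvanishing. -/
theorem exists_regular_family {U : ℝ → ℝ} (hU : ContDiff ℝ ∞ U) {y₀ : ℝ} (hd : 0 < deriv U y₀) (β : ℝ) :
    ∃ r > 0, ∃ ε > 0, ∃ χ ψ' : ℝ × ℂ → ℂ,
      ContDiffOn ℝ ∞ χ (Ioo (y₀ - r) (y₀ + r) ×ˢ Metric.ball (U y₀ : ℂ) ε) ∧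
      (∀ P ∈ Ioo (y₀ - r) (y₀ + r) ×ˢ Metric.ball (U y₀ : ℂ) ε, χ P ≠ 0) ∧
      (∀ y c, χ (y, (starRingEnd ℂ) c) = (starRingEnd ℂ) (χ (y, c))) ∧
      ∀ P ∈ Ioo (y₀ - r) (y₀ + r) ×ˢ Metric.ball (U y₀ : ℂ) ε, P.2.im ≠ 0 →
        HasDerivAt (fun y => ((U y : ℂ) - P.2) * χ (y, P.2)) (ψ' P) P.1 ∧
        HasDerivAt (fun y => ψ' (y, P.2)) (coeff U β P * (((U P.1 : ℂ) - P.2) * χ P)) P.1 := by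
  obtain ⟨r₁, hr₁, X, F, F₁, σ, hX, hX1, hF, hF₁, happ⟩ := exists_approximate_solution hU hd.ne' β
  have hU1 := contDiff_deriv hU
  obtain ⟨R, hR, hRm⟩ : ∃ R > 0, ∀ y ∈ Icc (y₀ - R) (y₀ + R), deriv U y₀ / 2 ≤ deriv U y := by
    have h1 : ∀ᶠ y in 𝓝 y₀, deriv U y₀ / 2 < deriv U y :=
      hU1.continuous.continuousAt.eventually (lt_mem_nhds (by linarith))
    obtain ⟨R, hR, hb⟩ := Metric.eventually_nhds_iff_ball.1 h1
    refine ⟨R / 2, by positivity, fun y hy => (hb y ?_).le⟩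
    rw [Real.ball_eq_Ioo]
    exact ⟨by linarith [hy.1], by linarith [hy.2]⟩
  set m := deriv U y₀ / 2 with hm_def
  have hm : 0 < m := by positivity
  obtain ⟨r, hr, hrr, hrR⟩ : ∃ r > 0, 2 * r ≤ r₁ ∧ r ≤ R :=
    ⟨min (r₁ / 2) R, by positivity, by linarith [min_le_left (r₁ / 2) R], min_le_right _ _⟩
  have hUp : m * r ≤ U y₀ - U (y₀ - r) := by
    have := Convex.mul_sub_le_image_sub_of_le_deriv (convex_Icc (y₀ - R) (y₀ + R)) hU.continuous.continuousOn
      (hU.differentiable (by norm_num)).differentiableOn (C := m)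
      (fun y hy => hRm y (interior_subset hy)) (y₀ - r) ⟨by linarith, by linarith⟩ y₀ ⟨by linarith, by linarith⟩
      (by linarith)
    linarith
  set ε := min (1 / 2) (m * r / 2) with hε_def
  have hε : 0 < ε := by positivity
  -- U drops by at least m r between y₀ and y₀ - r, while |c - U y₀| < ε ≤ m r / 2; this separates
  -- the initial point y₀ - r from the layer.
  set κ := m * r / 2 with hκ_def
  have hκ : 0 < κ := by positivity
  set D : Set ℂ := Metric.ball (U y₀ : ℂ) ε ∩ {c | c.im ≠ 0} with hDdef
  have hDo : IsOpen D := Metric.isOpen_ball.inter (isOpen_ne_fun Complex.continuous_im continuous_const)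
  have hDb : Bornology.IsBounded D := Metric.isBounded_ball.subset inter_subset_left
  have hD0 : ∀ c ∈ D, c.im ≠ 0 := fun c hc => hc.2
  have hball1 : ∀ c ∈ Metric.ball (U y₀ : ℂ) ε, ‖c - U y₀‖ < ε := fun c hc => by
    rwa [Metric.mem_ball, dist_eq_norm] at hc
  have hD1 : ∀ c ∈ D, |c.im| ≤ 1 := fun c hc => by
    have h1 := Complex.abs_im_le_norm (c - U y₀)
    have h2 := hball1 c hc.1
    have h3 : ε ≤ 1 / 2 := min_le_left _ _
    simp only [Complex.sub_im, Complex.ofReal_im, sub_zero] at h1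
    linarith
  have hκD : ∀ c ∈ D, κ ≤ ‖(U (y₀ - r) : ℂ) - c‖ := fun c hc => by
    have h2 := hball1 c hc.1
    have h3 : ε ≤ m * r / 2 := min_le_right _ _
    have h4 : ‖((U y₀ - U (y₀ - r) : ℝ) : ℂ)‖ ≤ ‖(U (y₀ - r) : ℂ) - c‖ + ‖c - U y₀‖ := by
      have : ((U y₀ - U (y₀ - r) : ℝ) : ℂ) = -(((U (y₀ - r) : ℂ) - c) + (c - U y₀)) := by push_cast; ring
      rw [this, norm_neg]
      exact norm_add_le _ _
    rw [Complex.norm_real, Real.norm_eq_abs] at h4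
    have h5 := le_abs_self (U y₀ - U (y₀ - r))
    linarith
  set a := y₀ - 2 * r with ha
  set b := y₀ + 2 * r with hb
  have hab : Ioo a b ⊆ Ioo (y₀ - r₁) (y₀ + r₁) := Ioo_subset_Ioo (by linarith) (by linarith)
  have hB : IsOpen (Ioo a b ×ˢ D) := isOpen_Ioo.prod hDo
  obtain ⟨hηF, hσF, hFode⟩ := happ (Ioo a b ×ˢ D) hB
    (prod_mono hab (inter_subset_left.trans (Metric.ball_subset_ball (by linarith [min_le_left (1 / 2) (m * r / 2)]))))
    (fun P hP => hP.2.2)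
  have hne : ∀ P ∈ Ioo a b ×ˢ D, (U P.1 : ℂ) ≠ P.2 := fun P hP =>
    sub_ne_zero.1 (sub_ne_zero_of_im (hD0 _ hP.2) _)
  -- The source of the correction φ: it removes the defect σ, so that F + φ solves the equation
  -- exactly.
  have hσs : ContDiffOn ℝ ∞ (fun P => -σ P) (Ioo a b ×ˢ D) := (hσF 0).contDiffOn.neg
  obtain ⟨φ, φ', hφ, hφ', hsol⟩ := exists_solution_family hDo (contDiffOn_coeff hU β hne) hσs
    (contDiffOn_const (c := (0 : ℂ))) (contDiffOn_const (c := (0 : ℂ)))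
    (y₁ := y₀ - r) ⟨by linarith, by linarith⟩
  have hφF : ∀ k, FlatOn (Ioo (y₀ - r) (y₀ + r) ×ˢ D) k φ := fun k =>
    (flatOn_of_zero_data hU (a := a) (b := b) (q := y₀ + r) (by linarith) (by linarith) (by linarith) hm
      (fun t ht => hRm t ⟨by linarith [ht.1], by linarith [ht.2]⟩) hDb hDo hκ hκD hD0 hD1 β k φ φ' _ hφ hφ' hσs
      (fun c hc => ⟨(hsol c hc).1, (hsol c hc).2.1⟩) (fun P hP => ((hsol P.2 hP.2).2.2 P.1 hP.1).1)
      (fun P hP => ((hsol P.2 hP.2).2.2 P.1 hP.1).2)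
      (((hσF k).mono_set (prod_mono (Ioo_subset_Ioo (by linarith) (by linarith)) subset_rfl)).clm_comp
        (isOpen_Ioo.prod hDo) (-ContinuousLinearMap.id ℝ ℂ))).1
  set S := Ioo (y₀ - r) (y₀ + r) ×ˢ D with hS_def
  have hSB : S ⊆ Ioo a b ×ˢ D := prod_mono (Ioo_subset_Ioo (by linarith) (by linarith)) subset_rfl
  have hS : IsOpen S := isOpen_Ioo.prod hDo
  set O := Ioo (y₀ - r) (y₀ + r) ×ˢ Metric.ball (U y₀ : ℂ) ε with hO_def
  have hO : IsOpen O := isOpen_Ioo.prod Metric.isOpen_ball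
  have hOS : O ∩ {P | P.2.im ≠ 0} = S := by
    ext P
    simp only [hO_def, hS_def, hDdef, mem_inter_iff, mem_prod, mem_ofPred_eq]
    tauto
  -- The quotient of F + φ by U - c differs from X by this flat function, which extends by zero to
  -- the real axis. Hence the quotient is smooth across the layer.
  set η : ℝ × ℂ → ℂ := fun P => if P.2.im = 0 then 0 else
    ((U P.1 : ℂ) - P.2)⁻¹ * ((F P - ((U P.1 : ℂ) - P.2) * X P) + φ P) with hη
  have hηflat : ∀ k, FlatOn (O ∩ {P | P.2.im ≠ 0}) k η := by
    intro k
    rw [hOS]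
    refine FlatOn.congr hS (FlatOn.bilin hS (fun P hP => hD0 _ hP.2) (ContinuousLinearMap.mul ℝ ℂ)
      (moderateOn_profile_inv hU hS ((Metric.isBounded_Ioo _ _).prod hDb) (fun P hP => hD0 _ hP.2)
        (fun P hP => hD1 _ hP.2) k) (FlatOn.add hS ((hηF k).mono_set hSB) (hφF k))) fun P hP => ?_
    have : P.2.im ≠ 0 := hD0 _ hP.2
    simp [hη, this]
  have hηs : ContDiffOn ℝ ∞ η O := contDiffOn_infty.2 fun n =>
    contDiffOn_of_flat hO n hηflat fun P hP => by simp [hη, hP]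
  set χ₀ : ℝ × ℂ → ℂ := fun P => X P + η P with hχ₀
  have hχ₀s : ContDiffOn ℝ ∞ χ₀ O := hX.contDiffOn.add hηs
  have hχ₀Q : ∀ P : ℝ × ℂ, P.2.im ≠ 0 → ((U P.1 : ℂ) - P.2) * χ₀ P = F P + φ P := by
    intro P hP
    have := sub_ne_zero_of_im hP (U P.1)
    simp only [hχ₀, hη, hP, if_false]
    field_simp
    ring
  have hχ₀ode : ∀ P ∈ O, P.2.im ≠ 0 →
        HasDerivAt (fun y => ((U y : ℂ) - P.2) * χ₀ (y, P.2)) (F₁ P + φ' P) P.1 ∧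
        HasDerivAt (fun y => F₁ (y, P.2) + φ' (y, P.2)) (coeff U β P * (((U P.1 : ℂ) - P.2) * χ₀ P)) P.1 := by
    intro P hP hP0
    have hPS : P ∈ S := by rw [← hOS]; exact ⟨hP, hP0⟩
    have hPB := hSB hPS
    have h1 := hFode P hPB
    have h2 := (hsol P.2 hPB.2).2.2 P.1 hPB.1
    constructor
    · exact (h1.1.add h2.1).congr_of_eventuallyEq (Eventually.of_forall fun y => hχ₀Q (y, P.2) hP0)
    · refine (h1.2.add h2.2).congr_deriv ?_
      rw [hχ₀Q P hP0]
      simp only [coeff]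
      ring
  -- Averaging with the conjugate solution makes the two boundary values on the real axis agree with
  -- one symmetric function. The equation is preserved because `U` and `β` are real.
  set χ : ℝ × ℂ → ℂ := fun P => (χ₀ P + (starRingEnd ℂ) (χ₀ (P.1, (starRingEnd ℂ) P.2))) / 2 with hχ
  set ψ' : ℝ × ℂ → ℂ := fun P => ((F₁ P + φ' P) +
    (starRingEnd ℂ) (F₁ (P.1, (starRingEnd ℂ) P.2) + φ' (P.1, (starRingEnd ℂ) P.2))) / 2 with hψ'
  have hOconj : ∀ P ∈ O, (P.1, (starRingEnd ℂ) P.2) ∈ O := by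
    intro P hP
    refine ⟨hP.1, ?_⟩
    have h1 := hball1 _ hP.2
    rw [Metric.mem_ball, dist_eq_norm]
    have h2 : (starRingEnd ℂ) P.2 - (U y₀ : ℂ) = (starRingEnd ℂ) (P.2 - U y₀) := by simp
    change ‖(starRingEnd ℂ) P.2 - (U y₀ : ℂ)‖ < ε
    rw [h2, RCLike.norm_conj]
    exact h1
  have hconjs : ContDiff ℝ ∞ fun P : ℝ × ℂ => (P.1, (starRingEnd ℂ) P.2) :=
    contDiff_fst.prodMk (Complex.conjCLE.contDiff.comp contDiff_snd)
  have hχs : ContDiffOn ℝ ∞ χ O := by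
    have h1 : ContDiffOn ℝ ∞ (fun P : ℝ × ℂ => (starRingEnd ℂ) (χ₀ (P.1, (starRingEnd ℂ) P.2))) O :=
      Complex.conjCLE.contDiff.comp_contDiffOn (hχ₀s.comp hconjs.contDiffOn hOconj)
    have h2 : χ = fun P => (χ₀ P + (starRingEnd ℂ) (χ₀ (P.1, (starRingEnd ℂ) P.2))) * (2 : ℂ)⁻¹ := by
      funext P; simp only [hχ, div_eq_mul_inv]
    rw [h2]
    exact (hχ₀s.add h1).mul contDiffOn_const
  have hmem : (y₀, (U y₀ : ℂ)) ∈ O := ⟨⟨by linarith, by linarith⟩, Metric.mem_ball_self hε⟩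
  have hχ1 : χ (y₀, (U y₀ : ℂ)) = 1 := by
    have : χ₀ (y₀, (U y₀ : ℂ)) = 1 := by simp [hχ₀, hη, hX1]
    simp [hχ, this]
  have hχev : ∀ᶠ P in 𝓝 (y₀, (U y₀ : ℂ)), P ∈ O ∧ χ P ≠ 0 :=
    Filter.Eventually.and (hO.mem_nhds hmem)
      ((hχs.continuousOn.continuousAt (hO.mem_nhds hmem)).eventually_ne (by rw [hχ1]; exact one_ne_zero))
  obtain ⟨δ, hδ, hδb⟩ := Metric.eventually_nhds_iff_ball.1 hχev
  have hsubδ : Ioo (y₀ - δ) (y₀ + δ) ×ˢ Metric.ball (U y₀ : ℂ) δ ⊆ Metric.ball (y₀, (U y₀ : ℂ)) δ := by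
    rw [← Real.ball_eq_Ioo, ← ball_prod_same]
  refine ⟨δ, hδ, δ, hδ, χ, ψ', hχs.mono fun P hP => (hδb P (hsubδ hP)).1, fun P hP => (hδb P (hsubδ hP)).2,
    fun y c => ?_, fun P hP hP0 => ?_⟩
  · have h2 : (starRingEnd ℂ) (2 : ℂ) = 2 := by exact_mod_cast Complex.conj_ofReal 2
    simp [hχ, add_comm, h2]
  · have hPO := (hδb P (hsubδ hP)).1
    have h1 := hχ₀ode P hPO hP0
    have h2 := hχ₀ode (P.1, (starRingEnd ℂ) P.2) (hOconj P hPO) (by simpa using hP0)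
    constructor
    · refine ((h1.1.add (hasDerivAt_conj h2.1)).div_const 2).congr_of_eventuallyEq
        (Eventually.of_forall fun y => ?_)
      simp only [hχ, map_mul, map_sub, Complex.conj_ofReal, Complex.conj_conj, Pi.add_apply]
      ring
    · refine (((h1.2.add (hasDerivAt_conj h2.2)).div_const 2).congr_of_eventuallyEq
        (Eventually.of_forall fun y => ?_)).congr_deriv ?_
      · simp only [hψ', Pi.add_apply]
      · simp only [hχ, map_mul, map_sub, Complex.conj_ofReal, Complex.conj_conj, coeff_conj]
        ring

end RegularFamily

/-! ### Integrals against a primitive of the logarithm of U - c. -/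

section LogPrimitive

/-- The logarithm with a cut along the positive imaginary axis. -/
noncomputable def lowerLog (z : ℂ) : ℂ := Complex.log (Complex.I * z)

/-- A primitive of `lowerLog`. -/
noncomputable def lowerLogPrim (z : ℂ) : ℂ := z * lowerLog z - z

theorem mem_slitPlane_of_im_nonpos {z : ℂ} (hz : z.im ≤ 0) (h0 : z ≠ 0) : Complex.I * z ∈ Complex.slitPlane := by
  rw [Complex.mem_slitPlane_iff]
  simp only [Complex.mul_re, Complex.I_re, Complex.I_im, Complex.mul_im]
  by_cases h : z.im = 0
  · right
    intro h1
    apply h0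
    apply Complex.ext
    · simpa using h1
    · simpa using h
  · left
    have : z.im < 0 := lt_of_le_of_ne hz h
    simp only [zero_mul, one_mul, zero_sub]
    linarith

theorem contDiffAt_lowerLog {z : ℂ} (hz : z.im ≤ 0) (h0 : z ≠ 0) : ContDiffAt ℝ ∞ lowerLog z := by
  have h1 : ContDiffAt ℂ ∞ lowerLog z :=
    (Complex.contDiffAt_log (mem_slitPlane_of_im_nonpos hz h0)).comp z (contDiffAt_const.mul contDiffAt_id)
  exact h1.restrict_scalars ℝ

theorem contDiffAt_lowerLogPrim {z : ℂ} (hz : z.im ≤ 0) (h0 : z ≠ 0) : ContDiffAt ℝ ∞ lowerLogPrim z :=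
  (contDiffAt_id.mul (contDiffAt_lowerLog hz h0)).sub contDiffAt_id

theorem hasDerivAt_lowerLog {z : ℂ} (hz : z.im ≤ 0) (h0 : z ≠ 0) : HasDerivAt lowerLog z⁻¹ z := by
  have h1 := (((hasDerivAt_id z).const_mul Complex.I).clog (mem_slitPlane_of_im_nonpos hz h0))
  refine h1.congr_deriv ?_
  have := Complex.I_ne_zero
  simp only [id]
  field_simp

theorem hasDerivAt_lowerLogPrim {z : ℂ} (hz : z.im ≤ 0) (h0 : z ≠ 0) :
    HasDerivAt lowerLogPrim (lowerLog z) z := by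
  refine (((hasDerivAt_id z).mul (hasDerivAt_lowerLog hz h0)).sub (hasDerivAt_id z)).congr_deriv ?_
  simp only [id]
  field_simp
  ring

theorem norm_lowerLog_le (z : ℂ) : ‖lowerLog z‖ ≤ |Real.log ‖z‖| + Real.pi := by
  rw [lowerLog]
  refine (norm_log_le _).trans ?_
  simp

theorem lowerLogPrim_zero : lowerLogPrim 0 = 0 := by simp [lowerLogPrim]

theorem norm_mul_lowerLog_le {z : ℂ} : ‖z * lowerLog z‖ ≤ ‖z‖ * |Real.log ‖z‖| + Real.pi * ‖z‖ := by
  rw [norm_mul]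
  nlinarith [norm_lowerLog_le z, norm_nonneg z]

theorem continuousOn_lowerLogPrim : ContinuousOn lowerLogPrim {z | z.im ≤ 0} := by
  intro z hz
  by_cases h0 : z = 0
  · subst h0
    refine ContinuousAt.continuousWithinAt ?_
    have h1 : Tendsto (fun z : ℂ => z * lowerLog z) (𝓝 0) (𝓝 0) := by
      refine squeeze_zero_norm (fun z => norm_mul_lowerLog_le) ?_
      have h2 : Tendsto (fun z : ℂ => ‖z‖) (𝓝 0) (𝓝 0) := by simpa using (continuous_norm (E := ℂ)).tendsto 0
      have h3 : Continuous fun x : ℝ => |x * Real.log x| := Real.continuous_mul_log.abs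
      have h4 := (h3.tendsto 0).comp h2
      simp only [Function.comp_def, zero_mul, abs_zero, abs_mul, abs_norm] at h4
      simpa using h4.add (h2.const_mul Real.pi)
    have h2 := h1.sub (tendsto_id (x := 𝓝 (0 : ℂ)))
    rw [ContinuousAt, lowerLogPrim_zero]
    change Tendsto (fun z => z * lowerLog z - z) (𝓝 0) (𝓝 0)
    simpa using h2
  · exact (contDiffAt_lowerLogPrim hz h0).continuousAt.continuousWithinAt

theorem eqOn_Ioo_of_hasDerivAt {a b y₁ : ℝ} {f g k : ℝ → ℂ} (hy₁ : y₁ ∈ Ioo a b)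
    (hf : ∀ y ∈ Ioo a b, HasDerivAt f (k y) y) (hg : ∀ y ∈ Ioo a b, HasDerivAt g (k y) y)
    (h : f y₁ = g y₁) : ∀ y ∈ Ioo a b, f y = g y :=
  isOpen_Ioo.eqOn_of_deriv_eq isPreconnected_Ioo
    (fun y hy => (hf y hy).differentiableAt.differentiableWithinAt)
    (fun y hy => (hg y hy).differentiableAt.differentiableWithinAt)
    (fun y hy => (hf y hy).deriv.trans (hg y hy).deriv.symm) hy₁ h

/-- The projection of the complex plane to the closed upper half-plane. -/
noncomputable def upperProj (c : ℂ) : ℂ := ⟨c.re, max c.im 0⟩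

theorem continuous_upperProj : Continuous upperProj :=
  Complex.equivRealProdCLM.symm.continuous.comp
    (Complex.continuous_re.prodMk (Complex.continuous_im.max continuous_const))

theorem upperProj_of_nonneg {c : ℂ} (hc : 0 ≤ c.im) : upperProj c = c := by
  simp [upperProj, hc]

/-- The integral of `h` against the primitive of the logarithm of `U - c`. -/
noncomputable def logIntegral (U : ℝ → ℝ) (y₁ : ℝ) (h : ℝ × ℂ → ℂ) (P : ℝ × ℂ) : ℂ :=
  ∫ t in y₁..P.1, h (t, P.2) * lowerLogPrim ((U t : ℂ) - P.2)

/-- The primitive z log z - z is continuous on the closed half-plane Im z ≤ 0, where U - c lies for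
Im c ≥ 0, the layer included. Projecting `c` to that half-plane gives a function continuous
everywhere. -/
theorem exists_continuous_logIntegral {U : ℝ → ℝ} (hU : Continuous U) (y₁ : ℝ) {h : ℝ × ℂ → ℂ}
    (hh : Continuous h) : ∃ T : ℝ × ℂ → ℂ, Continuous T ∧ ∀ P : ℝ × ℂ, 0 ≤ P.2.im → logIntegral U y₁ h P = T P := by
  refine ⟨fun P => ∫ t in y₁..P.1, h (t, P.2) * lowerLogPrim ((U t : ℂ) - upperProj P.2), ?_, fun P hP => ?_⟩
  · refine intervalIntegral.continuous_parametric_intervalIntegral_of_continuous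
      (f := fun (P : ℝ × ℂ) t => h (t, P.2) * lowerLogPrim ((U t : ℂ) - upperProj P.2)) ?_ continuous_fst
    refine (hh.comp (by fun_prop)).mul (continuousOn_lowerLogPrim.comp_continuous ?_ fun x => ?_)
    · have := continuous_upperProj
      fun_prop
    · simp [upperProj]
  · simp only [logIntegral, upperProj_of_nonneg hP]

theorem hasDerivAt_logIntegral {U : ℝ → ℝ} (hU : Continuous U) (y₁ : ℝ) {h : ℝ × ℂ → ℂ}
    (hh : Continuous h) {P : ℝ × ℂ} (hP : 0 ≤ P.2.im) :
    HasDerivAt (fun y => logIntegral U y₁ h (y, P.2)) (h P * lowerLogPrim ((U P.1 : ℂ) - P.2)) P.1 := by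
  have hc : Continuous fun t => h (t, P.2) * lowerLogPrim ((U t : ℂ) - P.2) := by
    refine (hh.comp (by fun_prop)).mul (continuousOn_lowerLogPrim.comp_continuous (by fun_prop) fun x => ?_)
    simpa using hP
  exact intervalIntegral.integral_hasDerivAt_right (hc.intervalIntegrable _ _)
    (hc.stronglyMeasurableAtFilter _ _) hc.continuousAt

theorem contDiffAt_lowerLogPrim_profile {U : ℝ → ℝ} (hU : ContDiff ℝ ∞ U) {P : ℝ × ℂ} (hP : 0 ≤ P.2.im)
    (h0 : (U P.1 : ℂ) ≠ P.2) : ContDiffAt ℝ ∞ (fun P : ℝ × ℂ => lowerLogPrim ((U P.1 : ℂ) - P.2)) P :=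
  ContDiffAt.comp (g := lowerLogPrim) P (contDiffAt_lowerLogPrim (by simpa using hP) (sub_ne_zero.2 h0)) (contDiff_profile_sub hU).contDiffAt

/-- The derivative of `logIntegral` with respect to the parameter, after an integration by parts. -/
theorem hasFDerivAt_logIntegral {U : ℝ → ℝ} (hU : ContDiff ℝ ∞ U) {a b y₁ : ℝ} (hy₁ : y₁ ∈ Ioo a b)
    {w : ℝ → ℝ} (hwU : ∀ t ∈ Ioo a b, w t * deriv U t = 1) {h h' : ℝ × ℂ → ℂ}
    (hh : ContDiff ℝ ∞ h) (hh's : ContDiff ℝ ∞ h')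
    (hh' : ∀ P : ℝ × ℂ, HasDerivAt (fun y => (w y : ℂ) * h (y, P.2)) (h' P) P.1) {P : ℝ × ℂ} (hP1 : P.1 ∈ Ioo a b)
    (hP2 : 0 < P.2.im) :
    DifferentiableAt ℝ (logIntegral U y₁ h) P ∧
    fderiv ℝ (logIntegral U y₁ h) P (1, 0) = h P * lowerLogPrim ((U P.1 : ℂ) - P.2) ∧ ∀ v : ℂ,
    fderiv ℝ (logIntegral U y₁ h) P (0, v) = logIntegral U y₁ (fun P => fderiv ℝ h P (0, v)) P
      - v * ((w P.1 : ℂ) * h P * lowerLogPrim ((U P.1 : ℂ) - P.2)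
        - (w y₁ : ℂ) * h (y₁, P.2) * lowerLogPrim ((U y₁ : ℂ) - P.2) - logIntegral U y₁ h' P) := by
  set D : Set ℂ := {c | 0 < c.im} with hD
  have hDo : IsOpen D := isOpen_lt continuous_const Complex.continuous_im
  have hB : IsOpen (Ioo a b ×ˢ D) := isOpen_Ioo.prod hDo
  set G : ℝ × ℂ → ℂ := fun P => h P * lowerLogPrim ((U P.1 : ℂ) - P.2) with hG
  have hne : ∀ P : ℝ × ℂ, P.2 ∈ D → (U P.1 : ℂ) ≠ P.2 := fun P hP =>
    sub_ne_zero.1 (sub_ne_zero_of_im (ne_of_gt hP) _)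
  have hGs : ContDiffOn ℝ ∞ G (Ioo a b ×ˢ D) := fun P hP => (hh.contDiffAt.mul
    (contDiffAt_lowerLogPrim_profile hU (le_of_lt hP.2) (hne P hP.2))).contDiffWithinAt
  have hdiff : ∀ {f : ℝ × ℂ → ℂ}, ContDiffOn ℝ ∞ f (Ioo a b ×ˢ D) → ∀ P ∈ Ioo a b ×ˢ D,
      DifferentiableAt ℝ f P := fun hf P hP => (hf.contDiffAt (hB.mem_nhds hP)).differentiableAt (by norm_num)
  -- The integral is the solution of φ'' = ∂_y G with φ = 0 and φ' = G at y₁. Joint smoothness for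
  -- Im c > 0 is thereby inherited from the theory of linear equations.
  obtain ⟨φ, φ', hφ, hφ', hsol⟩ := exists_solution_family (a := a) (b := b) hDo (q := fun _ => 0)
    (S := fun P => fderiv ℝ G P (1, 0)) contDiffOn_const
    ((hGs.fderiv_of_isOpen hB (m := ∞) (by norm_cast)).clm_apply contDiffOn_const)
    (d₀ := fun _ => 0) (d₁ := fun c => G (y₁, c)) contDiffOn_const
    (hGs.comp (contDiff_const.prodMk contDiff_id).contDiffOn fun c hc => ⟨hy₁, hc⟩) hy₁
  have hφ'G : ∀ P ∈ Ioo a b ×ˢ D, φ' P = G P := fun P hP => by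
    have hs := hsol P.2 hP.2
    exact eqOn_Ioo_of_hasDerivAt hy₁ (f := fun y => φ' (y, P.2)) (g := fun y => G (y, P.2))
      (fun y hy => by simpa using (hs.2.2 y hy).2)
      (fun y hy => hasDerivAt_slice (hdiff hGs (y, P.2) ⟨hy, hP.2⟩)) hs.2.1 P.1 hP.1
  have hφd : ∀ P ∈ Ioo a b ×ˢ D, HasDerivAt (fun y => φ (y, P.2)) (G P) P.1 := fun P hP => by
    rw [← hφ'G P hP]
    exact ((hsol P.2 hP.2).2.2 P.1 hP.1).1
  have hφT : ∀ P ∈ Ioo a b ×ˢ D, logIntegral U y₁ h P = φ P := fun P hP =>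
    eqOn_Ioo_of_hasDerivAt hy₁ (f := fun y => logIntegral U y₁ h (y, P.2)) (g := fun y => φ (y, P.2))
      (fun y hy => hasDerivAt_logIntegral hU.continuous y₁ hh.continuous (P := (y, P.2)) (le_of_lt hP.2))
      (fun y hy => hφd (y, P.2) ⟨hy, hP.2⟩) (by
        rw [(hsol P.2 hP.2).1]
        exact intervalIntegral.integral_same) P.1 hP.1
  have hPB : P ∈ Ioo a b ×ˢ D := ⟨hP1, hP2⟩
  have hev : logIntegral U y₁ h =ᶠ[𝓝 P] φ := by
    filter_upwards [hB.mem_nhds hPB] with R hR using hφT R hR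
  have hφP := hdiff hφ P hPB
  refine ⟨hφP.congr_of_eventuallyEq hev, ?_, fun v => ?_⟩
  · rw [hev.fderiv_eq]
    exact fderiv_apply_one_zero hφP (hφd P hPB)
  · rw [hev.fderiv_eq]
    have hfh : ContDiff ℝ ∞ fun P => fderiv ℝ h P (0, v) :=
      (hh.fderiv_right (m := ∞) (by norm_cast)).clm_apply contDiff_const
    have hPi : ∀ y : ℝ, 0 ≤ ((y, P.2) : ℝ × ℂ).2.im := fun y => le_of_lt hP2
    -- Both sides have the same `y` derivative and vanish at y₁. The parameter derivative produces
    -- -v log(U - c); with w = 1/U' this is -v w times the y-derivative of the primitive, and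
    -- integration by parts restores the primitive.
    refine eqOn_Ioo_of_hasDerivAt hy₁ (f := fun y => fderiv ℝ φ (y, P.2) (0, v))
      (g := fun y => logIntegral U y₁ (fun P => fderiv ℝ h P (0, v)) (y, P.2)
      - v * ((w y : ℂ) * h (y, P.2) * lowerLogPrim ((U y : ℂ) - P.2)
        - (w y₁ : ℂ) * h (y₁, P.2) * lowerLogPrim ((U y₁ : ℂ) - P.2) - logIntegral U y₁ h' (y, P.2)))
      (fun y hy => hasDerivAt_fderiv_apply hB hφ hφd (0, v) (y, P.2) ⟨hy, hP2⟩) (fun y hy => ?_) ?_ P.1 hP1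
    · have hz : (((U y : ℂ) - P.2)).im ≤ 0 := by simpa using le_of_lt hP2
      have hz0 : ((U y : ℂ) - P.2) ≠ 0 := sub_ne_zero.2 (hne (y, P.2) hP2)
      have h1 := hasDerivAt_logIntegral hU.continuous y₁ hfh.continuous (hPi y)
      have h2 := hasDerivAt_logIntegral hU.continuous y₁ hh's.continuous (hPi y)
      have h3 := (hasDerivAt_lowerLogPrim hz hz0).comp y (hasDerivAt_ofReal_sub (hasDerivAt_of_contDiff hU y) P.2)
      have h4 := (hh' (y, P.2)).mul h3
      refine (h1.sub (((h4.sub_const _).sub h2).const_mul v)).congr_deriv ?_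
      have h5 : fderiv ℝ G (y, P.2) (0, v) = h (y, P.2) * (lowerLog ((U y : ℂ) - P.2) * (-v)) +
          lowerLogPrim ((U y : ℂ) - P.2) * fderiv ℝ h (y, P.2) (0, v) := by
        have hE := ((hasDerivAt_lowerLogPrim hz hz0).hasFDerivAt.restrictScalars ℝ).comp ((y, P.2) : ℝ × ℂ)
          (((contDiff_profile_sub hU).differentiable (by norm_num)).differentiableAt (x := ((y, P.2) : ℝ × ℂ))).hasFDerivAt
        have hQv : fderiv ℝ (fun P : ℝ × ℂ => (U P.1 : ℂ) - P.2) (y, P.2) (0, v) = -v := by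
          have h6 := (((contDiff_profile_sub hU).differentiable (by norm_num)).differentiableAt (x := ((y, P.2) : ℝ × ℂ))).hasFDerivAt.comp
            P.2 (hasFDerivAt_prodMk_right y P.2)
          have h7 : HasFDerivAt ((fun P : ℝ × ℂ => (U P.1 : ℂ) - P.2) ∘ fun c => (y, c)) (-(ContinuousLinearMap.id ℝ ℂ)) P.2 :=
            (hasFDerivAt_id P.2).const_sub (U y : ℂ)
          have h8 := congrArg (fun A : ℂ →L[ℝ] ℂ => A v) (h6.unique h7)
          simpa using h8
        have h6 := (((hh.differentiable (by norm_num)).differentiableAt (x := ((y, P.2) : ℝ × ℂ))).hasFDerivAt.mul hE).fderiv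
        change fderiv ℝ G (y, P.2) = _ at h6
        rw [h6]
        simp only [_root_.add_apply, FunLike.coe_smul, Pi.smul_apply, smul_eq_mul, ContinuousLinearMap.comp_apply, hQv]
        simp [mul_comm]
      rw [h5]
      have h6 : (w y : ℂ) * ((deriv U y : ℝ) : ℂ) = 1 := by exact_mod_cast hwU y hy
      simp only [Function.comp_apply]
      linear_combination (-v * h (y, P.2) * lowerLog ((U y : ℂ) - P.2)) * h6
    · have h1 : fderiv ℝ φ (y₁, P.2) (0, v) = 0 := by
        have h1 := (hdiff hφ (y₁, P.2) ⟨hy₁, hP2⟩).hasFDerivAt.comp P.2 (hasFDerivAt_prodMk_right y₁ P.2)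
        have h2 : HasFDerivAt (φ ∘ fun c => (y₁, c)) (0 : ℂ →L[ℝ] ℂ) P.2 := by
          refine (hasFDerivAt_const (0 : ℂ) P.2).congr_of_eventuallyEq ?_
          filter_upwards [hDo.mem_nhds hP2] with z hz
          exact (hsol z hz).1
        have h3 := congrArg (fun A : ℂ →L[ℝ] ℂ => A v) (h1.unique h2)
        simpa using h3
      simp only [logIntegral, intervalIntegral.integral_same, h1]
      ring

/-- A parameter derivative is a sum of boundary terms, smooth off the layer, and integrals of the
same kind with other smooth densities. These are continuous up to the real axis, so the order of
smoothness rises by induction with `contDiffOn_succ_closedHalf`. -/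
theorem contDiffOn_logIntegral {U : ℝ → ℝ} (hU : ContDiff ℝ ∞ U) {a b y₁ : ℝ} (hy₁ : y₁ ∈ Ioo a b)
    {w : ℝ → ℝ} (hw : ContDiff ℝ ∞ w) (hwU : ∀ t ∈ Ioo a b, w t * deriv U t = 1) {B : Set ℂ} (hB : IsOpen B)
    (hBU : ∀ c ∈ B, (U y₁ : ℂ) ≠ c) (n : ℕ) : ∀ h : ℝ × ℂ → ℂ, ContDiff ℝ ∞ h →
    ContDiffOn ℝ n (logIntegral U y₁ h)
      ({P | P.1 ∈ Ioo a b ∧ P.2 ∈ B ∧ (U P.1 : ℂ) ≠ P.2} ∩ {P | 0 ≤ P.2.im}) := by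
  have hO : IsOpen {P : ℝ × ℂ | P.1 ∈ Ioo a b ∧ P.2 ∈ B ∧ (U P.1 : ℂ) ≠ P.2} :=
    (isOpen_Ioo.preimage continuous_fst).inter ((hB.preimage continuous_snd).inter
      (isOpen_ne_fun (Complex.continuous_ofReal.comp (hU.continuous.comp continuous_fst)) continuous_snd))
  have hcont : ∀ h : ℝ × ℂ → ℂ, ContDiff ℝ ∞ h → ContinuousOn (logIntegral U y₁ h)
      ({P | P.1 ∈ Ioo a b ∧ P.2 ∈ B ∧ (U P.1 : ℂ) ≠ P.2} ∩ {P | 0 ≤ P.2.im}) := by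
    intro h hh
    obtain ⟨T, hT, hTe⟩ := exists_continuous_logIntegral hU.continuous y₁ hh.continuous
    exact hT.continuousOn.congr fun P hP => hTe P hP.2
  induction n with
  | zero => exact fun h hh => contDiffOn_zero.2 (hcont h hh)
  | succ n ih =>
    intro h hh
    have hwh : ContDiff ℝ ∞ fun P : ℝ × ℂ => (w P.1 : ℂ) * h P :=
      (Complex.ofRealCLM.contDiff.comp (hw.comp contDiff_fst)).mul hh
    set h' : ℝ × ℂ → ℂ := fun P => fderiv ℝ (fun P : ℝ × ℂ => (w P.1 : ℂ) * h P) P (1, 0) with hh'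
    have hh's : ContDiff ℝ ∞ h' := (hwh.fderiv_right (m := ∞) (by norm_cast)).clm_apply contDiff_const
    have hh'd : ∀ P : ℝ × ℂ, HasDerivAt (fun y => (w y : ℂ) * h (y, P.2)) (h' P) P.1 := fun P =>
      hasDerivAt_slice ((hwh.differentiable (by norm_num)).differentiableAt)
    have hvs : ∀ v : ℂ, ContDiff ℝ ∞ fun P => fderiv ℝ h P (0, v) := fun v =>
      (hh.fderiv_right (m := ∞) (by norm_cast)).clm_apply contDiff_const
    set E : ℝ × ℂ → ℂ := fun P => lowerLogPrim ((U P.1 : ℂ) - P.2) with hE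
    set Z : ℂ → ℝ × ℂ → ℂ := fun v P => logIntegral U y₁ (fun P => fderiv ℝ h P (0, v)) P
      - v * ((w P.1 : ℂ) * h P * E P - (w y₁ : ℂ) * h (y₁, P.2) * E (y₁, P.2) - logIntegral U y₁ h' P) with hZ
    refine contDiffOn_succ_closedHalf hO (hcont h hh) (g := fun P =>
      ContinuousLinearMap.smulRightL ℝ (ℝ × ℂ) ℂ (ContinuousLinearMap.fst ℝ ℝ ℂ) (h P * E P) +
      (ContinuousLinearMap.smulRightL ℝ (ℝ × ℂ) ℂ (Complex.reCLM.comp (ContinuousLinearMap.snd ℝ ℝ ℂ)) (Z 1 P) +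
      ContinuousLinearMap.smulRightL ℝ (ℝ × ℂ) ℂ (Complex.imCLM.comp (ContinuousLinearMap.snd ℝ ℝ ℂ)) (Z Complex.I P)))
      (fun P hP hP0 => ?_) ?_
    · obtain ⟨h1, h2, h3⟩ := hasFDerivAt_logIntegral hU hy₁ hwU hh hh's hh'd hP.1 hP0
      have h4 := fderiv_eq_sum (logIntegral U y₁ h) P
      rw [h2, h3, h3] at h4
      rw [← h4]
      exact h1.hasFDerivAt
    · have hn : ((n : ℕ) : WithTop ℕ∞) ≤ ∞ := by exact_mod_cast le_top
      have hEs : ContDiffOn ℝ n E ({P | P.1 ∈ Ioo a b ∧ P.2 ∈ B ∧ (U P.1 : ℂ) ≠ P.2} ∩ {P | 0 ≤ P.2.im}) :=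
        fun P hP => ((contDiffAt_lowerLogPrim_profile hU hP.2 hP.1.2.2).of_le hn).contDiffWithinAt
      have hE₁s : ContDiffOn ℝ n (fun P : ℝ × ℂ => E (y₁, P.2))
          ({P | P.1 ∈ Ioo a b ∧ P.2 ∈ B ∧ (U P.1 : ℂ) ≠ P.2} ∩ {P | 0 ≤ P.2.im}) := by
        intro P hP
        have h1 : ContDiffAt ℝ ∞ E (y₁, P.2) := contDiffAt_lowerLogPrim_profile hU (P := (y₁, P.2)) hP.2 (hBU _ hP.1.2.1)
        exact ((h1.comp P (contDiff_const.prodMk contDiff_snd).contDiffAt).of_le hn).contDiffWithinAt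
      have hle : ∀ {f : ℝ × ℂ → ℂ}, ContDiff ℝ ∞ f → ContDiff ℝ n f := fun hf => hf.of_le hn
      have hZs : ∀ v, ContDiffOn ℝ n (Z v)
          ({P | P.1 ∈ Ioo a b ∧ P.2 ∈ B ∧ (U P.1 : ℂ) ≠ P.2} ∩ {P | 0 ≤ P.2.im}) := by
        intro v
        refine (ih _ (hvs v)).sub (contDiffOn_const.mul ((((hle hwh).contDiffOn.mul hEs).sub
          (ContDiffOn.mul (contDiffOn_const.mul ?_) hE₁s)).sub (ih _ hh's)))
        exact (hle (hh.comp (contDiff_const.prodMk contDiff_snd))).contDiffOn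
      have hclm : ∀ (ℓ : (ℝ × ℂ) →L[ℝ] ℝ), ContDiff ℝ n fun z : ℂ => ContinuousLinearMap.smulRightL ℝ (ℝ × ℂ) ℂ ℓ z :=
        fun ℓ => ContinuousLinearMap.contDiff _
      exact ((hclm _).comp_contDiffOn ((hle hh).contDiffOn.mul hEs)).add
        (((hclm _).comp_contDiffOn (hZs 1)).add ((hclm _).comp_contDiffOn (hZs Complex.I)))

end LogPrimitive

/-! ### The pair of solutions at a simple critical layer. -/

section SimpleLayer

theorem exists_contDiff_extension {f : ℝ × ℂ → ℂ} {y₀ r ε : ℝ} {c₀ : ℂ} (hr : 0 < r) (hε : 0 < ε)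
    (hf : ContDiffOn ℝ ∞ f (Ioo (y₀ - r) (y₀ + r) ×ˢ Metric.ball c₀ ε)) :
    ∃ g : ℝ × ℂ → ℂ, ContDiff ℝ ∞ g ∧
      ∀ P ∈ Ioo (y₀ - r / 2) (y₀ + r / 2) ×ˢ Metric.ball c₀ (ε / 2), g P = f P := by
  let b₁ : ContDiffBump y₀ := ⟨r / 2, 3 * r / 4, by linarith, by linarith⟩
  let b₂ : ContDiffBump c₀ := ⟨ε / 2, 3 * ε / 4, by linarith, by linarith⟩
  have hbs : ContDiff ℝ ∞ fun P : ℝ × ℂ => ((b₁ P.1 * b₂ P.2 : ℝ) : ℂ) :=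
    Complex.ofRealCLM.contDiff.comp ((b₁.contDiff.comp contDiff_fst).mul (b₂.contDiff.comp contDiff_snd))
  have h1 : tsupport b₁ ⊆ Ioo (y₀ - r) (y₀ + r) := by
    rw [b₁.tsupport_eq, ← Real.ball_eq_Ioo]
    exact Metric.closedBall_subset_ball (by change 3 * r / 4 < r; linarith)
  have h2 : tsupport b₂ ⊆ Metric.ball c₀ ε := by
    rw [b₂.tsupport_eq]
    exact Metric.closedBall_subset_ball (by change 3 * ε / 4 < ε; linarith)
  refine ⟨fun P => ((b₁ P.1 * b₂ P.2 : ℝ) : ℂ) * f P, ?_, fun P hP => ?_⟩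
  · rw [contDiff_iff_contDiffAt]
    intro p
    by_cases hp : p.1 ∈ tsupport b₁ ∧ p.2 ∈ tsupport b₂
    · exact hbs.contDiffAt.mul (hf.contDiffAt ((isOpen_Ioo.prod Metric.isOpen_ball).mem_nhds
        ⟨h1 hp.1, h2 hp.2⟩))
    · have : (fun p : ℝ × ℂ => ((b₁ p.1 * b₂ p.2 : ℝ) : ℂ) * f p) =ᶠ[𝓝 p] fun _ => 0 := by
        rw [not_and_or] at hp
        rcases hp with hp | hp
        · filter_upwards [(isClosed_tsupport b₁).isOpen_compl.preimage continuous_fst |>.mem_nhds hp]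
            with z hz
          simp [image_eq_zero_of_notMem_tsupport (f := b₁) hz]
        · filter_upwards [(isClosed_tsupport b₂).isOpen_compl.preimage continuous_snd |>.mem_nhds hp]
            with z hz
          simp [image_eq_zero_of_notMem_tsupport (f := b₂) hz]
      exact contDiffAt_const.congr_of_eventuallyEq this
  · have e1 : b₁ P.1 = 1 := b₁.one_of_mem_closedBall (by
      have := hP.1
      rw [← Real.ball_eq_Ioo] at this
      exact Metric.ball_subset_closedBall this)
    have e2 : b₂ P.2 = 1 := b₂.one_of_mem_closedBall (Metric.ball_subset_closedBall hP.2)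
    simp [e1, e2]

theorem exists_bound_of_isBounded {f : ℝ × ℂ → ℂ} (hf : Continuous f) {S : Set (ℝ × ℂ)}
    (hS : Bornology.IsBounded S) : ∃ C, ∀ P ∈ S, ‖f P‖ ≤ C := by
  obtain ⟨C, hC⟩ := hS.isCompact_closure.exists_bound_of_continuousOn hf.continuousOn
  exact ⟨C, fun p hp => hC p (subset_closure hp)⟩

/-- `φ`, with derivative `φ'` in `y`, solves the Rayleigh equation on `S`. -/
def SolvesOn (U : ℝ → ℝ) (β : ℝ) (φ φ' : ℝ × ℂ → ℂ) (S : Set (ℝ × ℂ)) : Prop :=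
  ∀ P ∈ S, HasDerivAt (fun y => φ (y, P.2)) (φ' P) P.1 ∧
    HasDerivAt (fun y => φ' (y, P.2)) (coeff U β P * φ P) P.1

/-- The two solutions of the Rayleigh equation near a noncritical point of the profile. -/
theorem exists_basis_of_deriv_pos {U : ℝ → ℝ} (hU : ContDiff ℝ ∞ U) {y₀ : ℝ} (hd : 0 < deriv U y₀) (β : ℝ) :
    ∃ r > 0, ∃ ε > 0, ∃ C : ℝ, ∃ ψ₁ ψ₂ ψ₁' ψ₂' : ℝ × ℂ → ℂ, ∀ O : Set (ℝ × ℂ),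
      O = Ioo (y₀ - r) (y₀ + r) ×ˢ Metric.ball (U y₀ : ℂ) ε →
      ContDiffOn ℝ ∞ ψ₁ O ∧ (∀ y c, ψ₁ (y, (starRingEnd ℂ) c) = (starRingEnd ℂ) (ψ₁ (y, c))) ∧
      ContDiffOn ℝ ∞ ψ₂ (O ∩ {P | 0 ≤ P.2.im ∧ (U P.1 : ℂ) ≠ P.2}) ∧
      ContinuousOn ψ₂ (O ∩ {P | 0 ≤ P.2.im}) ∧
      SolvesOn U β ψ₁ ψ₁' (O ∩ {P | 0 < P.2.im}) ∧ SolvesOn U β ψ₂ ψ₂' (O ∩ {P | 0 < P.2.im}) ∧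
      (∀ P ∈ O ∩ {P | 0 < P.2.im}, ψ₁ P * ψ₂' P - ψ₁' P * ψ₂ P = 1) ∧
      (∀ P ∈ O ∩ {P | 0 ≤ P.2.im}, ‖ψ₁ P‖ ≤ C ∧ ‖ψ₂ P‖ ≤ C) ∧
      (∀ P ∈ O ∩ {P | 0 ≤ P.2.im ∧ (U P.1 : ℂ) ≠ P.2},
        ‖deriv (fun y => ψ₂ (y, P.2)) P.1‖ ≤ C * ‖Complex.log ((U P.1 : ℂ) - P.2)‖) := by
  obtain ⟨r₁, hr₁, ε₁, hε₁, χ, ψ', hχ, hχ0, hχc, hode⟩ := exists_regular_family hU hd β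
  obtain ⟨g, hg, -, r₂, hr₂, hgU⟩ := exists_inverse_deriv hU hd.ne'
  obtain ⟨r₃, hr₃, hUr₃⟩ := Metric.continuousAt_iff.1 (hU.continuous.continuousAt (x := y₀)) (1 / 4) (by norm_num)
  set w : ℝ → ℝ := fun y => g (U y) with hw
  have hws : ContDiff ℝ ∞ w := hg.comp hU
  set R := min r₁ (min r₂ r₃) with hR_def
  have hR : 0 < R := by positivity
  have hR1 : R ≤ r₁ := min_le_left _ _
  have hR2 : R ≤ r₂ := (min_le_right _ _).trans (min_le_left _ _)
  have hR3 : R ≤ r₃ := (min_le_right _ _).trans (min_le_right _ _)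
  have hO₁ : Ioo (y₀ - R) (y₀ + R) ×ˢ Metric.ball (U y₀ : ℂ) ε₁ ⊆
      Ioo (y₀ - r₁) (y₀ + r₁) ×ˢ Metric.ball (U y₀ : ℂ) ε₁ :=
    prod_mono (Ioo_subset_Ioo (by linarith) (by linarith)) subset_rfl
  have hwC : ContDiff ℝ ∞ fun P : ℝ × ℂ => (w P.1 : ℂ) := Complex.ofRealCLM.contDiff.comp (hws.comp contDiff_fst)
  obtain ⟨X, hX, hXχ⟩ := exists_contDiff_extension hR hε₁ (hχ.mono hO₁)
  obtain ⟨h₀, hh₀, hh₀χ⟩ := exists_contDiff_extension hR hε₁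
    (f := fun P => (χ P ^ 2)⁻¹ * (w P.1 : ℂ)) ((((hχ.mono hO₁).pow 2).inv
      fun P hP => pow_ne_zero 2 (hχ0 P (hO₁ hP))).mul hwC.contDiffOn)
  have hdy : ∀ {f : ℝ × ℂ → ℂ}, ContDiff ℝ ∞ f → ∃ f' : ℝ × ℂ → ℂ, ContDiff ℝ ∞ f' ∧
      ∀ P : ℝ × ℂ, HasDerivAt (fun y => f (y, P.2)) (f' P) P.1 := fun hf =>
    ⟨_, (hf.fderiv_right (m := ∞) (by norm_cast)).clm_apply contDiff_const, fun P =>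
      hasDerivAt_slice ((hf.differentiable (by norm_num)).differentiableAt)⟩
  obtain ⟨X', hX's, hX'⟩ := hdy hX
  obtain ⟨h₀', hh₀', hh₀d⟩ := hdy hh₀
  set h₁ : ℝ × ℂ → ℂ := fun P => (w P.1 : ℂ) * h₀' P with hh₁_def
  have hh₁ : ContDiff ℝ ∞ h₁ := hwC.mul hh₀'
  obtain ⟨h₁', hh₁', hh₁d⟩ := hdy hh₁
  set h₂ : ℝ × ℂ → ℂ := fun P => (w P.1 : ℂ) * h₁' P with hh₂_def
  have hh₂ : ContDiff ℝ ∞ h₂ := hwC.mul hh₁'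
  obtain ⟨h₃, hh₃, hh₂d⟩ := hdy hh₂
  set a := y₀ - R / 2 with ha
  set b := y₀ + R / 2 with hb
  set y₁ := y₀ - R / 4 with hy₁_def
  have hy₁ : y₁ ∈ Ioo a b := ⟨by linarith, by linarith⟩
  have hwU : ∀ t ∈ Ioo a b, w t * deriv U t = 1 := fun t ht => hgU t ⟨by linarith [ht.1], by linarith [ht.2]⟩
  have hUy₁ : U y₁ ≠ U y₀ := by
    intro h
    obtain ⟨t, ht, ht0⟩ := exists_deriv_eq_zero (by linarith : y₁ < y₀) hU.continuous.continuousOn h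
    have := hwU t ⟨by linarith [ht.1], by linarith [ht.2]⟩
    rw [ht0, mul_zero] at this
    exact zero_ne_one this
  -- The last entry keeps the base point y₁ off the layer. The entry 1/4, with |U - U y₀| < 1/4,
  -- gives |Q| ≤ 1/2, so that |log Q| ≥ log 2 dominates constants.
  set ε := min (ε₁ / 2) (min (1 / 4) |U y₁ - U y₀|) with hε_def
  have hε : 0 < ε := lt_min (by linarith) (lt_min (by norm_num) (abs_pos.2 (sub_ne_zero.2 hUy₁)))
  have hε1 : ε ≤ ε₁ / 2 := min_le_left _ _
  have hε2 : ε ≤ 1 / 4 := (min_le_right _ _).trans (min_le_left _ _)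
  have hε3 : ε ≤ |U y₁ - U y₀| := (min_le_right _ _).trans (min_le_right _ _)
  set O₀ : Set (ℝ × ℂ) := Ioo a b ×ˢ Metric.ball (U y₀ : ℂ) ε with hO₀
  have hO₀o : IsOpen O₀ := isOpen_Ioo.prod Metric.isOpen_ball
  have hO₀b : Bornology.IsBounded O₀ := (Metric.isBounded_Ioo _ _).prod Metric.isBounded_ball
  have hO₀half : O₀ ⊆ Ioo (y₀ - R / 2) (y₀ + R / 2) ×ˢ Metric.ball (U y₀ : ℂ) (ε₁ / 2) :=
    prod_mono subset_rfl (Metric.ball_subset_ball hε1)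
  have hO₀1 : O₀ ⊆ Ioo (y₀ - r₁) (y₀ + r₁) ×ˢ Metric.ball (U y₀ : ℂ) ε₁ :=
    prod_mono (Ioo_subset_Ioo (by linarith) (by linarith)) (Metric.ball_subset_ball (by linarith))
  have hball : ∀ c ∈ Metric.ball (U y₀ : ℂ) ε, (U y₁ : ℂ) ≠ c := by
    intro c hc h
    rw [Metric.mem_ball, dist_eq_norm, ← h, ← Complex.ofReal_sub, Complex.norm_real, Real.norm_eq_abs] at hc
    linarith
  set Q : ℝ × ℂ → ℂ := fun P => (U P.1 : ℂ) - P.2 with hQ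
  have hQs : ContDiff ℝ ∞ Q := contDiff_profile_sub hU
  set E : ℝ × ℂ → ℂ := fun P => lowerLogPrim (Q P) with hE
  set T : ℝ × ℂ → ℂ := logIntegral U y₁ h₃ with hT
  -- Obtained from Q ∫ (Qχ)⁻² by three integrations by parts with w = 1/U'. Formally ∫ h₀ U'/Q² =
  -- -h₀/Q + h₁ log Q - h₂ E + ∫ h₃ E, where E is the primitive of the logarithm; multiplying by Q
  -- and using Q log Q = E + Q gives `A`, with no negative power of Q left.
  set A : ℝ × ℂ → ℂ := fun P => -h₀ P + h₁ P * (E P + Q P) - h₂ P * (Q P * E P) + Q P * T P with hA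
  set ψ₁ : ℝ × ℂ → ℂ := fun P => Q P * χ P with hψ₁
  -- Equal to ψ₁ κ off the layer, but this form is also defined and continuous on it.
  set ψ₂ : ℝ × ℂ → ℂ := fun P => X P * A P with hψ₂
  obtain ⟨T', hT'c, hTT'⟩ := exists_continuous_logIntegral hU.continuous y₁ hh₃.continuous
  set E' : ℝ × ℂ → ℂ := fun P => lowerLogPrim ((U P.1 : ℂ) - upperProj P.2) with hE'
  have hE'c : Continuous E' := continuousOn_lowerLogPrim.comp_continuous
    ((Complex.continuous_ofReal.comp (hU.continuous.comp continuous_fst)).sub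
      (continuous_upperProj.comp continuous_snd)) fun x => by simp [upperProj]
  have hEE' : ∀ P : ℝ × ℂ, 0 ≤ P.2.im → E P = E' P := fun P hP => by
    simp only [hE, hE', hQ, upperProj_of_nonneg hP]
  have hAc : ∃ A' : ℝ × ℂ → ℂ, Continuous A' ∧ ∀ P : ℝ × ℂ, 0 ≤ P.2.im → A P = A' P := by
    refine ⟨fun P => -h₀ P + h₁ P * (E' P + Q P) - h₂ P * (Q P * E' P) + Q P * T' P, ?_, fun P hP => ?_⟩
    · have := hh₀.continuous; have := hh₁.continuous; have := hh₂.continuous; have := hQs.continuous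
      fun_prop
    · simp only [hA, hEE' P hP, hT, hTT' P hP]
  obtain ⟨A', hA'c, hAA'⟩ := hAc
  have hQ0 : ∀ {P : ℝ × ℂ}, (U P.1 : ℂ) ≠ P.2 → Q P ≠ 0 := fun h => sub_ne_zero.2 h
  have hQim : ∀ {P : ℝ × ℂ}, 0 ≤ P.2.im → (Q P).im ≤ 0 := fun h => by simpa [hQ] using h
  have hQd : ∀ P : ℝ × ℂ, HasDerivAt (fun y => Q (y, P.2)) ((deriv U P.1 : ℝ) : ℂ) P.1 := fun P =>
    hasDerivAt_ofReal_sub (hasDerivAt_of_contDiff hU P.1) P.2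
  -- The relations between successive `h` cancel everything except a logarithm and bounded terms.
  -- This is the source of the logarithmic bound for ∂_y ψ₂.
  have hAd : ∀ P ∈ O₀, 0 ≤ P.2.im → (U P.1 : ℂ) ≠ P.2 → HasDerivAt (fun y => A (y, P.2))
      (((deriv U P.1 : ℝ) : ℂ) * (h₁ P * lowerLog (Q P) - h₂ P * E P + T P)) P.1 := by
    intro P hP hP0 hPU
    have hEd : HasDerivAt (fun y => E (y, P.2)) (lowerLog (Q P) * ((deriv U P.1 : ℝ) : ℂ)) P.1 :=
      HasDerivAt.comp (h₂ := lowerLogPrim) P.1 (hasDerivAt_lowerLogPrim (hQim hP0) (hQ0 hPU)) (hQd P)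
    have hTd := hasDerivAt_logIntegral hU.continuous y₁ hh₃.continuous hP0
    have e1 := ((((hh₀d P).neg).add ((hh₁d P).mul (hEd.add (hQd P)))).sub
      ((hh₂d P).mul ((hQd P).mul hEd))).add ((hQd P).mul hTd)
    refine e1.congr_deriv ?_
    have hwU' : (w P.1 : ℂ) * ((deriv U P.1 : ℝ) : ℂ) = 1 := by exact_mod_cast hwU P.1 hP.1
    have e2 : ((deriv U P.1 : ℝ) : ℂ) * h₁ P = h₀' P := by
      simp only [hh₁_def]; linear_combination h₀' P * hwU'
    have e3 : ((deriv U P.1 : ℝ) : ℂ) * h₂ P = h₁' P := by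
      simp only [hh₂_def]; linear_combination h₁' P * hwU'
    have e4 : E P = Q P * lowerLog (Q P) - Q P := rfl
    have e5 : lowerLogPrim ((U P.1 : ℂ) - P.2) = E P := rfl
    simp only [Pi.add_apply, Pi.mul_apply, Prod.mk.eta, e5]
    change _ = ((deriv U P.1 : ℝ) : ℂ) * (h₁ P * lowerLog (Q P) - h₂ P * E P + T P)
    linear_combination e2 - (E P + Q P) * e3 + ((deriv U P.1 : ℝ) : ℂ) * h₂ P * e4
  set κ : ℝ × ℂ → ℂ := fun P => A P / Q P with hκ
  have hpos : ∀ {P : ℝ × ℂ}, 0 < P.2.im → (U P.1 : ℂ) ≠ P.2 := fun h =>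
    sub_ne_zero.1 (sub_ne_zero_of_im (ne_of_gt h) _)
  have hκd : ∀ P ∈ O₀, 0 < P.2.im → HasDerivAt (fun y => κ (y, P.2)) ((ψ₁ P ^ 2)⁻¹) P.1 := by
    intro P hP hP0
    have hQP := hQ0 (hpos hP0)
    refine ((hAd P hP hP0.le (hpos hP0)).div (hQd P) hQP).congr_deriv ?_
    have hwU' : (w P.1 : ℂ) * ((deriv U P.1 : ℝ) : ℂ) = 1 := by exact_mod_cast hwU P.1 hP.1
    have hχP := hχ0 P (hO₀1 hP)
    have e1 : h₀ P * ((deriv U P.1 : ℝ) : ℂ) = (χ P ^ 2)⁻¹ := by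
      rw [hh₀χ P (hO₀half hP)]; linear_combination (χ P ^ 2)⁻¹ * hwU'
    have e4 : E P = Q P * lowerLog (Q P) - Q P := rfl
    simp only [Prod.mk.eta]
    have e6 : ((deriv U P.1 : ℝ) : ℂ) * (h₁ P * lowerLog (Q P) - h₂ P * E P + T P) * Q P - A P * ((deriv U P.1 : ℝ) : ℂ)
        = (χ P ^ 2)⁻¹ := by
      rw [← e1]; simp only [hA]; linear_combination -(((deriv U P.1 : ℝ) : ℂ) * h₁ P) * e4
    rw [e6]
    simp only [hψ₁, mul_pow]
    field_simp
  have hψ₂κ : ∀ P ∈ O₀, 0 < P.2.im → ψ₂ P = ψ₁ P * κ P := by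
    intro P hP hP0
    have hQP := hQ0 (hpos hP0)
    simp only [hψ₂, hψ₁, hκ, hXχ P (hO₀half hP)]
    field_simp
  obtain ⟨c1, hc1⟩ := exists_bound_of_isBounded (hQs.continuous.mul hX.continuous) hO₀b
  obtain ⟨c2, hc2⟩ := exists_bound_of_isBounded (hX.continuous.mul hA'c) hO₀b
  obtain ⟨c3, hc3⟩ := exists_bound_of_isBounded (hX's.continuous.mul hA'c) hO₀b
  have hU'c : Continuous fun P : ℝ × ℂ => ((deriv U P.1 : ℝ) : ℂ) :=
    Complex.continuous_ofReal.comp ((contDiff_deriv hU).continuous.comp continuous_fst)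
  obtain ⟨c4, hc4⟩ := exists_bound_of_isBounded ((hX.continuous.mul hU'c).mul hh₁.continuous) hO₀b
  obtain ⟨c5, hc5⟩ := exists_bound_of_isBounded ((hX.continuous.mul hU'c).mul ((hT'c.sub (hh₂.continuous.mul hE'c)))) hO₀b
  have hlog2 : 0 < Real.log 2 := Real.log_pos (by norm_num)
  set K := |c3| + |c5| + |c4| * Real.pi with hK
  set C := |c1| + |c2| + (K / Real.log 2 + |c4|) with hC
  have hK0 : 0 ≤ K := by have := Real.pi_pos; positivity
  refine ⟨R / 2, by positivity, ε, hε, C, ψ₁, ψ₂, ψ', fun P => ψ' P * κ P + (ψ₁ P)⁻¹, ?_⟩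
  rintro O rfl
  refine ⟨hQs.contDiffOn.mul (hχ.mono hO₀1), fun y c => ?_, ?_, ?_, ?_, ?_, ?_, ?_, ?_⟩
  · simp only [hψ₁, hQ, hχc]
    simp
  · have hB : ContDiffOn ℝ ∞ T ({P | P.1 ∈ Ioo a b ∧ P.2 ∈ Metric.ball (U y₀ : ℂ) ε ∧ (U P.1 : ℂ) ≠ P.2} ∩
        {P | 0 ≤ P.2.im}) :=
      contDiffOn_infty.2 fun n => contDiffOn_logIntegral hU hy₁ hws hwU Metric.isOpen_ball hball n h₃ hh₃
    have hTs : ContDiffOn ℝ ∞ T (O₀ ∩ {P | 0 ≤ P.2.im ∧ (U P.1 : ℂ) ≠ P.2}) :=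
      hB.mono fun P hP => ⟨⟨hP.1.1, hP.1.2, hP.2.2⟩, hP.2.1⟩
    have hEs : ContDiffOn ℝ ∞ E (O₀ ∩ {P | 0 ≤ P.2.im ∧ (U P.1 : ℂ) ≠ P.2}) := fun P hP =>
      (contDiffAt_lowerLogPrim_profile hU hP.2.1 hP.2.2).contDiffWithinAt
    exact hX.contDiffOn.mul ((((hh₀.neg).contDiffOn.add (hh₁.contDiffOn.mul (hEs.add hQs.contDiffOn))).sub
      (hh₂.contDiffOn.mul (hQs.contDiffOn.mul hEs))).add (hQs.contDiffOn.mul hTs))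
  · exact (hX.continuous.mul hA'c).continuousOn.congr fun P hP => by
      change X P * A P = X P * A' P
      rw [hAA' P hP.2]
  · exact fun P hP => hode P (hO₀1 hP.1) (ne_of_gt hP.2)
  · intro P hP
    have h1 := hode P (hO₀1 hP.1) (ne_of_gt hP.2)
    have h2 := hκd P hP.1 hP.2
    have hψ₁0 : ψ₁ P ≠ 0 := mul_ne_zero (hQ0 (hpos hP.2)) (hχ0 P (hO₀1 hP.1))
    constructor
    · have h3 : (fun y => ψ₂ (y, P.2)) =ᶠ[𝓝 P.1] fun y => ψ₁ (y, P.2) * κ (y, P.2) := by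
        filter_upwards [isOpen_Ioo.mem_nhds hP.1.1] with y hy
        exact hψ₂κ (y, P.2) ⟨hy, hP.1.2⟩ hP.2
      refine ((h1.1.mul h2).congr_of_eventuallyEq h3).congr_deriv ?_
      change ψ' P * κ P + ψ₁ P * (ψ₁ P ^ 2)⁻¹ = _
      field_simp
    · have h3 : HasDerivAt (fun y => (ψ₁ (y, P.2))⁻¹) _ P.1 := h1.1.inv hψ₁0
      refine ((h1.2.mul h2).add h3).congr_deriv ?_
      rw [hψ₂κ P hP.1 hP.2]
      change coeff U β P * ψ₁ P * κ P + ψ' P * (ψ₁ P ^ 2)⁻¹ + -ψ' P / (ψ₁ P) ^ 2 = _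
      field_simp
      ring
  · intro P hP
    have hψ₁0 : ψ₁ P ≠ 0 := mul_ne_zero (hQ0 (hpos hP.2)) (hχ0 P (hO₀1 hP.1))
    rw [hψ₂κ P hP.1 hP.2]
    field_simp
    ring
  · intro P hP
    have e1 : ‖Q P * X P‖ ≤ c1 := hc1 P hP.1
    have e2 : ‖X P * A' P‖ ≤ c2 := hc2 P hP.1
    rw [hXχ P (hO₀half hP.1)] at e1
    have e3 : ψ₂ P = X P * A' P := by simp only [hψ₂, hAA' P hP.2]
    have := le_abs_self c1
    have := le_abs_self c2
    have := abs_nonneg c1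
    have := abs_nonneg c2
    have : 0 ≤ K / Real.log 2 + |c4| := by positivity
    exact ⟨by linarith, by rw [e3]; linarith⟩
  · intro P hP
    obtain ⟨hPO, hP0, hPU⟩ := hP
    have h1 := (hX' P).mul (hAd P hPO hP0 hPU)
    have h2 : HasDerivAt (fun y => ψ₂ (y, P.2)) _ P.1 := h1
    rw [h2.deriv]
    simp only [Prod.mk.eta, hAA' P hP0]
    have e : X' P * A' P + X P * (((deriv U P.1 : ℝ) : ℂ) * (h₁ P * lowerLog (Q P) - h₂ P * E P + T P)) =
        X' P * A' P + X P * ((deriv U P.1 : ℝ) : ℂ) * (T' P - h₂ P * E' P) + X P * ((deriv U P.1 : ℝ) : ℂ) * h₁ P * lowerLog (Q P) := by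
      rw [hEE' P hP0, show T P = T' P from hTT' P hP0]; ring
    rw [e]
    have hQn : ‖Q P‖ ≤ 1 / 2 := by
      have e1 := hUr₃ (x := P.1) (by
        have := hPO.1
        rw [← Real.ball_eq_Ioo] at this
        exact lt_of_lt_of_le this (by linarith))
      have e2 := hPO.2
      rw [Real.dist_eq] at e1
      rw [Metric.mem_ball, dist_eq_norm] at e2
      have e3 : Q P = ((U P.1 - U y₀ : ℝ) : ℂ) - (P.2 - U y₀) := by simp only [hQ]; push_cast; ring
      rw [e3]
      refine (norm_sub_le _ _).trans ?_
      rw [Complex.norm_real, Real.norm_eq_abs]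
      linarith
    have hQpos : 0 < ‖Q P‖ := norm_pos_iff.2 (hQ0 hPU)
    have hlog : |Real.log ‖Q P‖| ≤ ‖Complex.log (Q P)‖ := by
      have := Complex.abs_re_le_norm (Complex.log (Q P))
      rwa [Complex.log_re] at this
    have hlog' : Real.log 2 ≤ ‖Complex.log (Q P)‖ := by
      refine le_trans ?_ hlog
      have h3 : Real.log ‖Q P‖ ≤ - Real.log 2 := by
        rw [← Real.log_inv]
        exact Real.log_le_log hQpos (by linarith)
      rw [abs_of_nonpos (by linarith)]
      linarith
    have hL := norm_lowerLog_le (Q P)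
    have e1 := (hc3 P hPO).trans (le_abs_self c3)
    have e2 := (hc5 P hPO).trans (le_abs_self c5)
    have e3 := (hc4 P hPO).trans (le_abs_self c4)
    have e4 : ‖X P * ((deriv U P.1 : ℝ) : ℂ) * h₁ P * lowerLog (Q P)‖ ≤ |c4| * (‖Complex.log (Q P)‖ + Real.pi) := by
      rw [norm_mul]
      exact mul_le_mul e3 (hL.trans (by linarith)) (norm_nonneg _) (abs_nonneg _)
    have e5 : K ≤ K / Real.log 2 * ‖Complex.log (Q P)‖ := by
      calc K = K / Real.log 2 * Real.log 2 := by field_simp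
        _ ≤ _ := by gcongr
    calc _ ≤ |c3| + |c5| + |c4| * (‖Complex.log (Q P)‖ + Real.pi) :=
          (norm_add_le _ _).trans (add_le_add ((norm_add_le _ _).trans (add_le_add e1 e2)) e4)
      _ = K + |c4| * ‖Complex.log (Q P)‖ := by rw [hK]; ring
      _ ≤ K / Real.log 2 * ‖Complex.log (Q P)‖ + |c4| * ‖Complex.log (Q P)‖ := by linarith
      _ = (K / Real.log 2 + |c4|) * ‖Complex.log (Q P)‖ := by ring
      _ ≤ C * ‖Complex.log (Q P)‖ := by
          refine mul_le_mul_of_nonneg_right ?_ (norm_nonneg _)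
          rw [hC]
          linarith [abs_nonneg c1, abs_nonneg c2]

end SimpleLayer

/-! ### Elementary properties of the weight ζ. -/

section Weight

variable {n : ℕ} {z : ℝ}

theorem zetaWeight_of_nonneg (hz : 0 ≤ z) : zetaWeight n z = (1 + |z|) ^ n := if_pos hz

theorem zetaWeight_of_nonpos (hn : 1 ≤ n) (hz : z ≤ 0) : zetaWeight n z = ((1 + |z|) ^ (n - 1))⁻¹ := by
  rcases hz.eq_or_lt with rfl | hz
  · simp [zetaWeight]
  · rw [zetaWeight, if_neg (not_le.2 hz), show (1 - (n : ℤ)) = -((n - 1 : ℕ) : ℤ) by omega, zpow_neg, zpow_natCast]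

theorem zetaWeight_pos : 0 < zetaWeight n z := by
  have : 0 < 1 + |z| := by positivity
  unfold zetaWeight
  split_ifs <;> positivity

theorem zetaWeight_mono (hn : 1 ≤ n) : Monotone (zetaWeight n) := by
  intro x y hxy
  have h1 : ∀ x : ℝ, 0 ≤ x → 1 ≤ zetaWeight n x := fun x hx => by
    rw [zetaWeight_of_nonneg hx]; exact one_le_pow₀ (by linarith [abs_nonneg x])
  have h2 : ∀ x : ℝ, x ≤ 0 → zetaWeight n x ≤ 1 := fun x hx => by
    rw [zetaWeight_of_nonpos hn hx]; exact inv_le_one_of_one_le₀ (one_le_pow₀ (by linarith [abs_nonneg x]))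
  rcases le_total 0 x with hx | hx
  · rw [zetaWeight_of_nonneg hx, zetaWeight_of_nonneg (hx.trans hxy), abs_of_nonneg hx, abs_of_nonneg (hx.trans hxy)]
    gcongr
  · rcases le_total 0 y with hy | hy
    · exact (h2 x hx).trans (h1 y hy)
    · rw [zetaWeight_of_nonpos hn hx, zetaWeight_of_nonpos hn hy, abs_of_nonpos hx, abs_of_nonpos hy]
      have : 0 < 1 + -y := by linarith
      gcongr

theorem continuous_zetaWeight : Continuous (zetaWeight n) := by
  have h1 : ∀ z : ℝ, (1 + |z|) ≠ 0 := fun z => by positivity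
  refine Continuous.if_le (by fun_prop) ?_ continuous_const continuous_id fun x hx => ?_
  · exact Continuous.zpow₀ (by fun_prop) _ fun a => Or.inl (h1 a)
  · subst hx; simp

/-- The exponents n and 1 - n add up to 1. This linear growth is what makes the perturbation by β
cost only a factor ρ² on [-ρ, ρ]. -/
theorem zetaWeight_mul_neg (hn : 1 ≤ n) : zetaWeight n z * zetaWeight n (-z) = 1 + |z| := by
  have h1 : (1 + |z|) ≠ 0 := by positivity
  have h2 : (1 + |z|) ^ n = (1 + |z|) * (1 + |z|) ^ (n - 1) := by
    rw [← pow_succ', Nat.sub_add_cancel hn]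
  rcases le_total 0 z with hz | hz
  · rw [zetaWeight_of_nonneg hz, zetaWeight_of_nonpos hn (neg_nonpos.2 hz), abs_neg, h2]
    field_simp
  · rw [zetaWeight_of_nonneg (neg_nonneg.2 hz), zetaWeight_of_nonpos hn hz, abs_neg, h2]
    field_simp

theorem inv_le_zetaWeight (hn : 1 ≤ n) {K : ℝ} (hK : |z| ≤ K) : ((1 + K) ^ (n - 1))⁻¹ ≤ zetaWeight n z := by
  have hK0 : 0 ≤ K := (abs_nonneg z).trans hK
  refine le_trans ?_ (zetaWeight_mono hn (neg_le_of_abs_le hK))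
  rw [zetaWeight_of_nonpos hn (neg_nonpos.2 hK0), abs_neg, abs_of_nonneg hK0]

theorem pow_le_zetaWeight (hz : 0 ≤ z) : z ^ n ≤ zetaWeight n z := by
  rw [zetaWeight_of_nonneg hz, abs_of_nonneg hz]
  gcongr
  linarith

theorem inv_pow_le_zetaWeight (hn : 1 ≤ n) (hz : z ≤ -1) : ((-z) ^ (n - 1))⁻¹ ≤ 2 ^ n * zetaWeight n z := by
  rw [zetaWeight_of_nonpos hn (by linarith), abs_of_nonpos (by linarith)]
  have h0 : 0 < (-z) := by linarith
  have h1 : (1 + -z) ^ (n - 1) ≤ (2 * -z) ^ (n - 1) := by gcongr; linarith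
  have h2 : (2:ℝ) ^ (n - 1) ≤ 2 ^ n := pow_le_pow_right₀ (by norm_num) (by omega)
  rw [inv_eq_one_div, div_le_iff₀ (by positivity), ← div_eq_mul_inv, div_mul_eq_mul_div, le_div_iff₀ (by
    have : 0 < 1 + -z := by linarith
    positivity), one_mul]
  refine h1.trans ?_
  rw [mul_pow]
  gcongr

end Weight

/-! ### Bounds for (V - c) ∫ (V - c)⁻² on the scaled interval. -/

section ScaledProfile

/-- A profile on `[-ρ, ρ]` comparable to `z ^ n`, uniformly in `ρ`, with controlled derivatives. -/
structure IsScaledProfile (n : ℕ) (m M ρ : ℝ) (V V₁ V₂ V₃ G H : ℝ → ℝ) : Prop where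
  d₀ : ∀ z, HasDerivAt V (V₁ z) z
  d₁ : ∀ z, HasDerivAt V₁ (V₂ z) z
  d₂ : ∀ z, HasDerivAt V₂ (V₃ z) z
  cont₃ : Continuous V₃
  eq₀ : ∀ z, V z = z ^ n * G z
  eq₁ : ∀ z, V₁ z = z ^ (n - 1) * H z
  bG : ∀ z, |z| ≤ ρ → m ≤ G z ∧ G z ≤ M
  bH : ∀ z, |z| ≤ ρ → m ≤ H z ∧ H z ≤ M
  b₂ : ∀ z, |z| ≤ 2 / m → |V₂ z| ≤ M
  b₃ : ∀ z, |z| ≤ 2 / m → |V₃ z| ≤ M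

variable {n : ℕ} {m M ρ : ℝ} {V V₁ V₂ V₃ G H : ℝ → ℝ} {c : ℂ}

theorem IsScaledProfile.reflect (hn : 1 ≤ n) (h : IsScaledProfile n m M ρ V V₁ V₂ V₃ G H) :
    IsScaledProfile n m M ρ (fun z => (-1) ^ n * V (-z)) (fun z => (-1) ^ n * -V₁ (-z)) (fun z => (-1) ^ n * V₂ (-z))
      (fun z => (-1) ^ n * -V₃ (-z)) (fun z => G (-z)) fun z => H (-z) := by
  have hd : ∀ {f f' : ℝ → ℝ}, (∀ z, HasDerivAt f (f' z) z) → ∀ z, HasDerivAt (fun z => f (-z)) (-f' (-z)) z := by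
    intro f f' hf z
    exact (HasDerivAt.comp (h₂ := f) z (hf (-z)) (hasDerivAt_neg z)).congr_deriv (by ring)
  have hs : ∀ k : ℕ, ((-1 : ℝ) ^ k) * (-1) ^ k = 1 := fun k => by rw [← mul_pow]; simp
  have ha : ∀ x : ℝ, |(-1 : ℝ) ^ n * x| = |x| := fun x => by simp [abs_mul, abs_pow]
  refine ⟨fun z => (hd h.d₀ z).const_mul _, fun z => ?_, fun z => (hd h.d₂ z).const_mul _, ?_, fun z => ?_, fun z => ?_,
    fun z hz => h.bG _ (by rwa [abs_neg]), fun z hz => h.bH _ (by rwa [abs_neg]), fun z hz => ?_, fun z hz => ?_⟩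
  · exact ((hd h.d₁ z).neg.const_mul ((-1) ^ n)).congr_deriv (by ring)
  · have := h.cont₃; fun_prop
  · rw [h.eq₀, neg_pow z n]; linear_combination (z ^ n * G (-z)) * hs n
  · obtain ⟨k, rfl⟩ : ∃ k, n = k + 1 := ⟨n - 1, by omega⟩
    rw [h.eq₁, Nat.add_sub_cancel, neg_pow z k, pow_succ]; linear_combination (z ^ k * H (-z)) * hs k
  · rw [ha]; exact h.b₂ _ (by rwa [abs_neg])
  · rw [ha, abs_neg]; exact h.b₃ _ (by rwa [abs_neg])

theorem integral_inv_pow_le {k : ℕ} (hk : 1 ≤ k) {p z : ℝ} (hp : 0 < p) (hpz : p ≤ z) :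
    ∫ t in p..z, (t ^ (2 * k))⁻¹ ≤ (p ^ (2 * k - 1))⁻¹ := by
  have hne : ∀ t ∈ uIcc p z, t ≠ 0 := fun t ht => by
    rw [uIcc_of_le hpz] at ht; linarith [ht.1]
  have h1 : ∫ t in p..z, (p ^ (2 * k - 2))⁻¹ * (t ^ 2)⁻¹ = (p ^ (2 * k - 2))⁻¹ * (p⁻¹ - z⁻¹) := by
    rw [intervalIntegral.integral_const_mul, intervalIntegral.integral_eq_sub_of_hasDerivAt (f := fun t => -t⁻¹)]
    · ring
    · intro t ht
      exact (hasDerivAt_inv (hne t ht)).neg.congr_deriv (by simp)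
    · exact (ContinuousOn.inv₀ (by fun_prop) fun t ht => pow_ne_zero 2 (hne t ht)).intervalIntegrable
  have h2 : (p ^ (2 * k - 2))⁻¹ * (p⁻¹ - z⁻¹) ≤ (p ^ (2 * k - 1))⁻¹ := by
    have : (p ^ (2 * k - 1))⁻¹ = (p ^ (2 * k - 2))⁻¹ * p⁻¹ := by
      rw [show 2 * k - 1 = (2 * k - 2) + 1 by omega, pow_succ, mul_inv]
    rw [this]
    gcongr
    have : 0 < z := by linarith
    linarith [inv_pos.2 this]
  rw [← h1] at h2
  refine le_trans (intervalIntegral.integral_mono_on hpz ?_ ?_ fun t ht => ?_) h2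
  · exact (ContinuousOn.inv₀ (by fun_prop) fun t ht => pow_ne_zero _ (hne t ht)).intervalIntegrable
  · exact (ContinuousOn.mul continuousOn_const (ContinuousOn.inv₀ (by fun_prop) fun t ht => pow_ne_zero 2 (hne t ht))).intervalIntegrable
  · rw [← mul_inv, show 2 * k = (2 * k - 2) + 2 by omega, pow_add, Nat.add_sub_cancel]
    have h3 := ht.1
    have h4 : 0 < t := hp.trans_le h3
    gcongr

theorem integral_inv_pow_le_of_neg {k : ℕ} (hk : 1 ≤ k) {p z : ℝ} (hz : z < 0) (hpz : p ≤ z) :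
    ∫ t in p..z, (t ^ (2 * k))⁻¹ ≤ ((-z) ^ (2 * k - 1))⁻¹ := by
  have h := integral_inv_pow_le hk (neg_pos.2 hz) (neg_le_neg hpz)
  rw [← intervalIntegral.integral_comp_neg (fun t : ℝ => (t ^ (2 * k))⁻¹)] at h
  simpa only [Even.neg_pow (even_two_mul k)] using h

namespace IsScaledProfile

variable (h : IsScaledProfile n m M ρ V V₁ V₂ V₃ G H)
include h

theorem continuous_inv_sq (hc : c.im ≠ 0) : Continuous fun t => (((V t : ℂ) - c) ^ 2)⁻¹ := by
  have hV : Continuous V := continuous_iff_continuousAt.2 fun z => (h.d₀ z).continuousAt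
  exact Continuous.inv₀ (by fun_prop) fun t => pow_ne_zero 2 (sub_ne_zero_of_im hc _)

theorem norm_sub_le (hm : 0 < m) (hc : ‖c‖ = 1) {z : ℝ} (hz : |z| ≤ ρ) : ‖(V z : ℂ) - c‖ ≤ M * |z| ^ n + 1 := by
  refine (_root_.norm_sub_le _ _).trans ?_
  rw [Complex.norm_real, Real.norm_eq_abs, h.eq₀, abs_mul, abs_pow, hc, abs_of_nonneg (by linarith [(h.bG z hz).1] : 0 ≤ G z), mul_comm]
  have := (h.bG z hz).2
  gcongr

/-- Beyond 2/m the profile satisfies |V| ≥ m |z|ⁿ ≥ 2, so the unit number `c` takes away at most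
half. No layer lies there, which is why second and third derivatives need bounds only on |z| ≤ 2/m.
-/
theorem le_norm_sub (hm : 0 < m) (hm1 : m ≤ 1) (hn : 1 ≤ n) (hc : ‖c‖ = 1) {z : ℝ} (hz : |z| ≤ ρ) (hz' : 2 / m ≤ |z|) :
    m / 2 * |z| ^ n ≤ ‖(V z : ℂ) - c‖ := by
  have h1 : m * |z| ^ n ≤ ‖(V z : ℂ)‖ := by
    rw [Complex.norm_real, Real.norm_eq_abs, h.eq₀, abs_mul, abs_pow, abs_of_nonneg (by linarith [(h.bG z hz).1] : 0 ≤ G z), mul_comm]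
    gcongr
    exact (h.bG z hz).1
  have h2 : 1 ≤ |z| := le_trans (by rw [le_div_iff₀ hm]; linarith) hz'
  have h3 : 2 ≤ m * |z| ^ n := by
    rw [div_le_iff₀ hm] at hz'
    nlinarith [le_self_pow₀ h2 (by omega : n ≠ 0)]
  have h4 := norm_sub_norm_le (V z : ℂ) c
  rw [hc] at h4
  linarith

theorem half_le_norm_sub (hm : 0 < m) (hM : 1 ≤ M) (hn : 1 ≤ n) (hc : ‖c‖ = 1) {z : ℝ} (hz : |z| ≤ ρ) (hz' : |z| ≤ 1 / (2 * M)) :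
    1 / 2 ≤ ‖(V z : ℂ) - c‖ := by
  have h1 : ‖(V z : ℂ)‖ ≤ 1 / 2 := by
    rw [Complex.norm_real, Real.norm_eq_abs, h.eq₀, abs_mul, abs_pow, abs_of_nonneg (by linarith [(h.bG z hz).1] : 0 ≤ G z)]
    have h2 : |z| ≤ 1 := hz'.trans (by rw [div_le_one (by positivity)]; linarith)
    calc |z| ^ n * G z ≤ |z| * M := mul_le_mul (pow_le_of_le_one (abs_nonneg z) h2 (by omega)) (h.bG z hz).2
          (by linarith [(h.bG z hz).1]) (abs_nonneg z)
      _ ≤ 1 / (2 * M) * M := by gcongr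
      _ = 1 / 2 := by field_simp
  have h4 := norm_sub_norm_le c (V z : ℂ)
  rw [hc, norm_sub_rev] at h4
  linarith

theorem norm_integral_far_le (hm : 0 < m) (hm1 : m ≤ 1) (hn : 1 ≤ n) (hc : ‖c‖ = 1) {p z : ℝ} (hpz : p ≤ z)
    (hz : ∀ t ∈ Icc p z, |t| ≤ ρ ∧ 2 / m ≤ |t|) :
    ‖∫ t in p..z, (((V t : ℂ) - c) ^ 2)⁻¹‖ ≤ 4 / m ^ 2 * ∫ t in p..z, (t ^ (2 * n))⁻¹ := by
  rw [← intervalIntegral.integral_const_mul]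
  have h0 : 0 < 2 / m := by positivity
  refine intervalIntegral.norm_integral_le_of_norm_le hpz (Eventually.of_forall fun t ht => ?_) ?_
  · obtain ⟨h1, h2⟩ := hz t (Ioc_subset_Icc_self ht)
    have h3 := h.le_norm_sub hm hm1 hn hc h1 h2
    have h4 : 0 < |t| := h0.trans_le h2
    rw [norm_inv, norm_pow]
    calc (‖(V t : ℂ) - c‖ ^ 2)⁻¹ ≤ ((m / 2 * |t| ^ n) ^ 2)⁻¹ := by gcongr
      _ = 4 / m ^ 2 * (t ^ (2 * n))⁻¹ := by
        rw [mul_pow, ← pow_mul, mul_comm n 2, Even.pow_abs (even_two_mul n), mul_inv]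
        congr 1
        field_simp
        norm_num
  · refine (ContinuousOn.mul continuousOn_const (ContinuousOn.inv₀ (by fun_prop) fun t ht => pow_ne_zero _ ?_)).intervalIntegrable
    rw [uIcc_of_le hpz] at ht
    exact abs_pos.1 (h0.trans_le (hz t ht).2)

end IsScaledProfile

/-- `exists_norm_mul_integral_inv_sq_le` for profiles which are strictly monotone in either sense. -/
theorem exists_norm_mul_integral_inv_sq_le_of_sign {m K κ l : ℝ} (hm : 0 < m) (hK1 : 1 ≤ K) (hκ : 0 < κ) :
    ∃ C, ∀ (V V₁ V₂ V₃ : ℝ → ℝ) (p q : ℝ) (c : ℂ), p ≤ q → q - p ≤ l →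
      (∀ t, HasDerivAt V (V₁ t) t) → (∀ t, HasDerivAt V₁ (V₂ t) t) →
      (∀ t, HasDerivAt V₂ (V₃ t) t) → Continuous V₃ →
      ((∀ t ∈ Icc p q, m ≤ V₁ t) ∨ ∀ t ∈ Icc p q, m ≤ -V₁ t) → (∀ t ∈ Icc p q, |V₂ t| ≤ K) → (∀ t ∈ Icc p q, |V₃ t| ≤ K) →
      c.im ≠ 0 → (∀ t ∈ Icc p q, ‖(V t : ℂ) - c‖ ≤ K) → κ ≤ ‖(V p : ℂ) - c‖ →
      ∀ y ∈ Icc p q, ‖((V y : ℂ) - c) * ∫ t in p..y, (((V t : ℂ) - c) ^ 2)⁻¹‖ ≤ C := by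
  obtain ⟨C, hC⟩ := exists_norm_mul_integral_inv_sq_le (l := l) hm hK1 hκ
  refine ⟨C, fun V V₁ V₂ V₃ p q c hpq hl h0 h1 h2 h3 hs hb2 hb3 hc hK hκ y hy => ?_⟩
  rcases hs with hs | hs
  · exact hC V V₁ V₂ V₃ p q c hpq hl (fun t _ => h0 t) (fun t _ => h1 t) (fun t _ => h2 t) h3.continuousOn hs hb2 hb3 hc hK hκ y hy
  · have e : ∀ t, (((-V t : ℝ) : ℂ) - -c) = -((V t : ℂ) - c) := fun t => by push_cast; ring
    have := hC (fun t => -V t) (fun t => -V₁ t) (fun t => -V₂ t) (fun t => -V₃ t) p q (-c) hpq hl (fun t _ => (h0 t).neg)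
      (fun t _ => (h1 t).neg) (fun t _ => (h2 t).neg) h3.neg.continuousOn hs (fun t ht => by rw [abs_neg]; exact hb2 t ht)
      (fun t ht => by rw [abs_neg]; exact hb3 t ht) (by simpa using hc) (fun t ht => by rw [e, norm_neg]; exact hK t ht)
      (by rw [e, norm_neg]; exact hκ) y hy
    simp only [e, neg_sq] at this
    rwa [norm_mul, norm_neg, ← norm_mul] at this

/-- The interval is cut at ±K and ±k with K = 2/m, k = 1/(2M). On the far left the tail of t⁻²ⁿ
gives |z|ⁿ |z|¹⁻²ⁿ = |z|¹⁻ⁿ. On k ≤ |z| ≤ K the profile is strictly monotone and the simple layer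
bound applies; on |z| ≤ k, |V - c| ≥ 1/2. On the far right the integral stays bounded and only the
growth zⁿ of V - c remains. -/
theorem exists_norm_mul_integral_le_zetaWeight (hn : 1 ≤ n) (hm : 0 < m) (hm1 : m ≤ 1) (hM : 1 ≤ M) :
    ∃ C, 0 < C ∧ ∀ (ρ : ℝ) (V V₁ V₂ V₃ G H : ℝ → ℝ), 2 / m ≤ ρ → IsScaledProfile n m M ρ V V₁ V₂ V₃ G H →
      ∀ c : ℂ, ‖c‖ = 1 → c.im ≠ 0 → ∀ z ∈ Icc (-ρ) ρ,
      ‖((V z : ℂ) - c) * ∫ t in (-ρ)..z, (((V t : ℂ) - c) ^ 2)⁻¹‖ ≤ C * zetaWeight n z := by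
  set K : ℝ := 2 / m with hK
  set k : ℝ := 1 / (2 * M) with hk
  have hK2 : 2 ≤ K := by rw [hK, le_div_iff₀ hm]; linarith
  have hk0 : 0 < k := by positivity
  have hk1 : k ≤ 1 / 2 := by rw [hk, div_le_div_iff₀ (by positivity) (by norm_num)]; linarith
  set B : ℝ := M * K ^ n + 1 with hB
  have hKn : 1 ≤ K ^ n := one_le_pow₀ (by linarith)
  have hBM : M ≤ B := by nlinarith
  have hB1 : 1 ≤ B := by linarith
  obtain ⟨C₁, hC₁⟩ := exists_norm_mul_integral_inv_sq_le_of_sign (m := m * k ^ (n - 1)) (K := B) (κ := 1 / 2) (l := K)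
    (by positivity) hB1 (by norm_num)
  set A : ℝ := 4 / m ^ 2 with hA
  have hA0 : 0 < A := by positivity
  set B₁ := B * A + |C₁| with hB₁
  set B₂ := 2 * B₁ + 4 with hB₂
  set B₃ := B * B₂ + |C₁| with hB₃
  have hB₁0 : 0 ≤ B₁ := by positivity
  have hB₂0 : 0 ≤ B₂ := by positivity
  have hB₃0 : 0 ≤ B₃ := by positivity
  have hB12 : B₁ ≤ B₃ := by nlinarith [abs_nonneg C₁]
  refine ⟨A * (M + 1) * 2 ^ n + B₃ * (1 + K) ^ (n - 1) + (M + 1) * (B₃ + A), by positivity, ?_⟩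
  intro ρ V V₁ V₂ V₃ G H hρ h c hc hci z hz
  have hζ : 0 < zetaWeight n z := zetaWeight_pos
  have hW := h.continuous_inv_sq hci
  set I : ℝ → ℂ := fun z => ∫ t in (-ρ)..z, (((V t : ℂ) - c) ^ 2)⁻¹ with hI
  have hsplit : ∀ p q, I q = I p + ∫ t in p..q, (((V t : ℂ) - c) ^ 2)⁻¹ := fun p q =>
    (intervalIntegral.integral_add_adjacent_intervals (hW.intervalIntegrable _ _) (hW.intervalIntegrable _ _)).symm
  have hQB : ∀ t, |t| ≤ K → ‖(V t : ℂ) - c‖ ≤ B := fun t ht => by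
    refine (h.norm_sub_le hm hc (ht.trans hρ)).trans ?_
    rw [hB]; gcongr
  have hfar : ∀ t, |t| ≤ ρ → K ≤ |t| → ‖(V t : ℂ) - c‖ ≤ (M + 1) * |t| ^ n := fun t ht ht' => by
    refine (h.norm_sub_le hm hc ht).trans ?_
    have : 1 ≤ |t| ^ n := one_le_pow₀ (by linarith)
    linarith
  have h1 : ∀ z, -ρ ≤ z → z ≤ -K → ‖I z‖ ≤ A * ((-z) ^ (2 * n - 1))⁻¹ := fun z hz1 hz2 => by
    refine (h.norm_integral_far_le hm hm1 hn hc hz1 fun t ht => ?_).trans ?_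
    · rw [abs_of_nonpos (by linarith [ht.2])]
      exact ⟨by linarith [ht.1], by linarith [ht.2]⟩
    · gcongr
      exact integral_inv_pow_le_of_neg hn (by linarith) hz1
  have hsgn₁ : (∀ t ∈ Icc k K, m * k ^ (n - 1) ≤ V₁ t) ∨ ∀ t ∈ Icc k K, m * k ^ (n - 1) ≤ -V₁ t := by
    left
    intro t ht
    rw [h.eq₁, mul_comm]
    have := (h.bH t (by rw [abs_of_nonneg (by linarith [ht.1])]; linarith [ht.2])).1
    have h3 := ht.1
    have h4 : 0 ≤ t := by linarith
    gcongr
  have hsgn₂ : (∀ t ∈ Icc (-K) (-k), m * k ^ (n - 1) ≤ V₁ t) ∨ ∀ t ∈ Icc (-K) (-k), m * k ^ (n - 1) ≤ -V₁ t := by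
    have h2 : ∀ t ∈ Icc (-K) (-k), m * k ^ (n - 1) ≤ (-t) ^ (n - 1) * H t := fun t ht => by
      rw [mul_comm]
      have := (h.bH t (by rw [abs_of_nonpos (by linarith [ht.2])]; linarith [ht.1])).1
      have h3 : k ≤ -t := by linarith [ht.2]
      have h4 : 0 ≤ -t := by linarith
      gcongr
    rcases Nat.even_or_odd (n - 1) with he | ho
    · refine Or.inl fun t ht => ?_
      rw [h.eq₁, ← he.neg_pow t]; exact h2 t ht
    · refine Or.inr fun t ht => ?_
      rw [h.eq₁, ← neg_mul, ← ho.neg_pow t]; exact h2 t ht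
  have hmid : ∀ p q : ℝ, p ≤ q → q - p ≤ K → ((∀ t ∈ Icc p q, m * k ^ (n - 1) ≤ V₁ t) ∨ ∀ t ∈ Icc p q, m * k ^ (n - 1) ≤ -V₁ t) →
      -K ≤ p → q ≤ K → 1 / 2 ≤ ‖(V p : ℂ) - c‖ → ∀ z ∈ Icc p q, ‖((V z : ℂ) - c) * I z‖ ≤ B * ‖I p‖ + |C₁| := by
    intro p q hpq hl hs hp hq hκ z hz
    have habs : ∀ t ∈ Icc p q, |t| ≤ K := fun t ht => abs_le.2 ⟨by linarith [ht.1], by linarith [ht.2]⟩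
    have h3 := hC₁ V V₁ V₂ V₃ p q c hpq hl h.d₀ h.d₁ h.d₂ h.cont₃ hs (fun t ht => (h.b₂ t (habs t ht)).trans hBM)
      (fun t ht => (h.b₃ t (habs t ht)).trans hBM) hci (fun t ht => hQB t (habs t ht)) hκ z hz
    rw [hsplit p z, mul_add]
    refine (norm_add_le _ _).trans (add_le_add ?_ (h3.trans (le_abs_self _)))
    rw [norm_mul]
    have := hQB z (habs z hz)
    gcongr
  have hone : 1 ≤ m / 2 * K ^ n := by
    have : K ≤ K ^ n := le_self_pow₀ (by linarith) (by omega)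
    calc 1 = m / 2 * K := by rw [hK]; field_simp
      _ ≤ _ := by gcongr
  have hKabs : |K| = K := abs_of_nonneg (by linarith)
  have hkabs : |k| = k := abs_of_nonneg hk0.le
  have hQK : ∀ t, |t| = K → 1 ≤ ‖(V t : ℂ) - c‖ := fun t ht => by
    have := h.le_norm_sub hm hm1 hn hc (z := t) (by rw [ht]; exact hρ) (by rw [ht])
    rw [ht] at this; linarith
  have hQk : ∀ t, |t| ≤ k → 1 / 2 ≤ ‖(V t : ℂ) - c‖ := fun t ht =>
    h.half_le_norm_sub hm hM hn hc (by linarith) ht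
  have hI1 : ‖I (-K)‖ ≤ A := by
    refine (h1 (-K) (by linarith) le_rfl).trans (mul_le_of_le_one_right hA0.le ?_)
    rw [neg_neg]
    exact inv_le_one_of_one_le₀ (one_le_pow₀ (by linarith))
  have hII : ∀ t b κ : ℝ, 0 < κ → κ ≤ ‖(V t : ℂ) - c‖ → ‖((V t : ℂ) - c) * I t‖ ≤ b → ‖I t‖ ≤ b / κ := by
    intro t b κ hκ h3 h4
    rw [norm_mul] at h4
    rw [le_div_iff₀ hκ, mul_comm]
    exact (mul_le_mul_of_nonneg_right h3 (norm_nonneg _)).trans h4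
  have hM1 : ∀ z ∈ Icc (-K) (-k), ‖((V z : ℂ) - c) * I z‖ ≤ B₁ := fun z hz => by
    refine (hmid (-K) (-k) (by linarith) (by linarith) hsgn₂ le_rfl (by linarith) (by
      have := hQK (-K) (by rw [abs_neg, hKabs]); linarith) z hz).trans ?_
    rw [hB₁]; gcongr
  have hM2 : ∀ z ∈ Icc (-k) k, ‖I z‖ ≤ B₂ := fun z hz => by
    have h3 := hII (-k) _ (1 / 2) (by norm_num) (hQk _ (by rw [abs_neg, hkabs])) (hM1 (-k) ⟨by linarith, le_rfl⟩)
    rw [hsplit (-k) z]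
    have h4 : ‖∫ t in (-k)..z, (((V t : ℂ) - c) ^ 2)⁻¹‖ ≤ 4 * |z - -k| := by
      refine intervalIntegral.norm_integral_le_of_norm_le_const fun t ht => ?_
      rw [uIoc_of_le hz.1] at ht
      have h5 := hQk t (abs_le.2 ⟨ht.1.le, ht.2.trans hz.2⟩)
      rw [norm_inv, norm_pow]
      calc (‖(V t : ℂ) - c‖ ^ 2)⁻¹ ≤ ((1 / 2) ^ 2)⁻¹ := by gcongr
        _ = 4 := by norm_num
    rw [abs_of_nonneg (by linarith [hz.1])] at h4
    refine (norm_add_le _ _).trans ?_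
    linarith [hz.2]
  have hM3 : ∀ z ∈ Icc k K, ‖((V z : ℂ) - c) * I z‖ ≤ B₃ := fun z hz => by
    refine (hmid k K (by linarith) (by linarith) hsgn₁ (by linarith) le_rfl (hQk k hkabs.le) z hz).trans ?_
    have := hM2 k ⟨by linarith, le_rfl⟩
    rw [hB₃]; gcongr
  have hmidall : |z| ≤ K → ‖((V z : ℂ) - c) * I z‖ ≤ B₃ * (1 + K) ^ (n - 1) * zetaWeight n z := by
    intro hzK
    have h3 : ‖((V z : ℂ) - c) * I z‖ ≤ B₃ := by
      rw [abs_le] at hzK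
      rcases le_total z (-k) with h4 | h4
      · exact (hM1 z ⟨hzK.1, h4⟩).trans hB12
      rcases le_total z k with h5 | h5
      · rw [norm_mul]
        have := hM2 z ⟨h4, h5⟩
        have := hQB z (abs_le.2 hzK)
        refine (mul_le_mul ‹_› ‹_› (norm_nonneg _) (by linarith)).trans ?_
        linarith [abs_nonneg C₁]
      · exact hM3 z ⟨h5, hzK.2⟩
    have h4 := inv_le_zetaWeight hn hzK
    rw [inv_le_iff_one_le_mul₀ (by positivity)] at h4
    calc _ ≤ B₃ * 1 := by linarith
      _ ≤ B₃ * (zetaWeight n z * (1 + K) ^ (n - 1)) := by gcongr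
      _ = _ := by ring
  have hz' : |z| ≤ ρ := abs_le.2 hz
  have e1 : 0 ≤ A * (M + 1) * 2 ^ n := by positivity
  have e2 : 0 ≤ B₃ * (1 + K) ^ (n - 1) := by positivity
  have e3 : 0 ≤ (M + 1) * (B₃ + A) := by positivity
  rcases le_total z (-K) with h3 | h3
  · have h4 : ‖((V z : ℂ) - c) * I z‖ ≤ A * (M + 1) * 2 ^ n * zetaWeight n z := by
      have h5 := hfar z hz' (by rw [abs_of_nonpos (by linarith)]; linarith)
      rw [abs_of_nonpos (by linarith)] at h5
      have h6 : 0 < -z := by linarith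
      calc _ ≤ ((M + 1) * (-z) ^ n) * (A * ((-z) ^ (2 * n - 1))⁻¹) := by
            rw [norm_mul]
            exact mul_le_mul h5 (h1 z hz.1 h3) (norm_nonneg _) (by positivity)
        _ = A * (M + 1) * ((-z) ^ (n - 1))⁻¹ := by
            rw [show 2 * n - 1 = n + (n - 1) by omega, pow_add]
            field_simp
        _ ≤ A * (M + 1) * (2 ^ n * zetaWeight n z) := by
            gcongr
            exact inv_pow_le_zetaWeight hn (by linarith)
        _ = _ := by ring
    exact h4.trans (mul_le_mul_of_nonneg_right (by linarith) hζ.le)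
  rcases le_total z K with h4 | h4
  · exact (hmidall (abs_le.2 ⟨h3, h4⟩)).trans (mul_le_mul_of_nonneg_right (by linarith) hζ.le)
  · have h5 : ‖I z‖ ≤ B₃ + A := by
      rw [hsplit K z]
      refine (norm_add_le _ _).trans (add_le_add ?_ ?_)
      · have := hII K _ 1 one_pos (hQK K hKabs) (hM3 K ⟨by linarith, le_rfl⟩)
        rwa [div_one] at this
      · refine (h.norm_integral_far_le hm hm1 hn hc h4 fun t ht => ?_).trans (mul_le_of_le_one_right hA0.le ?_)
        · rw [abs_of_nonneg (by linarith [ht.1])]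
          exact ⟨by linarith [ht.2, hz.2], ht.1⟩
        · exact (integral_inv_pow_le hn (by linarith) h4).trans (inv_le_one_of_one_le₀ (one_le_pow₀ (by linarith)))
    have h6 := hfar z hz' (by rw [abs_of_nonneg (by linarith)]; linarith)
    rw [abs_of_nonneg (by linarith)] at h6
    have h7 : ‖((V z : ℂ) - c) * I z‖ ≤ (M + 1) * (B₃ + A) * zetaWeight n z := by
      calc _ ≤ ((M + 1) * z ^ n) * (B₃ + A) := by
            rw [norm_mul]
            have : 0 ≤ z ^ n := pow_nonneg (by linarith) n
            exact mul_le_mul h6 h5 (norm_nonneg _) (by positivity)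
        _ = (M + 1) * (B₃ + A) * z ^ n := by ring
        _ ≤ _ := by
          gcongr
          exact pow_le_zetaWeight (by linarith)
    exact h7.trans (mul_le_mul_of_nonneg_right (by linarith) hζ.le)

end ScaledProfile

/-! ### Lower bound for the complete integral of (V - c)⁻². -/

section ScaledProfile

variable {n : ℕ} {m M ρ : ℝ} {V V₁ V₂ V₃ G H : ℝ → ℝ} {c : ℂ}

/-- A functional that is nonnegative on the integrand excludes cancellation, so a subinterval
already bounds the integral. One factor 2 is lost to f ≥ 1/2, another to the size of Λ. -/
theorem le_norm_integral_of_clm {f : ℝ → ℝ} {g : ℝ → ℂ} {ρ p q e : ℝ} (Λ : ℂ →L[ℝ] ℝ) (hΛ : ∀ w, Λ w ≤ 2 * ‖w‖)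
    (hf : ContinuousOn f (Icc (-ρ) ρ)) (hf2 : ∀ z ∈ Icc (-ρ) ρ, 1 / 2 ≤ f z) (hg : Continuous g)
    (h0 : ∀ t ∈ Icc (-ρ) ρ, 0 ≤ Λ (g t)) (hp : -ρ ≤ p) (hpq : p ≤ q) (hq : q ≤ ρ) (he0 : 0 ≤ e) (he : ∀ t ∈ Icc p q, e ≤ Λ (g t)) :
    e * (q - p) / 4 ≤ ‖∫ t in (-ρ)..ρ, (f t : ℂ) * g t‖ := by
  have hρ : -ρ ≤ ρ := hp.trans (hpq.trans hq)
  have hsub : Icc p q ⊆ Icc (-ρ) ρ := Icc_subset_Icc hp hq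
  have hfg : ContinuousOn (fun t => (f t : ℂ) * g t) (uIcc (-ρ) ρ) := by
    rw [uIcc_of_le hρ]
    exact (Complex.continuous_ofReal.comp_continuousOn hf).mul hg.continuousOn
  have h1 := Λ.intervalIntegral_comp_comm (hfg.intervalIntegrable (μ := volume))
  have hΛf : ∀ t, Λ ((f t : ℂ) * g t) = f t * Λ (g t) := fun t => by
    rw [← Complex.real_smul, map_smul, smul_eq_mul]
  simp only [hΛf] at h1
  have hc : ContinuousOn (fun t => f t * Λ (g t)) (Icc (-ρ) ρ) := hf.mul (Λ.continuous.comp hg).continuousOn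
  have h2 : ∫ t in p..q, (1 / 2 * e) ≤ ∫ t in p..q, f t * Λ (g t) := by
    refine intervalIntegral.integral_mono_on hpq (by simp) ?_ fun t ht => ?_
    · exact (hc.mono (by rw [uIcc_of_le hpq]; exact hsub)).intervalIntegrable
    · exact mul_le_mul (hf2 t (hsub ht)) (he t ht) he0 (by linarith [hf2 t (hsub ht)])
  have h3 : ∫ t in p..q, f t * Λ (g t) ≤ ∫ t in (-ρ)..ρ, f t * Λ (g t) := by
    refine intervalIntegral.integral_mono_interval hp hpq hq ?_ ?_
    · refine (ae_restrict_iff' measurableSet_Ioc).2 (Eventually.of_forall fun t ht => ?_)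
      have := Ioc_subset_Icc_self ht
      exact mul_nonneg (by linarith [hf2 t this]) (h0 t this)
    · rw [← uIcc_of_le hρ] at hc
      exact hc.intervalIntegrable
  rw [intervalIntegral.integral_const, smul_eq_mul] at h2
  have h4 := hΛ (∫ t in (-ρ)..ρ, (f t : ℂ) * g t)
  rw [h1] at h3
  linarith

/-- For μ = n V/V₁ one has (μ/Q)' = -f/Q - n c/Q². So n c times the integral of Q⁻² is, up to sign
and boundary terms, the integral of f/Q, whose integrand is less singular and has a definite sign
under a suitable functional. -/
theorem exists_le_norm_integral (hn : 2 ≤ n) (hm : 0 < m) (hm1 : m ≤ 1) (hM : 1 ≤ M) :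
    ∃ C₁ > 0, ∃ ρ₀ ≥ 2 / m, ∀ (ρ : ℝ) (V V₁ V₂ V₃ G H μ f : ℝ → ℝ), ρ₀ ≤ ρ → IsScaledProfile n m M ρ V V₁ V₂ V₃ G H →
      (∀ z ∈ Icc (-ρ) ρ, HasDerivAt μ (n - f z) z) → (∀ z ∈ Icc (-ρ) ρ, μ z * V₁ z = n * V z) →
      (∀ z ∈ Icc (-ρ) ρ, |μ z| ≤ M * |z|) → (∀ z ∈ Icc (-ρ) ρ, 1 / 2 ≤ f z) → ContinuousOn f (Icc (-ρ) ρ) →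
      ∀ c : ℂ, ‖c‖ = 1 → c.im ≠ 0 → C₁ ≤ ‖∫ t in (-ρ)..ρ, (((V t : ℂ) - c) ^ 2)⁻¹‖ := by
  set K : ℝ := 2 / m with hK
  set k : ℝ := 1 / (2 * M) with hk
  have hK2 : 2 ≤ K := by rw [hK, le_div_iff₀ hm]; linarith
  have hk0 : 0 < k := by positivity
  have hk1 : k ≤ 1 / 2 := by rw [hk, div_le_div_iff₀ (by positivity) (by norm_num)]; linarith
  set L : ℝ := M * (K + 1) ^ (n - 1) with hL
  have hL1 : 1 ≤ L := one_le_mul_of_one_le_of_one_le hM (one_le_pow₀ (by linarith))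
  -- The two entries are the lower bounds obtained when V does, respectively does not, take the
  -- value Re c on [-K, K].
  set e : ℝ := min (1 / (8 * L)) (k / 16) with he_def
  have he0 : 0 < e := lt_min (by positivity) (by positivity)
  have hn0 : (0:ℝ) < n := by exact_mod_cast (by omega : 0 < n)
  -- The second radius makes each boundary term at most e/4, which leaves e/2. The first leaves room
  -- for an interval of length one to the right of a point of [-K, K].
  refine ⟨e / (2 * n), by positivity, max (K + 1) (8 * M / (m * e)), le_max_of_le_left (by linarith), ?_⟩
  intro ρ V V₁ V₂ V₃ G H μ f hρ h hμ hμV hμb hf hfc c hc hci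
  have hρK : K + 1 ≤ ρ := (le_max_left _ _).trans hρ
  have hρe : 8 * M / (m * e) ≤ ρ := (le_max_right _ _).trans hρ
  have hρ0 : 0 < ρ := by linarith
  have hVc : Continuous V := continuous_iff_continuousAt.2 fun z => (h.d₀ z).continuousAt
  have hQ0 : ∀ t, (V t : ℂ) - c ≠ 0 := fun t => sub_ne_zero_of_im hci _
  have hW := h.continuous_inv_sq hci
  have hg : Continuous fun t => ((V t : ℂ) - c)⁻¹ := Continuous.inv₀ (by fun_prop) hQ0
  have hre : ∀ t, (((V t : ℂ) - c)⁻¹).re = (V t - c.re) / Complex.normSq ((V t : ℂ) - c) := fun t => by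
    rw [Complex.inv_re]; simp
  have him : ∀ t, (((V t : ℂ) - c)⁻¹).im = c.im / Complex.normSq ((V t : ℂ) - c) := fun t => by
    rw [Complex.inv_im]; simp
  have hns : ∀ t, 0 < Complex.normSq ((V t : ℂ) - c) := fun t => Complex.normSq_pos.2 (hQ0 t)
  have hnsq : ∀ t, Complex.normSq ((V t : ℂ) - c) = (V t - c.re) ^ 2 + c.im ^ 2 := fun t => by
    rw [Complex.normSq_apply]; simp; ring
  have hc2 : c.re ^ 2 + c.im ^ 2 = 1 := by
    have := Complex.sq_norm c
    rw [hc, Complex.normSq_apply] at this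
    linarith
  have hb0 : 0 < |c.im| := abs_pos.2 hci
  have hb1 : |c.im| ≤ 1 := hc ▸ Complex.abs_im_le_norm c
  have ha1 : |c.re| ≤ 1 := hc ▸ Complex.abs_re_le_norm c
  obtain ⟨σ, hσ, hσb⟩ : ∃ σ : ℝ, |σ| = 1 ∧ σ * c.im = |c.im| := by
    rcases le_total 0 c.im with h0 | h0
    · exact ⟨1, by simp, by rw [abs_of_nonneg h0, one_mul]⟩
    · exact ⟨-1, by simp, by rw [abs_of_nonpos h0]; ring⟩
  have hS : e ≤ ‖∫ t in (-ρ)..ρ, (f t : ℂ) * ((V t : ℂ) - c)⁻¹‖ := by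
    have hσim : ∀ w : ℂ, σ * w.im ≤ ‖w‖ := fun w => (le_abs_self _).trans (by
      rw [abs_mul, hσ, one_mul]; exact Complex.abs_im_le_norm w)
    -- If there is a layer point z₁, the imaginary part of 1/Q has a constant sign. On an interval
    -- of length |Im c|/L it is at least 1/(2 |Im c|) in size, so its mass does not depend on Im c.
    by_cases hz : ∃ z₁ ∈ Icc (-K) K, V z₁ = c.re
    · obtain ⟨z₁, hz₁, hVz⟩ := hz
      have hl1 : |c.im| / L ≤ 1 := by rw [div_le_one (by linarith)]; linarith
      have hl0 : 0 < |c.im| / L := by positivity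
      have hLip : ∀ t ∈ Icc z₁ (z₁ + |c.im| / L), |V t - c.re| ≤ |c.im| := by
        intro t ht
        have h1 := (convex_Icc z₁ (z₁ + |c.im| / L)).norm_image_sub_le_of_norm_hasDerivWithin_le (f := V) (f' := V₁) (C := L)
          (fun x _ => (h.d₀ x).hasDerivWithinAt) (fun x hx => ?_) (left_mem_Icc.2 (by linarith)) ht
        · rw [hVz, Real.norm_eq_abs, Real.norm_eq_abs, abs_of_nonneg (by linarith [ht.1] : 0 ≤ t - z₁)] at h1
          refine h1.trans ?_
          calc L * (t - z₁) ≤ L * (|c.im| / L) := by gcongr; linarith [ht.2]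
            _ = |c.im| := by field_simp
        · have h2 : |x| ≤ K + 1 := abs_le.2 ⟨by linarith [hx.1, hz₁.1], by linarith [hx.2, hz₁.2]⟩
          obtain ⟨h3, h4⟩ := h.bH x (h2.trans hρK)
          rw [h.eq₁, norm_mul, norm_pow, Real.norm_eq_abs, Real.norm_eq_abs, abs_of_nonneg (by linarith : 0 ≤ H x), mul_comm, hL]
          gcongr
      refine le_trans ?_ (le_norm_integral_of_clm (p := z₁) (q := z₁ + |c.im| / L) (e := 1 / (2 * |c.im|)) (σ • Complex.imCLM)
        (fun w => ?_) hfc hf hg (fun t _ => ?_) (by linarith [hz₁.1]) (by linarith) (by linarith [hz₁.2]) (by positivity) fun t ht => ?_)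
      · rw [add_sub_cancel_left]
        refine (min_le_left _ _).trans (le_of_eq ?_)
        field_simp
        norm_num
      · simp only [_root_.smul_apply, Complex.imCLM_apply, smul_eq_mul]
        linarith [hσim w, norm_nonneg w]
      · simp only [_root_.smul_apply, Complex.imCLM_apply, smul_eq_mul, him]
        rw [← mul_div_assoc, hσb]
        exact div_nonneg hb0.le (hns t).le
      · simp only [_root_.smul_apply, Complex.imCLM_apply, smul_eq_mul, him]
        rw [← mul_div_assoc, hσb, div_le_div_iff₀ (by positivity) (hns t), one_mul, hnsq, ← sq_abs c.im, ← sq_abs (V t - c.re)]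
        have := hLip t ht
        nlinarith [abs_nonneg (V t - c.re)]
    -- Without a layer point the intermediate value theorem forces Re c < 0, n even and V ≥ 0. Then
    -- real part plus |imaginary part| of 1/Q is nonnegative, and at least 1/4 near the origin.
    · push Not at hz
      have hV0 : V 0 = 0 := by rw [h.eq₀, zero_pow (by omega), zero_mul]
      have hVK : ∀ z, |z| = K → 2 ≤ |V z| := fun z hz => by
        have h1 := (h.bG z (by rw [hz]; linarith)).1
        rw [h.eq₀, abs_mul, abs_pow, hz, abs_of_nonneg (by linarith)]
        calc (2:ℝ) = K * m := by rw [hK]; field_simp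
          _ ≤ K ^ n * G z := by
            gcongr
            exact le_self_pow₀ (by linarith) (by omega)
      have ha := abs_le.1 ha1
      have hre0 : c.re < 0 := by
        by_contra! h0
        have h1 : 0 ≤ V K := by
          rw [h.eq₀]; exact mul_nonneg (pow_nonneg (by linarith) n) (by
            linarith [(h.bG K (by rw [abs_of_nonneg (by linarith)]; linarith)).1])
        have h2 := hVK K (abs_of_nonneg (by linarith))
        rw [abs_of_nonneg h1] at h2
        obtain ⟨z₁, hz₁, h3⟩ := intermediate_value_Icc (by linarith : (0:ℝ) ≤ K) hVc.continuousOn (show c.re ∈ Icc (V 0) (V K) from ⟨by rw [hV0]; exact h0, by linarith⟩)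
        exact hz z₁ ⟨by linarith [hz₁.1], hz₁.2⟩ h3
      have heven : Even n := by
        by_contra ho
        rw [Nat.not_even_iff_odd] at ho
        have h1 : V (-K) ≤ 0 := by
          rw [h.eq₀, ho.neg_pow, neg_mul, neg_nonpos]; exact mul_nonneg (pow_nonneg (by linarith) n) (by
            linarith [(h.bG (-K) (by rw [abs_neg, abs_of_nonneg (by linarith)]; linarith)).1])
        have h2 := hVK (-K) (by rw [abs_neg, abs_of_nonneg (by linarith)])
        rw [abs_of_nonpos h1] at h2
        obtain ⟨z₁, hz₁, h3⟩ := intermediate_value_Icc (by linarith : -K ≤ 0) hVc.continuousOn (show c.re ∈ Icc (V (-K)) (V 0) from ⟨by linarith, by rw [hV0]; exact hre0.le⟩)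
        exact hz z₁ ⟨hz₁.1, by linarith [hz₁.2]⟩ h3
      have hVnn : ∀ t ∈ Icc (-ρ) ρ, 0 ≤ V t := fun t ht => by
        rw [h.eq₀]; exact mul_nonneg (heven.pow_nonneg t) (by linarith [(h.bG t (abs_le.2 ht)).1])
      have hsum : 1 ≤ -c.re + |c.im| := by
        nlinarith [sq_abs c.im, abs_nonneg c.im]
      refine le_trans ?_ (le_norm_integral_of_clm (p := 0) (q := k) (e := 1 / 4) (Complex.reCLM + σ • Complex.imCLM)
        (fun w => ?_) hfc hf hg (fun t ht => ?_) (by linarith) hk0.le (by linarith) (by norm_num) fun t ht => ?_)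
      · exact (min_le_right _ _).trans (by linarith)
      · simp only [_root_.add_apply, _root_.smul_apply, Complex.imCLM_apply, Complex.reCLM_apply, smul_eq_mul]
        linarith [hσim w, Complex.re_le_norm w]
      · simp only [_root_.add_apply, _root_.smul_apply, Complex.imCLM_apply, Complex.reCLM_apply, smul_eq_mul, him, hre]
        rw [← mul_div_assoc, hσb, ← add_div]
        exact div_nonneg (by linarith [hVnn t ht]) (hns t).le
      · simp only [_root_.add_apply, _root_.smul_apply, Complex.imCLM_apply, Complex.reCLM_apply, smul_eq_mul, him, hre]
        have htρ : t ∈ Icc (-ρ) ρ := ⟨by linarith [ht.1], by linarith [ht.2]⟩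
        have hV1 : V t ≤ 1 := by
          have h1 := h.bG t (abs_le.2 htρ)
          rw [h.eq₀]
          have h2 : t ^ n ≤ k := (pow_le_of_le_one ht.1 (by linarith [ht.2]) (by omega)).trans ht.2
          calc t ^ n * G t ≤ k * M := mul_le_mul h2 h1.2 (by linarith) hk0.le
            _ = 1 / 2 := by rw [hk]; field_simp
            _ ≤ 1 := by norm_num
        have hV2 := hVnn t htρ
        rw [← mul_div_assoc, hσb, ← add_div, div_le_div_iff₀ (by norm_num) (hns t), hnsq]
        nlinarith
  have hFd : ∀ t ∈ uIcc (-ρ) ρ, HasDerivAt (fun t => (μ t : ℂ) * ((V t : ℂ) - c)⁻¹)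
      (-((f t : ℂ) * ((V t : ℂ) - c)⁻¹) - n * c * (((V t : ℂ) - c) ^ 2)⁻¹) t := by
    intro t ht
    rw [uIcc_of_le (by linarith)] at ht
    refine ((hμ t ht).ofReal_comp.mul ((hasDerivAt_ofReal_sub (h.d₀ t) c).inv (hQ0 t))).congr_deriv ?_
    have e1 : (μ t : ℂ) * (V₁ t : ℂ) = n * (V t : ℂ) := by exact_mod_cast hμV t ht
    have := hQ0 t
    simp only [Pi.inv_apply]
    push_cast
    field_simp
    linear_combination -e1
  have hfg : ContinuousOn (fun t => (f t : ℂ) * ((V t : ℂ) - c)⁻¹) (uIcc (-ρ) ρ) := by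
    rw [uIcc_of_le (by linarith)]
    exact (Complex.continuous_ofReal.comp_continuousOn hfc).mul hg.continuousOn
  have hint := intervalIntegral.integral_eq_sub_of_hasDerivAt hFd
    (ContinuousOn.intervalIntegrable (hfg.neg.sub (continuous_const.mul hW).continuousOn))
  have hi₁ : IntervalIntegrable (fun t => -((f t : ℂ) * ((V t : ℂ) - c)⁻¹)) volume (-ρ) ρ := hfg.neg.intervalIntegrable
  have hi₂ : IntervalIntegrable (fun t => n * c * (((V t : ℂ) - c) ^ 2)⁻¹) volume (-ρ) ρ :=
    (continuous_const.mul hW).intervalIntegrable _ _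
  rw [intervalIntegral.integral_sub hi₁ hi₂,
    intervalIntegral.integral_neg, intervalIntegral.integral_const_mul] at hint
  -- Here n ≥ 2 enters: μ grows linearly and Q at least quadratically, so the boundary terms are
  -- O(1/ρ).
  have hbd : ∀ t, |t| = ρ → t ∈ Icc (-ρ) ρ → ‖(μ t : ℂ) * ((V t : ℂ) - c)⁻¹‖ ≤ e / 4 := by
    intro t ht ht'
    have h1 := h.le_norm_sub hm hm1 (by omega) hc ht.le (by rw [ht]; linarith)
    have h2 := hμb t ht'
    rw [ht] at h1 h2
    have h3 : ρ ^ 2 ≤ ρ ^ n := pow_le_pow_right₀ (by linarith) hn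
    rw [norm_mul, norm_inv, Complex.norm_real, Real.norm_eq_abs]
    rw [div_le_iff₀ (by positivity)] at hρe
    calc |μ t| * ‖(V t : ℂ) - c‖⁻¹ ≤ (M * ρ) * (m / 2 * ρ ^ 2)⁻¹ := by
          gcongr
          exact le_trans (by gcongr) h1
      _ = 2 * M / (m * ρ) := by field_simp
      _ ≤ e / 4 := by
        rw [div_le_div_iff₀ (by positivity) (by norm_num)]
        linarith
  have e1 := hbd ρ (abs_of_pos hρ0) ⟨by linarith, le_rfl⟩
  have e2 := hbd (-ρ) (by rw [abs_neg, abs_of_pos hρ0]) ⟨le_rfl, by linarith⟩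
  set S := ∫ t in (-ρ)..ρ, (f t : ℂ) * ((V t : ℂ) - c)⁻¹ with hSdef
  set J := ∫ t in (-ρ)..ρ, (((V t : ℂ) - c) ^ 2)⁻¹ with hJ
  set F₁ := (μ ρ : ℂ) * ((V ρ : ℂ) - c)⁻¹ with hF₁
  set F₂ := (μ (-ρ) : ℂ) * ((V (-ρ) : ℂ) - c)⁻¹ with hF₂
  have e3 : S = -(n * c * J) - (F₁ - F₂) := by linear_combination -hint
  have e4 : ‖S‖ ≤ n * ‖J‖ + (e / 4 + e / 4) := by
    rw [e3]
    refine (_root_.norm_sub_le _ _).trans (add_le_add ?_ ((_root_.norm_sub_le _ _).trans (add_le_add e1 e2)))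
    rw [norm_neg, norm_mul, norm_mul, hc, mul_one, Complex.norm_natCast]
  rw [div_le_iff₀ (by positivity)]
  linarith

end ScaledProfile

/-! ### Solutions of the scaled equation. -/

section ScaledProfile

variable {n : ℕ} {m M : ℝ}

/-- By variation of constants φ is a multiple of Q I plus β times an integral operator. The kernel
of that operator has size O(ρ) relative to the weight; over a length at most 2ρ this gives O(β ρ²),
which `η` makes small enough to absorb. -/
theorem exists_scaled_solution_bound (hn : 2 ≤ n) (hm : 0 < m) (hm1 : m ≤ 1) (hM : 1 ≤ M) :
    ∃ C > 0, ∃ ρ₀ ≥ 2 / m, ∃ η > 0, ∀ (ρ : ℝ) (V V₁ V₂ V₃ G H μ f : ℝ → ℝ), ρ₀ ≤ ρ → IsScaledProfile n m M ρ V V₁ V₂ V₃ G H →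
      (∀ z ∈ Icc (-ρ) ρ, HasDerivAt μ (n - f z) z) → (∀ z ∈ Icc (-ρ) ρ, μ z * V₁ z = n * V z) →
      (∀ z ∈ Icc (-ρ) ρ, |μ z| ≤ M * |z|) → (∀ z ∈ Icc (-ρ) ρ, 1 / 2 ≤ f z) → ContinuousOn f (Icc (-ρ) ρ) →
      ∀ c : ℂ, ‖c‖ = 1 → c.im ≠ 0 → ∀ β : ℝ, 0 ≤ β → β * ρ ^ 2 ≤ η → ∀ a b : ℝ, a < -ρ → ρ < b → ∀ φ φ' : ℝ → ℂ,
      (∀ t ∈ Ioo a b, HasDerivAt φ (φ' t) t) →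
      (∀ t ∈ Ioo a b, HasDerivAt φ' ((β + (V₂ t : ℂ) / ((V t : ℂ) - c)) * φ t) t) → φ (-ρ) = 0 →
      (∀ z ∈ Icc (-ρ) ρ, ‖φ z‖ ≤ C * (‖φ' (-ρ)‖ * ρ ^ n * zetaWeight n z)) ∧ ‖φ' (-ρ)‖ * ρ ^ (2 * n) ≤ C * ‖φ ρ‖ := by
  obtain ⟨C, hC, hU⟩ := exists_norm_mul_integral_le_zetaWeight (n := n) (by omega) hm hm1 hM
  obtain ⟨e, he, ρ₀, hρ₀, hL⟩ := exists_le_norm_integral hn hm hm1 hM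
  set D : ℝ := C ^ 2 / e with hD
  have hD0 : 0 < D := by positivity
  have hρ₀2 : 2 ≤ ρ₀ := le_trans (by rw [le_div_iff₀ hm]; linarith) hρ₀
  -- The first entry bounds the perturbation by half of the weighted maximum; the second bounds it
  -- at the right end by half of the lower bound for the main term.
  set η : ℝ := min (1 / (16 * D)) (m * e / (64 * D * C * 2 ^ n)) with hη
  set T : ℝ := 2 * C * (M + 1) + 8 / (m ^ 2 * e) with hT
  refine ⟨T, by positivity, ρ₀, hρ₀, η, lt_min (by positivity) (by positivity), ?_⟩
  intro ρ V V₁ V₂ V₃ G H μ f hρ h hμ hμV hμb hf hfc c hc hci β hβ hβη a b ha hb φ φ' hφ hφ' hφ0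
  have hρ1 : 2 ≤ ρ := hρ₀2.trans hρ
  have hρm : 2 / m ≤ ρ := hρ₀.trans hρ
  have hη₁ : β * ρ ^ 2 * (16 * D) ≤ 1 := by
    have := hβη.trans (min_le_left _ _)
    rwa [le_div_iff₀ (by positivity)] at this
  have hη₂ : β * ρ ^ 2 * (64 * D * C * 2 ^ n) ≤ m * e := by
    have := hβη.trans (min_le_right _ _)
    rwa [le_div_iff₀ (by positivity)] at this
  have hVc : Continuous V := continuous_iff_continuousAt.2 fun z => (h.d₀ z).continuousAt
  have hQ0 : ∀ t, (V t : ℂ) - c ≠ 0 := fun t => sub_ne_zero_of_im hci _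
  have hW := h.continuous_inv_sq hci
  set w : ℝ → ℝ := zetaWeight n with hw
  have hw0 : ∀ t, 0 < w t := fun t => zetaWeight_pos
  have hwm : Monotone w := zetaWeight_mono (by omega)
  have hww : ∀ t ∈ Icc (-ρ) ρ, w t * w (-t) ≤ 2 * ρ := fun t ht => by
    rw [hw, zetaWeight_mul_neg (by omega)]
    linarith [abs_le.2 ht]
  set I : ℝ → ℂ := fun z => ∫ t in (-ρ)..z, (((V t : ℂ) - c) ^ 2)⁻¹ with hI
  set J : ℂ := I ρ with hJ
  have hJe : e ≤ ‖J‖ := hL ρ V V₁ V₂ V₃ G H μ f hρ h hμ hμV hμb hf hfc c hc hci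
  have hJ0 : J ≠ 0 := norm_pos_iff.1 (he.trans_le hJe)
  set Q : ℝ → ℂ := fun t => (V t : ℂ) - c with hQ
  have hI1 : ∀ z ∈ Icc (-ρ) ρ, ‖Q z * I z‖ ≤ C * w z := hU ρ V V₁ V₂ V₃ G H hρm h c hc hci
  -- The previous bound for the reflected profile (-1)ⁿ V(-z), with parameter (-1)ⁿ c.
  have hI2 : ∀ z ∈ Icc (-ρ) ρ, ‖Q z * (J - I z)‖ ≤ C * w (-z) := by
    intro z hz
    have hs : ((-1 : ℂ) ^ n) ^ 2 = 1 := by rw [← pow_mul, mul_comm, pow_mul]; simp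
    have hcast : ∀ x : ℝ, (((-1 : ℝ) ^ n * x : ℝ) : ℂ) - (-1) ^ n * c = (-1) ^ n * ((x : ℂ) - c) := fun t => by
      push_cast; ring
    have hn1 : ‖(-1 : ℂ) ^ n‖ = 1 := by simp
    have h1 := hU ρ _ _ _ _ _ _ hρm (h.reflect (by omega)) ((-1) ^ n * c) (by rw [norm_mul, hn1, hc, one_mul]) (by
      rcases neg_one_pow_eq_or ℂ n with h | h <;> simp [h, hci]) (-z) ⟨by linarith [hz.2], by linarith [hz.1]⟩
    simp only [hcast, mul_pow, hs, one_mul, neg_neg] at h1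
    rw [intervalIntegral.integral_comp_neg (fun t => (((V t : ℂ) - c) ^ 2)⁻¹), neg_neg, neg_neg, mul_assoc, norm_mul, hn1, one_mul] at h1
    have h2 : J - I z = ∫ t in z..ρ, (((V t : ℂ) - c) ^ 2)⁻¹ :=
      intervalIntegral.integral_interval_sub_left (hW.intervalIntegrable _ _) (hW.intervalIntegrable _ _)
    rwa [h2]
  have hIc : Continuous I := intervalIntegral.continuous_primitive (fun p q => hW.intervalIntegrable p q) _
  have hmem : ∀ z ∈ Icc (-ρ) ρ, z ∈ Ioo a b := fun z hz => ⟨by linarith [hz.1], by linarith [hz.2]⟩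
  have hφc : ContinuousOn φ (Icc (-ρ) ρ) := fun z hz => (hφ z (hmem z hz)).continuousAt.continuousWithinAt
  have hvar : ∀ z ∈ Icc (-ρ) ρ, φ z = Q (-ρ) * φ' (-ρ) * (Q z * I z) + β * ∫ t in (-ρ)..z, Q z * Q t * (I z - I t) * φ t := by
    intro z hz
    have h1 := variation_formula (p := -ρ) (hmem _ ⟨le_rfl, by linarith⟩) (hmem z hz) (fun t _ => h.d₀ t) (fun t _ => h.d₁ t) hci
      (f := φ) (f' := φ') (s := 0) (β := β) continuousOn_const hφ (fun t ht => (hφ' t ht).congr_deriv (by simp))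
    rw [hφ0, zero_div, zero_add, mul_zero, sub_zero, div_eq_iff (hQ0 z)] at h1
    rw [h1, add_mul]
    congr 1
    · simp only [hQ, hI]; ring
    · rw [← intervalIntegral.integral_mul_const, ← intervalIntegral.integral_const_mul]
      refine intervalIntegral.integral_congr fun t _ => ?_
      simp only [hQ, hI, Pi.zero_apply]; ring
  have hker : ∀ z ∈ Icc (-ρ) ρ, ∀ t ∈ Icc (-ρ) z, ‖Q z * Q t * (I z - I t)‖ * w t ≤ 4 * ρ * D * w z := by
    intro z hz t ht
    have ht' : t ∈ Icc (-ρ) ρ := ⟨ht.1, ht.2.trans hz.2⟩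
    -- Division by J, which is bounded below, expresses the kernel by Q I and Q (J - I). One carries
    -- the weight at z, the other the reflected weight, and the product of the two weights at a
    -- point grows only linearly.
    have e1 : Q z * Q t * (I z - I t) = ((Q z * I z) * (Q t * (J - I t)) - (Q t * I t) * (Q z * (J - I z))) / J := by
      field_simp; ring
    have e2 : ‖Q z * Q t * (I z - I t)‖ ≤ D * (w z * w (-t) + w t * w (-z)) := by
      rw [e1, norm_div]
      have h2 := hw0 z; have h3 := hw0 t; have h4 := hw0 (-z); have h5 := hw0 (-t)
      have h6 : 0 ≤ C * w z * (C * w (-t)) + C * w t * (C * w (-z)) := by positivity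
      calc _ ≤ ((C * w z) * (C * w (-t)) + (C * w t) * (C * w (-z))) / e := by
            gcongr
            refine (norm_sub_le _ _).trans (add_le_add ?_ ?_) <;> rw [norm_mul]
            · exact mul_le_mul (hI1 z hz) (hI2 t ht') (norm_nonneg _) (mul_nonneg hC.le (hw0 _).le)
            · exact mul_le_mul (hI1 t ht') (hI2 z hz) (norm_nonneg _) (mul_nonneg hC.le (hw0 _).le)
        _ = _ := by rw [hD]; ring
    have h1 := hwm ht.2
    have h2 := hwm (neg_le_neg ht.2)
    have h3 := hww t ht'
    calc _ ≤ D * (w z * w (-t) + w t * w (-z)) * w t := mul_le_mul_of_nonneg_right e2 (hw0 t).le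
      _ = D * (w z * (w t * w (-t)) + w t * (w t * w (-z))) := by ring
      _ ≤ D * (w z * (2 * ρ) + w z * (2 * ρ)) := by
        have h4 : w t * w (-z) ≤ 2 * ρ := le_trans (mul_le_mul_of_nonneg_left h2 (hw0 t).le) h3
        have := hw0 t; have := hw0 z; have := hw0 (-z)
        gcongr
      _ = _ := by ring
  set γ : ℝ := ‖Q (-ρ) * φ' (-ρ)‖ with hγ
  -- The maximum `X` of ‖φ‖ divided by the weight is finite by compactness, so the perturbation can
  -- be absorbed into it.
  obtain ⟨z₀, hz₀, hmax⟩ := isCompact_Icc.exists_isMaxOn (nonempty_Icc.2 (by linarith : -ρ ≤ ρ))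
    (f := fun z => ‖φ z‖ / w z) (hφc.norm.div continuous_zetaWeight.continuousOn fun z _ => (hw0 z).ne')
  set X : ℝ := ‖φ z₀‖ / w z₀ with hX
  have hX0 : 0 ≤ X := div_nonneg (norm_nonneg _) (hw0 _).le
  have hφX : ∀ z ∈ Icc (-ρ) ρ, ‖φ z‖ ≤ X * w z := fun z hz => by
    have := hmax hz
    rwa [mem_ofPred_eq, div_le_iff₀ (hw0 z)] at this
  have hintb : ∀ z ∈ Icc (-ρ) ρ, ‖(β : ℂ) * ∫ t in (-ρ)..z, Q z * Q t * (I z - I t) * φ t‖ ≤ β * ρ ^ 2 * (8 * D) * X * w z := by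
    intro z hz
    have h1 : ‖∫ t in (-ρ)..z, Q z * Q t * (I z - I t) * φ t‖ ≤ 4 * ρ * D * X * w z * |z - -ρ| := by
      refine intervalIntegral.norm_integral_le_of_norm_le_const fun t ht => ?_
      rw [uIoc_of_le hz.1] at ht
      have ht' := Ioc_subset_Icc_self ht
      rw [norm_mul]
      have h2 := hw0 t
      have h3 := hker z hz t ht'
      calc _ ≤ ‖Q z * Q t * (I z - I t)‖ * (X * w t) := by
            gcongr; exact hφX t ⟨ht'.1, ht'.2.trans hz.2⟩
        _ = X * (‖Q z * Q t * (I z - I t)‖ * w t) := by ring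
        _ ≤ X * (4 * ρ * D * w z) := by gcongr
        _ = _ := by ring
    rw [abs_of_nonneg (by linarith [hz.1])] at h1
    rw [norm_mul, Complex.norm_real, Real.norm_eq_abs, abs_of_nonneg hβ]
    have h0 := hw0 z
    calc _ ≤ β * (4 * ρ * D * X * w z * (z - -ρ)) := by gcongr
      _ ≤ β * (4 * ρ * D * X * w z * (2 * ρ)) := by gcongr; linarith [hz.2]
      _ = _ := by ring
  have hXγ : X ≤ 2 * C * γ := by
    have h1 : ‖φ z₀‖ ≤ γ * (C * w z₀) + β * ρ ^ 2 * (8 * D) * X * w z₀ := by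
      rw [hvar z₀ hz₀]
      refine (norm_add_le _ _).trans (add_le_add ?_ (hintb z₀ hz₀))
      rw [norm_mul]
      exact mul_le_mul_of_nonneg_left (hI1 z₀ hz₀) (norm_nonneg _)
    have h2 : X ≤ γ * C + β * ρ ^ 2 * (8 * D) * X := by
      rw [hX, div_le_iff₀ (hw0 z₀), ← hX]; linarith
    have h3 : β * ρ ^ 2 * (16 * D) * X ≤ 1 * X := mul_le_mul_of_nonneg_right hη₁ hX0
    linarith
  have hQρ : ‖Q (-ρ)‖ ≤ (M + 1) * ρ ^ n := by
    have h1 := h.norm_sub_le hm hc (z := -ρ) (by rw [abs_neg, abs_of_pos (by linarith)])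
    rw [abs_neg, abs_of_pos (by linarith)] at h1
    have : 1 ≤ ρ ^ n := one_le_pow₀ (by linarith)
    linarith
  have hQl : ∀ z, |z| = ρ → m / 2 * ρ ^ n ≤ ‖Q z‖ := fun z hz => by
    have := h.le_norm_sub hm hm1 (by omega) hc hz.le (by rw [hz]; exact hρm)
    rwa [hz] at this
  have hρa : |ρ| = ρ := abs_of_pos (by linarith)
  have hρmem : ρ ∈ Icc (-ρ) ρ := ⟨by linarith, le_rfl⟩
  constructor
  · intro z hz
    have h0 := hw0 z
    calc ‖φ z‖ ≤ (2 * C * γ) * w z := (hφX z hz).trans (by gcongr)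
      _ ≤ (2 * C * (((M + 1) * ρ ^ n) * ‖φ' (-ρ)‖)) * w z := by
        rw [hγ, norm_mul]; gcongr
      _ = (2 * C * (M + 1)) * (‖φ' (-ρ)‖ * ρ ^ n * w z) := by ring
      _ ≤ T * (‖φ' (-ρ)‖ * ρ ^ n * w z) := by
        gcongr
        rw [hT]
        have : 0 ≤ 8 / (m ^ 2 * e) := by positivity
        linarith
  · have h1 : γ * (m / 2 * ρ ^ n * e) ≤ ‖φ ρ‖ + β * ρ ^ 2 * (8 * D) * X * w ρ := by
      have h2 := hvar ρ hρmem
      have h3 : Q (-ρ) * φ' (-ρ) * (Q ρ * I ρ) = φ ρ - β * ∫ t in (-ρ)..ρ, Q ρ * Q t * (I ρ - I t) * φ t := by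
        linear_combination -h2
      have h4 : ‖Q (-ρ) * φ' (-ρ) * (Q ρ * I ρ)‖ ≤ ‖φ ρ‖ + β * ρ ^ 2 * (8 * D) * X * w ρ := by
        rw [h3]; exact (norm_sub_le _ _).trans (add_le_add le_rfl (hintb ρ hρmem))
      refine le_trans ?_ h4
      rw [norm_mul, norm_mul (Q ρ)]
      have := hQl ρ hρa
      gcongr
    have hwρ : w ρ ≤ 2 ^ n * ρ ^ n := by
      rw [hw, zetaWeight_of_nonneg (by linarith), hρa, ← mul_pow]
      gcongr; linarith
    have hγ0 : 0 ≤ γ := norm_nonneg _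
    have h5 : β * ρ ^ 2 * (8 * D) * X * w ρ ≤ γ * (m / 4 * ρ ^ n * e) := by
      have h0 := hw0 ρ
      calc _ ≤ β * ρ ^ 2 * (8 * D) * (2 * C * γ) * (2 ^ n * ρ ^ n) := by gcongr
        _ = β * ρ ^ 2 * (64 * D * C * 2 ^ n) * (γ * ρ ^ n / 4) := by ring
        _ ≤ m * e * (γ * ρ ^ n / 4) := by gcongr
        _ = _ := by ring
    have h6 : m / 2 * ρ ^ n * ‖φ' (-ρ)‖ ≤ γ := by
      rw [hγ, norm_mul]
      have := hQl (-ρ) (by rw [abs_neg, hρa])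
      gcongr
    have h7 : m / 2 * ρ ^ n * ‖φ' (-ρ)‖ * (m / 4 * ρ ^ n * e) ≤ ‖φ ρ‖ :=
      (mul_le_mul_of_nonneg_right h6 (by positivity)).trans (by linarith)
    calc ‖φ' (-ρ)‖ * ρ ^ (2 * n) = 8 / (m ^ 2 * e) * (m / 2 * ρ ^ n * ‖φ' (-ρ)‖ * (m / 4 * ρ ^ n * e)) := by
          rw [two_mul, pow_add]; field_simp; ring
      _ ≤ 8 / (m ^ 2 * e) * ‖φ ρ‖ := by gcongr
      _ ≤ T * ‖φ ρ‖ := by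
        gcongr
        rw [hT]
        have : 0 ≤ 2 * C * (M + 1) := by positivity
        linarith

end ScaledProfile

/-! ### Rescaling at a critical point of order n ≥ 2. -/

section CriticalPoint

/-- Hadamard's lemma in one variable. -/
theorem exists_eq_mul_of_zero {u : ℝ → ℝ} (hu : ContDiff ℝ ∞ u) (h0 : u 0 = 0) :
    ∃ v, ContDiff ℝ ∞ v ∧ ∀ x, u x = x * v x := by
  refine ⟨fun x => ∫ s in Icc (0:ℝ) 1, deriv u (s * x), contDiff_infty.2 fun n =>
    contDiff_setIntegral volume isCompact_Icc n (f := fun q : ℝ × ℝ => deriv u (q.1 * q.2))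
      (((contDiff_deriv hu).comp (contDiff_fst.mul contDiff_snd)).of_le (by exact_mod_cast le_top)), fun x => ?_⟩
  beta_reduce
  rw [integral_Icc_eq_integral_Ioc, ← intervalIntegral.integral_of_le zero_le_one, ← intervalIntegral.integral_const_mul]
  have h1 : ∀ s ∈ uIcc (0:ℝ) 1, HasDerivAt (fun s => u (s * x)) (x * deriv u (s * x)) s := fun s _ =>
    (HasDerivAt.comp (h₂ := u) s (hasDerivAt_of_contDiff hu (s * x)) ((hasDerivAt_id s).mul_const x)).congr_deriv (by ring)
  rw [intervalIntegral.integral_eq_sub_of_hasDerivAt h1]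
  · simp [h0]
  · have := (contDiff_deriv hu).continuous
    exact Continuous.intervalIntegrable (by fun_prop) _ _

theorem iteratedDeriv_pow_mul_zero (k : ℕ) {g : ℝ → ℝ} (hg : ContDiff ℝ ∞ g) :
    iteratedDeriv k (fun x => x ^ k * g x) 0 = k.factorial * g 0 := by
  induction k generalizing g with
  | zero => simp
  | succ k ih =>
    have h1 : deriv (fun x => x ^ (k + 1) * g x) = fun x => x ^ k * ((k + 1) * g x + x * deriv g x) := by
      funext x
      have h2 : HasDerivAt (fun x => x ^ (k + 1) * g x) _ x := (hasDerivAt_pow (k + 1) x).mul (hasDerivAt_of_contDiff hg x)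
      rw [h2.deriv]
      push_cast
      rw [pow_succ]
      ring
    rw [iteratedDeriv_succ', h1, ih (g := fun x => (k + 1) * g x + x * deriv g x)
      ((contDiff_const.mul hg).add (contDiff_id.mul (contDiff_deriv hg))), Nat.factorial_succ]
    push_cast
    ring

/-- Hadamard's lemma, applied n times: after k divisions the value of the quotient at 0 is the k-th
derivative divided by k!, which vanishes for k < n. -/
theorem exists_eq_add_pow_mul {U : ℝ → ℝ} (hU : ContDiff ℝ ∞ U) {n : ℕ} {y₀ : ℝ} {c₀ : ℂ}
    (hn : 1 ≤ n) (h : IsCriticalPointOfOrder U n y₀ c₀) :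
    ∃ g, ContDiff ℝ ∞ g ∧ g 0 ≠ 0 ∧ ∀ x, U (y₀ + x) = U y₀ + x ^ n * g x := by
  set u : ℝ → ℝ := fun x => U (y₀ + x) - U y₀ with hu_def
  have hu : ContDiff ℝ ∞ u := (hU.comp (contDiff_const.add contDiff_id)).sub contDiff_const
  have hit : ∀ k, 1 ≤ k → iteratedDeriv k u 0 = iteratedDeriv k U y₀ := fun k hk => by
    obtain ⟨k, rfl⟩ : ∃ j, k = j + 1 := ⟨k - 1, by omega⟩
    have h1 : deriv u = fun x => deriv U (y₀ + x) := by
      funext x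
      simp only [hu_def, deriv_sub_const_fun, deriv_comp_const_add]
    rw [iteratedDeriv_succ', iteratedDeriv_succ', h1]
    have := congrFun (iteratedDeriv_comp_const_add k (deriv U) y₀) 0
    rw [this, add_zero]
  have key : ∀ k ≤ n, ∃ g, ContDiff ℝ ∞ g ∧ ∀ x, u x = x ^ k * g x := by
    intro k hk
    induction k with
    | zero => exact ⟨u, hu, fun x => by simp⟩
    | succ k ih =>
      obtain ⟨g, hg, hug⟩ := ih (by omega)
      have h0 : g 0 = 0 := by
        have h1 : iteratedDeriv k u 0 = k.factorial * g 0 := by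
          rw [funext hug]; exact iteratedDeriv_pow_mul_zero k hg
        have h2 : iteratedDeriv k u 0 = 0 := by
          rcases Nat.eq_zero_or_pos k with rfl | hk0
          · simp [hu_def]
          · rw [hit k hk0]; exact h.2.1 k hk0 (by omega)
        rw [h2] at h1
        exact (mul_eq_zero.1 h1.symm).resolve_left (by exact_mod_cast k.factorial_ne_zero)
      obtain ⟨v, hv, hgv⟩ := exists_eq_mul_of_zero hg h0
      exact ⟨v, hv, fun x => by rw [hug, hgv, pow_succ]; ring⟩
  obtain ⟨g, hg, hug⟩ := key n le_rfl
  refine ⟨g, hg, fun h0 => ?_, fun x => by have := hug x; simp only [hu_def] at this; linarith⟩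
  · refine h.2.2 ?_
    rw [← hit n hn, funext hug, iteratedDeriv_pow_mul_zero n hg, h0, mul_zero]

theorem exists_slice_deriv {F : ℝ × ℝ → ℝ} (hF : ContDiff ℝ ∞ F) :
    ∃ F', ContDiff ℝ ∞ F' ∧ ∀ d z, HasDerivAt (fun z => F (d, z)) (F' (d, z)) z := by
  refine ⟨fun P => fderiv ℝ F P (0, 1), (hF.fderiv_right (m := ∞) (by norm_cast)).clm_apply contDiff_const, fun d z => ?_⟩
  have h1 : HasFDerivAt F (fderiv ℝ F (d, z)) (d, z) := ((hF.differentiable (by norm_num)).differentiableAt).hasFDerivAt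
  have h2 : HasDerivAt (fun z : ℝ => (d, z)) ((0 : ℝ), (1 : ℝ)) z := (hasDerivAt_const z d).prodMk (hasDerivAt_id z)
  exact HasFDerivAt.comp_hasDerivAt (l := F) z h1 h2

/-- With t = |c - U y₀| = δⁿ and V(z) = s (U(y₀ + δ z) - U(y₀))/t, where s = ±1 makes V/zⁿ positive,
the equation takes scaled form with β replaced by β δ². On |z| ≤ ρ = r/δ one has β δ² ρ² = β r²,
small for small r whatever δ is. -/
theorem exists_solution_bound {U g : ℝ → ℝ} (hU : ContDiff ℝ ∞ U) (hg : ContDiff ℝ ∞ g) (hg0 : g 0 ≠ 0) {n : ℕ} (hn : 2 ≤ n)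
    {y₀ : ℝ} (hUg : ∀ x, U (y₀ + x) = U y₀ + x ^ n * g x) {β : ℝ} (hβ : 0 ≤ β) :
    ∃ R > 0, ∀ r, 0 < r → r ≤ R → ∃ ε > 0, ∃ C > 0, ∀ c : ℂ, c.im ≠ 0 → ‖c - U y₀‖ < ε → ∀ a b, a < y₀ - r → y₀ + r < b →
      ∀ φ φ' : ℝ → ℂ, (∀ t ∈ Ioo a b, HasDerivAt φ (φ' t) t ∧ HasDerivAt φ' (coeff U β (t, c) * φ t) t) →
      φ (y₀ - r) = 0 → φ' (y₀ - r) = ((‖c - U y₀‖ ^ (2 - 1 / (n : ℝ)) : ℝ) : ℂ) →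
      (∀ y ∈ Icc (y₀ - r) (y₀ + r), ‖φ y‖ ≤ C * (‖c - U y₀‖ * zetaWeight n ((y - y₀) / ‖c - U y₀‖ ^ (1 / (n : ℝ))))) ∧
      1 ≤ C * ‖φ (y₀ + r)‖ := by
  have hn0 : (n : ℝ) ≠ 0 := by exact_mod_cast (by omega : n ≠ 0)
  have hn2 : (2 : ℝ) ≤ n := by exact_mod_cast hn
  obtain ⟨s, hs, hsg⟩ : ∃ s : ℝ, s ^ 2 = 1 ∧ 0 < s * g 0 := by
    rcases hg0.lt_or_gt with h | h
    · exact ⟨-1, by norm_num, by linarith⟩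
    · exact ⟨1, by norm_num, by linarith⟩
  set G : ℝ → ℝ := fun x => s * g x with hG
  have hGs : ContDiff ℝ ∞ G := contDiff_const.mul hg
  set H : ℝ → ℝ := fun x => n * G x + x * deriv G x with hH
  have hHs : ContDiff ℝ ∞ H := (contDiff_const.mul hGs).add (contDiff_id.mul (contDiff_deriv hGs))
  -- This is n minus the derivative of μ = n x G/H, which is n times the profile over its
  -- derivative. It equals n - 1 ≥ 1 at the origin, hence exceeds 1/2 nearby.
  set f : ℝ → ℝ := fun x => n - n * ((G x + x * deriv G x) * H x - x * G x * deriv H x) / H x ^ 2 with hf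
  set γ := G 0 with hγ
  have hγ0 : 0 < γ := hsg
  have hH0 : H 0 = n * γ := by simp [hH, hγ]
  have hf0 : f 0 = n - 1 := by
    simp only [hf, hH0, zero_mul, add_zero, sub_zero]
    rw [← hγ]; field_simp
  have hGc := hGs.continuous
  have hHc := hHs.continuous
  have hG'c := (contDiff_deriv hGs).continuous
  have hH'c := (contDiff_deriv hHs).continuous
  have hfc : ∀ x, H x ≠ 0 → ContinuousAt f x := fun x hx => by
    have h1 : ContinuousAt (fun x => n * ((G x + x * deriv G x) * H x - x * G x * deriv H x)) x :=
      Continuous.continuousAt (by fun_prop)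
    exact continuousAt_const.sub (h1.div (hHc.pow 2).continuousAt (pow_ne_zero 2 hx))
  have hev : ∀ᶠ x in 𝓝 (0 : ℝ), γ / 2 < G x ∧ γ / 2 < H x ∧ G x < 2 * γ ∧ H x < n * γ + 1 ∧ 1 / 2 < f x := by
    have h1 : n * γ > γ / 2 := by nlinarith
    filter_upwards [hGc.continuousAt.eventually_const_lt (show γ / 2 < G 0 by linarith),
      hHc.continuousAt.eventually_const_lt (show γ / 2 < H 0 by rw [hH0]; exact h1),
      hGc.continuousAt.eventually_lt_const (show G 0 < 2 * γ by linarith),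
      hHc.continuousAt.eventually_lt_const (show H 0 < n * γ + 1 by rw [hH0]; linarith),
      (hfc 0 (by rw [hH0]; positivity)).eventually_const_lt (show 1 / 2 < f 0 by rw [hf0]; linarith)] with x h1 h2 h3 h4 h5
    exact ⟨h1, h2, h3, h4, h5⟩
  obtain ⟨R₁, hR₁, hnear⟩ := Metric.eventually_nhds_iff.1 hev
  have hnear : ∀ x, |x| < R₁ → γ / 2 < G x ∧ γ / 2 < H x ∧ G x < 2 * γ ∧ H x < n * γ + 1 ∧ 1 / 2 < f x := fun x hx =>
    hnear (by rwa [Real.dist_eq, sub_zero])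
  set m : ℝ := min 1 (γ / 2) with hm_def
  have hm : 0 < m := lt_min one_pos (by linarith)
  have hm1 : m ≤ 1 := min_le_left _ _
  have hmγ : m ≤ γ / 2 := min_le_right _ _
  -- The scaled profile, as a function of (δ, z), is smooth down to δ = 0. Compactness of δ ∈ [0, 1]
  -- gives derivative bounds uniform in δ.
  have hF : ContDiff ℝ ∞ fun P : ℝ × ℝ => P.2 ^ n * G (P.1 * P.2) :=
    (contDiff_snd.pow n).mul (hGs.comp (contDiff_fst.mul contDiff_snd))
  set F : ℝ × ℝ → ℝ := fun P => P.2 ^ n * G (P.1 * P.2) with hF_def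
  obtain ⟨F₁, hF₁, hFd₀⟩ := exists_slice_deriv hF
  obtain ⟨F₂, hF₂, hFd₁⟩ := exists_slice_deriv hF₁
  obtain ⟨F₃, hF₃, hFd₂⟩ := exists_slice_deriv hF₂
  have hcomp : IsCompact (Icc (0:ℝ) 1 ×ˢ Icc (-(2 / m)) (2 / m)) := isCompact_Icc.prod isCompact_Icc
  obtain ⟨M₂, hM₂⟩ := hcomp.exists_bound_of_continuousOn hF₂.continuous.continuousOn
  obtain ⟨M₃, hM₃⟩ := hcomp.exists_bound_of_continuousOn hF₃.continuous.continuousOn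
  set M : ℝ := 1 + 2 * γ + n * γ + |M₂| + |M₃| + n * 4 with hM_def
  have hM1 : 1 ≤ M := by
    have : 0 ≤ 2 * γ + n * γ + |M₂| + |M₃| + n * 4 := by positivity
    linarith
  obtain ⟨C, hC, ρ₀, hρ₀, η, hη, hmain⟩ := exists_scaled_solution_bound hn hm hm1 hM1
  have hρ₀0 : 0 < ρ₀ := lt_of_lt_of_le (by positivity) hρ₀
  -- The last two entries give β r² ≤ η.
  refine ⟨min (R₁ / 2) (min 1 (η / (β + 1))), lt_min (by linarith) (lt_min one_pos (by positivity)), fun r hr hrR => ?_⟩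
  have hr1 : r < R₁ := by linarith [hrR.trans (min_le_left _ _)]
  have hr2 : r ≤ 1 := hrR.trans ((min_le_right _ _).trans (min_le_left _ _))
  have hr3 : r ≤ η / (β + 1) := hrR.trans ((min_le_right _ _).trans (min_le_right _ _))
  -- Ensures δ ≤ 1 and δ ≤ r/ρ₀, that is ρ ≥ ρ₀.
  refine ⟨min 1 ((r / ρ₀) ^ n), lt_min one_pos (by positivity), C * r ^ n + C / r ^ (2 * n), by positivity, ?_⟩
  intro c hci hcε a b ha hb φ φ' hφ hφ0 hφ1
  set t : ℝ := ‖c - U y₀‖ with ht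
  have ht0 : 0 < t := norm_pos_iff.2 fun h => hci (by rw [sub_eq_zero.1 h]; simp)
  set δ : ℝ := t ^ (1 / (n : ℝ)) with hδ
  have hδ0 : 0 < δ := Real.rpow_pos_of_pos ht0 _
  have hδn : δ ^ n = t := by rw [hδ, one_div, Real.rpow_inv_natCast_pow ht0.le (by omega)]
  have hδ1 : δ ≤ 1 := Real.rpow_le_one ht0.le (hcε.le.trans (min_le_left _ _)) (by positivity)
  have hδr : δ ≤ r / ρ₀ := by
    refine le_of_lt (lt_of_pow_lt_pow_left₀ n (by positivity) ?_)
    rw [hδn]; exact hcε.trans_le (min_le_right _ _)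
  -- The prescribed slope becomes δ²ⁿ after scaling, and δ²ⁿ ρ²ⁿ = r²ⁿ. This is why the value at the
  -- right end is bounded below independently of c.
  have hpow : t ^ (2 - 1 / (n : ℝ)) * δ = δ ^ (2 * n) := by
    rw [hδ, ← Real.rpow_add ht0, mul_comm 2 n, pow_mul, ← hδ, hδn, sub_add_cancel]
    norm_num
  set ρ : ℝ := r / δ with hρ_def
  have hδρ : δ * ρ = r := by rw [hρ_def]; field_simp
  have hρ0 : 0 < ρ := by positivity
  have hρ : ρ₀ ≤ ρ := by
    rw [hρ_def, le_div_iff₀ hδ0]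
    rw [le_div_iff₀ hρ₀0] at hδr
    linarith
  have habs : ∀ z, |z| ≤ ρ → |δ * z| < R₁ := fun z hz => by
    rw [abs_mul, abs_of_pos hδ0]
    calc δ * |z| ≤ δ * ρ := by gcongr
      _ < R₁ := by rw [hδρ]; exact hr1
  have hδd : ∀ z, HasDerivAt (fun z => δ * z) δ z := fun z => by simpa using (hasDerivAt_id z).const_mul δ
  have hGd : ∀ z, HasDerivAt (fun z => G (δ * z)) (deriv G (δ * z) * δ) z := fun z =>
    HasDerivAt.comp (h₂ := G) z (hasDerivAt_of_contDiff hGs _) (hδd z)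
  have hHd : ∀ z, HasDerivAt (fun z => H (δ * z)) (deriv H (δ * z) * δ) z := fun z =>
    HasDerivAt.comp (h₂ := H) z (hasDerivAt_of_contDiff hHs _) (hδd z)
  have hV₁ : ∀ z, F₁ (δ, z) = z ^ (n - 1) * H (δ * z) := fun z => by
    refine (hFd₀ δ z).unique (((hasDerivAt_pow n z).mul (hGd z)).congr_deriv ?_)
    have : z ^ n = z ^ (n - 1) * z := by rw [← pow_succ, Nat.sub_add_cancel (by omega)]
    simp only [hH]
    rw [this]; ring
  have hprof : IsScaledProfile n m M ρ (fun z => F (δ, z)) (fun z => F₁ (δ, z)) (fun z => F₂ (δ, z)) (fun z => F₃ (δ, z))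
      (fun z => G (δ * z)) (fun z => H (δ * z)) := by
    have hb : ∀ (z : ℝ), |z| ≤ 2 / m → (δ, z) ∈ Icc (0:ℝ) 1 ×ˢ Icc (-(2 / m)) (2 / m) := fun z hz =>
      ⟨⟨hδ0.le, hδ1⟩, abs_le.1 hz⟩
    have hnγ : 0 < n * γ := by positivity
    refine ⟨hFd₀ δ, hFd₁ δ, hFd₂ δ, ?_, fun z => rfl, hV₁, fun z hz => ?_, fun z hz => ?_, fun z hz => ?_, fun z hz => ?_⟩
    · have := hF₃.continuous; fun_prop
    · obtain ⟨h1, h2, h3, h4, h5⟩ := hnear _ (habs z hz)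
      exact ⟨by linarith, by linarith [abs_nonneg M₂, abs_nonneg M₃]⟩
    · obtain ⟨h1, h2, h3, h4, h5⟩ := hnear _ (habs z hz)
      exact ⟨by linarith, by linarith [abs_nonneg M₂, abs_nonneg M₃]⟩
    · have := (hM₂ _ (hb z hz)).trans (le_abs_self _)
      rw [Real.norm_eq_abs] at this
      linarith [abs_nonneg M₂, abs_nonneg M₃]
    · have := (hM₃ _ (hb z hz)).trans (le_abs_self _)
      rw [Real.norm_eq_abs] at this
      linarith [abs_nonneg M₂, abs_nonneg M₃]
  have hHpos : ∀ z ∈ Icc (-ρ) ρ, 0 < H (δ * z) := fun z hz => by linarith [(hnear _ (habs z (abs_le.2 hz))).2.1]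
  have hμ : ∀ z ∈ Icc (-ρ) ρ, HasDerivAt (fun z => n * (z * G (δ * z)) / H (δ * z)) (n - f (δ * z)) z := fun z hz => by
    refine ((((hasDerivAt_id z).mul (hGd z)).const_mul (n : ℝ)).div (hHd z) (hHpos z hz).ne').congr_deriv ?_
    simp only [hf, id, Pi.mul_apply]
    ring
  have hVU : ∀ z, F (δ, z) = s * (U (y₀ + δ * z) - U y₀) / t := fun z => by
    rw [hUg, ← hδn]; simp only [hF_def, hG]; rw [mul_pow]; field_simp; ring
  have hUd : ∀ z, HasDerivAt (fun z => U (y₀ + δ * z)) (deriv U (y₀ + δ * z) * δ) z := fun z =>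
    HasDerivAt.comp (h₂ := U) z (hasDerivAt_of_contDiff hU _) ((hδd z).const_add y₀)
  have hU'd : ∀ z, HasDerivAt (fun z => deriv U (y₀ + δ * z)) (deriv (deriv U) (y₀ + δ * z) * δ) z := fun z =>
    HasDerivAt.comp (h₂ := deriv U) z (hasDerivAt_of_contDiff (contDiff_deriv hU) _) ((hδd z).const_add y₀)
  have hV₁U : ∀ z, F₁ (δ, z) = s * (deriv U (y₀ + δ * z) * δ) / t := fun z => by
    have h1 := hFd₀ δ z
    simp only [hVU] at h1
    exact h1.unique ((((hUd z).sub_const _).const_mul s).div_const t)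
  have hV₂U : ∀ z, F₂ (δ, z) = s * (deriv (deriv U) (y₀ + δ * z) * δ * δ) / t := fun z => by
    have h1 := hFd₁ δ z
    simp only [hV₁U] at h1
    exact h1.unique ((((hU'd z).mul_const δ).const_mul s).div_const t)
  have hs0 : s ≠ 0 := fun h => by simp [h] at hs
  have hQne : ∀ y, (U y : ℂ) - c ≠ 0 := fun y => sub_ne_zero_of_im hci _
  have hsabs : ‖(s : ℂ)‖ = 1 := by
    rw [Complex.norm_real, Real.norm_eq_abs, ← sq_eq_sq₀ (abs_nonneg s) zero_le_one, sq_abs, hs, one_pow]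
  have htC : (t : ℂ) ≠ 0 := by exact_mod_cast ht0.ne'
  have hsC : (s : ℂ) ≠ 0 := by exact_mod_cast hs0
  have hyz : ∀ z ∈ Ioo ((a - y₀) / δ) ((b - y₀) / δ), y₀ + δ * z ∈ Ioo a b := fun z hz => by
    have h1 := hz.1; have h2 := hz.2
    rw [div_lt_iff₀ hδ0] at h1
    rw [lt_div_iff₀ hδ0] at h2
    exact ⟨by linarith, by linarith⟩
  obtain ⟨hb1, hb2⟩ := hmain ρ _ _ _ _ _ _ (fun z => n * (z * G (δ * z)) / H (δ * z)) (fun z => f (δ * z)) hρ hprof hμ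
    (fun z hz => by
      have h1 := (hHpos z hz).ne'
      have h2 : z ^ n = z ^ (n - 1) * z := by rw [← pow_succ, Nat.sub_add_cancel (by omega)]
      simp only [hV₁]
      simp only [hF_def]
      rw [h2, div_mul_eq_mul_div, div_eq_iff h1]; ring)
    (fun z hz => by
      obtain ⟨h1, h2, h3, h4, h5⟩ := hnear _ (habs z (abs_le.2 hz))
      rw [abs_div, abs_mul, abs_mul, Nat.abs_cast, abs_of_pos (hHpos z hz), abs_of_pos (by linarith : 0 < G (δ * z)), div_le_iff₀ (hHpos z hz)]
      have h6 : 4 * n ≤ M := by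
        have : 0 ≤ 1 + 2 * γ + n * γ + |M₂| + |M₃| := by positivity
        linarith
      calc n * (|z| * G (δ * z)) ≤ n * (|z| * (2 * γ)) := by gcongr
        _ = (4 * n) * |z| * (γ / 2) := by ring
        _ ≤ M * |z| * H (δ * z) := by gcongr)
    (fun z hz => (hnear _ (habs z (abs_le.2 hz))).2.2.2.2.le)
    (fun z hz => ((hfc _ (hHpos z hz).ne').comp (f := fun z => δ * z) (by fun_prop)).continuousWithinAt)
    (s * (c - U y₀) / t) (by rw [norm_div, norm_mul, hsabs, ← ht, one_mul, Complex.norm_real, Real.norm_eq_abs, abs_of_pos ht0, div_self ht0.ne'])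
    (by
      have : (s * (c - U y₀) / t : ℂ) = ((s / t : ℝ) : ℂ) * (c - U y₀) := by push_cast; ring
      rw [this, Complex.im_ofReal_mul, Complex.sub_im, Complex.ofReal_im, sub_zero]
      exact mul_ne_zero (div_ne_zero hs0 ht0.ne') hci)
    (β * δ ^ 2) (by positivity) (by
      rw [mul_assoc, ← mul_pow, hδρ]
      rw [le_div_iff₀ (by positivity)] at hr3
      nlinarith [mul_nonneg hβ hr.le])
    ((a - y₀) / δ) ((b - y₀) / δ) (by rw [div_lt_iff₀ hδ0]; linarith) (by rw [lt_div_iff₀ hδ0]; linarith)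
    (fun z => φ (y₀ + δ * z)) (fun z => δ * φ' (y₀ + δ * z))
    (fun z hz => by
      have := HasDerivAt.scomp (h := fun z => y₀ + δ * z) z (hφ _ (hyz z hz)).1 ((hδd z).const_add y₀)
      exact this.congr_deriv (by simp))
    (fun z hz => by
      have := (HasDerivAt.scomp (h := fun z => y₀ + δ * z) z (hφ _ (hyz z hz)).2 ((hδd z).const_add y₀)).const_mul (δ : ℂ)
      refine this.congr_deriv ?_
      have h1 := hQne (y₀ + δ * z)
      have h2 : (((F (δ, z) : ℝ) : ℂ) - s * (c - U y₀) / t) = s * ((U (y₀ + δ * z) : ℂ) - c) / t := by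
        rw [hVU]; push_cast; ring
      rw [h2]
      simp only [hV₂U, coeff, Complex.real_smul]
      push_cast
      field_simp)
    (by rw [mul_neg, hδρ]; exact hφ0)
  have hdat : ‖(δ : ℂ) * φ' (y₀ + δ * -ρ)‖ = δ ^ (2 * n) := by
    rw [mul_neg, hδρ, ← sub_eq_add_neg, hφ1, ← Complex.ofReal_mul, Complex.norm_real, Real.norm_eq_abs, mul_comm, hpow, abs_of_pos (by positivity)]
  simp only [hdat] at hb1 hb2
  have hCr : 0 < C / r ^ (2 * n) := by positivity
  have hCr' : 0 < C * r ^ n := by positivity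
  constructor
  · intro y hy
    have h1 := hb1 ((y - y₀) / δ) ⟨by rw [le_div_iff₀ hδ0]; linarith [hy.1], by rw [div_le_iff₀ hδ0]; linarith [hy.2]⟩
    rw [mul_div_cancel₀ _ hδ0.ne', add_sub_cancel] at h1
    have h2 : δ ^ (2 * n) * ρ ^ n = t * r ^ n := by rw [two_mul, pow_add, mul_assoc, ← mul_pow, hδρ, hδn]
    rw [h2] at h1
    have hz : 0 < zetaWeight n ((y - y₀) / δ) := zetaWeight_pos
    calc _ ≤ C * (t * r ^ n * zetaWeight n ((y - y₀) / δ)) := h1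
      _ = C * r ^ n * (t * zetaWeight n ((y - y₀) / δ)) := by ring
      _ ≤ _ := by gcongr; linarith
  · rw [← mul_pow, hδρ] at hb2
    calc 1 = r ^ (2 * n) / r ^ (2 * n) := (div_self (by positivity)).symm
      _ ≤ C * ‖φ (y₀ + r)‖ / r ^ (2 * n) := by gcongr
      _ = C / r ^ (2 * n) * ‖φ (y₀ + r)‖ := by ring
      _ ≤ _ := by gcongr; linarith

end CriticalPoint

/-! ### Solutions on the closed upper half-plane. -/

section UpperSolution

variable {U : ℝ → ℝ} {β : ℝ} {O : Set (ℝ × ℂ)}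

theorem mem_closure_upper (hO : IsOpen O) {P : ℝ × ℂ} (hP : P ∈ O) (h0 : 0 ≤ P.2.im) :
    P ∈ closure (O ∩ {P | 0 < P.2.im}) := by
  refine hO.inter_closure ⟨hP, ?_⟩
  have : {P : ℝ × ℂ | 0 < P.2.im} = univ ×ˢ {c : ℂ | 0 < c.im} := by ext; simp
  rw [this, closure_prod_eq, closure_univ, Complex.closure_setOfPred_lt_im]
  exact ⟨mem_univ _, h0⟩

/-- Every point with Im c = 0 is a limit of points of `O` with Im c > 0. Estimates are proved in the
open half-plane, where there is no layer, and passed to the boundary by this lemma. -/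
theorem le_of_le_upper (hO : IsOpen O) {f g : ℝ × ℂ → ℝ} (hf : ContinuousOn f (O ∩ {P | 0 ≤ P.2.im}))
    (hg : ContinuousOn g (O ∩ {P | 0 ≤ P.2.im})) (h : ∀ P ∈ O ∩ {P | 0 < P.2.im}, f P ≤ g P) :
    ∀ P ∈ O ∩ {P | 0 ≤ P.2.im}, f P ≤ g P := by
  intro P hP
  have hsub : O ∩ {P : ℝ × ℂ | 0 < P.2.im} ⊆ O ∩ {P | 0 ≤ P.2.im} := fun P hP => ⟨hP.1, (show 0 < P.2.im from hP.2).le⟩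
  exact ContinuousWithinAt.closure_le (mem_closure_upper hO hP.1 hP.2) ((hf P hP).mono hsub) ((hg P hP).mono hsub) h

theorem eqOn_of_eqOn_upper (hO : IsOpen O) {f g : ℝ × ℂ → ℂ} (hf : ContinuousOn f (O ∩ {P | 0 ≤ P.2.im}))
    (hg : ContinuousOn g (O ∩ {P | 0 ≤ P.2.im})) (h : ∀ P ∈ O ∩ {P | 0 < P.2.im}, f P = g P) :
    ∀ P ∈ O ∩ {P | 0 ≤ P.2.im}, f P = g P := fun P hP =>
  sub_eq_zero.1 (norm_le_zero_iff.1 (le_of_le_upper hO (hf.sub hg).norm continuousOn_const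
    (fun P hP => by simp [h P hP]) P hP))

theorem isOpen_offCritical (hU : Continuous U) (hO : IsOpen O) : IsOpen (O ∩ {P : ℝ × ℂ | (U P.1 : ℂ) ≠ P.2}) :=
  hO.inter (isOpen_ne_fun (Complex.continuous_ofReal.comp (hU.comp continuous_fst)) continuous_snd)

theorem offCritical_eq : O ∩ {P : ℝ × ℂ | 0 ≤ P.2.im ∧ (U P.1 : ℂ) ≠ P.2} =
    (O ∩ {P : ℝ × ℂ | (U P.1 : ℂ) ≠ P.2}) ∩ {P | 0 ≤ P.2.im} := by
  ext P; simp only [mem_inter_iff, mem_ofPred_eq]; tauto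

theorem upper_subset : O ∩ {P : ℝ × ℂ | 0 < P.2.im} ⊆ O ∩ {P : ℝ × ℂ | 0 ≤ P.2.im ∧ (U P.1 : ℂ) ≠ P.2} := fun P hP =>
  ⟨hP.1, (show 0 < P.2.im from hP.2).le, sub_ne_zero.1 (sub_ne_zero_of_im (ne_of_gt hP.2) _)⟩

/-- The half-space has unique differentials, so the derivative within it is smooth. The `y`
direction is tangent to the boundary, hence the slice derivative is two-sided even there. -/
theorem exists_slice_deriv_closedHalf (hO : IsOpen O) {f : ℝ × ℂ → ℂ} (hf : ContDiffOn ℝ ∞ f (O ∩ {P | 0 ≤ P.2.im})) :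
    ∃ f', ContDiffOn ℝ ∞ f' (O ∩ {P | 0 ≤ P.2.im}) ∧
      ∀ P ∈ O ∩ {P | 0 ≤ P.2.im}, HasDerivAt (fun y => f (y, P.2)) (f' P) P.1 := by
  set T : Set (ℝ × ℂ) := O ∩ {P | 0 ≤ P.2.im} with hT
  have hu : UniqueDiffOn ℝ T := by
    rw [hT, inter_comm]
    refine UniqueDiffOn.inter (uniqueDiffOn_convex ?_ ⟨((0 : ℝ), Complex.I), ?_⟩) hO
    · exact convex_halfSpace_ge (f := fun P : ℝ × ℂ => P.2.im) ⟨fun _ _ => by simp, fun _ _ => by simp⟩ 0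
    · exact interior_maximal (t := {P : ℝ × ℂ | 0 < P.2.im}) (fun P hP => (show 0 < P.2.im from hP).le)
        (isOpen_lt continuous_const (Complex.continuous_im.comp continuous_snd)) (show 0 < Complex.I.im by simp)
  refine ⟨fun P => fderivWithin ℝ f T P (1, 0), (hf.fderivWithin hu (m := ∞) (by norm_cast)).clm_apply contDiffOn_const, fun P hP => ?_⟩
  have h1 := ((hf.differentiableOn (by norm_num)) P hP).hasFDerivWithinAt
  have hc : Continuous fun y : ℝ => (y, P.2) := by fun_prop
  have h2 : HasDerivWithinAt (fun y : ℝ => (y, P.2)) ((1 : ℝ), (0 : ℂ)) ((fun y : ℝ => (y, P.2)) ⁻¹' T) P.1 :=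
    ((hasDerivAt_id P.1).prodMk (hasDerivAt_const P.1 P.2)).hasDerivWithinAt
  refine (HasFDerivWithinAt.comp_hasDerivWithinAt (l := f) (t := T) P.1 h1 h2 fun y hy => hy).hasDerivAt ?_
  filter_upwards [hc.continuousAt.preimage_mem_nhds (hO.mem_nhds hP.1)] with y hy
  exact ⟨hy, hP.2⟩

/-- A solution of the Rayleigh equation on `O ∩ {0 ≤ Im c}`, smooth off the critical layer and continuous
across it. -/
structure IsUpperSolution (U : ℝ → ℝ) (β : ℝ) (O : Set (ℝ × ℂ)) (f f' : ℝ × ℂ → ℂ) : Prop where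
  smooth : ContDiffOn ℝ ∞ f (O ∩ {P | 0 ≤ P.2.im ∧ (U P.1 : ℂ) ≠ P.2})
  smooth' : ContDiffOn ℝ ∞ f' (O ∩ {P | 0 ≤ P.2.im ∧ (U P.1 : ℂ) ≠ P.2})
  cont : ContinuousOn f (O ∩ {P | 0 ≤ P.2.im})
  solves : SolvesOn U β f f' (O ∩ {P | 0 ≤ P.2.im ∧ (U P.1 : ℂ) ≠ P.2})

theorem IsUpperSolution.mono {O₂ : Set (ℝ × ℂ)} {f f' : ℝ × ℂ → ℂ} (h : IsUpperSolution U β O f f') (hO : O₂ ⊆ O) :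
    IsUpperSolution U β O₂ f f' :=
  ⟨h.smooth.mono (inter_subset_inter_left _ hO), h.smooth'.mono (inter_subset_inter_left _ hO),
    h.cont.mono (inter_subset_inter_left _ hO), fun P hP => h.solves P (inter_subset_inter_left _ hO hP)⟩

/-- Off the layer both sides of the equation are continuous up to the real axis, so it persists in
the limit. -/
theorem exists_isUpperSolution (hU : ContDiff ℝ ∞ U) (hO : IsOpen O) {f g : ℝ × ℂ → ℂ}
    (hf : ContDiffOn ℝ ∞ f (O ∩ {P | 0 ≤ P.2.im ∧ (U P.1 : ℂ) ≠ P.2})) (hc : ContinuousOn f (O ∩ {P | 0 ≤ P.2.im}))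
    (hs : SolvesOn U β f g (O ∩ {P | 0 < P.2.im})) :
    ∃ f', IsUpperSolution U β O f f' ∧ ∀ P ∈ O ∩ {P | 0 < P.2.im}, f' P = g P := by
  have hO' := isOpen_offCritical hU.continuous hO
  have hf₀ := hf
  rw [offCritical_eq] at hf
  obtain ⟨f', hf', hd'⟩ := exists_slice_deriv_closedHalf hO' hf
  obtain ⟨f'', hf'', hd''⟩ := exists_slice_deriv_closedHalf hO' hf'
  have hup : ∀ P ∈ O ∩ {P | 0 < P.2.im}, f' P = g P := fun P hP =>
    (hd' P (offCritical_eq (U := U) ▸ upper_subset hP)).unique (hs P hP).1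
  refine ⟨f', ⟨hf₀, by rwa [offCritical_eq], hc, ?_⟩, hup⟩
  rw [offCritical_eq]
  have hcoeff : ContinuousOn (coeff U β) ((O ∩ {P : ℝ × ℂ | (U P.1 : ℂ) ≠ P.2}) ∩ {P | 0 ≤ P.2.im}) :=
    (contDiffOn_coeff hU β fun P hP => hP.1.2).continuousOn
  have h2 := eqOn_of_eqOn_upper hO' hf''.continuousOn (hcoeff.mul hf.continuousOn) fun P hP => by
    have hP' : P ∈ O ∩ {P | 0 < P.2.im} := ⟨hP.1.1, hP.2⟩
    refine (hd'' P ⟨hP.1, (show 0 < P.2.im from hP.2).le⟩).unique ((hs P hP').2.congr_of_eventuallyEq ?_)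
    have hc : Continuous fun y : ℝ => (y, P.2) := by fun_prop
    filter_upwards [hc.continuousAt.preimage_mem_nhds (hO.mem_nhds hP'.1)] with y hy
    exact hup (y, P.2) ⟨hy, hP.2⟩
  exact fun P hP => ⟨hd' P hP, (hd'' P hP).congr_deriv (h2 P hP)⟩

theorem IsUpperSolution.combination {D : Set ℂ} (hOD : ∀ P ∈ O, P.2 ∈ D) {e₁ e₂ e₁' e₂' : ℝ × ℂ → ℂ}
    (h₁ : IsUpperSolution U β O e₁ e₁') (h₂ : IsUpperSolution U β O e₂ e₂') {k₁ k₂ : ℂ → ℂ}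
    (hk₁ : ContDiffOn ℝ ∞ k₁ (D ∩ {c | 0 ≤ c.im})) (hk₂ : ContDiffOn ℝ ∞ k₂ (D ∩ {c | 0 ≤ c.im})) :
    IsUpperSolution U β O (fun P => k₁ P.2 * e₁ P + k₂ P.2 * e₂ P) (fun P => k₁ P.2 * e₁' P + k₂ P.2 * e₂' P) := by
  have hk : ∀ {k : ℂ → ℂ}, ContDiffOn ℝ ∞ k (D ∩ {c | 0 ≤ c.im}) → ContDiffOn ℝ ∞ (fun P : ℝ × ℂ => k P.2) (O ∩ {P | 0 ≤ P.2.im}) :=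
    fun hk => hk.comp contDiff_snd.contDiffOn fun P hP => ⟨hOD P hP.1, hP.2⟩
  have hsub : O ∩ {P | 0 ≤ P.2.im ∧ (U P.1 : ℂ) ≠ P.2} ⊆ O ∩ {P | 0 ≤ P.2.im} := fun P hP => ⟨hP.1, hP.2.1⟩
  refine ⟨(((hk hk₁).mono hsub).mul h₁.smooth).add (((hk hk₂).mono hsub).mul h₂.smooth),
    (((hk hk₁).mono hsub).mul h₁.smooth').add (((hk hk₂).mono hsub).mul h₂.smooth'),
    ((hk hk₁).continuousOn.mul h₁.cont).add ((hk hk₂).continuousOn.mul h₂.cont), fun P hP => ?_⟩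
  obtain ⟨a1, a2⟩ := h₁.solves P hP
  obtain ⟨b1, b2⟩ := h₂.solves P hP
  exact ⟨(a1.const_mul (k₁ P.2)).add (b1.const_mul (k₂ P.2)),
    ((a2.const_mul (k₁ P.2)).add (b2.const_mul (k₂ P.2))).congr_deriv (by ring)⟩

theorem hasDerivAt_reflect {f : ℝ → ℂ} {f' : ℂ} {m y : ℝ} (h : HasDerivAt f f' (2 * m - y)) :
    HasDerivAt (fun y => f (2 * m - y)) (-f') y :=
  (HasDerivAt.scomp (h := fun y => 2 * m - y) y h ((hasDerivAt_id y).const_sub (2 * m))).congr_deriv (by simp)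

theorem coeff_reflect (m : ℝ) (P : ℝ × ℂ) :
    coeff (fun y => U (2 * m - y)) β P = coeff U β (2 * m - P.1, P.2) := by
  have h1 : deriv (fun y => U (2 * m - y)) = fun y => -deriv U (2 * m - y) := by
    funext y; exact deriv_comp_const_sub ..
  have h2 : deriv (fun y => -deriv U (2 * m - y)) P.1 = deriv (deriv U) (2 * m - P.1) := by
    rw [deriv.fun_neg, deriv_comp_const_sub, neg_neg]
  simp only [coeff, h1, h2]

/-- Wronskians of solutions are constant. -/
theorem wronskian_eq {a b : ℝ} {q f f' g g' : ℝ → ℂ}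
    (hf : ∀ y ∈ Ioo a b, HasDerivAt f (f' y) y ∧ HasDerivAt f' (q y * f y) y)
    (hg : ∀ y ∈ Ioo a b, HasDerivAt g (g' y) y ∧ HasDerivAt g' (q y * g y) y) {x y : ℝ} (hx : x ∈ Ioo a b) (hy : y ∈ Ioo a b) :
    f y * g' y - f' y * g y = f x * g' x - f' x * g x := by
  have hd : ∀ t ∈ Ioo a b, HasDerivAt (fun t => f t * g' t - f' t * g t) 0 t := fun t ht =>
    (((hf t ht).1.mul (hg t ht).2).sub ((hf t ht).2.mul (hg t ht).1)).congr_deriv (by ring)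
  exact isOpen_Ioo.is_const_of_deriv_eq_zero isPreconnected_Ioo (fun t ht => (hd t ht).differentiableAt.differentiableWithinAt)
    (fun t ht => (hd t ht).deriv) hy hx

end UpperSolution

/-! ### Local bases of solutions on the closed upper half-plane. -/

section LocalBasis

variable {U : ℝ → ℝ} {β : ℝ}

/-- A basis of solutions near a point where the profile has nonzero derivative: one solution is smooth across the
critical layer, the derivative of the other one is logarithmically singular. -/
structure IsSimpleBasis (U : ℝ → ℝ) (β : ℝ) (O : Set (ℝ × ℂ)) (C : ℝ) (e₁ e₂ e₁' e₂' : ℝ × ℂ → ℂ) : Prop where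
  sol₁ : IsUpperSolution U β O e₁ e₁'
  sol₂ : IsUpperSolution U β O e₂ e₂'
  wronskian : ∀ P ∈ O ∩ {P | 0 < P.2.im}, e₁ P * e₂' P - e₁' P * e₂ P = 1
  smooth : ContDiffOn ℝ ∞ e₁ O
  symm : ∀ y c, e₁ (y, (starRingEnd ℂ) c) = (starRingEnd ℂ) (e₁ (y, c))
  bound : ∀ P ∈ O ∩ {P | 0 ≤ P.2.im}, ‖e₁ P‖ ≤ C ∧ ‖e₂ P‖ ≤ C
  log_bound : ∀ P ∈ O ∩ {P | 0 ≤ P.2.im ∧ (U P.1 : ℂ) ≠ P.2}, ‖e₂' P‖ ≤ C * ‖Complex.log ((U P.1 : ℂ) - P.2)‖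

theorem IsSimpleBasis.mono {O O₂ : Set (ℝ × ℂ)} {C : ℝ} {e₁ e₂ e₁' e₂' : ℝ × ℂ → ℂ} (h : IsSimpleBasis U β O C e₁ e₂ e₁' e₂') (hO : O₂ ⊆ O) :
    IsSimpleBasis U β O₂ C e₁ e₂ e₁' e₂' :=
  ⟨h.sol₁.mono hO, h.sol₂.mono hO, fun P hP => h.wronskian P ⟨hO hP.1, hP.2⟩, h.smooth.mono hO, h.symm,
    fun P hP => h.bound P ⟨hO hP.1, hP.2⟩, fun P hP => h.log_bound P ⟨hO hP.1, hP.2⟩⟩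

theorem IsUpperSolution.neg {O : Set (ℝ × ℂ)} {f f' : ℝ × ℂ → ℂ} (h : IsUpperSolution U β O f f') :
    IsUpperSolution U β O (fun P => -f P) (fun P => -f' P) :=
  ⟨h.smooth.neg, h.smooth'.neg, h.cont.neg, fun P hP => ⟨(h.solves P hP).1.neg, (h.solves P hP).2.neg.congr_deriv (by ring)⟩⟩

theorem reflect_mem {m s : ℝ} {B : Set ℂ} {P : ℝ × ℂ} (hP : P ∈ Ioo (m - s) (m + s) ×ˢ B) :
    (2 * m - P.1, P.2) ∈ Ioo (m - s) (m + s) ×ˢ B :=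
  ⟨⟨by linarith [hP.1.2], by linarith [hP.1.1]⟩, hP.2⟩

theorem IsUpperSolution.reflect {m s : ℝ} {B : Set ℂ} {f f' : ℝ × ℂ → ℂ}
    (h : IsUpperSolution (fun y => U (2 * m - y)) β (Ioo (m - s) (m + s) ×ˢ B) f f') :
    IsUpperSolution U β (Ioo (m - s) (m + s) ×ˢ B) (fun P => f (2 * m - P.1, P.2)) (fun P => -f' (2 * m - P.1, P.2)) := by
  have hr : ContDiff ℝ ∞ fun P : ℝ × ℂ => (2 * m - P.1, P.2) := by fun_prop
  have hm' : ∀ P ∈ (Ioo (m - s) (m + s) ×ˢ B) ∩ {P | 0 ≤ P.2.im ∧ (U P.1 : ℂ) ≠ P.2}, (2 * m - P.1, P.2) ∈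
      (Ioo (m - s) (m + s) ×ˢ B) ∩ {P | 0 ≤ P.2.im ∧ ((fun y => U (2 * m - y)) P.1 : ℂ) ≠ P.2} := fun P hP =>
    ⟨reflect_mem hP.1, hP.2.1, by simpa using hP.2.2⟩
  refine ⟨h.smooth.comp hr.contDiffOn hm', (h.smooth'.comp hr.contDiffOn hm').neg,
    h.cont.comp hr.continuous.continuousOn fun P hP => ⟨reflect_mem hP.1, hP.2⟩, fun P hP => ?_⟩
  obtain ⟨h1, h2⟩ := h.solves _ (hm' P hP)
  refine ⟨hasDerivAt_reflect h1, (hasDerivAt_reflect h2).neg.congr_deriv ?_⟩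
  rw [coeff_reflect, neg_neg]
  simp

/-- A negative slope is reduced to a positive one by reflection about y₀. Reflection changes the
sign of Wronskians, so the second solution is negated as well. -/
theorem exists_isSimpleBasis (hU : ContDiff ℝ ∞ U) {y₀ : ℝ} (hd : deriv U y₀ ≠ 0) (β : ℝ) :
    ∃ s > 0, ∃ ε > 0, ∃ C, ∃ e₁ e₂ e₁' e₂' : ℝ × ℂ → ℂ,
      IsSimpleBasis U β (Ioo (y₀ - s) (y₀ + s) ×ˢ Metric.ball (U y₀ : ℂ) ε) C e₁ e₂ e₁' e₂' := by
  have key : ∀ {U : ℝ → ℝ}, ContDiff ℝ ∞ U → 0 < deriv U y₀ → ∃ s > 0, ∃ ε > 0, ∃ C, ∃ e₁ e₂ e₁' e₂' : ℝ × ℂ → ℂ,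
      IsSimpleBasis U β (Ioo (y₀ - s) (y₀ + s) ×ˢ Metric.ball (U y₀ : ℂ) ε) C e₁ e₂ e₁' e₂' := by
    intro U hU hd
    obtain ⟨r, hr, ε, hε, C, ψ₁, ψ₂, ψ₁', ψ₂', h⟩ := exists_basis_of_deriv_pos hU hd β
    obtain ⟨h1, hsym, h2, h3, h4, h5, h6, hb, hl⟩ := h _ rfl
    have hO : IsOpen (Ioo (y₀ - r) (y₀ + r) ×ˢ Metric.ball (U y₀ : ℂ) ε) := isOpen_Ioo.prod Metric.isOpen_ball
    obtain ⟨f₁, hf₁, hg₁⟩ := exists_isUpperSolution hU hO (h1.mono inter_subset_left) (h1.continuousOn.mono inter_subset_left) h4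
    obtain ⟨f₂, hf₂, hg₂⟩ := exists_isUpperSolution hU hO h2 h3 h5
    refine ⟨r, hr, ε, hε, C, ψ₁, ψ₂, f₁, f₂, hf₁, hf₂, fun P hP => ?_, h1, hsym, hb, fun P hP => ?_⟩
    · rw [hg₁ P hP, hg₂ P hP]
      exact h6 P hP
    · rw [← (hf₂.solves P hP).1.deriv]
      exact hl P hP
  rcases hd.lt_or_gt with hd | hd
  · have hUr : ContDiff ℝ ∞ fun y => U (2 * y₀ - y) := hU.comp (contDiff_const.sub contDiff_id)
    have hy : 2 * y₀ - y₀ = y₀ := by ring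
    obtain ⟨s, hs, ε, hε, C, e₁, e₂, e₁', e₂', h⟩ := key hUr (by rw [deriv_comp_const_sub, hy]; linarith)
    rw [hy] at h
    refine ⟨s, hs, ε, hε, C, _, _, _, _, h.sol₁.reflect, h.sol₂.reflect.neg, fun P hP => ?_, ?_, fun y c => h.symm _ _, fun P hP => ?_, fun P hP => ?_⟩
    · linear_combination h.wronskian _ ⟨reflect_mem hP.1, hP.2⟩
    · exact h.smooth.comp (by fun_prop : ContDiff ℝ ∞ fun P : ℝ × ℂ => (2 * y₀ - P.1, P.2)).contDiffOn fun P hP => reflect_mem hP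
    · simpa using h.bound _ ⟨reflect_mem hP.1, hP.2⟩
    · have := h.log_bound _ ⟨reflect_mem hP.1, hP.2.1, by simpa using hP.2.2⟩
      simpa using this
  · exact key hU hd

/-- On a layer point the basis of the simple layer is used; elsewhere the coefficient is smooth and
the solutions with unit Cauchy data serve. -/
theorem exists_upper_basis (hU : ContDiff ℝ ∞ U) {y₀ : ℝ} {c₁ : ℂ} (h : (U y₀ : ℂ) = c₁ → deriv U y₀ ≠ 0) (β : ℝ) {s₀ ε₀ : ℝ}
    (hs₀ : 0 < s₀) (hε₀ : 0 < ε₀) :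
    ∃ s ε, 0 < s ∧ s ≤ s₀ ∧ 0 < ε ∧ ε ≤ ε₀ ∧ ∃ e₁ e₂ e₁' e₂' : ℝ × ℂ → ℂ,
      IsUpperSolution U β (Ioo (y₀ - s) (y₀ + s) ×ˢ Metric.ball c₁ ε) e₁ e₁' ∧
      IsUpperSolution U β (Ioo (y₀ - s) (y₀ + s) ×ˢ Metric.ball c₁ ε) e₂ e₂' ∧
      ∀ P ∈ (Ioo (y₀ - s) (y₀ + s) ×ˢ Metric.ball c₁ ε) ∩ {P | 0 < P.2.im}, e₁ P * e₂' P - e₁' P * e₂ P = 1 := by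
  by_cases hc : (U y₀ : ℂ) = c₁
  · subst hc
    obtain ⟨r, hr, ε, hε, C, e₁, e₂, e₁', e₂', hb⟩ := exists_isSimpleBasis hU (h rfl) β
    have hb' := hb.mono (O₂ := Ioo (y₀ - min r s₀) (y₀ + min r s₀) ×ˢ Metric.ball (U y₀ : ℂ) (min ε ε₀))
      (prod_mono (Ioo_subset_Ioo (by linarith [min_le_left r s₀]) (by linarith [min_le_left r s₀]))
        (Metric.ball_subset_ball (min_le_left ε ε₀)))
    exact ⟨min r s₀, min ε ε₀, lt_min hr hs₀, min_le_right _ _, lt_min hε hε₀, min_le_right _ _, e₁, e₂, e₁', e₂', hb'.sol₁, hb'.sol₂, hb'.wronskian⟩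
  · have hcont : Continuous fun P : ℝ × ℂ => (U P.1 : ℂ) - P.2 := (contDiff_profile_sub hU).continuous
    obtain ⟨t, ht, hball⟩ := Metric.eventually_nhds_iff_ball.1 (hcont.continuousAt.eventually_ne (show (fun P : ℝ × ℂ => (U P.1 : ℂ) - P.2) (y₀, c₁) ≠ 0 from sub_ne_zero.2 hc))
    have hne : ∀ P ∈ Ioo (y₀ - min t s₀) (y₀ + min t s₀) ×ˢ Metric.ball c₁ (min t ε₀), (U P.1 : ℂ) ≠ P.2 := fun P hP => by
      refine sub_ne_zero.1 (hball P ?_)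
      rw [← ball_prod_same, ← Real.ball_eq_Ioo] at *
      exact ⟨Metric.ball_subset_ball (min_le_left _ _) hP.1, Metric.ball_subset_ball (min_le_left _ _) hP.2⟩
    have hs : 0 < min t s₀ := lt_min ht hs₀
    have hy₀ : y₀ ∈ Ioo (y₀ - min t s₀) (y₀ + min t s₀) := ⟨by linarith, by linarith⟩
    have hq := contDiffOn_coeff hU β hne
    obtain ⟨e₁, e₁', h1, h1', hs1⟩ := exists_solution_family Metric.isOpen_ball hq (S := 0) contDiffOn_const (d₀ := fun _ => 1) (d₁ := fun _ => 0)
      contDiffOn_const contDiffOn_const hy₀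
    obtain ⟨e₂, e₂', h2, h2', hs2⟩ := exists_solution_family Metric.isOpen_ball hq (S := 0) contDiffOn_const (d₀ := fun _ => 0) (d₁ := fun _ => 1)
      contDiffOn_const contDiffOn_const hy₀
    simp only [Pi.zero_apply, add_zero] at hs1 hs2
    refine ⟨min t s₀, min t ε₀, hs, min_le_right _ _, lt_min ht hε₀, min_le_right _ _, e₁, e₂, e₁', e₂',
      ⟨h1.mono inter_subset_left, h1'.mono inter_subset_left, h1.continuousOn.mono inter_subset_left, fun P hP => (hs1 P.2 hP.1.2).2.2 P.1 hP.1.1⟩,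
      ⟨h2.mono inter_subset_left, h2'.mono inter_subset_left, h2.continuousOn.mono inter_subset_left, fun P hP => (hs2 P.2 hP.1.2).2.2 P.1 hP.1.1⟩,
      fun P hP => ?_⟩
    have := wronskian_eq (hs1 P.2 hP.1.2).2.2 (hs2 P.2 hP.1.2).2.2 hy₀ hP.1.1
    rw [this, (hs1 P.2 hP.1.2).1, (hs1 P.2 hP.1.2).2.1, (hs2 P.2 hP.1.2).1, (hs2 P.2 hP.1.2).2.1]
    ring

end LocalBasis

/-! ### Extension of solutions to real parameters. -/

section Extension

/-- A family of solutions in the open half-plane, with smooth data at a point away from the critical layer,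
extends to the closed half-plane. -/
theorem exists_upper_extension {U : ℝ → ℝ} {β : ℝ} (hU : ContDiff ℝ ∞ U) {a b : ℝ} {D : Set ℂ} (hD : IsOpen D)
    (hcrit : ∀ y ∈ Ioo a b, ∀ c ∈ D, (U y : ℂ) = c → deriv U y ≠ 0) {φ φ' : ℝ × ℂ → ℂ}
    (hs : SolvesOn U β φ φ' ((Ioo a b ×ˢ D) ∩ {P | 0 < P.2.im})) {y₁ : ℝ} (hy₁ : y₁ ∈ Ioo a b)
    (hy₁c : ∀ c ∈ D, (U y₁ : ℂ) ≠ c) {d₀ d₁ : ℂ → ℂ} (hd₀ : ContDiffOn ℝ ∞ d₀ D) (hd₁ : ContDiffOn ℝ ∞ d₁ D)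
    (hdat : ∀ c ∈ D, 0 < c.im → φ (y₁, c) = d₀ c ∧ φ' (y₁, c) = d₁ c) :
    ∃ Φ Φ', IsUpperSolution U β (Ioo a b ×ˢ D) Φ Φ' ∧ ∀ P ∈ (Ioo a b ×ˢ D) ∩ {P | 0 < P.2.im}, Φ P = φ P ∧ Φ' P = φ' P := by
  have hO : IsOpen (Ioo a b ×ˢ D) := isOpen_Ioo.prod hD
  have hlocal : ∀ c₁ ∈ D, ∀ y ∈ Ioo a b, ∃ s > 0, ∃ ε > 0, Ioo (y - s) (y + s) ×ˢ Metric.ball c₁ ε ⊆ Ioo a b ×ˢ D ∧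
      ∃ F F', IsUpperSolution U β (Ioo (y - s) (y + s) ×ˢ Metric.ball c₁ ε) F F' ∧
        ∀ P ∈ (Ioo (y - s) (y + s) ×ˢ Metric.ball c₁ ε) ∩ {P | 0 < P.2.im}, F P = φ P ∧ F' P = φ' P := by
    intro c₁ hc₁
    obtain ⟨ε₀, hε₀, hε₀D⟩ := Metric.isOpen_iff.1 hD c₁ hc₁
    -- `G z`: near c₁ the Cauchy data of φ at `z` extend smoothly to real parameters.
    let G : ℝ → Prop := fun z => ∃ ε > 0, ∃ E E' : ℂ → ℂ, ContDiffOn ℝ ∞ E (Metric.ball c₁ ε ∩ {c | 0 ≤ c.im}) ∧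
      ContDiffOn ℝ ∞ E' (Metric.ball c₁ ε ∩ {c | 0 ≤ c.im}) ∧ ∀ c ∈ Metric.ball c₁ ε, 0 < c.im → φ (z, c) = E c ∧ φ' (z, c) = E' c
    have hslice : ∀ {s ε y z : ℝ} {f : ℝ × ℂ → ℂ}, z ∈ Ioo (y - s) (y + s) → (U z : ℂ) ≠ c₁ →
        ContDiffOn ℝ ∞ f ((Ioo (y - s) (y + s) ×ˢ Metric.ball c₁ ε) ∩ {P | 0 ≤ P.2.im ∧ (U P.1 : ℂ) ≠ P.2}) →
        ContDiffOn ℝ ∞ (fun c => f (z, c)) (Metric.ball c₁ (min ε ‖(U z : ℂ) - c₁‖) ∩ {c | 0 ≤ c.im}) := by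
      intro s ε y z f hz hzc hf
      refine hf.comp (contDiff_const.prodMk contDiff_id).contDiffOn fun c hc => ⟨⟨hz, Metric.ball_subset_ball (min_le_left _ _) hc.1⟩, hc.2, ?_⟩
      rintro (rfl : (U z : ℂ) = c)
      have := hc.1
      rw [Metric.mem_ball, dist_eq_norm] at this
      exact absurd (this.trans_le (min_le_right _ _)) (lt_irrefl _)
    -- Good data at a single point `z` off the layer extend φ on a whole neighbourhood of `y`, also
    -- across a layer between `z` and `y`. The width `s` does not depend on `z`, which makes the
    -- propagation below possible.
    have hprop : ∀ y ∈ Ioo a b, ∃ s > 0, Ioo (y - s) (y + s) ⊆ Ioo a b ∧ ∀ z ∈ Ioo (y - s) (y + s), (U z : ℂ) ≠ c₁ → G z →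
        ∃ ε > 0, Metric.ball c₁ ε ⊆ D ∧ ∃ F F', IsUpperSolution U β (Ioo (y - s) (y + s) ×ˢ Metric.ball c₁ ε) F F' ∧
          ∀ P ∈ (Ioo (y - s) (y + s) ×ˢ Metric.ball c₁ ε) ∩ {P | 0 < P.2.im}, F P = φ P ∧ F' P = φ' P := by
      intro y hy
      obtain ⟨s, ε, hs0, hss, hε, hεε, e₁, e₂, e₁', e₂', h1, h2, hW⟩ := exists_upper_basis hU (hcrit y hy c₁ hc₁) β
        (lt_min (sub_pos.2 hy.1) (sub_pos.2 hy.2)) hε₀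
      have hsub : Ioo (y - s) (y + s) ⊆ Ioo a b := Ioo_subset_Ioo (by linarith [hss.trans (min_le_left _ _)]) (by linarith [hss.trans (min_le_right _ _)])
      refine ⟨s, hs0, hsub, fun z hz hzc ⟨ε₂, hε₂, E, E', hE, hE', hEφ⟩ => ?_⟩
      set δ := min (min ε ‖(U z : ℂ) - c₁‖) ε₂ with hδ
      have hδε : δ ≤ ε := (min_le_left _ _).trans (min_le_left _ _)
      have hδ0 : 0 < δ := lt_min (lt_min hε (norm_pos_iff.2 (sub_ne_zero.2 hzc))) hε₂
      have hb1 : Metric.ball c₁ δ ∩ {c | 0 ≤ c.im} ⊆ Metric.ball c₁ (min ε ‖(U z : ℂ) - c₁‖) ∩ {c | 0 ≤ c.im} :=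
        inter_subset_inter_left _ (Metric.ball_subset_ball (min_le_left _ _))
      have hb2 : Metric.ball c₁ δ ∩ {c | 0 ≤ c.im} ⊆ Metric.ball c₁ ε₂ ∩ {c | 0 ≤ c.im} :=
        inter_subset_inter_left _ (Metric.ball_subset_ball (min_le_right _ _))
      have hδD : Metric.ball c₁ δ ⊆ D := (Metric.ball_subset_ball (hδε.trans hεε)).trans hε₀D
      have hOδ : Ioo (y - s) (y + s) ×ˢ Metric.ball c₁ δ ⊆ Ioo (y - s) (y + s) ×ˢ Metric.ball c₁ ε :=
        prod_mono subset_rfl (Metric.ball_subset_ball hδε)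
      -- Cramer's rule at `z`: since the basis has Wronskian 1, the coefficients of φ are its
      -- Wronskians with the basis functions.
      have hk₁ := ((hE.mono hb2).mul ((hslice hz hzc h2.smooth').mono hb1)).sub ((hE'.mono hb2).mul ((hslice hz hzc h2.smooth).mono hb1))
      have hk₂ := (((hslice hz hzc h1.smooth).mono hb1).mul (hE'.mono hb2)).sub (((hslice hz hzc h1.smooth').mono hb1).mul (hE.mono hb2))
      have hF := (h1.mono hOδ).combination (fun P hP => hP.2) (h2.mono hOδ) hk₁ hk₂
      refine ⟨δ, hδ0, hδD, _, _, hF, fun P hP => ?_⟩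
      have hPc : P.2.im ≠ 0 := ne_of_gt hP.2
      have hcoeff : ContinuousOn (fun y => coeff U β (y, P.2)) (Ioo (y - s) (y + s)) := by
        have h3 : ContinuousOn (coeff U β) {Q : ℝ × ℂ | Q.2.im ≠ 0} := (contDiffOn_coeff hU β fun Q hQ =>
          sub_ne_zero.1 (sub_ne_zero_of_im hQ _)).continuousOn
        exact ContinuousOn.comp (g := coeff U β) (f := fun y : ℝ => (y, P.2)) h3 (by fun_prop) fun x _ => hPc
      have hmem : ∀ x ∈ Ioo (y - s) (y + s), (x, P.2) ∈ (Ioo (y - s) (y + s) ×ˢ Metric.ball c₁ δ) ∩ {P | 0 < P.2.im} :=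
        fun x hx => ⟨⟨hx, hP.1.2⟩, hP.2⟩
      have hWz := hW (z, P.2) (inter_subset_inter_left _ hOδ (hmem z hz))
      obtain ⟨e3, e4⟩ := hEφ P.2 (Metric.ball_subset_ball (min_le_right _ _) hP.1.2) hP.2
      refine solution_unique hz hcoeff (S := 0) (φ := fun y => _) (ψ := fun y => φ (y, P.2)) (ψ' := fun y => φ' (y, P.2))
        (fun x hx => by simpa using hF.solves _ (upper_subset (hmem x hx)))
        (fun x hx => by simpa using hs (x, P.2) ⟨⟨hsub hx, hδD hP.1.2⟩, hP.2⟩) ?_ ?_ P.1 hP.1.1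
      · simp only [e3]; linear_combination E P.2 * hWz
      · simp only [e4]; linear_combination E' P.2 * hWz
    -- Otherwise U is locally constant, contradicting its nonzero derivative on the layer.
    have hdense : ∀ y ∈ Ioo a b, ∀ W ∈ 𝓝 y, ∃ z ∈ W, (U z : ℂ) ≠ c₁ := by
      intro y hy W hW
      by_contra! hcon
      have h1 : (U y : ℂ) = c₁ := hcon y (mem_of_mem_nhds hW)
      refine hcrit y hy c₁ hc₁ h1 ?_
      have h2 : U =ᶠ[𝓝 y] fun _ => U y := by
        filter_upwards [hW] with z hz
        exact_mod_cast (hcon z hz).trans h1.symm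
      rw [h2.deriv_eq, deriv_const]
    -- By `hstep` this property is locally constant in `y`. It holds at y₁ because of the given
    -- data, hence on the whole interval.
    let Q : ℝ → Prop := fun y => ∀ᶠ z in 𝓝 y, (U z : ℂ) ≠ c₁ → G z
    have hGall : ∀ {y s ε : ℝ} {F F' : ℝ × ℂ → ℂ}, 0 < ε → IsUpperSolution U β (Ioo (y - s) (y + s) ×ˢ Metric.ball c₁ ε) F F' →
        (∀ P ∈ (Ioo (y - s) (y + s) ×ˢ Metric.ball c₁ ε) ∩ {P | 0 < P.2.im}, F P = φ P ∧ F' P = φ' P) →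
        ∀ z ∈ Ioo (y - s) (y + s), (U z : ℂ) ≠ c₁ → G z := by
      intro y s ε F F' hε hF hFφ z hz hzc
      refine ⟨min ε ‖(U z : ℂ) - c₁‖, lt_min hε (norm_pos_iff.2 (sub_ne_zero.2 hzc)), _, _, hslice hz hzc hF.smooth, hslice hz hzc hF.smooth', fun c hc hc0 => ?_⟩
      obtain ⟨e1, e2⟩ := hFφ (z, c) ⟨⟨hz, Metric.ball_subset_ball (min_le_left _ _) hc⟩, hc0⟩
      exact ⟨e1.symm, e2.symm⟩
    have hstep : ∀ y ∈ Ioo a b, ∃ s > 0, Ioo (y - s) (y + s) ⊆ Ioo a b ∧ ∀ y' ∈ Ioo (y - s) (y + s), Q y' →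
        (∃ ε > 0, Metric.ball c₁ ε ⊆ D ∧ ∃ F F', IsUpperSolution U β (Ioo (y - s) (y + s) ×ˢ Metric.ball c₁ ε) F F' ∧
          ∀ P ∈ (Ioo (y - s) (y + s) ×ˢ Metric.ball c₁ ε) ∩ {P | 0 < P.2.im}, F P = φ P ∧ F' P = φ' P) ∧
        ∀ x ∈ Ioo (y - s) (y + s), Q x := by
      intro y hy
      obtain ⟨s, hs0, hsub, h⟩ := hprop y hy
      refine ⟨s, hs0, hsub, fun y' hy' hQ => ?_⟩
      obtain ⟨z, hz, hzc⟩ := hdense y' (hsub hy') _ (inter_mem (isOpen_Ioo.mem_nhds hy') hQ)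
      obtain ⟨ε, hε, hεD, F, F', hF, hFφ⟩ := h z hz.1 hzc (hz.2 hzc)
      refine ⟨⟨ε, hε, hεD, F, F', hF, hFφ⟩, fun x hx => ?_⟩
      filter_upwards [isOpen_Ioo.mem_nhds hx] with w hw
      exact hGall hε hF hFφ w hw
    have hQ₁ : Q y₁ := by
      obtain ⟨s, hs0, hsub, h⟩ := hprop y₁ hy₁
      have hy : y₁ ∈ Ioo (y₁ - s) (y₁ + s) := ⟨by linarith, by linarith⟩
      obtain ⟨ε, hε, hεD, F, F', hF, hFφ⟩ := h y₁ hy (hy₁c c₁ hc₁) ⟨ε₀, hε₀, d₀, d₁, hd₀.mono (inter_subset_left.trans hε₀D),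
        hd₁.mono (inter_subset_left.trans hε₀D), fun c hc hc0 => hdat c (hε₀D hc) hc0⟩
      filter_upwards [isOpen_Ioo.mem_nhds hy] with w hw
      exact hGall hε hF hFφ w hw
    have hQ : ∀ y ∈ Ioo a b, Q y := by
      intro y hy
      refine (isPreconnected_Ioo.induction₂ (fun x y => (Q x ↔ Q y)) (fun x hx => ?_)
        (fun x y z _ _ _ h1 h2 => h1.trans h2) (fun x y _ _ h => h.symm) hy₁ hy).1 hQ₁
      obtain ⟨s, hs0, hsub, h⟩ := hstep x hx
      have hx' : x ∈ Ioo (x - s) (x + s) := ⟨by linarith, by linarith⟩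
      filter_upwards [mem_nhdsWithin_of_mem_nhds (isOpen_Ioo.mem_nhds hx')] with y hy
      exact ⟨fun hq => (h x hx' hq).2 y hy, fun hq => (h y hy hq).2 x hx'⟩
    intro y hy
    obtain ⟨s, hs0, hsub, h⟩ := hstep y hy
    obtain ⟨⟨ε, hε, hεD, F, F', hF, hFφ⟩, -⟩ := h y ⟨by linarith, by linarith⟩ (hQ y hy)
    exact ⟨s, hs0, ε, hε, prod_mono hsub hεD, F, F', hF, hFφ⟩
  set Hp : Set (ℝ × ℂ) := {P | 0 < P.2.im} with hHp
  -- Every local extension is the limit of φ from Im c > 0, so the extension by limits agrees with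
  -- all of them and no gluing is needed.
  set Φ : ℝ × ℂ → ℂ := extendFrom Hp φ with hΦ
  have hloc : ∀ P ∈ Ioo a b ×ˢ D, ∃ N, IsOpen N ∧ P ∈ N ∧ ∃ F F', IsUpperSolution U β N F F' ∧ N ⊆ Ioo a b ×ˢ D ∧
      ∀ P ∈ N ∩ {P | 0 ≤ P.2.im}, Φ P = F P := by
    intro P hP
    obtain ⟨s, hs0, ε, hε, hN, F, F', hF, hFφ⟩ := hlocal P.2 hP.2 P.1 hP.1
    have hNo : IsOpen (Ioo (P.1 - s) (P.1 + s) ×ˢ Metric.ball P.2 ε) := isOpen_Ioo.prod Metric.isOpen_ball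
    refine ⟨_, hNo, ⟨⟨by linarith, by linarith⟩, Metric.mem_ball_self hε⟩, F, F', hF, hN, fun R hR => ?_⟩
    have hcl : R ∈ closure Hp := closure_mono inter_subset_right (mem_closure_upper hNo hR.1 hR.2)
    refine extendFrom_eq hcl ?_
    have hle : 𝓝[Hp] R ≤ 𝓝[(Ioo (P.1 - s) (P.1 + s) ×ˢ Metric.ball P.2 ε) ∩ {P | 0 ≤ P.2.im}] R := by
      refine nhdsWithin_le_iff.2 ?_
      filter_upwards [mem_nhdsWithin_of_mem_nhds (hNo.mem_nhds hR.1), self_mem_nhdsWithin] with x hx hx'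
      exact ⟨hx, (show 0 < x.2.im from hx').le⟩
    refine ((hF.cont R hR).mono_left hle).congr' ?_
    filter_upwards [mem_nhdsWithin_of_mem_nhds (hNo.mem_nhds hR.1), self_mem_nhdsWithin] with x hx hx'
    exact (hFφ x ⟨hx, hx'⟩).1
  have hφc : ∀ P ∈ (Ioo a b ×ˢ D) ∩ Hp, Φ P = φ P := by
    intro P hP
    obtain ⟨s, hs0, ε, hε, hN, F, F', hF, hFφ⟩ := hlocal P.2 hP.1.2 P.1 hP.1.1
    have hNo : IsOpen (Ioo (P.1 - s) (P.1 + s) ×ˢ Metric.ball P.2 ε) := isOpen_Ioo.prod Metric.isOpen_ball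
    have hPN : P ∈ Ioo (P.1 - s) (P.1 + s) ×ˢ Metric.ball P.2 ε := ⟨⟨by linarith, by linarith⟩, Metric.mem_ball_self hε⟩
    refine extendFrom_eq (subset_closure hP.2) ?_
    rw [← (hFφ P ⟨hPN, hP.2⟩).1]
    have h0 : P ∈ (Ioo (P.1 - s) (P.1 + s) ×ˢ Metric.ball P.2 ε) ∩ {P | 0 ≤ P.2.im} := ⟨hPN, (show 0 < P.2.im from hP.2).le⟩
    have h1 : ContinuousWithinAt F Hp P := (hF.cont P h0).mono_of_mem_nhdsWithin (by
      filter_upwards [mem_nhdsWithin_of_mem_nhds (hNo.mem_nhds hPN), self_mem_nhdsWithin] with x hx hx'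
      exact ⟨hx, (show 0 < x.2.im from hx').le⟩)
    refine Tendsto.congr' ?_ h1
    filter_upwards [mem_nhdsWithin_of_mem_nhds (hNo.mem_nhds hPN), self_mem_nhdsWithin] with x hx hx'
    exact (hFφ x ⟨hx, hx'⟩).1
  have hΦs : ContDiffOn ℝ ∞ Φ ((Ioo a b ×ˢ D) ∩ {P | 0 ≤ P.2.im ∧ (U P.1 : ℂ) ≠ P.2}) := by
    intro P hP
    obtain ⟨N, hNo, hPN, F, F', hF, hN, hFΦ⟩ := hloc P hP.1
    refine (((hF.smooth P ⟨hPN, hP.2⟩).congr (fun R hR => hFΦ R ⟨hR.1, hR.2.1⟩) (hFΦ P ⟨hPN, hP.2.1⟩))).mono_of_mem_nhdsWithin ?_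
    filter_upwards [mem_nhdsWithin_of_mem_nhds (hNo.mem_nhds hPN), self_mem_nhdsWithin] with x hx hx'
    exact ⟨hx, hx'.2⟩
  have hΦc : ContinuousOn Φ ((Ioo a b ×ˢ D) ∩ {P | 0 ≤ P.2.im}) := by
    intro P hP
    obtain ⟨N, hNo, hPN, F, F', hF, hN, hFΦ⟩ := hloc P hP.1
    refine (((hF.cont P ⟨hPN, hP.2⟩).congr (fun R hR => hFΦ R hR) (hFΦ P ⟨hPN, hP.2⟩))).mono_of_mem_nhdsWithin ?_
    filter_upwards [mem_nhdsWithin_of_mem_nhds (hNo.mem_nhds hPN), self_mem_nhdsWithin] with x hx hx'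
    exact ⟨hx, hx'.2⟩
  have hΦd : SolvesOn U β Φ φ' ((Ioo a b ×ˢ D) ∩ {P | 0 < P.2.im}) := by
    intro P hP
    obtain ⟨h1, h2⟩ := hs P hP
    refine ⟨h1.congr_of_eventuallyEq ?_, by rw [hφc P hP]; exact h2⟩
    filter_upwards [isOpen_Ioo.mem_nhds hP.1.1] with y hy
    exact hφc (y, P.2) ⟨⟨hy, hP.1.2⟩, hP.2⟩
  obtain ⟨Φ', hΦ', hΦφ'⟩ := exists_isUpperSolution hU hO hΦs hΦc hΦd
  exact ⟨Φ, Φ', hΦ', fun P hP => ⟨hφc P hP, hΦφ' P hP⟩⟩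

end Extension

/-! ### Reflection to the lower half-plane. -/

section TwoSided

variable {U : ℝ → ℝ} {α : ℝ} {n : ℕ} {y₀ r ε : ℝ} {c₀ : ℂ} {s : ℤˣ}

open Classical in
/-- The extension of a function on the closed upper half-plane to both half-planes by complex conjugation. -/
noncomputable def twoSided (f : ℝ × ℂ → ℂ) (s : ℤˣ) (y : ℝ) (c : ℂ) : ℂ :=
  if 0 < c.im ∨ (c.im = 0 ∧ s = 1) then f (y, c) else (starRingEnd ℂ) (f (y, (starRingEnd ℂ) c))

theorem twoSided_one (f : ℝ × ℂ → ℂ) (y : ℝ) {c : ℂ} (hc : 0 ≤ c.im) : twoSided f 1 y c = f (y, c) :=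
  if_pos (hc.lt_or_eq.imp id fun h => ⟨h.symm, rfl⟩)

theorem twoSided_neg_one (f : ℝ × ℂ → ℂ) (y : ℝ) (c : ℂ) :
    twoSided f (-1) y c = (starRingEnd ℂ) (twoSided f 1 y ((starRingEnd ℂ) c)) := by
  have h1 : (-1 : ℤˣ) ≠ 1 := by decide
  rcases lt_trichotomy c.im 0 with h | h | h
  · simp [twoSided, h1, not_lt.2 h.le, h]
  · simp [twoSided, h1, h]
  · simp [twoSided, h1, h, not_lt.2 h.le, h.ne']

theorem mem_closedHalfPlane_one {c : ℂ} : c ∈ closedHalfPlane 1 ↔ 0 ≤ c.im := by simp [closedHalfPlane]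

theorem mem_closedHalfPlane_neg_one {c : ℂ} : c ∈ closedHalfPlane (-1) ↔ (starRingEnd ℂ) c ∈ closedHalfPlane 1 := by
  simp [closedHalfPlane]

theorem mem_paramSet_conj (hc₀ : (U y₀ : ℂ) = c₀) {c : ℂ} (hc : c ∈ paramSet n c₀ ε) : (starRingEnd ℂ) c ∈ paramSet n c₀ ε := by
  have h0 : (starRingEnd ℂ) c₀ = c₀ := by rw [← hc₀]; exact Complex.conj_ofReal _
  refine ⟨?_, hc.2.imp id fun h h' => h ?_⟩
  · have := hc.1
    rw [Metric.mem_ball, dist_eq_norm] at this ⊢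
    rwa [← h0, ← map_sub, RCLike.norm_conj]
  · rw [← h0, ← h', Complex.conj_conj]

theorem ofReal_ne_conj {x : ℝ} {c : ℂ} (h : (x : ℂ) ≠ c) : (x : ℂ) ≠ (starRingEnd ℂ) c := fun h' =>
  h (by rw [← Complex.conj_ofReal, h', Complex.conj_conj])

theorem mem_noncriticalParams_conj (hc₀ : (U y₀ : ℂ) = c₀) {c : ℂ} (hc : c ∈ noncriticalParams U n y₀ c₀ r ε) :
    (starRingEnd ℂ) c ∈ noncriticalParams U n y₀ c₀ r ε :=
  ⟨mem_paramSet_conj hc₀ hc.1, fun z hz => ofReal_ne_conj (hc.2 z hz)⟩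

theorem mem_offCritical_conj (hc₀ : (U y₀ : ℂ) = c₀) {y : ℝ} {c : ℂ} (h : (y, c) ∈ offCritical U n y₀ c₀ r ε (-1)) :
    (y, (starRingEnd ℂ) c) ∈ offCritical U n y₀ c₀ r ε 1 :=
  ⟨h.1, ⟨mem_paramSet_conj hc₀ h.2.1.1, mem_closedHalfPlane_neg_one.1 h.2.1.2⟩, ofReal_ne_conj h.2.2⟩

theorem offCritical_one : offCritical U n y₀ c₀ r ε 1 =
    (Ioo (y₀ - r) (y₀ + r) ×ˢ paramSet n c₀ ε) ∩ {P | 0 ≤ P.2.im ∧ (U P.1 : ℂ) ≠ P.2} := by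
  ext P
  simp only [offCritical, mem_ofPred_eq, mem_inter_iff, mem_closedHalfPlane_one, mem_prod]
  tauto

theorem deriv_conj (h : ℝ → ℂ) (y : ℝ) : deriv (fun x => (starRingEnd ℂ) (h x)) y = (starRingEnd ℂ) (deriv h y) := deriv.star ..

theorem iteratedDeriv_two_conj (h : ℝ → ℂ) (y : ℝ) :
    iteratedDeriv 2 (fun x => (starRingEnd ℂ) (h x)) y = (starRingEnd ℂ) (iteratedDeriv 2 h y) := by
  have h1 : deriv (fun x => (starRingEnd ℂ) (h x)) = fun y => (starRingEnd ℂ) (deriv h y) := funext (deriv_conj h)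
  rw [iteratedDeriv_succ, iteratedDeriv_one, iteratedDeriv_succ, iteratedDeriv_one, h1, deriv_conj]

theorem rayleighOp_conj (h : ℝ → ℂ) (c : ℂ) (y : ℝ) :
    rayleighOp U α c (fun x => (starRingEnd ℂ) (h x)) y = (starRingEnd ℂ) (rayleighOp U α ((starRingEnd ℂ) c) h y) := by
  simp [rayleighOp, iteratedDeriv_two_conj]

/-- A bounded solution on the closed upper half-plane whose extension by conjugation is smooth at the
noncritical parameters. -/
structure IsUpperFamily (U : ℝ → ℝ) (β : ℝ) (n : ℕ) (y₀ : ℝ) (c₀ : ℂ) (r ε C : ℝ) (f f' : ℝ × ℂ → ℂ) : Prop where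
  sol : IsUpperSolution U β (Ioo (y₀ - r) (y₀ + r) ×ˢ paramSet n c₀ ε) f f'
  bound : ∀ P ∈ (Ioo (y₀ - r) (y₀ + r) ×ˢ paramSet n c₀ ε) ∩ {P | 0 ≤ P.2.im}, ‖f P‖ ≤ C
  symm : ∃ Ψ, ContDiffOn ℝ ∞ Ψ (Ioo (y₀ - r) (y₀ + r) ×ˢ noncriticalParams U n y₀ c₀ r ε) ∧
    (∀ y ∈ Ioo (y₀ - r) (y₀ + r), ∀ c ∈ noncriticalParams U n y₀ c₀ r ε, Ψ (y, (starRingEnd ℂ) c) = (starRingEnd ℂ) (Ψ (y, c))) ∧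
    ∀ y ∈ Ioo (y₀ - r) (y₀ + r), ∀ c ∈ noncriticalParams U n y₀ c₀ r ε, 0 ≤ c.im → Ψ (y, c) = f (y, c)

theorem IsUpperSolution.deriv_twoSided {β : ℝ} {O : Set (ℝ × ℂ)} {f f' : ℝ × ℂ → ℂ} (hU : Continuous U) (hO : IsOpen O)
    (h : IsUpperSolution U β O f f') {y : ℝ} {c : ℂ} (hP : (y, c) ∈ O ∩ {P | 0 ≤ P.2.im ∧ (U P.1 : ℂ) ≠ P.2}) :
    deriv (fun x => twoSided f 1 x c) y = f' (y, c) ∧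
      iteratedDeriv 2 (fun x => twoSided f 1 x c) y = coeff U β (y, c) * f (y, c) := by
  have h1 : (fun x => twoSided f 1 x c) = fun x => f (x, c) := funext fun x => twoSided_one f x hP.2.1
  rw [h1, iteratedDeriv_succ, iteratedDeriv_one]
  refine ⟨(h.solves _ hP).1.deriv, ?_⟩
  rw [← (h.solves _ hP).2.deriv]
  refine Filter.EventuallyEq.deriv_eq ?_
  have hc : Continuous fun y : ℝ => (y, c) := by fun_prop
  filter_upwards [hc.continuousAt.preimage_mem_nhds ((isOpen_offCritical hU hO).mem_nhds ⟨hP.1, hP.2.2⟩)] with x hx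
  exact (h.solves (x, c) ⟨hx.1, hP.2.1, hx.2⟩).1.deriv

theorem isOpen_paramSet : IsOpen (paramSet n c₀ ε) := by
  have : paramSet n c₀ ε = Metric.ball c₀ ε ∩ {c | n = 1 ∨ c ≠ c₀} := rfl
  rw [this]
  refine Metric.isOpen_ball.inter ?_
  by_cases hn : n = 1
  · simp [hn]
  · simpa [hn] using isOpen_ne

/-- Each property is proved for the sign 1 and transferred to -1 by conjugation. The second
derivative is coefficient times solution, and the coefficient is at most (α² K + K₂)/|U - c|. -/
theorem IsUpperFamily.isLocalRayleighFamily (hU : Continuous U) (hc₀ : (U y₀ : ℂ) = c₀) {C K K₂ C' : ℝ} {f f' : ℝ × ℂ → ℂ}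
    (h : IsUpperFamily U (α ^ 2) n y₀ c₀ r ε C f f')
    (hK : ∀ y ∈ Ioo (y₀ - r) (y₀ + r), ∀ c ∈ paramSet n c₀ ε, ‖(U y : ℂ) - c‖ ≤ K)
    (hK₂ : ∀ y ∈ Ioo (y₀ - r) (y₀ + r), |deriv (deriv U) y| ≤ K₂) (hC : C ≤ C') (hC' : (α ^ 2 * K + K₂) * C ≤ C') :
    IsLocalRayleighFamily U α n y₀ c₀ r ε C' (twoSided f) := by
  have hO : IsOpen (Ioo (y₀ - r) (y₀ + r) ×ˢ paramSet n c₀ ε) := isOpen_Ioo.prod isOpen_paramSet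
  obtain ⟨Ψ, hΨ, hΨs, hΨf⟩ := h.symm
  -- At noncritical parameters both boundary values are the same symmetric smooth function Ψ; this
  -- also gives smoothness across the real axis there.
  have heq : ∀ s : ℤˣ, ∀ y ∈ Ioo (y₀ - r) (y₀ + r), ∀ c ∈ noncriticalParams U n y₀ c₀ r ε, twoSided f s y c = Ψ (y, c) := by
    have h1 : ∀ y ∈ Ioo (y₀ - r) (y₀ + r), ∀ c ∈ noncriticalParams U n y₀ c₀ r ε, twoSided f 1 y c = Ψ (y, c) := fun y hy c hc => by
      rcases le_or_gt 0 c.im with h0 | h0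
      · rw [twoSided_one f y h0, hΨf y hy c hc h0]
      · have h2 : ¬ (0 < c.im ∨ (c.im = 0 ∧ (1 : ℤˣ) = 1)) := by
          rintro (h2 | h2)
          · exact absurd h0 h2.not_gt
          · exact absurd h2.1 h0.ne
        rw [twoSided, if_neg h2, ← hΨf y hy _ (mem_noncriticalParams_conj hc₀ hc) (by simpa using h0.le), hΨs y hy c hc, Complex.conj_conj]
    intro s y hy c hc
    rcases Int.units_eq_one_or s with rfl | rfl
    · exact h1 y hy c hc
    · rw [twoSided_neg_one, h1 y hy _ (mem_noncriticalParams_conj hc₀ hc), hΨs y hy c hc, Complex.conj_conj]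
  have hr : ContDiff ℝ ∞ fun P : ℝ × ℂ => (P.1, (starRingEnd ℂ) P.2) :=
    contDiff_fst.prodMk ((Complex.conjCLE : ℂ →L[ℝ] ℂ).contDiff.comp contDiff_snd)
  have hcj : ContDiff ℝ ∞ fun z : ℂ => (starRingEnd ℂ) z := (Complex.conjCLE : ℂ →L[ℝ] ℂ).contDiff
  have hsm : ContDiffOn ℝ ∞ (fun p : ℝ × ℂ => twoSided f 1 p.1 p.2) (offCritical U n y₀ c₀ r ε 1) := by
    rw [offCritical_one]
    exact h.sol.smooth.congr fun P hP => twoSided_one f _ hP.2.1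
  have hco : ContinuousOn (fun p : ℝ × ℂ => twoSided f 1 p.1 p.2) (Ioo (y₀ - r) (y₀ + r) ×ˢ (paramSet n c₀ ε ∩ closedHalfPlane 1)) :=
    (h.sol.cont.congr fun P hP => twoSided_one f _ hP.2).mono fun P hP => ⟨⟨hP.1, hP.2.1⟩, mem_closedHalfPlane_one.1 hP.2.2⟩
  have hbd : ∀ y ∈ Ioo (y₀ - r) (y₀ + r), ∀ c ∈ paramSet n c₀ ε ∩ closedHalfPlane 1, ‖twoSided f 1 y c‖ ≤ C' := fun y hy c hc => by
    rw [twoSided_one f y (mem_closedHalfPlane_one.1 hc.2)]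
    exact (h.bound (y, c) ⟨⟨hy, hc.1⟩, mem_closedHalfPlane_one.1 hc.2⟩).trans hC
  have hso : ∀ y c, (y, c) ∈ offCritical U n y₀ c₀ r ε 1 → rayleighOp U α c (fun x => twoSided f 1 x c) y = 0 ∧
      ‖iteratedDeriv 2 (fun x => twoSided f 1 x c) y‖ ≤ C' * ‖(U y : ℂ) - c‖⁻¹ := fun y c hP => by
    rw [offCritical_one] at hP
    have hne : (U y : ℂ) - c ≠ 0 := sub_ne_zero.2 hP.2.2
    have hpos : 0 < ‖(U y : ℂ) - c‖ := norm_pos_iff.2 hne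
    obtain ⟨-, h2⟩ := h.sol.deriv_twoSided hU hO hP
    rw [rayleighOp, h2, twoSided_one f y hP.2.1]
    refine ⟨?_, ?_⟩
    · rw [iteratedDeriv_succ, iteratedDeriv_one, coeff]
      push_cast
      field_simp
      ring
    · have hb := h.bound (y, c) ⟨hP.1, hP.2.1⟩
      have hC0 : 0 ≤ C := (norm_nonneg _).trans hb
      have hK1 := hK y hP.1.1 c hP.1.2
      have hK3 := hK₂ y hP.1.1
      have h3 : ‖coeff U (α ^ 2) (y, c)‖ ≤ (α ^ 2 * K + K₂) * ‖(U y : ℂ) - c‖⁻¹ := by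
        rw [coeff]
        refine (norm_add_le _ _).trans ?_
        rw [norm_div, Complex.norm_real, Complex.norm_real, Real.norm_eq_abs, Real.norm_eq_abs, abs_of_nonneg (sq_nonneg α), add_mul, ← div_eq_mul_inv, ← div_eq_mul_inv]
        refine add_le_add ?_ (by gcongr)
        rw [le_div_iff₀ hpos]
        exact mul_le_mul_of_nonneg_left hK1 (sq_nonneg α)
      calc ‖coeff U (α ^ 2) (y, c) * f (y, c)‖ ≤ ((α ^ 2 * K + K₂) * ‖(U y : ℂ) - c‖⁻¹) * C := by
            rw [norm_mul]; exact mul_le_mul h3 hb (norm_nonneg _) ((norm_nonneg _).trans h3)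
        _ = (α ^ 2 * K + K₂) * C * ‖(U y : ℂ) - c‖⁻¹ := by ring
        _ ≤ _ := by gcongr
  refine ⟨fun y hy c hc => by rw [heq 1 y hy c hc, heq (-1) y hy c hc], fun s => hΨ.congr fun P hP => heq s _ hP.1 _ hP.2,
    fun s => ?_, fun s => ?_, fun s => ?_, fun s => ?_, fun s => ?_⟩ <;>
    rcases Int.units_eq_one_or s with rfl | rfl
  · exact hsm
  · simp only [twoSided_neg_one]
    exact hcj.comp_contDiffOn (hsm.comp hr.contDiffOn fun P hP => mem_offCritical_conj hc₀ hP)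
  · exact hco
  · simp only [twoSided_neg_one]
    exact hcj.continuous.comp_continuousOn (hco.comp hr.continuous.continuousOn fun P hP =>
      ⟨hP.1, mem_paramSet_conj hc₀ hP.2.1, mem_closedHalfPlane_neg_one.1 hP.2.2⟩)
  · exact fun y c hP => (hso y c hP).1
  · intro y c hP
    simp only [twoSided_neg_one]
    rw [rayleighOp_conj, (hso y _ (mem_offCritical_conj hc₀ hP)).1, map_zero]
  · exact hbd
  · intro y hy c hc
    rw [twoSided_neg_one, RCLike.norm_conj]
    exact hbd y hy _ ⟨mem_paramSet_conj hc₀ hc.1, mem_closedHalfPlane_neg_one.1 hc.2⟩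
  · exact fun y c hP => (hso y c hP).2
  · intro y c hP
    simp only [twoSided_neg_one]
    rw [iteratedDeriv_two_conj, RCLike.norm_conj]
    refine (hso y _ (mem_offCritical_conj hc₀ hP)).2.trans_eq ?_
    rw [← RCLike.norm_conj ((U y : ℂ) - c), map_sub, Complex.conj_ofReal]

end TwoSided

/-! ### Families with prescribed Cauchy data. -/

section CauchyData

variable {U : ℝ → ℝ} {β : ℝ} {n : ℕ} {y₀ r ε : ℝ} {c₀ : ℂ}

/-- The solution with given Cauchy data at a point away from the critical layer. -/
theorem exists_family_of_data (hU : ContDiff ℝ ∞ U) (hc₀ : (U y₀ : ℂ) = c₀) {a b : ℝ} (hab : Icc (y₀ - r) (y₀ + r) ⊆ Ioo a b)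
    (hcrit : ∀ y ∈ Ioo a b, ∀ c ∈ paramSet n c₀ ε, (U y : ℂ) = c → deriv U y ≠ 0)
    (hout : ∀ y ∈ Ioo a b, y ∉ Ioo (y₀ - r) (y₀ + r) → ∀ c ∈ paramSet n c₀ ε, (U y : ℂ) ≠ c)
    {p : ℝ} (hp : p ∈ Ioo a b) (hpr : p ∉ Ioo (y₀ - r) (y₀ + r)) {d : ℂ → ℂ} (hd : ContDiffOn ℝ ∞ d (paramSet n c₀ ε))
    (hds : ∀ c ∈ paramSet n c₀ ε, d ((starRingEnd ℂ) c) = (starRingEnd ℂ) (d c)) :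
    ∃ Φ Φ', IsUpperSolution U β (Ioo a b ×ˢ paramSet n c₀ ε) Φ Φ' ∧
      (∀ c ∈ paramSet n c₀ ε, 0 < c.im → Φ (p, c) = 0 ∧ Φ' (p, c) = d c) ∧
      ∃ Ψ, ContDiffOn ℝ ∞ Ψ (Ioo (y₀ - r) (y₀ + r) ×ˢ noncriticalParams U n y₀ c₀ r ε) ∧
        (∀ y ∈ Ioo (y₀ - r) (y₀ + r), ∀ c ∈ noncriticalParams U n y₀ c₀ r ε, Ψ (y, (starRingEnd ℂ) c) = (starRingEnd ℂ) (Ψ (y, c))) ∧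
        ∀ y ∈ Ioo (y₀ - r) (y₀ + r), ∀ c ∈ noncriticalParams U n y₀ c₀ r ε, 0 ≤ c.im → Ψ (y, c) = Φ (y, c) := by
  set D := paramSet n c₀ ε with hD_def
  set N := noncriticalParams U n y₀ c₀ r ε with hN_def
  have hD : IsOpen D := isOpen_paramSet
  have hsub : Ioo (y₀ - r) (y₀ + r) ⊆ Ioo a b := Ioo_subset_Icc_self.trans hab
  have hNe : ∀ P ∈ Ioo a b ×ˢ N, (U P.1 : ℂ) ≠ P.2 := fun P hP => by
    by_cases h : P.1 ∈ Ioo (y₀ - r) (y₀ + r)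
    · exact hP.2.2 _ h
    · exact hout _ hP.1 h _ hP.2.1
  -- The closed interval may replace the open one, since its end points are never critical; the
  -- excluded values then form a compact set.
  have hN : IsOpen N := by
    have hK : IsCompact ((fun z : ℝ => (U z : ℂ)) '' Icc (y₀ - r) (y₀ + r)) :=
      isCompact_Icc.image (Complex.continuous_ofReal.comp hU.continuous)
    have : N = D ∩ ((fun z : ℝ => (U z : ℂ)) '' Icc (y₀ - r) (y₀ + r))ᶜ := by
      ext c
      refine ⟨fun hc => ⟨hc.1, ?_⟩, fun hc => ⟨hc.1, fun z hz h => hc.2 ⟨z, Ioo_subset_Icc_self hz, h⟩⟩⟩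
      rintro ⟨z, hz, hzc⟩
      exact hNe (z, c) ⟨hab hz, hc⟩ hzc
    rw [this]
    exact hD.inter hK.isClosed.isOpen_compl
  have hupper : IsOpen {c : ℂ | 0 < c.im} := isOpen_lt continuous_const Complex.continuous_im
  have him : ∀ {y : ℝ} {c : ℂ}, 0 < c.im → (U y : ℂ) ≠ c := fun hc => sub_ne_zero.1 (sub_ne_zero_of_im hc.ne' _)
  obtain ⟨φ, φ', -, -, hφ⟩ := exists_solution_family (a := a) (b := b) (hD.inter hupper)
    (contDiffOn_coeff hU β (B := Ioo a b ×ˢ (D ∩ {c : ℂ | 0 < c.im})) fun P hP => him hP.2.2) (S := 0) contDiffOn_const (d₀ := fun _ => 0) contDiffOn_const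
    (hd.mono inter_subset_left) hp
  -- The same data over all noncritical parameters, real ones and both half-planes included.
  -- Uniqueness gives its symmetry and, with continuity, its agreement with Φ.
  obtain ⟨Ψ, Ψ', hΨ, hΨ', hΨs⟩ := exists_solution_family (a := a) (b := b) hN
    (contDiffOn_coeff hU β hNe) (S := 0) contDiffOn_const (d₀ := fun _ => 0) contDiffOn_const (hd.mono fun c hc => hc.1) hp
  simp only [Pi.zero_apply, add_zero] at hφ hΨs
  obtain ⟨Φ, Φ', hΦ, hΦφ⟩ := exists_upper_extension (β := β) hU hD hcrit (φ := φ) (φ' := φ')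
    (fun P hP => (hφ P.2 ⟨hP.1.2, hP.2⟩).2.2 P.1 hP.1.1) hp (hout p hp hpr) (d₀ := fun _ => 0) contDiffOn_const hd
    fun c hc h => ⟨(hφ c ⟨hc, h⟩).1, (hφ c ⟨hc, h⟩).2.1⟩
  have hdat : ∀ c ∈ D, 0 < c.im → Φ (p, c) = 0 ∧ Φ' (p, c) = d c := fun c hc h => by
    obtain ⟨h1, h2⟩ := hΦφ (p, c) ⟨⟨hp, hc⟩, h⟩
    rw [h1, h2]
    exact ⟨(hφ c ⟨hc, h⟩).1, (hφ c ⟨hc, h⟩).2.1⟩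
  have hqc : ∀ c ∈ N, ContinuousOn (fun y => coeff U β (y, c)) (Ioo a b) := fun c hc =>
    (contDiffOn_coeff hU β hNe).continuousOn.comp (by fun_prop) fun y hy => ⟨hy, hc⟩
  refine ⟨Φ, Φ', hΦ, hdat, Ψ, hΨ.mono (prod_mono hsub subset_rfl), fun y hy c hc => ?_, fun y hy c hc h0 => ?_⟩
  · have hcc := mem_noncriticalParams_conj hc₀ hc
    refine (solution_unique hp (hqc _ hcc) (S := 0) (φ := fun y => Ψ (y, (starRingEnd ℂ) c)) (φ' := fun y => Ψ' (y, (starRingEnd ℂ) c))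
      (ψ := fun y => (starRingEnd ℂ) (Ψ (y, c))) (ψ' := fun y => (starRingEnd ℂ) (Ψ' (y, c)))
      (fun t ht => by simpa using (hΨs _ hcc).2.2 t ht) (fun t ht => ?_) ?_ ?_ y (hsub hy)).1
    · obtain ⟨h1, h2⟩ := (hΨs c hc).2.2 t ht
      exact ⟨hasDerivAt_conj h1, (hasDerivAt_conj h2).congr_deriv (by rw [coeff_conj]; simp)⟩
    · rw [(hΨs _ hcc).1, (hΨs _ hc).1, map_zero]
    · rw [(hΨs _ hcc).2.1, (hΨs _ hc).2.1, hds c hc.1]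
  · have hO : IsOpen (Ioo a b ×ˢ N) := isOpen_Ioo.prod hN
    refine eqOn_of_eqOn_upper hO (hΨ.continuousOn.mono inter_subset_left) (hΦ.cont.mono
      (inter_subset_inter_left _ (prod_mono subset_rfl fun c hc => hc.1))) (fun P hP => ?_) (y, c) ⟨⟨hsub hy, hc⟩, h0⟩
    obtain ⟨y, c⟩ := P
    obtain ⟨⟨hy, hc⟩, h0⟩ := hP
    change 0 < c.im at h0
    refine (solution_unique hp (hqc _ hc) (S := 0) (φ := fun y => Ψ (y, c)) (φ' := fun y => Ψ' (y, c))
      (ψ := fun y => Φ (y, c)) (ψ' := fun y => Φ' (y, c)) (fun t ht => by simpa using (hΨs _ hc).2.2 t ht) (fun t ht => ?_) ?_ ?_ y hy).1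
    · simpa using hΦ.solves (t, c) ⟨⟨ht, hc.1⟩, h0.le, him h0⟩
    · rw [(hΨs _ hc).1, (hdat c hc.1 h0).1]
    · rw [(hΨs _ hc).2.1, (hdat c hc.1 h0).2]

end CauchyData

/-! ### The pair of solutions for n ≥ 2. -/

section DegeneratePoint

variable {U : ℝ → ℝ} {β : ℝ} {n : ℕ} {y₀ r ε : ℝ} {c₀ : ℂ}

/-- With t = δⁿ the left side is at most (δ + |x|)ⁿ. So the weighted bounds imply plain boundedness.
-/
theorem mul_zetaWeight_le (hn : 1 ≤ n) {t x : ℝ} (ht : 0 < t) (ht1 : t ≤ 1) (hx : |x| ≤ r) :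
    t * zetaWeight n (x / t ^ (1 / (n : ℝ))) ≤ (1 + r) ^ n := by
  have hδ : 0 < t ^ (1 / (n : ℝ)) := Real.rpow_pos_of_pos ht _
  have hδ1 : t ^ (1 / (n : ℝ)) ≤ 1 := Real.rpow_le_one ht.le ht1 (by positivity)
  have hδn : (t ^ (1 / (n : ℝ))) ^ n = t := by
    rw [one_div, Real.rpow_inv_natCast_pow ht.le (by omega)]
  set δ := t ^ (1 / (n : ℝ))
  calc t * zetaWeight n (x / δ) ≤ t * (1 + |x / δ|) ^ n := by
        refine mul_le_mul_of_nonneg_left ((zetaWeight_mono hn (le_abs_self _)).trans_eq ?_) ht.le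
        rw [zetaWeight_of_nonneg (abs_nonneg _), abs_abs]
    _ = (δ + |x|) ^ n := by
        rw [← hδn, ← mul_pow, abs_div, abs_of_pos hδ]
        congr 1
        field_simp
    _ ≤ _ := pow_le_pow_left₀ (by positivity) (add_le_add hδ1 hx) n

theorem continuousOn_zetaWeight_div {S : Set (ℝ × ℂ)} (hS : ∀ P ∈ S, P.2 ≠ c₀) (C : ℝ) :
    ContinuousOn (fun P : ℝ × ℂ => C * (‖P.2 - c₀‖ * zetaWeight n ((P.1 - y₀) / ‖P.2 - c₀‖ ^ (1 / (n : ℝ))))) S ∧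
    ContinuousOn (fun P : ℝ × ℂ => C * (‖P.2 - c₀‖ * zetaWeight n (-((P.1 - y₀) / ‖P.2 - c₀‖ ^ (1 / (n : ℝ)))))) S := by
  have hd : ContinuousOn (fun P : ℝ × ℂ => ‖P.2 - c₀‖) S := by fun_prop
  have hne : ∀ P ∈ S, ‖P.2 - c₀‖ ≠ 0 := fun P hP => norm_ne_zero_iff.2 (sub_ne_zero.2 (hS P hP))
  have hq : ContinuousOn (fun P : ℝ × ℂ => (P.1 - y₀) / ‖P.2 - c₀‖ ^ (1 / (n : ℝ))) S :=
    ContinuousOn.div (by fun_prop) (hd.rpow_const fun P hP => Or.inl (hne P hP)) fun P hP =>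
      (Real.rpow_pos_of_pos (lt_of_le_of_ne (norm_nonneg _) (hne P hP).symm) _).ne'
  exact ⟨continuousOn_const.mul (hd.mul (continuous_zetaWeight.comp_continuousOn hq)),
    continuousOn_const.mul (hd.mul (continuous_zetaWeight.comp_continuousOn hq.neg))⟩

/-- A profile near a critical point of order at least two. -/
theorem exists_profile_lower_bound {g : ℝ → ℝ} (hg : ContDiff ℝ ∞ g) (hg0 : g 0 ≠ 0) (hn : 1 ≤ n)
    (hUg : ∀ x, U (y₀ + x) = U y₀ + x ^ n * g x) :
    ∃ m > 0, ∃ ρ > 0, ∀ y, |y - y₀| < ρ → m * |y - y₀| ^ n ≤ |U y - U y₀| ∧ (y ≠ y₀ → deriv U y ≠ 0) := by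
  have hn0 : (n : ℝ) ≠ 0 := by exact_mod_cast (by omega : n ≠ 0)
  have hg' : Continuous (deriv g) := (contDiff_deriv hg).continuous
  have h1 : ∀ᶠ x in 𝓝 (0 : ℝ), |g 0| / 2 < |g x| :=
    hg.continuous.abs.continuousAt.eventually_const_lt (by linarith [abs_pos.2 hg0])
  have h2 : ∀ᶠ x in 𝓝 (0 : ℝ), (n : ℝ) * g x + x * deriv g x ≠ 0 := by
    have hc : Continuous fun x : ℝ => (n : ℝ) * g x + x * deriv g x :=
      (continuous_const.mul hg.continuous).add (continuous_id.mul hg')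
    exact hc.continuousAt.eventually_ne (by simp [hn0, hg0])
  obtain ⟨ρ, hρ, h⟩ := Metric.eventually_nhds_iff.1 (h1.and h2)
  refine ⟨|g 0| / 2, by positivity, ρ, hρ, fun y hy => ?_⟩
  obtain ⟨h3, h4⟩ := h (y := y - y₀) (by simpa using hy)
  have hy' : y = y₀ + (y - y₀) := by ring
  refine ⟨?_, fun hne => ?_⟩
  · have : U y - U y₀ = (y - y₀) ^ n * g (y - y₀) := by
      have := hUg (y - y₀); rw [← hy'] at this; linarith
    rw [this, abs_mul, abs_pow, mul_comm]
    exact mul_le_mul_of_nonneg_left h3.le (by positivity)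
  · have hd : HasDerivAt (fun y => U y₀ + (y - y₀) ^ n * g (y - y₀))
        (((n : ℝ) * (y - y₀) ^ (n - 1)) * g (y - y₀) + (y - y₀) ^ n * deriv g (y - y₀)) y := by
      have e1 : HasDerivAt (fun y => y - y₀) 1 y := (hasDerivAt_id y).sub_const y₀
      have e2 := e1.pow n
      have e3 := HasDerivAt.comp (h₂ := g) y (hasDerivAt_of_contDiff hg (y - y₀)) e1
      exact ((e2.mul e3).const_add (U y₀)).congr_deriv (by simp)
    have hfun : (fun y => U y₀ + (y - y₀) ^ n * g (y - y₀)) = U := by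
      funext y
      rw [← hUg, add_sub_cancel]
    rw [hfun] at hd
    rw [hd.deriv]
    obtain ⟨k, rfl⟩ : ∃ k, n = k + 1 := ⟨n - 1, by omega⟩
    have : ((k + 1 : ℕ) : ℝ) * (y - y₀) ^ (k + 1 - 1) * g (y - y₀) + (y - y₀) ^ (k + 1) * deriv g (y - y₀) =
        (y - y₀) ^ k * (((k + 1 : ℕ) : ℝ) * g (y - y₀) + (y - y₀) * deriv g (y - y₀)) := by
      rw [Nat.add_sub_cancel]; ring
    rw [this]
    exact mul_ne_zero (pow_ne_zero _ (sub_ne_zero.2 hne)) h4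

theorem contDiffOn_norm_rpow (hn : n ≠ 1) (s : ℝ) :
    ContDiffOn ℝ ∞ (fun c => ((‖c - c₀‖ ^ s : ℝ) : ℂ)) (paramSet n c₀ ε) := by
  have hne : ∀ c ∈ paramSet n c₀ ε, c - c₀ ≠ 0 := fun c hc => sub_ne_zero.2 (hc.2.resolve_left hn)
  refine Complex.ofRealCLM.contDiff.comp_contDiffOn (ContDiffOn.rpow_const_of_ne (ContDiffOn.norm ℝ ?_ hne) fun c hc => norm_ne_zero_iff.2 (hne c hc))
  exact (contDiff_id.sub contDiff_const).contDiffOn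

theorem norm_conj_sub {c : ℂ} (x : ℝ) : ‖(starRingEnd ℂ) c - x‖ = ‖c - x‖ := by
  rw [← RCLike.norm_conj (c - x), map_sub, Complex.conj_ofReal]

/-- One solution vanishes at the left end, the other at the right end; the estimates for the second
are those of the first for the profile reflected about y₀. -/
theorem exists_upper_pair_of_two_le (hU : ContDiff ℝ ∞ U) (hn : 2 ≤ n) (h : IsCriticalPointOfOrder U n y₀ c₀) (hβ : 0 ≤ β) {r₀ : ℝ} (hr₀ : 0 < r₀) :
    ∃ r > 0, r ≤ r₀ ∧ ∃ ε > 0, ∃ C > 0, ∃ f₁ f₂ f₁' f₂' : ℝ × ℂ → ℂ,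
      IsUpperFamily U β n y₀ c₀ r ε C f₁ f₁' ∧ IsUpperFamily U β n y₀ c₀ r ε C f₂ f₂' ∧
      (∀ P ∈ (Ioo (y₀ - r) (y₀ + r) ×ˢ paramSet n c₀ ε) ∩ {P | 0 ≤ P.2.im},
        ‖f₁ P‖ ≤ C * (‖P.2 - c₀‖ * zetaWeight n ((P.1 - y₀) / ‖P.2 - c₀‖ ^ (1 / (n : ℝ)))) ∧
        ‖f₂ P‖ ≤ C * (‖P.2 - c₀‖ * zetaWeight n (-((P.1 - y₀) / ‖P.2 - c₀‖ ^ (1 / (n : ℝ)))))) ∧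
      ∀ P ∈ (Ioo (y₀ - r) (y₀ + r) ×ˢ paramSet n c₀ ε) ∩ {P | 0 ≤ P.2.im ∧ (U P.1 : ℂ) ≠ P.2},
        ‖P.2 - c₀‖ ^ (2 - 1 / (n : ℝ)) ≤ C * ‖f₁ P * f₂' P - f₁' P * f₂ P‖ := by
  have hn1 : 1 ≤ n := by omega
  have hn1' : n ≠ 1 := by omega
  obtain ⟨g, hg, hg0, hUg⟩ := exists_eq_add_pow_mul hU hn1 h
  obtain rfl : (U y₀ : ℂ) = c₀ := h.1
  have hy2 : 2 * y₀ - y₀ = y₀ := by ring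
  have hUr : ContDiff ℝ ∞ fun y => U (2 * y₀ - y) := hU.comp (contDiff_const.sub contDiff_id)
  have hgr : ContDiff ℝ ∞ fun x => (-1) ^ n * g (-x) := contDiff_const.mul (hg.comp contDiff_neg)
  obtain ⟨R₁, hR₁, hb₁⟩ := exists_solution_bound hU hg hg0 hn hUg hβ
  obtain ⟨R₂, hR₂, hb₂⟩ := exists_solution_bound hUr hgr (by simpa using hg0) hn (y₀ := y₀) (fun x => by
    have := hUg (-x)
    simp only [hy2]
    rw [show 2 * y₀ - (y₀ + x) = y₀ + -x by ring, this, neg_pow]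
    ring) hβ
  simp only [hy2] at hb₂
  obtain ⟨m, hm, ρ, hρ, hprof⟩ := exists_profile_lower_bound hg hg0 hn1 hUg
  set r := min (min R₁ R₂) (min r₀ (ρ / 2)) with hr_def
  have hr : 0 < r := lt_min (lt_min hR₁ hR₂) (lt_min hr₀ (half_pos hρ))
  have hrρ : r ≤ ρ / 2 := (min_le_right _ _).trans (min_le_right _ _)
  obtain ⟨ε₁, hε₁, C₁, hC₁, hb₁⟩ := hb₁ r hr ((min_le_left _ _).trans (min_le_left _ _))
  obtain ⟨ε₂, hε₂, C₂, hC₂, hb₂⟩ := hb₂ r hr ((min_le_left _ _).trans (min_le_right _ _))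
  -- The entry m rⁿ keeps all points at distance at least r from y₀ off the layer, in particular the
  -- two points where data are prescribed.
  set ε := min (min ε₁ ε₂) (min 1 (m * r ^ n)) with hε_def
  have hε : 0 < ε := lt_min (lt_min hε₁ hε₂) (lt_min one_pos (by positivity))
  set D := paramSet n (U y₀ : ℂ) ε with hD_def
  have hDε : ∀ c ∈ D, ‖c - U y₀‖ < ε := fun c hc => by simpa [dist_eq_norm] using hc.1
  have hDne : ∀ c ∈ D, c ≠ U y₀ := fun c hc => hc.2.resolve_left hn1'
  set a := y₀ - 2 * r with ha
  set b := y₀ + 2 * r with hb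
  have habs : ∀ y ∈ Ioo a b, |y - y₀| < ρ := fun y hy => by
    rw [abs_lt]; constructor <;> linarith [hy.1, hy.2]
  have hab : Icc (y₀ - r) (y₀ + r) ⊆ Ioo a b := fun y hy => ⟨by linarith [hy.1], by linarith [hy.2]⟩
  have hcrit : ∀ y ∈ Ioo a b, ∀ c ∈ D, (U y : ℂ) = c → deriv U y ≠ 0 := fun y hy c hc hyc =>
    (hprof y (habs y hy)).2 fun h' => hDne c hc (by rw [← hyc, h'])
  have hout : ∀ y ∈ Ioo a b, y ∉ Ioo (y₀ - r) (y₀ + r) → ∀ c ∈ D, (U y : ℂ) ≠ c := fun y hy hyr c hc hyc => by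
    have h1 : r ≤ |y - y₀| := by
      by_contra! h1
      rw [abs_lt] at h1
      exact hyr ⟨by linarith, by linarith⟩
    have h2 := hDε c hc
    rw [← hyc, ← Complex.ofReal_sub, Complex.norm_real, Real.norm_eq_abs] at h2
    have h3 : m * r ^ n ≤ m * |y - y₀| ^ n := by gcongr
    have h4 : ε ≤ m * r ^ n := (min_le_right _ _).trans (min_le_right _ _)
    linarith [(hprof y (habs y hy)).1]
  have hp₁ : y₀ - r ∈ Ioo a b := hab ⟨le_rfl, by linarith⟩
  have hp₂ : y₀ + r ∈ Ioo a b := hab ⟨by linarith, le_rfl⟩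
  have hd := contDiffOn_norm_rpow (c₀ := (U y₀ : ℂ)) (ε := ε) hn1' (2 - 1 / (n : ℝ))
  obtain ⟨f₁, f₁', hf₁, hdat₁, hsym₁⟩ := exists_family_of_data (β := β) hU rfl hab hcrit hout hp₁ (fun h => lt_irrefl _ h.1) hd
    fun c _ => by rw [norm_conj_sub, Complex.conj_ofReal]
  -- The slope is negated because reflection turns it back into the positive slope required by the
  -- bound.
  obtain ⟨f₂, f₂', hf₂, hdat₂, hsym₂⟩ := exists_family_of_data (β := β) hU rfl hab hcrit hout hp₂ (fun h => lt_irrefl _ h.2) hd.neg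
    fun c _ => by simp only [norm_conj_sub, map_neg, Complex.conj_ofReal]
  have hO : IsOpen (Ioo a b ×ˢ D) := isOpen_Ioo.prod isOpen_paramSet
  have hs₁ : ∀ c ∈ D, 0 < c.im → ∀ t ∈ Ioo a b, HasDerivAt (fun t => f₁ (t, c)) (f₁' (t, c)) t ∧
      HasDerivAt (fun t => f₁' (t, c)) (coeff U β (t, c) * f₁ (t, c)) t := fun c hc h0 t ht =>
    hf₁.solves (t, c) (upper_subset ⟨⟨ht, hc⟩, h0⟩)
  have hs₂ : ∀ c ∈ D, 0 < c.im → ∀ t ∈ Ioo a b, HasDerivAt (fun t => f₂ (t, c)) (f₂' (t, c)) t ∧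
      HasDerivAt (fun t => f₂' (t, c)) (coeff U β (t, c) * f₂ (t, c)) t := fun c hc h0 t ht =>
    hf₂.solves (t, c) (upper_subset ⟨⟨ht, hc⟩, h0⟩)
  have key₁ : ∀ c ∈ D, 0 < c.im → (∀ y ∈ Icc (y₀ - r) (y₀ + r), ‖f₁ (y, c)‖ ≤ C₁ * (‖c - U y₀‖ * zetaWeight n ((y - y₀) / ‖c - U y₀‖ ^ (1 / (n : ℝ))))) ∧
      1 ≤ C₁ * ‖f₁ (y₀ + r, c)‖ := fun c hc h0 =>
    hb₁ c h0.ne' ((hDε c hc).trans_le ((min_le_left _ _).trans (min_le_left _ _))) a b hp₁.1 hp₂.2 (fun t => f₁ (t, c)) (fun t => f₁' (t, c))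
      (hs₁ c hc h0) (hdat₁ c hc h0).1 (hdat₁ c hc h0).2
  have key₂ : ∀ c ∈ D, 0 < c.im → ∀ y ∈ Icc (y₀ - r) (y₀ + r), ‖f₂ (y, c)‖ ≤ C₂ * (‖c - U y₀‖ * zetaWeight n (-((y - y₀) / ‖c - U y₀‖ ^ (1 / (n : ℝ))))) := by
    intro c hc h0 y hy
    have := (hb₂ c h0.ne' ((hDε c hc).trans_le ((min_le_left _ _).trans (min_le_right _ _))) a b hp₁.1 hp₂.2
      (fun t => f₂ (2 * y₀ - t, c)) (fun t => -f₂' (2 * y₀ - t, c)) (fun t ht => ?_) ?_ ?_).1 (2 * y₀ - y) ⟨by linarith [hy.2], by linarith [hy.1]⟩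
    · rwa [show 2 * y₀ - (2 * y₀ - y) = y by ring, show 2 * y₀ - y - y₀ = -(y - y₀) by ring, neg_div] at this
    · obtain ⟨h1, h2⟩ := hs₂ c hc h0 (2 * y₀ - t) ⟨by linarith [ht.2], by linarith [ht.1]⟩
      refine ⟨hasDerivAt_reflect h1, (hasDerivAt_reflect h2).neg.congr_deriv ?_⟩
      rw [coeff_reflect, neg_neg]
    · rw [show 2 * y₀ - (y₀ - r) = y₀ + r by ring]
      exact (hdat₂ c hc h0).1
    · rw [show 2 * y₀ - (y₀ - r) = y₀ + r by ring, (hdat₂ c hc h0).2]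
      simp
  have hO' : IsOpen (Ioo (y₀ - r) (y₀ + r) ×ˢ D) := isOpen_Ioo.prod isOpen_paramSet
  have hsubO : Ioo (y₀ - r) (y₀ + r) ×ˢ D ⊆ Ioo a b ×ˢ D := prod_mono (Ioo_subset_Icc_self.trans hab) subset_rfl
  have hg₁ := hf₁.mono hsubO
  have hg₂ := hf₂.mono hsubO
  set K := (1 + r) ^ n with hK_def
  have hK1 : 1 ≤ K := one_le_pow₀ (by linarith)
  have hle₁ : C₁ ≤ (C₁ + C₂) * K := by nlinarith
  have hle₂ : C₂ ≤ (C₁ + C₂) * K := by nlinarith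
  have hbd₁ : ∀ P ∈ (Ioo (y₀ - r) (y₀ + r) ×ˢ D) ∩ {P | 0 ≤ P.2.im},
      ‖f₁ P‖ ≤ C₁ * (‖P.2 - U y₀‖ * zetaWeight n ((P.1 - y₀) / ‖P.2 - U y₀‖ ^ (1 / (n : ℝ)))) :=
    le_of_le_upper hO' hg₁.cont.norm (continuousOn_zetaWeight_div (fun P hP => hDne _ hP.1.2) C₁).1
      fun P hP => (key₁ P.2 hP.1.2 hP.2).1 P.1 (Ioo_subset_Icc_self hP.1.1)
  have hbd₂ : ∀ P ∈ (Ioo (y₀ - r) (y₀ + r) ×ˢ D) ∩ {P | 0 ≤ P.2.im},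
      ‖f₂ P‖ ≤ C₂ * (‖P.2 - U y₀‖ * zetaWeight n (-((P.1 - y₀) / ‖P.2 - U y₀‖ ^ (1 / (n : ℝ))))) :=
    le_of_le_upper hO' hg₂.cont.norm (continuousOn_zetaWeight_div (fun P hP => hDne _ hP.1.2) C₂).2
      fun P hP => key₂ P.2 hP.1.2 hP.2 P.1 (Ioo_subset_Icc_self hP.1.1)
  have hw : ∀ P ∈ (Ioo (y₀ - r) (y₀ + r) ×ˢ D) ∩ {P | 0 ≤ P.2.im}, 0 < ‖P.2 - U y₀‖ ∧ ‖P.2 - U y₀‖ ≤ 1 ∧ |P.1 - y₀| ≤ r := fun P hP =>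
    ⟨norm_pos_iff.2 (sub_ne_zero.2 (hDne _ hP.1.2)), (hDε _ hP.1.2).le.trans ((min_le_right _ _).trans (min_le_left _ _)),
      abs_le.2 ⟨by linarith [hP.1.1.1], by linarith [hP.1.1.2]⟩⟩
  refine ⟨r, hr, (min_le_right _ _).trans (min_le_left _ _), ε, hε, (C₁ + C₂) * K, by positivity, f₁, f₂, f₁', f₂',
    ⟨hg₁, fun P hP => ?_, hsym₁⟩, ⟨hg₂, fun P hP => ?_, hsym₂⟩, fun P hP => ⟨?_, ?_⟩, fun P hP => ?_⟩
  · obtain ⟨h1, h2, h3⟩ := hw P hP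
    refine (hbd₁ P hP).trans (mul_le_mul (by linarith) (mul_zetaWeight_le hn1 h1 h2 h3) (mul_nonneg h1.le zetaWeight_pos.le) (by positivity))
  · obtain ⟨h1, h2, h3⟩ := hw P hP
    rw [← abs_neg] at h3
    have := mul_zetaWeight_le hn1 h1 h2 h3
    rw [neg_div] at this
    exact (hbd₂ P hP).trans (mul_le_mul (by linarith) this (mul_nonneg h1.le zetaWeight_pos.le) (by positivity))
  · exact (hbd₁ P hP).trans (mul_le_mul_of_nonneg_right hle₁ (mul_nonneg (norm_nonneg _) zetaWeight_pos.le))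
  · exact (hbd₂ P hP).trans (mul_le_mul_of_nonneg_right hle₂ (mul_nonneg (norm_nonneg _) zetaWeight_pos.le))
  · have hQ := isOpen_offCritical hU.continuous hO'
    rw [offCritical_eq] at hP
    refine (le_of_le_upper hQ (f := fun P => ‖P.2 - U y₀‖ ^ (2 - 1 / (n : ℝ))) (g := fun P => C₁ * ‖f₁ P * f₂' P - f₁' P * f₂ P‖) ?_ ?_ ?_ P hP).trans
      (mul_le_mul_of_nonneg_right hle₁ (norm_nonneg _))
    · exact ContinuousOn.rpow_const (by fun_prop) fun P hP => Or.inl (norm_ne_zero_iff.2 (sub_ne_zero.2 (hDne _ hP.1.1.2)))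
    · rw [← offCritical_eq]
      exact continuousOn_const.mul ((hg₁.smooth.continuousOn.mul hg₂.smooth'.continuousOn).sub
        (hg₁.smooth'.continuousOn.mul hg₂.smooth.continuousOn)).norm
    · rintro ⟨y, c⟩ ⟨⟨⟨hy, hc⟩, -⟩, h0⟩
      change 0 < c.im at h0
      -- Evaluated at y₀ + r, where the second solution vanishes: there the Wronskian is f₁ times
      -- the prescribed slope, and |f₁| ≥ 1/C₁.
      have hW := wronskian_eq (hs₁ c hc h0) (hs₂ c hc h0) hp₂ (hab (Ioo_subset_Icc_self hy))
      simp only at hW ⊢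
      rw [hW, (hdat₂ c hc h0).1, (hdat₂ c hc h0).2, mul_zero, sub_zero, norm_mul, norm_neg, Complex.norm_real,
        Real.norm_of_nonneg (by positivity), ← mul_assoc]
      exact le_mul_of_one_le_left (by positivity) (key₁ c hc h0).2

end DegeneratePoint

/-! ### Assembly of the two cases. -/

section Assembly

variable {U : ℝ → ℝ} {α β : ℝ} {n : ℕ} {y₀ r ε : ℝ} {c₀ : ℂ}

/-- When all noncritical parameters are nonreal, they lie in two disjoint open half-planes. The
conjugate extension is smooth on each and nothing has to match at the real axis. -/
theorem IsUpperSolution.isUpperFamily {C : ℝ} {f f' : ℝ × ℂ → ℂ} (hsol : IsUpperSolution U β (Ioo (y₀ - r) (y₀ + r) ×ˢ paramSet n c₀ ε) f f')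
    (hc₀ : (U y₀ : ℂ) = c₀) (hb : ∀ P ∈ (Ioo (y₀ - r) (y₀ + r) ×ˢ paramSet n c₀ ε) ∩ {P | 0 ≤ P.2.im}, ‖f P‖ ≤ C)
    (him : ∀ c ∈ noncriticalParams U n y₀ c₀ r ε, c.im ≠ 0) : IsUpperFamily U β n y₀ c₀ r ε C f f' := by
  set O := Ioo (y₀ - r) (y₀ + r) ×ˢ paramSet n c₀ ε with hO_def
  have hO : IsOpen O := isOpen_Ioo.prod isOpen_paramSet
  have hpos : ∀ {y : ℝ} {c : ℂ}, c.im < 0 → twoSided f 1 y c = (starRingEnd ℂ) (f (y, (starRingEnd ℂ) c)) := fun h => by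
    simp [twoSided, h.not_gt, h.ne]
  have hr : ContDiff ℝ ∞ fun P : ℝ × ℂ => (P.1, (starRingEnd ℂ) P.2) :=
    contDiff_fst.prodMk ((Complex.conjCLE : ℂ →L[ℝ] ℂ).contDiff.comp contDiff_snd)
  have hcj : ContDiff ℝ ∞ fun z : ℂ => (starRingEnd ℂ) z := (Complex.conjCLE : ℂ →L[ℝ] ℂ).contDiff
  have hf : ContDiffOn ℝ ∞ f (O ∩ {P | 0 < P.2.im}) := hsol.smooth.mono upper_subset
  have h1 : ContDiffOn ℝ ∞ (fun P : ℝ × ℂ => twoSided f 1 P.1 P.2) (O ∩ {P | 0 < P.2.im}) :=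
    hf.congr fun P hP => twoSided_one f _ (show 0 < P.2.im from hP.2).le
  have h2 : ContDiffOn ℝ ∞ (fun P : ℝ × ℂ => twoSided f 1 P.1 P.2) (O ∩ {P | P.2.im < 0}) :=
    (hcj.comp_contDiffOn (hf.comp (s := O ∩ {P : ℝ × ℂ | P.2.im < 0}) hr.contDiffOn fun P hP =>
      ⟨⟨hP.1.1, mem_paramSet_conj hc₀ hP.1.2⟩, by simpa using hP.2⟩)).congr fun P hP => hpos hP.2
  have hi : Continuous fun P : ℝ × ℂ => P.2.im := Complex.continuous_im.comp continuous_snd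
  have h3 := h1.union_of_isOpen h2 (hO.inter (isOpen_lt continuous_const hi)) (hO.inter (isOpen_lt hi continuous_const))
  refine ⟨hsol, hb, fun P => twoSided f 1 P.1 P.2, h3.mono fun P hP => ?_, fun y hy c hc => ?_, fun y hy c hc h0 => twoSided_one f y h0⟩
  · exact (him _ hP.2).lt_or_gt.elim (fun h => Or.inr ⟨⟨hP.1, hP.2.1⟩, h⟩) fun h => Or.inl ⟨⟨hP.1, hP.2.1⟩, h⟩
  · rcases (him c hc).lt_or_gt with h | h
    · simp only
      rw [hpos h, twoSided_one f y (by simpa using h.le), Complex.conj_conj]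
    · simp only
      rw [hpos (by simpa using h), twoSided_one f y h.le, Complex.conj_conj]

theorem exists_upper_pair_of_deriv_ne_zero (hU : ContDiff ℝ ∞ U) (hd : deriv U y₀ ≠ 0) (hc₀ : (U y₀ : ℂ) = c₀) (β : ℝ) {r₀ : ℝ} (hr₀ : 0 < r₀) :
    ∃ r > 0, r ≤ r₀ ∧ ∃ ε > 0, ∃ C > 0, ∃ f₁ f₂ f₁' f₂' : ℝ × ℂ → ℂ,
      IsUpperFamily U β 1 y₀ c₀ r ε C f₁ f₁' ∧ IsUpperFamily U β 1 y₀ c₀ r ε C f₂ f₂' ∧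
      IsSimpleBasis U β (Ioo (y₀ - r) (y₀ + r) ×ˢ Metric.ball c₀ ε) C f₁ f₂ f₁' f₂' ∧
      ∀ P ∈ (Ioo (y₀ - r) (y₀ + r) ×ˢ paramSet 1 c₀ ε) ∩ {P | 0 ≤ P.2.im ∧ (U P.1 : ℂ) ≠ P.2}, 1 ≤ ‖f₁ P * f₂' P - f₁' P * f₂ P‖ := by
  obtain rfl := hc₀
  obtain ⟨s, hs, ε₁, hε₁, C, f₁, f₂, f₁', f₂', hb⟩ := exists_isSimpleBasis hU hd β
  have hr : 0 < min s r₀ := lt_min hs hr₀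
  set r := min s r₀ with hr_def
  have hstrict : HasStrictDerivAt U (deriv U y₀) y₀ := hU.contDiffAt.hasStrictDerivAt (by norm_num)
  -- With nonzero derivative U is open at y₀, so every real `c` near c₀ is a value of U and hence
  -- not a noncritical parameter.
  have himage : U '' Ioo (y₀ - r) (y₀ + r) ∈ 𝓝 (U y₀) := by
    rw [← hstrict.map_nhds_eq hd]
    exact image_mem_map (Ioo_mem_nhds (by linarith) (by linarith))
  obtain ⟨ε₂, hε₂, hball⟩ := Metric.mem_nhds_iff.1 himage
  have hP : paramSet 1 (U y₀ : ℂ) (min ε₁ ε₂) = Metric.ball (U y₀ : ℂ) (min ε₁ ε₂) := by ext c; simp [paramSet]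
  have hb' := hb.mono (O₂ := Ioo (y₀ - r) (y₀ + r) ×ˢ Metric.ball (U y₀ : ℂ) (min ε₁ ε₂))
    (prod_mono (Ioo_subset_Ioo (by linarith [min_le_left s r₀]) (by linarith [min_le_left s r₀])) (Metric.ball_subset_ball (min_le_left _ _)))
  have him : ∀ c ∈ noncriticalParams U 1 y₀ (U y₀ : ℂ) r (min ε₁ ε₂), c.im ≠ 0 := fun c hc h0 => by
    have hre : c = (c.re : ℂ) := by apply Complex.ext <;> simp [h0]
    obtain ⟨z, hz, hzc⟩ := hball (show c.re ∈ Metric.ball (U y₀) ε₂ by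
      have := hc.1.1
      rw [Metric.mem_ball, dist_eq_norm, hre, ← Complex.ofReal_sub, Complex.norm_real] at this
      rw [Metric.mem_ball, dist_eq_norm]
      exact this.trans_le (min_le_right _ _))
    exact hc.2 z hz (by rw [hzc, ← hre])
  have hsol₁ := hb'.sol₁
  have hsol₂ := hb'.sol₂
  have hbd := hb'.bound
  have hO : IsOpen (Ioo (y₀ - r) (y₀ + r) ×ˢ Metric.ball (U y₀ : ℂ) (min ε₁ ε₂)) := isOpen_Ioo.prod Metric.isOpen_ball
  have hW : ∀ P ∈ (Ioo (y₀ - r) (y₀ + r) ×ˢ Metric.ball (U y₀ : ℂ) (min ε₁ ε₂)) ∩ {P | 0 ≤ P.2.im ∧ (U P.1 : ℂ) ≠ P.2},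
      f₁ P * f₂' P - f₁' P * f₂ P = 1 := fun P hP => by
    rw [offCritical_eq] at hP
    refine eqOn_of_eqOn_upper (isOpen_offCritical hU.continuous hO) (f := fun P => f₁ P * f₂' P - f₁' P * f₂ P) (g := fun _ => 1) ?_ continuousOn_const
      (fun P hP => hb'.wronskian P ⟨hP.1.1, hP.2⟩) P hP
    rw [← offCritical_eq]
    exact (hsol₁.smooth.continuousOn.mul hsol₂.smooth'.continuousOn).sub (hsol₁.smooth'.continuousOn.mul hsol₂.smooth.continuousOn)
  rw [← hP] at hsol₁ hsol₂ hbd hW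
  refine ⟨r, hr, min_le_right _ _, min ε₁ ε₂, lt_min hε₁ hε₂, |C| + 1, by positivity, f₁, f₂, f₁', f₂',
    hsol₁.isUpperFamily rfl (fun P hP => (hbd P hP).1.trans ?_) him, hsol₂.isUpperFamily rfl (fun P hP => (hbd P hP).2.trans ?_) him,
    ⟨hb'.sol₁, hb'.sol₂, hb'.wronskian, hb'.smooth, hb'.symm, fun P hP => ⟨(hb'.bound P hP).1.trans ?_, (hb'.bound P hP).2.trans ?_⟩,
      fun P hP => (hb'.log_bound P hP).trans (mul_le_mul_of_nonneg_right ?_ (norm_nonneg _))⟩, fun P hP => ?_⟩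
  any_goals linarith [le_abs_self C]
  rw [hW P hP, norm_one]

theorem le_wronskianAt_twoSided (hU : Continuous U) (hc₀ : (U y₀ : ℂ) = c₀) {f₁ f₂ f₁' f₂' : ℝ × ℂ → ℂ}
    (h₁ : IsUpperSolution U β (Ioo (y₀ - r) (y₀ + r) ×ˢ paramSet n c₀ ε) f₁ f₁')
    (h₂ : IsUpperSolution U β (Ioo (y₀ - r) (y₀ + r) ×ˢ paramSet n c₀ ε) f₂ f₂') {G : ℝ → ℝ} {C : ℝ}
    (hW : ∀ P ∈ (Ioo (y₀ - r) (y₀ + r) ×ˢ paramSet n c₀ ε) ∩ {P | 0 ≤ P.2.im ∧ (U P.1 : ℂ) ≠ P.2},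
      G ‖P.2 - c₀‖ ≤ C * ‖f₁ P * f₂' P - f₁' P * f₂ P‖) {s : ℤˣ} {y : ℝ} {c : ℂ} (hP : (y, c) ∈ offCritical U n y₀ c₀ r ε s) :
    G ‖c - c₀‖ ≤ C * ‖wronskianAt (fun x => twoSided f₁ s x c) (fun x => twoSided f₂ s x c) y‖ := by
  have hO : IsOpen (Ioo (y₀ - r) (y₀ + r) ×ˢ paramSet n c₀ ε) := isOpen_Ioo.prod isOpen_paramSet
  have key : ∀ c, (y, c) ∈ offCritical U n y₀ c₀ r ε 1 →
      G ‖c - c₀‖ ≤ C * ‖wronskianAt (fun x => twoSided f₁ 1 x c) (fun x => twoSided f₂ 1 x c) y‖ := fun c hP => by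
    rw [offCritical_one] at hP
    have := hW _ hP
    rwa [wronskianAt, (h₁.deriv_twoSided hU hO hP).1, (h₂.deriv_twoSided hU hO hP).1, twoSided_one _ _ hP.2.1, twoSided_one _ _ hP.2.1]
  rcases Int.units_eq_one_or s with rfl | rfl
  · exact key c hP
  · have h := key _ (mem_offCritical_conj hc₀ hP)
    rw [← hc₀, norm_conj_sub, hc₀, ← RCLike.norm_conj (wronskianAt _ _ _)] at h
    simpa only [twoSided_neg_one, wronskianAt, deriv_conj, map_sub, map_mul] using h

/-- Conjugation commutes with log except on the negative axis, whose points are their own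
conjugates. -/
theorem norm_log_conj (z : ℂ) : ‖Complex.log ((starRingEnd ℂ) z)‖ = ‖Complex.log z‖ := by
  rw [Complex.log_conj_eq_ite]
  split_ifs
  · rfl
  · exact RCLike.norm_conj _

theorem norm_deriv_twoSided_le (hU : Continuous U) (hc₀ : (U y₀ : ℂ) = c₀) {f f' : ℝ × ℂ → ℂ} {C : ℝ}
    (h : IsUpperSolution U β (Ioo (y₀ - r) (y₀ + r) ×ˢ paramSet n c₀ ε) f f')
    (hl : ∀ P ∈ (Ioo (y₀ - r) (y₀ + r) ×ˢ paramSet n c₀ ε) ∩ {P | 0 ≤ P.2.im ∧ (U P.1 : ℂ) ≠ P.2},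
      ‖f' P‖ ≤ C * ‖Complex.log ((U P.1 : ℂ) - P.2)‖) {s : ℤˣ} {y : ℝ} {c : ℂ} (hP : (y, c) ∈ offCritical U n y₀ c₀ r ε s) :
    ‖deriv (fun x => twoSided f s x c) y‖ ≤ C * ‖Complex.log ((U y : ℂ) - c)‖ := by
  have hO : IsOpen (Ioo (y₀ - r) (y₀ + r) ×ˢ paramSet n c₀ ε) := isOpen_Ioo.prod isOpen_paramSet
  have key : ∀ c, (y, c) ∈ offCritical U n y₀ c₀ r ε 1 →
      ‖deriv (fun x => twoSided f 1 x c) y‖ ≤ C * ‖Complex.log ((U y : ℂ) - c)‖ := fun c hP => by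
    rw [offCritical_one] at hP
    rw [(h.deriv_twoSided hU hO hP).1]
    exact hl _ hP
  rcases Int.units_eq_one_or s with rfl | rfl
  · exact key c hP
  · have h := key _ (mem_offCritical_conj hc₀ hP)
    rw [← RCLike.norm_conj, ← norm_log_conj, map_sub, Complex.conj_ofReal, Complex.conj_conj] at h
    simpa only [twoSided_neg_one, deriv_conj] using h

theorem exists_coefficient_bounds (hU : ContDiff ℝ ∞ U) (n : ℕ) (y₀ r ε : ℝ) (c₀ : ℂ) :
    ∃ K K₂, (∀ y ∈ Ioo (y₀ - r) (y₀ + r), ∀ c ∈ paramSet n c₀ ε, ‖(U y : ℂ) - c‖ ≤ K) ∧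
      ∀ y ∈ Ioo (y₀ - r) (y₀ + r), |deriv (deriv U) y| ≤ K₂ := by
  obtain ⟨K, hK⟩ := isCompact_Icc.exists_bound_of_continuousOn (hU.continuous.continuousOn (s := Icc (y₀ - r) (y₀ + r)))
  obtain ⟨K₂, hK₂⟩ := isCompact_Icc.exists_bound_of_continuousOn ((contDiff_deriv (contDiff_deriv hU)).continuous.continuousOn (s := Icc (y₀ - r) (y₀ + r)))
  refine ⟨K + (‖c₀‖ + ε), K₂, fun y hy c hc => ?_, fun y hy => hK₂ y (Ioo_subset_Icc_self hy)⟩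
  have h1 : ‖(U y : ℂ)‖ ≤ K := by rw [Complex.norm_real]; exact hK y (Ioo_subset_Icc_self hy)
  have h2 : ‖c - c₀‖ < ε := by simpa [dist_eq_norm] using hc.1
  have h3 : ‖c‖ ≤ ‖c₀‖ + ‖c - c₀‖ := by simpa using norm_add_le c₀ (c - c₀)
  linarith [norm_sub_le (U y : ℂ) c]

/-- The theorem is local in `y`, so the profile may be cut off to a globally smooth one. -/
theorem exists_contDiff_eqOn {V : Set ℝ} (hV : IsOpen V) (hU : ContDiffOn ℝ ∞ U V) (hy₀ : y₀ ∈ V) :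
    ∃ W : ℝ → ℝ, ContDiff ℝ ∞ W ∧ ∃ R > 0, ∀ y ∈ Ioo (y₀ - R) (y₀ + R), W y = U y := by
  obtain ⟨R, hR, hRV⟩ := Metric.isOpen_iff.1 hV y₀ hy₀
  rw [Real.ball_eq_Ioo] at hRV
  obtain ⟨g, hg, hgU⟩ := exists_contDiff_extension (f := fun P => (U P.1 : ℂ)) (c₀ := 0) hR one_pos
    (Complex.ofRealCLM.contDiff.comp_contDiffOn (hU.comp contDiff_fst.contDiffOn fun P hP => hRV hP.1))
  refine ⟨fun y => (g (y, 0)).re, Complex.reCLM.contDiff.comp (hg.comp (contDiff_id.prodMk contDiff_const)), R / 2, half_pos hR, fun y hy => ?_⟩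
  simp [hgU (y, 0) ⟨hy, by simp⟩]

end Assembly

/-! ### Return from the globally smooth profile to the given one. -/

section Transfer

variable {U W : ℝ → ℝ} {α : ℝ} {n : ℕ} {y₀ r ε R : ℝ} {c₀ : ℂ}

theorem iteratedDeriv_eq_of_eqOn_Ioo (h : ∀ y ∈ Ioo (y₀ - R) (y₀ + R), W y = U y) (k : ℕ) {y : ℝ} (hy : y ∈ Ioo (y₀ - R) (y₀ + R)) :
    iteratedDeriv k W y = iteratedDeriv k U y :=
  Filter.EventuallyEq.iteratedDeriv_eq k (by filter_upwards [Ioo_mem_nhds hy.1 hy.2] with x hx using h x hx)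

theorem offCritical_congr (h : ∀ y ∈ Ioo (y₀ - r) (y₀ + r), W y = U y) (s : ℤˣ) :
    offCritical W n y₀ c₀ r ε s = offCritical U n y₀ c₀ r ε s := by
  ext P
  simp only [offCritical, mem_ofPred_eq]
  exact and_congr_right fun hP => by rw [h _ hP]

theorem noncriticalParams_congr (h : ∀ y ∈ Ioo (y₀ - r) (y₀ + r), W y = U y) :
    noncriticalParams W n y₀ c₀ r ε = noncriticalParams U n y₀ c₀ r ε := by
  ext c
  simp only [noncriticalParams, mem_ofPred_eq]
  exact and_congr_right fun _ => forall₂_congr fun z hz => by rw [h z hz]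

theorem isLocalRayleighFamily_congr {C : ℝ} {ψ : ℤˣ → ℝ → ℂ → ℂ} (h : ∀ y ∈ Ioo (y₀ - r) (y₀ + r), W y = U y)
    (hψ : IsLocalRayleighFamily W α n y₀ c₀ r ε C ψ) : IsLocalRayleighFamily U α n y₀ c₀ r ε C ψ := by
  obtain ⟨h1, h2, h3, h4, h5, h6, h7⟩ := hψ
  simp only [offCritical_congr h, noncriticalParams_congr h] at h1 h2 h3 h4 h5 h6 h7
  refine ⟨h1, h2, h3, h4, fun s y c hP => ?_, h6, fun s y c hP => ?_⟩
  · have := h5 s y c hP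
    rwa [rayleighOp, h y hP.1, iteratedDeriv_eq_of_eqOn_Ioo h 2 hP.1] at this
  · have := h7 s y c hP
    rwa [h y hP.1] at this

end Transfer

end Rayleigh

/-! ### The theorem. -/

open Rayleigh in
theorem theorem1 (U : ℝ → ℝ) (V : Set ℝ) (hV : IsOpen V) (hU : ContDiffOn ℝ ∞ U V)
    (y₀ : ℝ) (hy₀ : y₀ ∈ V) (c₀ : ℂ) (n : ℕ) (hn : 1 ≤ n)
    (hcrit : IsCriticalPointOfOrder U n y₀ c₀) (α : ℝ) (hα : 0 < |α|) :
    ∃ r > (0 : ℝ), ∃ ε > (0 : ℝ), ∃ C > (0 : ℝ), ∃ ψ₁ ψ₂ : ℤˣ → ℝ → ℂ → ℂ,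
      IsLocalRayleighFamily U α n y₀ c₀ r ε C ψ₁ ∧
      IsLocalRayleighFamily U α n y₀ c₀ r ε C ψ₂ ∧
      (∀ s : ℤˣ, ∀ y c, (y, c) ∈ offCritical U n y₀ c₀ r ε s →
        wronskianAt (fun x => ψ₁ s x c) (fun x => ψ₂ s x c) y ≠ 0) ∧
      (n = 1 →
        (∀ s : ℤˣ, ContDiffOn ℝ ∞ (fun p : ℝ × ℂ => ψ₁ s p.1 p.2)
          (Set.Ioo (y₀ - r) (y₀ + r) ×ˢ Metric.ball c₀ ε)) ∧
        (∀ s : ℤˣ, ∀ y c, (y, c) ∈ offCritical U n y₀ c₀ r ε s →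
          ‖deriv (fun x => ψ₂ s x c) y‖ ≤ C * ‖Complex.log ((U y : ℂ) - c)‖)) ∧
      (2 ≤ n →
        (∀ s : ℤˣ, ∀ y ∈ Set.Ioo (y₀ - r) (y₀ + r), ∀ c ∈ paramSet n c₀ ε ∩ closedHalfPlane s,
          ‖ψ₁ s y c‖ ≤ C * (‖c - c₀‖ * zetaWeight n ((y - y₀) / ‖c - c₀‖ ^ (1 / (n : ℝ)))) ∧
          ‖ψ₂ s y c‖ ≤ C * (‖c - c₀‖ * zetaWeight n (-((y - y₀) / ‖c - c₀‖ ^ (1 / (n : ℝ)))))) ∧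
        (∀ s : ℤˣ, ∀ y c, (y, c) ∈ offCritical U n y₀ c₀ r ε s →
          ‖c - c₀‖ ^ (2 - 1 / (n : ℝ)) ≤
            C * ‖wronskianAt (fun x => ψ₁ s x c) (fun x => ψ₂ s x c) y‖)) := by
  obtain ⟨W, hW, R, hR, hWU⟩ := exists_contDiff_eqOn hV hU hy₀
  have hy₀R : y₀ ∈ Set.Ioo (y₀ - R) (y₀ + R) := ⟨by linarith, by linarith⟩
  have hcrit' : IsCriticalPointOfOrder W n y₀ c₀ := by
    simpa only [IsCriticalPointOfOrder, hWU y₀ hy₀R, iteratedDeriv_eq_of_eqOn_Ioo hWU _ hy₀R] using hcrit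
  have hc₀ : (W y₀ : ℂ) = c₀ := hcrit'.1
  have hlocal : ∀ {r : ℝ}, r ≤ R → ∀ y ∈ Set.Ioo (y₀ - r) (y₀ + r), W y = U y := fun hr y hy =>
    hWU y ⟨by linarith [hy.1], by linarith [hy.2]⟩
  rcases hn.eq_or_lt with rfl | hn2
  · have hd : deriv W y₀ ≠ 0 := by simpa using hcrit'.2.2
    obtain ⟨r, hr, hrR, ε, hε, C, hC, f₁, f₂, f₁', f₂', h₁, h₂, hb, hw⟩ := exists_upper_pair_of_deriv_ne_zero hW hd hc₀ (α ^ 2) hR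
    obtain ⟨K, K₂, hK, hK₂⟩ := exists_coefficient_bounds hW 1 y₀ r ε c₀
    set C' := max C ((α ^ 2 * K + K₂) * C) with hC'
    have hEq := hlocal hrR
    have hball : paramSet 1 c₀ ε = Metric.ball c₀ ε := by ext c; simp [paramSet]
    refine ⟨r, hr, ε, hε, C', lt_max_of_lt_left hC, twoSided f₁, twoSided f₂,
      isLocalRayleighFamily_congr hEq (h₁.isLocalRayleighFamily hW.continuous hc₀ hK hK₂ (le_max_left _ _) (le_max_right _ _)),
      isLocalRayleighFamily_congr hEq (h₂.isLocalRayleighFamily hW.continuous hc₀ hK hK₂ (le_max_left _ _) (le_max_right _ _)),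
      fun s y c hP h0 => ?_, fun _ => ⟨fun s => ?_, fun s y c hP => ?_⟩, fun h => absurd h (by norm_num)⟩
    · rw [← offCritical_congr hEq] at hP
      have := le_wronskianAt_twoSided hW.continuous hc₀ h₁.sol h₂.sol (G := fun _ => 1) (C := 1) (fun P hP => by simpa using hw P hP) hP
      rw [h0, norm_zero] at this
      norm_num at this
    -- The regular solution is symmetric under conjugation, so reflection gives back the same
    -- function for both signs and it has no jump at the real axis.
    · refine hb.smooth.congr fun P _ => ?_
      rw [twoSided]
      split_ifs
      · rfl
      · rw [hb.symm, Complex.conj_conj]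
    · have hy := hP.1
      rw [← offCritical_congr hEq] at hP
      refine (norm_deriv_twoSided_le hW.continuous hc₀ h₂.sol (by rw [hball]; exact hb.log_bound) hP).trans ?_
      rw [hEq y hy]
      exact mul_le_mul_of_nonneg_right (le_max_left _ _) (norm_nonneg _)
  · obtain ⟨r, hr, hrR, ε, hε, C, hC, f₁, f₂, f₁', f₂', h₁, h₂, hb, hw⟩ := exists_upper_pair_of_two_le hW hn2 hcrit' (sq_nonneg α) hR
    obtain ⟨K, K₂, hK, hK₂⟩ := exists_coefficient_bounds hW n y₀ r ε c₀
    set C' := max C ((α ^ 2 * K + K₂) * C) with hC'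
    have hEq := hlocal hrR
    have hCC : C ≤ C' := le_max_left _ _
    -- This lower bound also yields independence, since c ≠ c₀ for n ≥ 2.
    have hwr : ∀ s : ℤˣ, ∀ y c, (y, c) ∈ offCritical U n y₀ c₀ r ε s → ‖c - c₀‖ ^ (2 - 1 / (n : ℝ)) ≤
        C * ‖wronskianAt (fun x => twoSided f₁ s x c) (fun x => twoSided f₂ s x c) y‖ := fun s y c hP => by
      rw [← offCritical_congr hEq] at hP
      exact le_wronskianAt_twoSided hW.continuous hc₀ h₁.sol h₂.sol (G := fun t => t ^ (2 - 1 / (n : ℝ))) hw hP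
    refine ⟨r, hr, ε, hε, C', lt_max_of_lt_left hC, twoSided f₁, twoSided f₂,
      isLocalRayleighFamily_congr hEq (h₁.isLocalRayleighFamily hW.continuous hc₀ hK hK₂ hCC (le_max_right _ _)),
      isLocalRayleighFamily_congr hEq (h₂.isLocalRayleighFamily hW.continuous hc₀ hK hK₂ hCC (le_max_right _ _)),
      fun s y c hP h0 => ?_, fun h => absurd h (by omega), fun _ => ⟨fun s y hy c hc => ?_, fun s y c hP => ?_⟩⟩
    · have := hwr s y c hP
      rw [h0, norm_zero, mul_zero] at this
      have hne : c ≠ c₀ := hP.2.1.1.2.resolve_left (by omega)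
      exact absurd this (not_le.2 (Real.rpow_pos_of_pos (norm_pos_iff.2 (sub_ne_zero.2 hne)) _))
    · have key : ∀ c ∈ paramSet n c₀ ε ∩ closedHalfPlane 1,
          ‖twoSided f₁ 1 y c‖ ≤ C' * (‖c - c₀‖ * zetaWeight n ((y - y₀) / ‖c - c₀‖ ^ (1 / (n : ℝ)))) ∧
          ‖twoSided f₂ 1 y c‖ ≤ C' * (‖c - c₀‖ * zetaWeight n (-((y - y₀) / ‖c - c₀‖ ^ (1 / (n : ℝ))))) := fun c hc => by
        have h0 := mem_closedHalfPlane_one.1 hc.2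
        rw [twoSided_one _ _ h0, twoSided_one _ _ h0]
        obtain ⟨b1, b2⟩ := hb (y, c) ⟨⟨hy, hc.1⟩, h0⟩
        exact ⟨b1.trans (mul_le_mul_of_nonneg_right hCC (mul_nonneg (norm_nonneg _) zetaWeight_pos.le)),
          b2.trans (mul_le_mul_of_nonneg_right hCC (mul_nonneg (norm_nonneg _) zetaWeight_pos.le))⟩
      rcases Int.units_eq_one_or s with rfl | rfl
      · exact key c hc
      · have := key _ ⟨mem_paramSet_conj hc₀ hc.1, mem_closedHalfPlane_neg_one.1 hc.2⟩
        rw [← hc₀, norm_conj_sub, hc₀] at this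
        rwa [twoSided_neg_one, twoSided_neg_one, RCLike.norm_conj, RCLike.norm_conj]
    · exact (hwr s y c hP).trans (mul_le_mul_of_nonneg_right hCC (norm_nonneg _))
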